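/- **Setting and conventions.** Let $X$ be a connected compact Kähler manifold of complex dimension $n$, and let $T\subset\mathrm{Aut}_{\mathrm{red}}(X)$ be a compact torus with Lie algebra $\mathfrak t$ (that is, $T$ acts faithfully and smoothly by holomorphic automorphisms, and the induced vector fields are annihilated by all holomorphic $1$-forms on $X$). Fix a basis $(\xi_\alpha)$ of $\mathfrak t$. Put $d^c=\frac{i}{2}(\bar\partial-\partial)$, so $dd^c=i\partial\bar\partial$. A moment map of a closed $T$-invariant real $(1,1)$-form $\theta$ is a smooth $T$-invariant map $m_\theta:X\to\mathfrak t^\vee$ with $-dm_\theta^\xi=\theta(\xi,\cdot)$ for all $\xi\in\mathfrak t$, where $m_\theta^\xi=\langle m_\theta,\xi\rangle$. Given a $T$-invariant Kähler form $\omega$ with moment map $m_\omega$ and a smooth $T$-invariant function $\varphi$ with $\omega_\varphi:=\omega+dd^c\varphi>0$, use the moment maps $m_\varphi^\xi=m_\omega^\xi+d^c\varphi(\xi)$ of $\omega_\varphi$, $m_{dd^cf}^\xi=d^cf(\xi)$ of $dd^cf$ (for smooth $T$-invariant $f$), and $m_{\mathrm{Ric}(\omega)}^\xi=-\mathrm{tr}_{\omega}(dd^c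 m_{\omega}^\xi)$ of $\mathrm{Ric}(\omega)=-dd^c\log\omega^n$. For smooth $v:\mathfrak t^\vee\to\mathbb R_{>0}$ with partial derivatives $v_\alpha,v_{\alpha\beta}$, put $$\mathrm{tr}_{\varphi,v}\theta=\mathrm{tr}_{\omega_\varphi}\theta+\sum_\alpha(\log v)_\alpha(m_\varphi)\,m_\theta^{\xi_\alpha},\qquad \Delta_{\varphi,v}f=\mathrm{tr}_{\varphi,v}(dd^cf).$$ **Proposition.** Fix $X$, $T$, a $T$-invariant Kähler form $\omega_X$ with a moment map $m_{\omega_X}$, and constants $A,B$ with $\mathrm{Ric}(\omega_X)\le A\omega_X$ and holomorphic bisectional curvature $\mathrm{Bisec}(\omega_X)\ge -B$. Fix a compact set $\mathcal K\subset X$, a real number $p>1$, and real constants $C_\omega$, $C_\rho>0$, $C_0$, $K_2$, $C_v$, $s$, $M$. Then there is a constant $C_1$, depending only on these data, such that the following holds for all $v,\omega,m_\omega,\rho,\varphi,F,S$ as described here. * $v:\mathfrak t^\vee\to\mathbb R_{>0}$ is smooth and $\log v$ is concave. $\omega$ is a $T$-invariant Kähler form with moment map $m_\omega$ and $\omega\le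 C_\omega\omega_X$. On $m_\omega(X)\cup m_{\omega_X}(X)$ one has $C_v^{-1}\le v$ and $v+\sum_\alpha|v_\alpha|+\sum_{\alpha,\beta}|v_{\alpha\beta}|\le C_v$. * $\rho:X\to[-\infty,\infty)$ is a $T$-invariant $\omega$-plurisubharmonic function, smooth on the open set $X\setminus\{\rho=-\infty\}$, with $\omega+dd^c\rho\ge C_\rho\omega_X$ as currents, $\rho\le M$ on $X$, and $\rho\ge -M$ on $\mathcal K$ (in particular $\mathcal K\subset X\setminus\{\rho=-\infty\}$; every $\rho$ and every compact $\mathcal K\subset X\setminus\{\rho=-\infty\}$ admit such an $M$). * $\varphi,F,S$ are smooth $T$-invariant real functions on $X$ with $\omega_\varphi>0$ and $S\ge s$, satisfying $$\begin{cases} v(m_\varphi)\,(\omega+dd^c\varphi)^n=e^F\omega_X^n,\qquad \sup_X\varphi=0,\\ \Delta_{\varphi,v}F=-S+\mathrm{tr}_{\varphi,v}(\mathrm{Ric}(\omega_X)).\end{cases}$$ * $\|\varphi\|_{L^\infty}\le C_0$, $F\le C_0$, and $F\ge K_2\rho-C_0$ on $X\setminus\{\rho=-\infty\}$. Under these assumptions,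 $$\|\mathrm{tr}_{\omega_X}\omega_\varphi\|_{L^{2p+2}(\mathcal K,\,\omega_X^n)}\le C_1 .$$ -/

import Mathlib

open scoped Manifold ContDiff

namespace WCscK

noncomputable section

/-! ### Linear algebra of real two-forms on complex Euclidean space -/

/-- The model space `ℂⁿ`. -/
abbrev Cn (n : ℕ) : Type := EuclideanSpace ℂ (Fin n)

/-- The `j`-th standard basis vector of `ℂⁿ`. -/
def stdVec {n : ℕ} (j : Fin n) : Cn n := EuclideanSpace.single j 1

/-- Real bilinear forms on `ℂⁿ`. -/
abbrev BilForm (n : ℕ) : Type := Cn n →L[ℝ] Cn n →L[ℝ] ℝ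

/-- The complex structure `J`, i.e. multiplication by `i`. -/
def cplxJ (n : ℕ) : Cn n →L[ℝ] Cn n := (Complex.I • ContinuousLinearMap.id ℂ (Cn n)).restrictScalars ℝ

/-- A real `(1,1)`-form at a point: alternating and `J`-invariant. -/
def IsOneOne {n : ℕ} (α : BilForm n) : Prop :=
  (∀ a b, α a b = -α b a) ∧ (∀ a b, α (cplxJ n a) (cplxJ n b) = α a b)

/-- The coefficient matrix `(α_{j k̄})` of a real `(1,1)`-form
`α = i ∑ α_{j k̄} dz^j ∧ dz̄^k`; one has `α(a,b) = -2 Im ∑ α_{j k̄} a_j b̄_k`. -/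
def coeffMatrix {n : ℕ} (α : BilForm n) : Matrix (Fin n) (Fin n) ℂ := fun j k =>
  (1 / 2 : ℂ) * ((α (stdVec j) (cplxJ n (stdVec k)) : ℂ) - Complex.I * (α (stdVec j) (stdVec k) : ℂ))

/-- `det (α_{j k̄})`, so that `α^n = n! · 2^n · det (α_{j k̄})` times Lebesgue measure. -/
def formDet {n : ℕ} (α : BilForm n) : ℝ := (coeffMatrix α).det.re

/-- The trace `tr_ω θ = ω^{j k̄} θ_{j k̄}`. -/
def formTrace {n : ℕ} (om th : BilForm n) : ℝ := ((coeffMatrix om)⁻¹ * coeffMatrix th).trace.re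

/-! ### Differential operators on `ℂⁿ` -/

/-- `∂f/∂z_k`. -/
def wirt {n : ℕ} (k : Fin n) (f : Cn n → ℂ) (z : Cn n) : ℂ :=
  (1 / 2 : ℂ) * (fderiv ℝ f z (stdVec k) - Complex.I * fderiv ℝ f z (cplxJ n (stdVec k)))

/-- `∂f/∂z̄_k`. -/
def wirtBar {n : ℕ} (k : Fin n) (f : Cn n → ℂ) (z : Cn n) : ℂ :=
  (1 / 2 : ℂ) * (fderiv ℝ f z (stdVec k) + Complex.I * fderiv ℝ f z (cplxJ n (stdVec k)))

/-- `d^c f = (i/2)(∂̄ - ∂) f = -(1/2) df ∘ J` on `ℂⁿ`. -/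
def dcLocal {n : ℕ} (f : Cn n → ℝ) (z : Cn n) : Cn n →L[ℝ] ℝ :=
  (-(1 / 2) : ℝ) • (fderiv ℝ f z).comp (cplxJ n)

/-- `dd^c f = i ∂∂̄ f` on `ℂⁿ`: `dd^c f (a,b) = ½ (D²f(Ja,b) - D²f(a,Jb))`. -/
def ddcLocal {n : ℕ} (f : Cn n → ℝ) (z : Cn n) : BilForm n :=
  (1 / 2 : ℝ) •
    ((fderiv ℝ (fderiv ℝ f) z).bilinearComp (cplxJ n) (ContinuousLinearMap.id ℝ (Cn n)) -
      (fderiv ℝ (fderiv ℝ f) z).bilinearComp (ContinuousLinearMap.id ℝ (Cn n)) (cplxJ n))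

/-! ### Forms on a complex manifold

The tangent space at `x` is `ℂⁿ`, read in the preferred chart `chartAt (Cn n) x`, as in Mathlib's
`TangentSpace`. -/

/-- Fields of real bilinear forms on the tangent spaces of `X`. -/
abbrev FormField (n : ℕ) (X : Type*) : Type _ := X → BilForm n

section Manifold

variable {n : ℕ} {X : Type*} [TopologicalSpace X] [ChartedSpace (Cn n) X]

/-- The function `f` read in the preferred chart at `x`. -/
def inChart (n : ℕ) {X : Type*} [TopologicalSpace X] [ChartedSpace (Cn n) X] {Y : Type*}
    (x : X) (f : X → Y) : Cn n → Y :=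
  fun z => f ((chartAt (Cn n) x).symm z)

/-- The derivative at `z` of the change of coordinates from the preferred chart at `x₀` to the
preferred chart at the point with coordinate `z`. -/
def transition (x₀ : X) (z : Cn n) : Cn n →L[ℂ] Cn n :=
  fderiv ℂ (fun z' => chartAt (Cn n) ((chartAt (Cn n) x₀).symm z) ((chartAt (Cn n) x₀).symm z')) z

/-- The coordinate expression of a field of bilinear forms in the preferred chart at `x₀`. -/
def coordForm (α : FormField n X) (x₀ : X) (z : Cn n) : BilForm n :=
  (α ((chartAt (Cn n) x₀).symm z)).bilinearComp
    ((transition x₀ z).restrictScalars ℝ) ((transition x₀ z).restrictScalars ℝ)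

/-- Smooth closed real `(1,1)`-forms: the exterior derivative is computed in charts. -/
structure IsClosedOneOne (α : FormField n X) : Prop where
  oneOne : ∀ x, IsOneOne (α x)
  smooth : ∀ x₀ : X, ContDiffOn ℝ ∞ (coordForm α x₀) (chartAt (Cn n) x₀).target
  closed : ∀ x₀ : X, ∀ z ∈ (chartAt (Cn n) x₀).target, ∀ a b c : Cn n,
    fderiv ℝ (coordForm α x₀) z a b c + fderiv ℝ (coordForm α x₀) z b c a +
      fderiv ℝ (coordForm α x₀) z c a b = 0

/-- The order on real `(1,1)`-forms: `α ≤ β` iff `(β - α)(a, Ja) ≥ 0` for all `a`. -/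
def FormLE (α β : FormField n X) : Prop :=
  ∀ (x : X) (a : Cn n), α x a (cplxJ n a) ≤ β x a (cplxJ n a)

/-- Strict positivity of a real `(1,1)`-form. -/
def IsPositive (α : FormField n X) : Prop :=
  ∀ (x : X) (a : Cn n), a ≠ 0 → 0 < α x a (cplxJ n a)

/-- Kähler forms. -/
structure IsKahler (om : FormField n X) : Prop extends IsClosedOneOne om where
  pos : IsPositive om

/-- Smooth real functions on `X`, viewed as a real manifold. -/
def IsSmooth (n : ℕ) {X : Type*} [TopologicalSpace X] [ChartedSpace (Cn n) X] (f : X → ℝ) : Prop :=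
  ContMDiff 𝓘(ℝ, Cn n) 𝓘(ℝ, ℝ) ∞ f

/-- `df` at `x`. -/
def dX (f : X → ℝ) (x : X) : Cn n →L[ℝ] ℝ := fderiv ℝ (inChart n x f) (chartAt (Cn n) x x)

/-- `d^c f` at `x`. -/
def dcX (f : X → ℝ) (x : X) : Cn n →L[ℝ] ℝ := dcLocal (inChart n x f) (chartAt (Cn n) x x)

/-- `dd^c f`. -/
def ddcX (f : X → ℝ) : FormField n X := fun x => ddcLocal (inChart n x f) (chartAt (Cn n) x x)

/-- `ω_φ = ω + dd^c φ`. -/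
def twist (om : FormField n X) (φ : X → ℝ) : FormField n X := fun x => om x + ddcX φ x

/-- `Ric(ω) = -dd^c log det (ω_{j k̄})`. -/
def ricci (om : FormField n X) : FormField n X := fun x =>
  -ddcLocal (fun z => Real.log (formDet (coordForm om x z))) (chartAt (Cn n) x x)

/-- The curvature tensor
`R_{i j̄ k l̄} = -∂_k ∂_l̄ g_{i j̄} + g^{p q̄} ∂_k g_{i q̄} ∂_l̄ g_{p j̄}` at `x`. -/
def curvature (om : FormField n X) (x : X) (i j k l : Fin n) : ℂ :=
  let g : Fin n → Fin n → Cn n → ℂ := fun a b z => coeffMatrix (coordForm om x z) a b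
  let z₀ : Cn n := chartAt (Cn n) x x
  (∑ p, ∑ q, (coeffMatrix (coordForm om x z₀))⁻¹ q p * wirt k (g i q) z₀ * wirtBar l (g p j) z₀) -
    wirt k (wirtBar l (g i j)) z₀

/-- The squared length `g_{i j̄} ξ^i ξ̄^j` of the `(1,0)`-vector `ξ` at `x`. -/
def hermNormSq (om : FormField n X) (x : X) (ξ : Cn n) : ℝ :=
  (∑ i, ∑ j, coeffMatrix (om x) i j * ξ i * (starRingEnd ℂ) (ξ j)).re

/-- `Bisec(ω) ≥ -B`: `R(ξ, ξ̄, η, η̄) ≥ -B |ξ|² |η|²` for all `(1,0)`-vectors `ξ`, `η`. -/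
def BisecGE (om : FormField n X) (B : ℝ) : Prop :=
  ∀ (x : X) (ξ η : Cn n),
    -B * hermNormSq om x ξ * hermNormSq om x η ≤
      (∑ i, ∑ j, ∑ k, ∑ l, curvature om x i j k l *
        ξ i * (starRingEnd ℂ) (ξ j) * η k * (starRingEnd ℂ) (η l)).re

/-- The measure `ω^n` on `X`. In each chart it is `n! · 2^n · det (ω_{j k̄})` times Lebesgue measure;
these local measures agree on overlaps, and their supremum is the measure they glue to. -/
def volumeMeasure [MeasurableSpace X] (om : FormField n X) : MeasureTheory.Measure X :=
  ⨆ x₀ : X, MeasureTheory.Measure.map (chartAt (Cn n) x₀).symm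
    (((MeasureTheory.volume : MeasureTheory.Measure (Cn n)).restrict
      (chartAt (Cn n) x₀).target).withDensity
        fun z => ENNReal.ofReal (n.factorial * 2 ^ n * formDet (coordForm om x₀ z)))

/-! ### Plurisubharmonic functions -/

/-- Plurisubharmonic functions on an open set `U ⊆ X`, with values in `[-∞, ∞)`: upper
semicontinuous, and on every closed disc `ζ ↦ z + ζ w` (`|ζ| ≤ 1`) in a chart, the value at the centre
is at most the average of any continuous majorant on the boundary circle (equivalently, at most
the average of the function itself). -/
def PshOn (n : ℕ) {X : Type*} [TopologicalSpace X] [ChartedSpace (Cn n) X]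
    (f : X → EReal) (U : Set X) : Prop :=
  UpperSemicontinuousOn f U ∧ (∀ x ∈ U, f x ≠ ⊤) ∧
    ∀ (x₀ : X) (z w : Cn n),
      (∀ ζ : ℂ, ‖ζ‖ ≤ 1 → z + ζ • w ∈ (chartAt (Cn n) x₀).target ∧
        (chartAt (Cn n) x₀).symm (z + ζ • w) ∈ U) →
      ∀ h : ℂ → ℝ, Continuous h →
        (∀ ζ : ℂ, ‖ζ‖ = 1 → f ((chartAt (Cn n) x₀).symm (z + ζ • w)) ≤ (h ζ : EReal)) →
        f ((chartAt (Cn n) x₀).symm z) ≤ ((Real.circleAverage h 0 1 : ℝ) : EReal)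

/-- `θ`-plurisubharmonic functions on a connected `X`, for a closed real `(1,1)`-form `θ`, i.e.
`θ + dd^c ρ ≥ 0` as currents: `ρ + u` is plurisubharmonic for local potentials `u` of `θ`, and
`ρ` is not identically `-∞` (equivalently, `ρ` is integrable). -/
def IsQuasiPsh (th : FormField n X) (ρ : X → EReal) : Prop :=
  (∃ x, ρ x ≠ ⊥) ∧
    ∀ x₀ : X, ∃ (U : Set X) (u : X → ℝ), IsOpen U ∧ x₀ ∈ U ∧
      ContMDiffOn 𝓘(ℝ, Cn n) 𝓘(ℝ, ℝ) ∞ u U ∧ (∀ x ∈ U, ddcX u x = th x) ∧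
      PshOn n (fun x => ρ x + (u x : EReal)) U

/-- `ρ ∈ C^∞(X ∖ {ρ = -∞})`, the set `X ∖ {ρ = -∞}` being open. -/
def SmoothOffPoles (n : ℕ) {X : Type*} [TopologicalSpace X] [ChartedSpace (Cn n) X]
    (ρ : X → EReal) : Prop :=
  IsOpen {x | ρ x ≠ ⊥} ∧
    ContMDiffOn 𝓘(ℝ, Cn n) 𝓘(ℝ, ℝ) ∞ (fun x => (ρ x).toReal) {x | ρ x ≠ ⊥}

/-- Holomorphic one-forms on `X`. -/
def IsHolomorphicOneForm (β : X → (Cn n →L[ℂ] ℂ)) : Prop :=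
  ∀ x₀ : X, DifferentiableOn ℂ
    (fun z => (β ((chartAt (Cn n) x₀).symm z)).comp (transition x₀ z)) (chartAt (Cn n) x₀).target

/-! ### Torus actions and moment maps -/

/-- The compact torus `(S¹)^r`; its Lie algebra `𝔱` and the dual `𝔱^∨` are identified with `ℝ^r`. -/
abbrev Torus (r : ℕ) : Type := Fin r → Circle

/-- The exponential map of the torus. -/
def torusExp {r : ℕ} (ξ : Fin r → ℝ) : Torus r := fun i => Circle.exp (ξ i)

variable {r : ℕ} [MulAction (Torus r) X]

/-- The vector field on `X` induced by the `i`-th basis vector `ξ_i` of `𝔱`. -/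
def fundField (n r : ℕ) {X : Type*} [TopologicalSpace X] [ChartedSpace (Cn n) X]
    [MulAction (Torus r) X] (i : Fin r) (x : X) : Cn n :=
  deriv (fun s : ℝ => chartAt (Cn n) x (torusExp (s • (Pi.single i 1 : Fin r → ℝ)) • x)) 0

/-- The given action embeds the torus in `Aut_red(X)`: it is faithful, smooth, by holomorphic
maps, and the induced vector fields are annihilated by all holomorphic one-forms. -/
structure IsReducedTorusAction (n r : ℕ) (X : Type*) [TopologicalSpace X] [ChartedSpace (Cn n) X]
    [MulAction (Torus r) X] : Prop where
  faithful : ∀ t : Torus r, (∀ x : X, t • x = x) → t = 1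
  holomorphic : ∀ t : Torus r, MDifferentiable 𝓘(ℂ, Cn n) 𝓘(ℂ, Cn n) (fun x : X => t • x)
  smooth : ContMDiff (𝓘(ℝ, Fin r → ℝ).prod 𝓘(ℝ, Cn n)) 𝓘(ℝ, Cn n) ∞
    (fun q : (Fin r → ℝ) × X => torusExp q.1 • q.2)
  reduced : ∀ β : X → (Cn n →L[ℂ] ℂ), IsHolomorphicOneForm β →
    ∀ (i : Fin r) (x : X), β x (fundField n r i x) = 0

/-- `T`-invariant functions. -/
def InvariantFun (r : ℕ) {X Y : Type*} [MulAction (Torus r) X] (f : X → Y) : Prop :=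
  ∀ (t : Torus r) (x : X), f (t • x) = f x

/-- The differential at `x` of the action of `t`. -/
def actDeriv (t : Torus r) (x : X) : Cn n →L[ℝ] Cn n :=
  fderiv ℝ (inChart n x (fun y : X => chartAt (Cn n) (t • x) (t • y))) (chartAt (Cn n) x x)

/-- `T`-invariant forms. -/
def InvariantForm (r : ℕ) [MulAction (Torus r) X] (α : FormField n X) : Prop :=
  ∀ (t : Torus r) (x : X) (a b : Cn n), α (t • x) (actDeriv t x a) (actDeriv t x b) = α x a b

/-- `m : X → 𝔱^∨` is a moment map for `ω`: smooth, `T`-invariant, and `-d m^ξ = ω(ξ, ·)`. -/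
structure IsMomentMap (om : FormField n X) (m : X → Fin r → ℝ) : Prop where
  smooth : ∀ i, IsSmooth n (fun x => m x i)
  invariant : InvariantFun r m
  hamiltonian : ∀ (i : Fin r) (x : X) (a : Cn n),
    -(dX (fun y => m y i) x a) = om x (fundField n r i x) a

/-- The moment map `m_{dd^c f}^ξ = d^c f(ξ)` of `dd^c f`. -/
def ddcMoment (n r : ℕ) {X : Type*} [TopologicalSpace X] [ChartedSpace (Cn n) X]
    [MulAction (Torus r) X] (f : X → ℝ) : X → Fin r → ℝ :=
  fun x i => dcX f x (fundField n r i x)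

/-- The normalized moment map `m_φ^ξ = m_ω^ξ + d^c φ(ξ)` of `ω_φ`. -/
def momentTwist (n : ℕ) {r : ℕ} {X : Type*} [TopologicalSpace X] [ChartedSpace (Cn n) X]
    [MulAction (Torus r) X] (m : X → Fin r → ℝ) (φ : X → ℝ) : X → Fin r → ℝ :=
  fun x i => m x i + ddcMoment n r φ x i

/-- The canonical moment map `m_{Ric(ω)}^ξ = -Δ_ω m_ω^ξ` of `Ric(ω)`. -/
def ricciMoment (om : FormField n X) (m : X → Fin r → ℝ) : X → Fin r → ℝ :=
  fun x i => -formTrace (om x) (ddcX (fun y => m y i) x)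

/-! ### Weighted operators -/

/-- The partial derivative `v_i` on `𝔱^∨ = ℝ^r`. -/
def partialV {r : ℕ} (v : (Fin r → ℝ) → ℝ) (i : Fin r) (p : Fin r → ℝ) : ℝ :=
  fderiv ℝ v p (Pi.single i 1)

/-- `tr_{ω,v} θ = tr_ω θ + ⟨(log v)'(m_ω), m_θ⟩`. -/
def weightedTrace (v : (Fin r → ℝ) → ℝ) (om : FormField n X) (m : X → Fin r → ℝ)
    (th : FormField n X) (mth : X → Fin r → ℝ) (x : X) : ℝ :=
  formTrace (om x) (th x) + ∑ i, partialV (fun p => Real.log (v p)) i (m x) * mth x i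

/-- `Δ_{ω,v} f = tr_{ω,v} (dd^c f)`. -/
def weightedLaplacian (v : (Fin r → ℝ) → ℝ) (om : FormField n X) (m : X → Fin r → ℝ)
    (f : X → ℝ) (x : X) : ℝ :=
  weightedTrace v om m (ddcX f) (ddcMoment n r f) x

/-- `C⁻¹ ≤ v` and `v + ∑ |v_i| + ∑ |v_{ij}| ≤ C` on the set `P`. -/
def WeightBound {r : ℕ} (v : (Fin r → ℝ) → ℝ) (C : ℝ) (P : Set (Fin r → ℝ)) : Prop :=
  ∀ p ∈ P, C⁻¹ ≤ v p ∧
    v p + ∑ i, |partialV v i p| + ∑ i, ∑ j, |partialV (partialV v i) j p| ≤ C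

/-- The coupled weighted cscK equations
`v(m_φ) (ω + dd^c φ)^n = e^F ω_X^n`, `sup φ = 0`, `Δ_{φ,v} F = -S + tr_{φ,v} Ric(ω_X)`. -/
structure SolvesWcscK (v : (Fin r → ℝ) → ℝ) (om : FormField n X) (m : X → Fin r → ℝ)
    (omX : FormField n X) (mX : X → Fin r → ℝ) (φ F S : X → ℝ) : Prop where
  mongeAmpere : ∀ x, v (momentTwist n m φ x) * formDet (twist om φ x) =
    Real.exp (F x) * formDet (omX x)
  sup_eq_zero : IsLUB (Set.range φ) 0
  laplace : ∀ x, weightedLaplacian v (twist om φ) (momentTwist n m φ) F x =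
    -S x + weightedTrace v (twist om φ) (momentTwist n m φ) (ricci omX) (ricciMoment omX mX) x

end Manifold

end

end WCscK

section

open scoped ComplexOrder Topology

namespace WCscK
noncomputable section

/-! ### Linear algebra of `(1,1)`-forms -/

/-! Write g = ω_X, h = ω_φ, Y = tr_g h, T = tr_h g, V = log v(m_φ) and q = 2p + 2. The plan is to
exhibit a function J of mean zero for g^n such that J + C is nonnegative on X and at least c Y^q on
K, with c > 0 and C depending only on the fixed data. Integrating J + C gives the bound.

Pointwise estimates. The Yau–Siu computation (`formTrace_laplacian_ge`) gives Δ_{h,v} log Y ≥ Δ_g F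
/ Y - const - const·T. The weight enters through Δ_g V - Γ_h(Y, V), where Γ is the gradient pairing.
Concavity of log v reduces this to the components of the moment map, and those are controlled by
`moment_laplacian_bound`, a consequence of ∂̄m_φ = ∂̄m_{ω_X} · g⁻¹h and closedness. The second
equation gives Δ_{h,v} F ≤ const + const·T. Let ψ = φ - f, where f is a smooth truncation of ρ at
level -N. Then Δ_{h,v} ψ ≤ const - C_ρ T wherever ρ ≥ 1 - N: the weighted part is bounded by
concavity, because the moment maps of ω_φ and of ω + dd^c f both take values in m_ω(X)
(`range_momentTwist_subset`). So for large λ the function Θ = log Y - (1 + q)(F + λψ) satisfies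
Δ_{h,v} Θ ≥ Δ_g F / Y + T - const there.

The term Δ_g F has no sign and no bound. It is removed by integration: Δ_{h,v} Θ is tested against
e^{qΘ} v h^n = e^{qΘ+F} g^n, and from this is subtracted Δ_g G, with G = qF + (1 + q)λψ, tested
against e^{(q-1)Θ-G} g^n. The choice of G makes the second weight equal to e^{qΘ+F}/Y, so Δ_g F
cancels, and the gradient terms form a nonnegative quadratic because |∂Θ|²_g ≤ Y |∂Θ|²_h. Both
integrals vanish by Green's formula (`integral_green`, `integral_testIntegrand`), and
`testIntegrand_ge` leaves J ≥ e^{qΘ+F}(T - const) where ρ ≥ 1 - N.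

Conclusion (`exists_trace_lower_bound`). Where T is large, J dominates e^{qΘ+F}. Where T is bounded,
the Monge–Ampère equation bounds Y, and F ≥ K₂ρ - C₀ together with λ ≥ |K₂| bounds e^{qΘ+F}. Below
the truncation level e^{qΘ+F} contains the tiny factor e^{q(1+q)λf}; N may depend on the solution,
since no final constant involves it. On K all other factors are bounded below, so e^{qΘ+F} ≥ c Y^q.
-/

theorem cplxJ_apply {n : ℕ} (a : Cn n) : cplxJ n a = Complex.I • a := rfl

theorem cplxJ_cplxJ {n : ℕ} (a : Cn n) : cplxJ n (cplxJ n a) = -a := by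
  rw [cplxJ_apply, cplxJ_apply, smul_smul, Complex.I_mul_I, neg_one_smul]

theorem map_cplxJ {n : ℕ} (P : Cn n →L[ℂ] Cn n) (a : Cn n) : P (cplxJ n a) = cplxJ n (P a) := by
  rw [cplxJ_apply, cplxJ_apply, map_smul]

theorem complex_smul_eq {n : ℕ} (c : ℂ) (a : Cn n) : c • a = c.re • a + c.im • cplxJ n a := by
  rw [cplxJ_apply, ← Complex.coe_smul, ← Complex.coe_smul (c.im), smul_smul, ← add_smul,
    Complex.re_add_im]

theorem sum_coord_smul_stdVec {n : ℕ} (a : Cn n) : ∑ i, a i • stdVec i = a := by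
  ext k
  simp [stdVec, Finset.sum_apply, Pi.single_apply]

namespace IsOneOne

variable {n : ℕ} {α β : BilForm n}

theorem add (hα : IsOneOne α) (hβ : IsOneOne β) : IsOneOne (α + β) :=
  ⟨fun a b => by simp only [add_apply]; rw [hα.1 a b, hβ.1 a b]; ring,
    fun a b => by simp only [add_apply]; rw [hα.2 a b, hβ.2 a b]⟩

theorem smul (hα : IsOneOne α) (c : ℝ) : IsOneOne (c • α) :=
  ⟨fun a b => by simp only [smul_apply, smul_eq_mul]; rw [hα.1 a b]; ring,
    fun a b => by simp only [smul_apply, smul_eq_mul]; rw [hα.2 a b]⟩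

theorem apply_J_right (hα : IsOneOne α) (a b : Cn n) : α (cplxJ n a) b = -α a (cplxJ n b) := by
  have h := hα.2 a (cplxJ n b)
  rw [cplxJ_cplxJ, map_neg] at h
  rw [← h, neg_neg]

theorem apply_self (hα : IsOneOne α) (a : Cn n) : α a a = 0 := by
  have h := hα.1 a a
  linarith

end IsOneOne

/-- The hermitian form `½ (α(a, Jb) - i α(a, b))` of a real `(1,1)`-form. -/
def herm {n : ℕ} (α : BilForm n) (a b : Cn n) : ℂ :=
  (1 / 2 : ℂ) * ((α a (cplxJ n b) : ℂ) - Complex.I * (α a b : ℂ))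

section herm

variable {n : ℕ} {α : BilForm n}

theorem coeffMatrix_apply (α : BilForm n) (j k : Fin n) :
    coeffMatrix α j k = herm α (stdVec j) (stdVec k) := rfl

theorem herm_self (hα : IsOneOne α) (a : Cn n) : herm α a a = ((1 / 2 * α a (cplxJ n a) : ℝ) : ℂ) := by
  simp [herm, hα.apply_self]

theorem herm_conj (hα : IsOneOne α) (a b : Cn n) :
    herm α b a = (starRingEnd ℂ) (herm α a b) := by
  have h1 : α b (cplxJ n a) = α a (cplxJ n b) := by
    rw [hα.1 b, hα.apply_J_right a b, neg_neg]
  simp only [herm, map_mul, map_sub, Complex.conj_ofReal, Complex.conj_I, h1, hα.1 b a]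
  norm_num [Complex.ext_iff]

theorem herm_add_left (a b c : Cn n) : herm α (a + b) c = herm α a c + herm α b c := by
  simp only [herm, map_add, add_apply, Complex.ofReal_add]; ring

/-- Type (1,1) turns into complex sesquilinearity here: `J`-invariance moves `J` to the second slot,
where the factor `i` in the definition absorbs it. -/
theorem herm_smul_left (hα : IsOneOne α) (c : ℂ) (a b : Cn n) :
    herm α (c • a) b = c * herm α a b := by
  have h : α (cplxJ n a) (cplxJ n b) = α a b := hα.2 a b
  have h' : α (cplxJ n a) b = -α a (cplxJ n b) := hα.apply_J_right a b
  rw [complex_smul_eq]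
  simp only [herm, map_add, map_smul, add_apply, smul_apply,
    smul_eq_mul, h, h']
  conv_rhs => rw [← Complex.re_add_im c]
  push_cast
  linear_combination ((1 / 2 : ℂ) * c.im * (α a b)) * Complex.I_sq

theorem herm_sum_left {ι : Type*} (s : Finset ι) (f : ι → Cn n) (b : Cn n) :
    herm α (∑ i ∈ s, f i) b = ∑ i ∈ s, herm α (f i) b := by
  classical
  induction s using Finset.induction_on with
  | empty => simp [herm]
  | insert i s hi ih => rw [Finset.sum_insert hi, Finset.sum_insert hi, herm_add_left, ih]

theorem herm_expand_left (hα : IsOneOne α) (a b : Cn n) :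
    herm α a b = ∑ i, a i * herm α (stdVec i) b := by
  conv_lhs => rw [← sum_coord_smul_stdVec a]
  rw [herm_sum_left]
  exact Finset.sum_congr rfl fun i _ => herm_smul_left hα _ _ _

theorem herm_expand (hα : IsOneOne α) (a b : Cn n) :
    herm α a b = ∑ i, ∑ j, a i * coeffMatrix α i j * (starRingEnd ℂ) (b j) := by
  rw [herm_expand_left hα]
  refine Finset.sum_congr rfl fun i _ => ?_
  rw [herm_conj hα b (stdVec i), herm_expand_left hα b (stdVec i), map_sum, Finset.mul_sum]
  refine Finset.sum_congr rfl fun j _ => ?_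
  rw [map_mul, ← herm_conj hα (stdVec j) (stdVec i), coeffMatrix_apply]; ring

end herm

/-- Pull-back of a bilinear form under a complex linear map. -/
def pull {n : ℕ} (β : BilForm n) (P : Cn n →L[ℂ] Cn n) : BilForm n :=
  β.bilinearComp (P.restrictScalars ℝ) (P.restrictScalars ℝ)

/-- The matrix of a complex linear map. -/
def matOf {n : ℕ} (P : Cn n →L[ℂ] Cn n) : Matrix (Fin n) (Fin n) ℂ := fun i j => P (stdVec j) i

section pull

variable {n : ℕ}

@[simp] theorem pull_apply (β : BilForm n) (P : Cn n →L[ℂ] Cn n) (a b : Cn n) :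
    pull β P a b = β (P a) (P b) := rfl

theorem IsOneOne.pull {β : BilForm n} (hβ : IsOneOne β) (P : Cn n →L[ℂ] Cn n) :
    IsOneOne (pull β P) :=
  ⟨fun a b => by simp only [pull_apply]; exact hβ.1 _ _,
    fun a b => by simp only [pull_apply, map_cplxJ]; exact hβ.2 _ _⟩

theorem pull_pull (β : BilForm n) (P Q : Cn n →L[ℂ] Cn n) : pull (pull β P) Q = pull β (P.comp Q) := by
  ext a b; rfl

theorem pull_id (β : BilForm n) : pull β (ContinuousLinearMap.id ℂ (Cn n)) = β := by
  ext a b; rfl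

theorem pull_add (β γ : BilForm n) (P : Cn n →L[ℂ] Cn n) : pull (β + γ) P = pull β P + pull γ P := by
  ext a b; rfl

theorem matOf_comp (P Q : Cn n →L[ℂ] Cn n) : matOf (P.comp Q) = matOf P * matOf Q := by
  ext i j
  rw [Matrix.mul_apply]
  change P (Q (stdVec j)) i = ∑ k, P (stdVec k) i * Q (stdVec j) k
  conv_lhs => rw [← sum_coord_smul_stdVec (Q (stdVec j))]
  simp [map_sum, mul_comm]

theorem matOf_id : matOf (ContinuousLinearMap.id ℂ (Cn n)) = 1 := by
  ext i j
  simp [matOf, stdVec, Matrix.one_apply]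

/-- The first index of the coefficient matrix is the holomorphic one, so the matrix of `P` appears
transposed on the left and conjugated on the right. -/
theorem coeffMatrix_pull {β : BilForm n} (hβ : IsOneOne β) (P : Cn n →L[ℂ] Cn n) :
    coeffMatrix (pull β P) =
      (matOf P).transpose * coeffMatrix β * (matOf P).map (starRingEnd ℂ) := by
  ext j k
  have h : coeffMatrix (pull β P) j k = herm β (P (stdVec j)) (P (stdVec k)) := by
    rw [coeffMatrix_apply]; simp only [herm, pull_apply, map_cplxJ]
  rw [h, herm_expand hβ, Matrix.mul_apply]
  simp only [Matrix.mul_apply, Finset.sum_mul, Matrix.transpose_apply, Matrix.map_apply, matOf]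
  rw [Finset.sum_comm]

theorem coeffMatrix_isHermitian {β : BilForm n} (hβ : IsOneOne β) : (coeffMatrix β).IsHermitian := by
  ext j k
  rw [Matrix.conjTranspose_apply, coeffMatrix_apply, coeffMatrix_apply, herm_conj hβ]
  simp

theorem coeffMatrix_posDef {β : BilForm n} (hβ : IsOneOne β)
    (hpos : ∀ a, a ≠ 0 → 0 < β a (cplxJ n a)) : (coeffMatrix β).PosDef := by
  rw [Matrix.posDef_iff_dotProduct_mulVec]
  refine ⟨coeffMatrix_isHermitian hβ, fun {x} hx => ?_⟩
  -- Positive definiteness of a matrix conjugates the left vector, while coefficient matrices are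
  -- linear in the left slot; hence the conjugate.
  let a : Cn n := WithLp.toLp 2 (star x)
  have ha : a ≠ 0 := by
    intro h
    apply hx
    ext i
    have : a i = 0 := by rw [h]; rfl
    simpa [a] using this
  have h : star x ⬝ᵥ (coeffMatrix β).mulVec x = herm β a a := by
    rw [herm_expand hβ, dotProduct]
    refine Finset.sum_congr rfl fun i _ => ?_
    rw [Matrix.mulVec, dotProduct, Finset.mul_sum]
    refine Finset.sum_congr rfl fun j _ => ?_
    simp [a, mul_assoc]
  rw [h, herm_self hβ]
  have := hpos a ha
  exact_mod_cast (by positivity : 0 < 1 / 2 * β a (cplxJ n a))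

theorem coeffMatrix_add (α β : BilForm n) : coeffMatrix (α + β) = coeffMatrix α + coeffMatrix β := by
  ext j k
  simp only [coeffMatrix, Matrix.add_apply, add_apply, Complex.ofReal_add]; ring

theorem coeffMatrix_smul (c : ℝ) (α : BilForm n) : coeffMatrix (c • α) = (c : ℂ) • coeffMatrix α := by
  ext j k
  simp only [coeffMatrix, Matrix.smul_apply, smul_apply, smul_eq_mul,
    Complex.ofReal_mul]; ring

theorem formTrace_add (om α β : BilForm n) :
    formTrace om (α + β) = formTrace om α + formTrace om β := by
  simp [formTrace, coeffMatrix_add, Matrix.mul_add]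

theorem formTrace_smul (om : BilForm n) (c : ℝ) (α : BilForm n) :
    formTrace om (c • α) = c * formTrace om α := by
  simp [formTrace, coeffMatrix_smul]

theorem formTrace_neg (om α : BilForm n) : formTrace om (-α) = -formTrace om α := by
  have h : -α = (-1 : ℝ) • α := by ext a b; simp
  rw [h, formTrace_smul, neg_one_mul]

theorem formTrace_sum {ι : Type*} (om : BilForm n) (s : Finset ι) (f : ι → BilForm n) :
    formTrace om (∑ i ∈ s, f i) = ∑ i ∈ s, formTrace om (f i) := by
  classical
  induction s using Finset.induction_on with
  | empty =>
    have h : (0 : BilForm n) = (0 : ℝ) • (0 : BilForm n) := by ext a b; simp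
    rw [Finset.sum_empty, Finset.sum_empty, h, formTrace_smul, zero_mul]
  | insert i s hi ih => rw [Finset.sum_insert hi, Finset.sum_insert hi, formTrace_add, ih]

theorem isUnit_matOf_of_equiv {P Q : Cn n →L[ℂ] Cn n} (h : P.comp Q = ContinuousLinearMap.id ℂ _) :
    IsUnit (matOf P) :=
  IsUnit.of_mul_eq_one (matOf Q) (by rw [← matOf_comp, h, matOf_id])

/-- Both forms undergo the same congruence, so the quotient matrix changes by conjugation. Traces
may therefore be computed in any frame or chart. -/
theorem formTrace_pull {om th : BilForm n} (hom : IsOneOne om) (hth : IsOneOne th)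
    {P : Cn n →L[ℂ] Cn n} (hP : IsUnit (matOf P)) :
    formTrace (pull om P) (pull th P) = formTrace om th := by
  have hPc : IsUnit ((matOf P).map (starRingEnd ℂ)) := by
    have := hP.map ((starRingEnd ℂ).mapMatrix (m := Fin n))
    simpa using this
  have hPt : IsUnit (matOf P).transpose := Matrix.isUnit_transpose _ |>.mpr hP
  have hd1 := (Matrix.isUnit_iff_isUnit_det _).mp hPc
  have hd2 := (Matrix.isUnit_iff_isUnit_det _).mp hPt
  unfold formTrace
  rw [coeffMatrix_pull hom, coeffMatrix_pull hth, Matrix.mul_inv_rev, Matrix.mul_inv_rev]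
  set C := (matOf P).map (starRingEnd ℂ)
  set A := (matOf P).transpose
  have : C⁻¹ * ((coeffMatrix om)⁻¹ * A⁻¹) * (A * coeffMatrix th * C) =
      C⁻¹ * ((coeffMatrix om)⁻¹ * coeffMatrix th * C) := by
    rw [Matrix.mul_assoc, Matrix.mul_assoc, Matrix.mul_assoc A, ← Matrix.mul_assoc A⁻¹,
      Matrix.nonsing_inv_mul _ hd2, Matrix.one_mul, Matrix.mul_assoc]
  rw [this, Matrix.trace_mul_comm, Matrix.mul_assoc, Matrix.mul_nonsing_inv _ hd1, Matrix.mul_one]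

/-- The factor `|det P|²` is the real Jacobian of `P` (`abs_det_restrictScalars`), which is why the
local densities of the volume form glue. -/
theorem formDet_pull {om : BilForm n} (hom : IsOneOne om) (P : Cn n →L[ℂ] Cn n) :
    formDet (pull om P) = Complex.normSq (matOf P).det * formDet om := by
  unfold formDet
  rw [coeffMatrix_pull hom, Matrix.det_mul, Matrix.det_mul, Matrix.det_transpose]
  have : ((matOf P).map (starRingEnd ℂ)).det = (starRingEnd ℂ) (matOf P).det :=
    (RingHom.map_det _ _).symm
  rw [this, mul_assoc, mul_comm (coeffMatrix om).det, ← mul_assoc, Complex.mul_conj,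
    Complex.re_ofReal_mul]

theorem formDet_pos {β : BilForm n} (hβ : IsOneOne β)
    (hpos : ∀ a, a ≠ 0 → 0 < β a (cplxJ n a)) : 0 < formDet β :=
  (Complex.pos_iff.mp (coeffMatrix_posDef hβ hpos).det_pos).1

theorem coeffMatrix_det_eq {β : BilForm n} (hβ : IsOneOne β)
    (hpos : ∀ a, a ≠ 0 → 0 < β a (cplxJ n a)) : (coeffMatrix β).det = (formDet β : ℂ) := by
  have := (Complex.pos_iff.mp (coeffMatrix_posDef hβ hpos).det_pos).2
  apply Complex.ext
  · rfl
  · simp [← this]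

end pull

/-! ### Normal forms: frames that are unitary for one form and diagonal for another -/

variable {n : ℕ}

/-- `R` is the unitary matrix of eigenvectors with its columns divided by the square roots of the
eigenvalues. -/
theorem exists_conjTranspose_mul_mul_eq_one {G : Matrix (Fin n) (Fin n) ℂ} (hG : G.PosDef) :
    ∃ R : Matrix (Fin n) (Fin n) ℂ, R.conjTranspose * G * R = 1 := by
  have hH := hG.isHermitian
  set U : Matrix (Fin n) (Fin n) ℂ := (hH.eigenvectorUnitary : Matrix (Fin n) (Fin n) ℂ)
  set D : Matrix (Fin n) (Fin n) ℂ :=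
    Matrix.diagonal fun i => (((Real.sqrt (hH.eigenvalues i))⁻¹ : ℝ) : ℂ)
  have hU : U.conjTranspose * U = 1 := (Matrix.mem_unitaryGroup_iff' ).mp hH.eigenvectorUnitary.2
  have hs : G = U * Matrix.diagonal (RCLike.ofReal ∘ hH.eigenvalues) * U.conjTranspose := by
    conv_lhs => rw [hH.spectral_theorem]
    rfl
  refine ⟨U * D, ?_⟩
  have h1 : (U * D).conjTranspose * G * (U * D) =
      D.conjTranspose * (U.conjTranspose * U) * Matrix.diagonal (RCLike.ofReal ∘ hH.eigenvalues) *
        (U.conjTranspose * U) * D := by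
    conv_lhs => rw [hs]
    rw [Matrix.conjTranspose_mul]
    simp only [Matrix.mul_assoc]
  rw [h1, hU, Matrix.mul_one, Matrix.mul_one, Matrix.diagonal_conjTranspose,
    Matrix.diagonal_mul_diagonal, Matrix.diagonal_mul_diagonal, ← Matrix.diagonal_one]
  congr 1
  ext i
  have hp := hG.eigenvalues_pos i
  have hsq : Real.sqrt (hH.eigenvalues i) * Real.sqrt (hH.eigenvalues i) = hH.eigenvalues i :=
    Real.mul_self_sqrt hp.le
  have hne : Real.sqrt (hH.eigenvalues i) ≠ 0 := (Real.sqrt_pos.mpr hp).ne'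
  simp only [Pi.star_apply, RCLike.star_def, Complex.conj_ofReal, Function.comp]
  norm_cast
  rw [← Complex.ofReal_one]
  change (((Real.sqrt (hH.eigenvalues i))⁻¹ : ℝ) : ℂ) * ((hH.eigenvalues i : ℝ) : ℂ) *
    (((Real.sqrt (hH.eigenvalues i))⁻¹ : ℝ) : ℂ) = _
  norm_cast
  field_simp
  nlinarith

theorem exists_unitary_diagonalization {A : Matrix (Fin n) (Fin n) ℂ} (hA : A.IsHermitian) :
    ∃ (U : Matrix (Fin n) (Fin n) ℂ) (d : Fin n → ℝ), U.conjTranspose * U = 1 ∧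
      A = U * Matrix.diagonal (fun i => (d i : ℂ)) * U.conjTranspose := by
  refine ⟨(hA.eigenvectorUnitary : Matrix (Fin n) (Fin n) ℂ), hA.eigenvalues,
    Matrix.mem_unitaryGroup_iff'.mp hA.eigenvectorUnitary.2, ?_⟩
  conv_lhs => rw [hA.spectral_theorem]
  rfl

/-- Once `G` is normalised to the identity, a unitary change of basis diagonalises the transformed
`H` without disturbing the identity. -/
theorem exists_simultaneous_diagonalization {G H : Matrix (Fin n) (Fin n) ℂ} (hG : G.PosDef)
    (hH : H.IsHermitian) :
    ∃ (R : Matrix (Fin n) (Fin n) ℂ) (d : Fin n → ℝ), R.conjTranspose * G * R = 1 ∧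
      R.conjTranspose * H * R = Matrix.diagonal fun i => (d i : ℂ) := by
  obtain ⟨R, hR⟩ := exists_conjTranspose_mul_mul_eq_one hG
  have hH' : (R.conjTranspose * H * R).IsHermitian := by
    rw [Matrix.IsHermitian, Matrix.conjTranspose_mul, Matrix.conjTranspose_mul,
      Matrix.conjTranspose_conjTranspose, hH.eq, Matrix.mul_assoc]
  obtain ⟨U, d, hU, hs⟩ := exists_unitary_diagonalization hH'
  refine ⟨R * U, d, ?_, ?_⟩
  · have : (R * U).conjTranspose * G * (R * U) =
        U.conjTranspose * (R.conjTranspose * G * R) * U := by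
      rw [Matrix.conjTranspose_mul]; simp only [Matrix.mul_assoc]
    rw [this, hR, Matrix.mul_one, hU]
  · have : (R * U).conjTranspose * H * (R * U) =
        U.conjTranspose * (R.conjTranspose * H * R) * U := by
      rw [Matrix.conjTranspose_mul]; simp only [Matrix.mul_assoc]
    rw [this, hs]
    have : U.conjTranspose * (U * Matrix.diagonal (fun i => (d i : ℂ)) * U.conjTranspose) * U =
        (U.conjTranspose * U) * Matrix.diagonal (fun i => (d i : ℂ)) * (U.conjTranspose * U) := by
      simp only [Matrix.mul_assoc]
    rw [this, hU, Matrix.one_mul, Matrix.mul_one]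

/-- The complex linear map with a given matrix. -/
def clmOf (A : Matrix (Fin n) (Fin n) ℂ) : Cn n →L[ℂ] Cn n :=
  LinearMap.toContinuousLinearMap (Matrix.toEuclideanLin A)

theorem matOf_clmOf (A : Matrix (Fin n) (Fin n) ℂ) : matOf (clmOf A) = A := by
  ext i j
  simp [matOf, clmOf, stdVec]

theorem matOf_injective {P Q : Cn n →L[ℂ] Cn n} (h : matOf P = matOf Q) : P = Q := by
  ext1 a
  rw [← sum_coord_smul_stdVec a, map_sum, map_sum]
  refine Finset.sum_congr rfl fun j _ => ?_
  rw [map_smul, map_smul]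
  congr 1
  ext i
  exact congrFun (congrFun h i) j

theorem exists_inverse_of_isUnit_matOf {P : Cn n →L[ℂ] Cn n} (h : IsUnit (matOf P)) :
    ∃ Q : Cn n →L[ℂ] Cn n, P.comp Q = ContinuousLinearMap.id ℂ _ ∧
      Q.comp P = ContinuousLinearMap.id ℂ _ := by
  have hd := (Matrix.isUnit_iff_isUnit_det _).mp h
  refine ⟨clmOf (matOf P)⁻¹, matOf_injective ?_, matOf_injective ?_⟩
  · rw [matOf_comp, matOf_clmOf, matOf_id, Matrix.mul_nonsing_inv _ hd]
  · rw [matOf_comp, matOf_clmOf, matOf_id, Matrix.nonsing_inv_mul _ hd]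

/-- `P` is a frame unitary for `om` in which `ta` is diagonal with eigenvalues `d`. -/
structure IsFrame (om ta : BilForm n) (P : Cn n →L[ℂ] Cn n) (d : Fin n → ℝ) : Prop where
  isUnit : IsUnit (matOf P)
  pos : ∀ k, 0 < d k
  left : coeffMatrix (pull om P) = 1
  right : coeffMatrix (pull ta P) = Matrix.diagonal fun k => (d k : ℂ)

theorem exists_isFrame {om ta : BilForm n} (hom : IsOneOne om) (hta : IsOneOne ta)
    (pom : ∀ a, a ≠ 0 → 0 < om a (cplxJ n a)) (pta : ∀ a, a ≠ 0 → 0 < ta a (cplxJ n a)) :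
    ∃ P d, IsFrame om ta P d := by
  obtain ⟨R, d, h1, h2⟩ := exists_simultaneous_diagonalization (coeffMatrix_posDef hom pom)
    (coeffMatrix_isHermitian hta)
  have hR : IsUnit R := by
    rw [Matrix.isUnit_iff_isUnit_det]
    exact Matrix.isUnit_det_of_left_inverse h1
  -- Pulling back by `P` produces `Pᵗ A P̄`; the conjugate of `R` makes this `R* A R`.
  set P := clmOf (R.map (starRingEnd ℂ)) with hPdef
  have hmat : matOf P = R.map (starRingEnd ℂ) := matOf_clmOf _
  have hT : (matOf P).transpose = R.conjTranspose := by rw [hmat]; rfl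
  have hC : (matOf P).map (starRingEnd ℂ) = R := by rw [hmat]; ext i j; simp
  have hU : IsUnit (matOf P) := by
    rw [hmat]
    have := hR.map ((starRingEnd ℂ).mapMatrix (m := Fin n))
    simpa using this
  have hr : coeffMatrix (pull ta P) = Matrix.diagonal fun k => (d k : ℂ) := by
    rw [coeffMatrix_pull hta, hT, hC, h2]
  refine ⟨P, d, hU, fun k => ?_, by rw [coeffMatrix_pull hom, hT, hC, h1], hr⟩
  have hk := congrFun (congrFun hr k) k
  rw [Matrix.diagonal_apply_eq, coeffMatrix_apply, herm_self (hta.pull P)] at hk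
  have hk' : 1 / 2 * pull ta P (stdVec k) (cplxJ n (stdVec k)) = d k := by exact_mod_cast hk
  rw [← hk', pull_apply, map_cplxJ]
  obtain ⟨Q, -, hQ⟩ := exists_inverse_of_isUnit_matOf hU
  have hne : P (stdVec k) ≠ 0 := by
    intro h0
    have h1 : Q (P (stdVec k)) = stdVec k := by
      rw [← ContinuousLinearMap.comp_apply, hQ]; rfl
    rw [h0, map_zero] at h1
    have := congrArg (fun a : Cn n => a k) h1
    simp [stdVec] at this
  have := pta _ hne
  positivity

namespace IsFrame

variable {om ta : BilForm n} {P : Cn n →L[ℂ] Cn n} {d : Fin n → ℝ}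

theorem formTrace_left (h : IsFrame om ta P d) (hom : IsOneOne om) {th : BilForm n}
    (hth : IsOneOne th) :
    formTrace om th = ∑ k, 1 / 2 * th (P (stdVec k)) (cplxJ n (P (stdVec k))) := by
  rw [← formTrace_pull hom hth h.isUnit, formTrace, h.left, inv_one, one_mul, Matrix.trace,
    Complex.re_sum]
  refine Finset.sum_congr rfl fun k _ => ?_
  rw [Matrix.diag_apply, coeffMatrix_apply, herm_self (hth.pull P), Complex.ofReal_re, pull_apply,
    map_cplxJ]

theorem formTrace_right (h : IsFrame om ta P d) (hta : IsOneOne ta) {th : BilForm n}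
    (hth : IsOneOne th) :
    formTrace ta th = ∑ k, (d k)⁻¹ * (1 / 2 * th (P (stdVec k)) (cplxJ n (P (stdVec k)))) := by
  rw [← formTrace_pull hta hth h.isUnit, formTrace, h.right]
  have hinv : (Matrix.diagonal fun k => (d k : ℂ))⁻¹ = Matrix.diagonal fun k => ((d k)⁻¹ : ℂ) := by
    apply Matrix.inv_eq_right_inv
    rw [Matrix.diagonal_mul_diagonal, ← Matrix.diagonal_one]
    congr 1
    ext k
    exact mul_inv_cancel₀ (by exact_mod_cast (h.pos k).ne')
  rw [hinv, Matrix.trace, Complex.re_sum]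
  refine Finset.sum_congr rfl fun k _ => ?_
  rw [Matrix.diag_apply, Matrix.diagonal_mul, coeffMatrix_apply, herm_self (hth.pull P),
    pull_apply, map_cplxJ, ← Complex.ofReal_inv, ← Complex.ofReal_mul, Complex.ofReal_re]

theorem left_apply (h : IsFrame om ta P d) (hom : IsOneOne om) (k : Fin n) :
    1 / 2 * om (P (stdVec k)) (cplxJ n (P (stdVec k))) = 1 := by
  have hk := congrFun (congrFun h.left k) k
  rw [Matrix.one_apply_eq, coeffMatrix_apply, herm_self (hom.pull P)] at hk
  rw [← map_cplxJ, ← pull_apply]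
  exact_mod_cast hk

theorem right_apply (h : IsFrame om ta P d) (hta : IsOneOne ta) (k : Fin n) :
    1 / 2 * ta (P (stdVec k)) (cplxJ n (P (stdVec k))) = d k := by
  have hk := congrFun (congrFun h.right k) k
  rw [Matrix.diagonal_apply_eq, coeffMatrix_apply, herm_self (hta.pull P)] at hk
  rw [← map_cplxJ, ← pull_apply]
  exact_mod_cast hk

theorem trace_eq (h : IsFrame om ta P d) (hom : IsOneOne om) (hta : IsOneOne ta) :
    formTrace om ta = ∑ k, d k := by
  rw [h.formTrace_left hom hta]
  exact Finset.sum_congr rfl fun k _ => h.right_apply hta k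

theorem trace_inv_eq (h : IsFrame om ta P d) (hom : IsOneOne om) (hta : IsOneOne ta) :
    formTrace ta om = ∑ k, (d k)⁻¹ := by
  rw [h.formTrace_right hta hom]
  refine Finset.sum_congr rfl fun k _ => ?_
  rw [h.left_apply hom k, mul_one]

theorem formDet_eq (h : IsFrame om ta P d) (hom : IsOneOne om) (hta : IsOneOne ta) :
    formDet ta = (∏ k, d k) * formDet om := by
  have h1 := formDet_pull hom P
  have h2 := formDet_pull hta P
  have h3 : formDet (pull om P) = 1 := by rw [formDet, h.left]; simp
  have h4 : formDet (pull ta P) = ∏ k, d k := by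
    rw [formDet, h.right, Matrix.det_diagonal, ← Complex.ofReal_prod, Complex.ofReal_re]
  have hne : Complex.normSq (matOf P).det ≠ 0 := by
    intro h0
    rw [h0, h3] at h1
    norm_num at h1
  rw [h4] at h2
  rw [h3] at h1
  have : Complex.normSq (matOf P).det * formDet ta =
      Complex.normSq (matOf P).det * ((∏ k, d k) * formDet om) := by
    rw [← h2]; linear_combination (∏ k, d k) * h1
  exact mul_left_cancel₀ hne this

end IsFrame

/-! ### Trace inequalities -/

theorem formTrace_self [NeZero n] {om : BilForm n} (hom : IsOneOne om)
    (pom : ∀ a, a ≠ 0 → 0 < om a (cplxJ n a)) : formTrace om om = n := by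
  obtain ⟨P, d, h⟩ := exists_isFrame hom hom pom pom
  rw [h.formTrace_left hom hom, Finset.sum_congr rfl fun k _ => h.left_apply hom k]
  simp

theorem formTrace_mono {om α β : BilForm n} (hom : IsOneOne om)
    (pom : ∀ a, a ≠ 0 → 0 < om a (cplxJ n a)) (hα : IsOneOne α) (hβ : IsOneOne β)
    (h : ∀ a, α a (cplxJ n a) ≤ β a (cplxJ n a)) : formTrace om α ≤ formTrace om β := by
  obtain ⟨P, d, hf⟩ := exists_isFrame hom hom pom pom
  rw [hf.formTrace_left hom hα, hf.formTrace_left hom hβ]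
  exact Finset.sum_le_sum fun k _ => by have := h (P (stdVec k)); linarith

theorem formTrace_nonneg {om α : BilForm n} (hom : IsOneOne om)
    (pom : ∀ a, a ≠ 0 → 0 < om a (cplxJ n a)) (hα : IsOneOne α)
    (h : ∀ a, 0 ≤ α a (cplxJ n a)) : 0 ≤ formTrace om α := by
  obtain ⟨P, d, hf⟩ := exists_isFrame hom hom pom pom
  rw [hf.formTrace_left hom hα]
  exact Finset.sum_nonneg fun k _ => by have := h (P (stdVec k)); linarith

theorem formTrace_pos [NeZero n] {om α : BilForm n} (hom : IsOneOne om)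
    (pom : ∀ a, a ≠ 0 → 0 < om a (cplxJ n a)) (hα : IsOneOne α)
    (h : ∀ a, a ≠ 0 → 0 < α a (cplxJ n a)) : 0 < formTrace om α := by
  obtain ⟨P, d, hf⟩ := exists_isFrame hom hα pom h
  rw [hf.trace_eq hom hα]
  exact Finset.sum_pos (fun k _ => hf.pos k) Finset.univ_nonempty

/-- A single eigenvalue already contributes `d · d⁻¹ = 1`. The inequality serves to absorb bounded
terms into multiples of the product of the two traces. -/
theorem one_le_formTrace_mul [NeZero n] {om α : BilForm n} (hom : IsOneOne om)
    (pom : ∀ a, a ≠ 0 → 0 < om a (cplxJ n a)) (hα : IsOneOne α)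
    (h : ∀ a, a ≠ 0 → 0 < α a (cplxJ n a)) : 1 ≤ formTrace om α * formTrace α om := by
  obtain ⟨P, d, hf⟩ := exists_isFrame hom hα pom h
  rw [hf.trace_eq hom hα, hf.trace_inv_eq hom hα]
  have k0 : Fin n := 0
  have h1 : d k0 ≤ ∑ k, d k := Finset.single_le_sum (fun k _ => (hf.pos k).le) (Finset.mem_univ k0)
  have h2 : (d k0)⁻¹ ≤ ∑ k, (d k)⁻¹ :=
    Finset.single_le_sum (f := fun k => (d k)⁻¹) (fun k _ => (inv_pos.mpr (hf.pos k)).le)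
      (Finset.mem_univ k0)
  calc (1 : ℝ) = d k0 * (d k0)⁻¹ := (mul_inv_cancel₀ (hf.pos k0).ne').symm
    _ ≤ _ := mul_le_mul h1 h2 (inv_pos.mpr (hf.pos k0)).le ((hf.pos k0).le.trans h1)

/-- In a common frame this is `1 ≤ (∑ d) d_k⁻¹` for each `k`: the inverse of `om` is at most `tr_om
ta` times the inverse of `ta`. It compares squared gradients in the two metrics. -/
theorem formTrace_le_mul {om ta th : BilForm n} (hom : IsOneOne om)
    (pom : ∀ a, a ≠ 0 → 0 < om a (cplxJ n a)) (hta : IsOneOne ta)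
    (pta : ∀ a, a ≠ 0 → 0 < ta a (cplxJ n a)) (hth : IsOneOne th)
    (h : ∀ a, 0 ≤ th a (cplxJ n a)) : formTrace om th ≤ formTrace om ta * formTrace ta th := by
  obtain ⟨P, d, hf⟩ := exists_isFrame hom hta pom pta
  rw [hf.trace_eq hom hta, hf.formTrace_left hom hth, hf.formTrace_right hta hth, Finset.mul_sum]
  refine Finset.sum_le_sum fun k _ => ?_
  have h1 : d k ≤ ∑ k, d k := Finset.single_le_sum (fun k _ => (hf.pos k).le) (Finset.mem_univ k)
  have h2 := h (P (stdVec k))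
  have h3 : 1 ≤ (∑ k, d k) * (d k)⁻¹ := by
    rw [← div_eq_mul_inv, le_div_iff₀ (hf.pos k), one_mul]; exact h1
  rw [← mul_assoc]
  nlinarith

/-- If `tr_ta om ≤ C` and `det ta ≤ D det om`, then `tr_om ta ≤ n D C^(n-1)`. -/
theorem formTrace_le_of_inverse_le {om ta : BilForm n} (hom : IsOneOne om)
    (pom : ∀ a, a ≠ 0 → 0 < om a (cplxJ n a)) (hta : IsOneOne ta)
    (pta : ∀ a, a ≠ 0 → 0 < ta a (cplxJ n a)) {C D : ℝ} (hC : formTrace ta om ≤ C)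
    (hD : formDet ta ≤ D * formDet om) : formTrace om ta ≤ n * (D * C ^ (n - 1)) := by
  obtain ⟨P, d, hf⟩ := exists_isFrame hom hta pom pta
  rw [hf.trace_inv_eq hom hta] at hC
  have hD' : ∏ k, d k ≤ D := by
    rw [hf.formDet_eq hom hta] at hD
    exact le_of_mul_le_mul_right hD (formDet_pos hom pom)
  rw [hf.trace_eq hom hta]
  have key : ∀ k, d k ≤ D * C ^ (n - 1) := by
    intro k
    have hinv : ∀ j, (d j)⁻¹ ≤ C := fun j =>
      (Finset.single_le_sum (f := fun k => (d k)⁻¹) (fun k _ => (inv_pos.mpr (hf.pos k)).le)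
        (Finset.mem_univ j)).trans hC
    have h1 : ∏ j ∈ Finset.univ.erase k, (d j)⁻¹ ≤ C ^ (n - 1) := by
      have h2 : (Finset.univ.erase k).card = n - 1 := by simp
      rw [← h2]
      calc _ ≤ ∏ j ∈ Finset.univ.erase k, C :=
            Finset.prod_le_prod (fun j _ => (inv_pos.mpr (hf.pos j)).le) fun j _ => hinv j
        _ = _ := by rw [Finset.prod_const]
    -- An eigenvalue is the relative determinant times the inverses of the `n - 1` other
    -- eigenvalues, each of which is at most `C`.
    have h3 : d k = (∏ j, d j) * ∏ j ∈ Finset.univ.erase k, (d j)⁻¹ := by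
      rw [← Finset.mul_prod_erase _ _ (Finset.mem_univ k), mul_assoc, ← Finset.prod_mul_distrib,
        Finset.prod_eq_one fun j _ => mul_inv_cancel₀ (hf.pos j).ne', mul_one]
    have hp : 0 < ∏ j, d j := Finset.prod_pos fun j _ => hf.pos j
    rw [h3]
    exact mul_le_mul hD' h1 (Finset.prod_nonneg fun j _ => (inv_pos.mpr (hf.pos j)).le)
      (hp.le.trans hD')
  calc ∑ k, d k ≤ ∑ _k : Fin n, D * C ^ (n - 1) := Finset.sum_le_sum fun k _ => key k
    _ = _ := by simp

/-! ### First order operators on open subsets of `ℂⁿ` -/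

section calculus

variable {E F : Type*} [NormedAddCommGroup E] [NormedSpace ℝ E] [NormedAddCommGroup F]
  [NormedSpace ℝ F] {U : Set E} {z : E}

theorem smoothOn_contDiffAt {f : E → F} (hf : ContDiffOn ℝ ∞ f U) (hU : IsOpen U) (hz : z ∈ U) :
    ContDiffAt ℝ ∞ f z := hf.contDiffAt (hU.mem_nhds hz)

theorem smoothOn_differentiableAt {f : E → F} (hf : ContDiffOn ℝ ∞ f U) (hU : IsOpen U)
    (hz : z ∈ U) : DifferentiableAt ℝ f z :=
  (smoothOn_contDiffAt hf hU hz).differentiableAt (by simp)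

theorem smoothOn_fderiv {f : E → F} (hf : ContDiffOn ℝ ∞ f U) (hU : IsOpen U) :
    ContDiffOn ℝ ∞ (fderiv ℝ f) U := hf.fderiv_of_isOpen hU (by simp)

theorem smoothOn_fderiv_apply {f : E → F} (hf : ContDiffOn ℝ ∞ f U) (hU : IsOpen U) (a : E) :
    ContDiffOn ℝ ∞ (fun z => fderiv ℝ f z a) U := (smoothOn_fderiv hf hU).clm_apply contDiffOn_const

theorem fderiv_fderiv_apply {f : E → F} (hf : ContDiffOn ℝ ∞ f U) (hU : IsOpen U) (hz : z ∈ U)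
    (a b : E) : fderiv ℝ (fun z => fderiv ℝ f z a) z b = fderiv ℝ (fderiv ℝ f) z b a := by
  have h := (smoothOn_differentiableAt (smoothOn_fderiv hf hU) hU hz).hasFDerivAt.clm_apply
    (hasFDerivAt_const a z)
  rw [h.fderiv]
  simp

theorem fderiv_fderiv_symm {f : E → F} (hf : ContDiffOn ℝ ∞ f U) (hU : IsOpen U) (hz : z ∈ U)
    (a b : E) : fderiv ℝ (fderiv ℝ f) z a b = fderiv ℝ (fderiv ℝ f) z b a :=
  ((smoothOn_contDiffAt hf hU hz).isSymmSndFDerivAt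
    (by simpa using WithTop.coe_le_coe.mpr (le_top : (2 : ℕ∞) ≤ ⊤))) a b

end calculus

/-- The operator `½ (∂_u + c ∂_v)`. -/
def dirD (u v : Cn n) (c : ℂ) (f : Cn n → ℂ) (z : Cn n) : ℂ :=
  (1 / 2 : ℂ) * (fderiv ℝ f z u + c * fderiv ℝ f z v)

theorem wirt_eq_dirD (k : Fin n) (f : Cn n → ℂ) (z : Cn n) :
    wirt k f z = dirD (stdVec k) (cplxJ n (stdVec k)) (-Complex.I) f z := by
  simp only [wirt, dirD]; ring

theorem wirtBar_eq_dirD (k : Fin n) (f : Cn n → ℂ) (z : Cn n) :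
    wirtBar k f z = dirD (stdVec k) (cplxJ n (stdVec k)) Complex.I f z := rfl

theorem wirt_eq_dirD' (k : Fin n) :
    wirt k = dirD (stdVec k) (cplxJ n (stdVec k)) (-Complex.I) := by
  ext f z; exact wirt_eq_dirD k f z

theorem wirtBar_eq_dirD' (k : Fin n) :
    wirtBar k = dirD (stdVec k) (cplxJ n (stdVec k)) Complex.I := rfl

section dirD

variable {U : Set (Cn n)} {z : Cn n} {f g : Cn n → ℂ} (u v : Cn n) (c : ℂ)

theorem dirD_congr (h : f =ᶠ[𝓝 z] g) : dirD u v c f z = dirD u v c g z := by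
  simp only [dirD, h.fderiv_eq]

theorem dirD_congr_of_isOpen (hU : IsOpen U) (hz : z ∈ U) (h : ∀ z ∈ U, f z = g z) :
    dirD u v c f z = dirD u v c g z :=
  dirD_congr u v c (Filter.eventuallyEq_of_mem (hU.mem_nhds hz) h)

theorem dirD_add (hf : DifferentiableAt ℝ f z) (hg : DifferentiableAt ℝ g z) :
    dirD u v c (fun z => f z + g z) z = dirD u v c f z + dirD u v c g z := by
  simp only [dirD, fderiv_fun_add hf hg, add_apply]; ring

theorem dirD_mul (hf : DifferentiableAt ℝ f z) (hg : DifferentiableAt ℝ g z) :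
    dirD u v c (fun z => f z * g z) z = dirD u v c f z * g z + f z * dirD u v c g z := by
  simp only [dirD, fderiv_fun_mul hf hg, add_apply, smul_apply, smul_eq_mul]; ring

theorem dirD_sum {ι : Type*} (s : Finset ι) {f : ι → Cn n → ℂ}
    (hf : ∀ i ∈ s, DifferentiableAt ℝ (f i) z) :
    dirD u v c (fun z => ∑ i ∈ s, f i z) z = ∑ i ∈ s, dirD u v c (f i) z := by
  simp only [dirD, fderiv_fun_sum hf, sum_apply, Finset.mul_sum, Finset.sum_add_distrib, mul_add]

theorem dirD_conj :
    dirD u v c (fun z => (starRingEnd ℂ) (f z)) z =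
      (starRingEnd ℂ) (dirD u v ((starRingEnd ℂ) c) f z) := by
  have h : (fun z => (starRingEnd ℂ) (f z)) = Complex.conjCLE ∘ f := rfl
  have h2 : fderiv ℝ (Complex.conjCLE ∘ f) z = (Complex.conjCLE : ℂ →L[ℝ] ℂ).comp (fderiv ℝ f z) :=
    Complex.conjCLE.comp_fderiv
  simp only [dirD, h, h2]
  simp only [ContinuousLinearMap.comp_apply, map_mul, map_add, map_div₀, map_one, map_ofNat,
    Complex.conj_conj]
  rfl

theorem smoothOn_dirD (hf : ContDiffOn ℝ ∞ f U) (hU : IsOpen U) :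
    ContDiffOn ℝ ∞ (dirD u v c f) U :=
  contDiffOn_const.mul ((smoothOn_fderiv_apply hf hU u).add
    (contDiffOn_const.mul (smoothOn_fderiv_apply hf hU v)))

theorem fderiv_dirD (hf : ContDiffOn ℝ ∞ f U) (hU : IsOpen U) (hz : z ∈ U) (a : Cn n) :
    fderiv ℝ (dirD u v c f) z a =
      (1 / 2 : ℂ) * (fderiv ℝ (fderiv ℝ f) z a u + c * fderiv ℝ (fderiv ℝ f) z a v) := by
  have h1 := smoothOn_differentiableAt (smoothOn_fderiv_apply hf hU u) hU hz
  have h2 := smoothOn_differentiableAt (smoothOn_fderiv_apply hf hU v) hU hz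
  have h : dirD u v c f = fun z => (1 / 2 : ℂ) * (fderiv ℝ f z u + c * fderiv ℝ f z v) := rfl
  rw [h, fderiv_const_mul (h1.fun_add (h2.const_mul c)), smul_apply, fderiv_fun_add h1 (h2.const_mul c),
    add_apply, fderiv_const_mul h2, smul_apply, fderiv_fderiv_apply hf hU hz,
    fderiv_fderiv_apply hf hU hz]
  rfl

theorem dirD_comm (u' v' : Cn n) (c' : ℂ) (hf : ContDiffOn ℝ ∞ f U) (hU : IsOpen U) (hz : z ∈ U) :
    dirD u v c (dirD u' v' c' f) z = dirD u' v' c' (dirD u v c f) z := by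
  simp only [dirD.eq_1 u v c (dirD u' v' c' f), dirD.eq_1 u' v' c' (dirD u v c f)]
  simp only [fderiv_dirD _ _ _ hf hU hz]
  rw [fderiv_fderiv_symm hf hU hz u u', fderiv_fderiv_symm hf hU hz u v',
    fderiv_fderiv_symm hf hU hz v u', fderiv_fderiv_symm hf hU hz v v']
  ring

end dirD

/-! ### `dd^c` and `d^c` -/

theorem fderiv_ofReal {E : Type*} [NormedAddCommGroup E] [NormedSpace ℝ E] {f : E → ℝ} {z : E}
    (hf : DifferentiableAt ℝ f z) (a : E) :
    fderiv ℝ (fun z => ((f z : ℝ) : ℂ)) z a = ((fderiv ℝ f z a : ℝ) : ℂ) := by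
  have h := Complex.ofRealCLM.hasFDerivAt.comp z hf.hasFDerivAt
  have h2 : (fun z => ((f z : ℝ) : ℂ)) = Complex.ofRealCLM ∘ f := rfl
  rw [h2, h.fderiv]
  rfl

theorem smoothOn_ofReal {E : Type*} [NormedAddCommGroup E] [NormedSpace ℝ E] {f : E → ℝ}
    {U : Set E} (hf : ContDiffOn ℝ ∞ f U) : ContDiffOn ℝ ∞ (fun z => ((f z : ℝ) : ℂ)) U :=
  Complex.ofRealCLM.contDiff.comp_contDiffOn hf

section ddc

variable {U : Set (Cn n)} {z : Cn n} {f : Cn n → ℝ}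

theorem ddcLocal_apply (f : Cn n → ℝ) (z a b : Cn n) :
    ddcLocal f z a b = 1 / 2 * (fderiv ℝ (fderiv ℝ f) z (cplxJ n a) b -
      fderiv ℝ (fderiv ℝ f) z a (cplxJ n b)) := rfl

theorem ddcLocal_self (f : Cn n → ℝ) (z a : Cn n) :
    ddcLocal f z a (cplxJ n a) = 1 / 2 * (fderiv ℝ (fderiv ℝ f) z (cplxJ n a) (cplxJ n a) +
      fderiv ℝ (fderiv ℝ f) z a a) := by
  rw [ddcLocal_apply, cplxJ_cplxJ, map_neg, sub_neg_eq_add]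

theorem isOneOne_ddcLocal (hf : ContDiffOn ℝ ∞ f U) (hU : IsOpen U) (hz : z ∈ U) :
    IsOneOne (ddcLocal f z) := by
  refine ⟨fun a b => ?_, fun a b => ?_⟩
  · rw [ddcLocal_apply, ddcLocal_apply, fderiv_fderiv_symm hf hU hz _ b,
      fderiv_fderiv_symm hf hU hz a]
    ring
  · rw [ddcLocal_apply, ddcLocal_apply, cplxJ_cplxJ, cplxJ_cplxJ]
    simp only [map_neg, neg_apply]
    ring

theorem wirt_wirtBar_eq_coeffMatrix (hf : ContDiffOn ℝ ∞ f U) (hU : IsOpen U) (hz : z ∈ U)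
    (k l : Fin n) :
    wirt k (wirtBar l (fun z => (f z : ℂ))) z = coeffMatrix (ddcLocal f z) k l := by
  have hc := smoothOn_ofReal hf
  have h2 : ∀ a b, fderiv ℝ (fderiv ℝ (fun z => (f z : ℂ))) z a b =
      ((fderiv ℝ (fderiv ℝ f) z a b : ℝ) : ℂ) := by
    intro a b
    rw [← fderiv_fderiv_apply hc hU hz, ← fderiv_fderiv_apply hf hU hz, ← fderiv_ofReal
      (smoothOn_differentiableAt (smoothOn_fderiv_apply hf hU b) hU hz)]
    congr 1
    apply Filter.EventuallyEq.fderiv_eq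
    filter_upwards [hU.mem_nhds hz] with y hy
    exact fderiv_ofReal (smoothOn_differentiableAt hf hU hy) b
  rw [wirt_eq_dirD, wirtBar_eq_dirD', dirD, fderiv_dirD _ _ _ hc hU hz, fderiv_dirD _ _ _ hc hU hz]
  simp only [h2, coeffMatrix, ddcLocal_apply, cplxJ_cplxJ, map_neg]
  push_cast
  linear_combination (-(1 / 4 : ℂ) * (fderiv ℝ (fderiv ℝ f) z (cplxJ n (stdVec k))
    (cplxJ n (stdVec l)) : ℂ)) * Complex.I_sq

end ddc

/-! ### Behaviour under holomorphic maps -/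

section comp

variable {U V : Set (Cn n)} {w : Cn n} {f : Cn n → ℝ} {ψ : Cn n → Cn n}

theorem fderiv_comp_holomorphic (hV : IsOpen V) (hw : w ∈ V) (hψ : ContDiffOn ℂ ∞ ψ V) :
    fderiv ℝ ψ w = (fderiv ℂ ψ w).restrictScalars ℝ :=
  (((hψ.contDiffAt (hV.mem_nhds hw)).differentiableAt (by simp)).hasFDerivAt.restrictScalars ℝ).fderiv

theorem fderiv_comp_of_holomorphic (hU : IsOpen U) (hV : IsOpen V) (hw : w ∈ V)
    (hψ : ContDiffOn ℂ ∞ ψ V) (hm : Set.MapsTo ψ V U) (hf : ContDiffOn ℝ ∞ f U) :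
    fderiv ℝ (fun z => f (ψ z)) w =
      (fderiv ℝ f (ψ w)).comp ((fderiv ℂ ψ w).restrictScalars ℝ) := by
  have hψr := hψ.restrict_scalars ℝ
  have := fderiv_comp w (smoothOn_differentiableAt hf hU (hm hw))
    (smoothOn_differentiableAt hψr hV hw)
  rw [← fderiv_comp_holomorphic hV hw hψ, ← this]
  rfl

/-- The chain rule leaves the extra terms `df(D²ψ(Ja, b))` and `df(D²ψ(a, Jb))`. For holomorphic `ψ`
the second derivative is complex bilinear, so the two agree and cancel. -/
theorem ddcLocal_comp (hU : IsOpen U) (hV : IsOpen V) (hw : w ∈ V)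
    (hψ : ContDiffOn ℂ ∞ ψ V) (hm : Set.MapsTo ψ V U) (hf : ContDiffOn ℝ ∞ f U) :
    ddcLocal (fun z => f (ψ z)) w = pull (ddcLocal f (ψ w)) (fderiv ℂ ψ w) := by
  have hψr : ContDiffOn ℝ ∞ ψ V := hψ.restrict_scalars ℝ
  have hJ : ∀ z ∈ V, ∀ b, fderiv ℝ ψ z (cplxJ n b) = cplxJ n (fderiv ℝ ψ z b) := by
    intro z hz b
    rw [fderiv_comp_holomorphic hV hz hψ]
    exact map_cplxJ _ b
  have hJ2 : ∀ a b, fderiv ℝ (fderiv ℝ ψ) w a (cplxJ n b) =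
      cplxJ n (fderiv ℝ (fderiv ℝ ψ) w a b) := by
    intro a b
    rw [← fderiv_fderiv_apply hψr hV hw, ← fderiv_fderiv_apply hψr hV hw]
    have h1 : (fun z => fderiv ℝ ψ z (cplxJ n b)) =ᶠ[𝓝 w]
        (fun z => cplxJ n (fderiv ℝ ψ z b)) := by
      filter_upwards [hV.mem_nhds hw] with z hz using hJ z hz b
    rw [h1.fderiv_eq]
    have h2 := (cplxJ n).hasFDerivAt.comp w
      (smoothOn_differentiableAt (smoothOn_fderiv_apply hψr hV b) hV hw).hasFDerivAt
    have h3 : (fun z => cplxJ n (fderiv ℝ ψ z b)) = (cplxJ n) ∘ fun z => fderiv ℝ ψ z b := rfl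
    rw [h3, h2.fderiv]
    rfl
  have hJ3 : ∀ a b, fderiv ℝ (fderiv ℝ ψ) w (cplxJ n a) b =
      fderiv ℝ (fderiv ℝ ψ) w a (cplxJ n b) := by
    intro a b
    rw [fderiv_fderiv_symm hψr hV hw, hJ2, fderiv_fderiv_symm hψr hV hw b a, ← hJ2]
  have hD2 : ∀ a b, fderiv ℝ (fderiv ℝ (fun z => f (ψ z))) w a b =
      fderiv ℝ (fderiv ℝ f) (ψ w) (fderiv ℝ ψ w a) (fderiv ℝ ψ w b) +
        fderiv ℝ f (ψ w) (fderiv ℝ (fderiv ℝ ψ) w a b) := by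
    intro a b
    have h1 : fderiv ℝ (fun z => f (ψ z)) =ᶠ[𝓝 w]
        fun z => (fderiv ℝ f (ψ z)).comp (fderiv ℝ ψ z) := by
      filter_upwards [hV.mem_nhds hw] with z hz
      exact fderiv_comp z (smoothOn_differentiableAt hf hU (hm hz))
        (smoothOn_differentiableAt hψr hV hz)
    rw [h1.fderiv_eq]
    have hc : HasFDerivAt (fun z => fderiv ℝ f (ψ z))
        ((fderiv ℝ (fderiv ℝ f) (ψ w)).comp (fderiv ℝ ψ w)) w :=
      (smoothOn_differentiableAt (smoothOn_fderiv hf hU) hU (hm hw)).hasFDerivAt.comp w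
        (smoothOn_differentiableAt hψr hV hw).hasFDerivAt
    have hd := (smoothOn_differentiableAt (smoothOn_fderiv hψr hV) hV hw).hasFDerivAt
    rw [(hc.clm_comp hd).fderiv]
    simp [add_comm]
  have hre := fderiv_comp_holomorphic hV hw hψ
  ext a b
  rw [ddcLocal_apply, hD2, hD2, hJ3, hJ w hw, hJ w hw, pull_apply, ddcLocal_apply, hre]
  simp

end comp

/-! ### Gradient forms and the chain rule -/

/-- The `(1,1)`-form polarizing `i ∂f ∧ ∂̄f`. -/
def gradForm (u v : Cn n →L[ℝ] ℝ) : BilForm n :=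
  (1 / 4 : ℝ) • ((u.comp (cplxJ n)).smulRight v + (v.comp (cplxJ n)).smulRight u -
    u.smulRight (v.comp (cplxJ n)) - v.smulRight (u.comp (cplxJ n)))

theorem gradForm_apply (u v : Cn n →L[ℝ] ℝ) (a b : Cn n) :
    gradForm u v a b = 1 / 4 * (u (cplxJ n a) * v b + v (cplxJ n a) * u b - u a * v (cplxJ n b) -
      v a * u (cplxJ n b)) := rfl

theorem gradForm_self (u v : Cn n →L[ℝ] ℝ) (a : Cn n) :
    gradForm u v a (cplxJ n a) = 1 / 2 * (u (cplxJ n a) * v (cplxJ n a) + u a * v a) := by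
  rw [gradForm_apply, cplxJ_cplxJ, map_neg, map_neg]; ring

theorem isOneOne_gradForm (u v : Cn n →L[ℝ] ℝ) : IsOneOne (gradForm u v) := by
  refine ⟨fun a b => ?_, fun a b => ?_⟩
  · rw [gradForm_apply, gradForm_apply]; ring
  · rw [gradForm_apply, gradForm_apply, cplxJ_cplxJ, cplxJ_cplxJ]
    simp only [map_neg]; ring

theorem gradForm_add_left (u u' v : Cn n →L[ℝ] ℝ) :
    gradForm (u + u') v = gradForm u v + gradForm u' v := by
  ext a b; simp only [add_apply, gradForm_apply]; ring

theorem gradForm_smul_left (c : ℝ) (u v : Cn n →L[ℝ] ℝ) :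
    gradForm (c • u) v = c • gradForm u v := by
  ext a b; simp only [smul_apply, gradForm_apply, smul_eq_mul]; ring

theorem gradForm_comm (u v : Cn n →L[ℝ] ℝ) : gradForm u v = gradForm v u := by
  ext a b; simp only [gradForm_apply]; ring

theorem pull_gradForm (u v : Cn n →L[ℝ] ℝ) (P : Cn n →L[ℂ] Cn n) :
    pull (gradForm u v) P =
      gradForm (u.comp (P.restrictScalars ℝ)) (v.comp (P.restrictScalars ℝ)) := by
  ext a b
  simp only [pull_apply, gradForm_apply, ContinuousLinearMap.comp_apply,
    ContinuousLinearMap.coe_restrictScalars', map_cplxJ]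

section chain

variable {U : Set (Cn n)} {z : Cn n} {f : Cn n → ℝ}

theorem fderiv_fderiv_comp_real {E : Type*} [NormedAddCommGroup E] [NormedSpace ℝ E] {U : Set E}
    {z : E} {f : E → ℝ} {S : Set ℝ} {χ : ℝ → ℝ} (hU : IsOpen U) (hz : z ∈ U)
    (hf : ContDiffOn ℝ ∞ f U) (hS : IsOpen S) (hm : Set.MapsTo f U S) (hχ : ContDiffOn ℝ ∞ χ S)
    (a b : E) :
    fderiv ℝ (fderiv ℝ (fun z => χ (f z))) z a b = deriv χ (f z) * fderiv ℝ (fderiv ℝ f) z a b +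
      deriv (deriv χ) (f z) * (fderiv ℝ f z a * fderiv ℝ f z b) := by
  have hdχ : ContDiffOn ℝ ∞ (deriv χ) S := hχ.deriv_of_isOpen hS (by simp)
  have h1 : fderiv ℝ (fun z => χ (f z)) =ᶠ[𝓝 z] fun z => deriv χ (f z) • fderiv ℝ f z := by
    filter_upwards [hU.mem_nhds hz] with y hy
    exact ((smoothOn_differentiableAt hχ hS (hm hy)).hasDerivAt.comp_hasFDerivAt y
      (smoothOn_differentiableAt hf hU hy).hasFDerivAt).fderiv
  rw [h1.fderiv_eq]
  have h2 : HasFDerivAt (fun z => deriv χ (f z)) (deriv (deriv χ) (f z) • fderiv ℝ f z) z :=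
    (smoothOn_differentiableAt hdχ hS (hm hz)).hasDerivAt.comp_hasFDerivAt z
      (smoothOn_differentiableAt hf hU hz).hasFDerivAt
  have h3 := h2.smul (smoothOn_differentiableAt (smoothOn_fderiv hf hU) hU hz).hasFDerivAt
  have h4 : fderiv ℝ (fun z => deriv χ (f z) • fderiv ℝ f z) z = _ := h3.fderiv
  rw [h4]
  simp [mul_assoc]

theorem ddcLocal_comp_real {S : Set ℝ} {χ : ℝ → ℝ} (hU : IsOpen U) (hz : z ∈ U)
    (hf : ContDiffOn ℝ ∞ f U) (hS : IsOpen S) (hm : Set.MapsTo f U S) (hχ : ContDiffOn ℝ ∞ χ S) :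
    ddcLocal (fun z => χ (f z)) z = deriv χ (f z) • ddcLocal f z +
      deriv (deriv χ) (f z) • gradForm (fderiv ℝ f z) (fderiv ℝ f z) := by
  ext a b
  rw [ddcLocal_apply, fderiv_fderiv_comp_real hU hz hf hS hm hχ,
    fderiv_fderiv_comp_real hU hz hf hS hm hχ]
  simp only [add_apply, smul_apply, smul_eq_mul, ddcLocal_apply, gradForm_apply]
  ring

theorem ddcLocal_congr {g : Cn n → ℝ} (hU : IsOpen U) (hz : z ∈ U) (h : ∀ z ∈ U, f z = g z) :
    ddcLocal f z = ddcLocal g z := by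
  have h1 : f =ᶠ[𝓝 z] g := Filter.eventuallyEq_of_mem (hU.mem_nhds hz) h
  have h2 : fderiv ℝ (fderiv ℝ f) z = fderiv ℝ (fderiv ℝ g) z := h1.fderiv.fderiv_eq
  simp only [ddcLocal, h2]

theorem ddcLocal_add {g : Cn n → ℝ} (hU : IsOpen U) (hz : z ∈ U) (hf : ContDiffOn ℝ ∞ f U)
    (hg : ContDiffOn ℝ ∞ g U) :
    ddcLocal (fun z => f z + g z) z = ddcLocal f z + ddcLocal g z := by
  have h1 : fderiv ℝ (fun z => f z + g z) =ᶠ[𝓝 z] fun z => fderiv ℝ f z + fderiv ℝ g z := by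
    filter_upwards [hU.mem_nhds hz] with y hy
    exact fderiv_fun_add (smoothOn_differentiableAt hf hU hy) (smoothOn_differentiableAt hg hU hy)
  have h2 : fderiv ℝ (fderiv ℝ (fun z => f z + g z)) z =
      fderiv ℝ (fderiv ℝ f) z + fderiv ℝ (fderiv ℝ g) z := by
    rw [h1.fderiv_eq]
    exact fderiv_fun_add (smoothOn_differentiableAt (smoothOn_fderiv hf hU) hU hz)
      (smoothOn_differentiableAt (smoothOn_fderiv hg hU) hU hz)
  ext a b
  simp only [add_apply, ddcLocal_apply, h2]
  ring

theorem ddcLocal_const_mul (c : ℝ) (hU : IsOpen U) (hz : z ∈ U) (hf : ContDiffOn ℝ ∞ f U) :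
    ddcLocal (fun z => c * f z) z = c • ddcLocal f z := by
  have h := ddcLocal_comp_real (χ := fun t => c * t) hU hz hf isOpen_univ (Set.mapsTo_univ _ _)
    (contDiffOn_const.mul contDiffOn_id)
  have h1 : deriv (fun t : ℝ => c * t) = fun _ => c := by
    ext t; simp
  rw [h, h1]
  ext a b; simp

end chain

/-! ### Kähler coefficient matrices -/

/-- The coefficient matrix of a Kähler form (without positivity) on an open set of `ℂⁿ`. -/
structure KahlerMat (U : Set (Cn n)) (g : Fin n → Fin n → Cn n → ℂ) : Prop where
  smooth : ∀ i j, ContDiffOn ℝ ∞ (g i j) U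
  herm : ∀ z ∈ U, ∀ i j, g j i z = (starRingEnd ℂ) (g i j z)
  closed : ∀ z ∈ U, ∀ k i j, wirt k (g i j) z = wirt i (g k j) z

section

variable {U : Set (Cn n)} {z : Cn n}

theorem smoothOn_wirtBar {f : Cn n → ℂ} (hf : ContDiffOn ℝ ∞ f U) (hU : IsOpen U) (k : Fin n) :
    ContDiffOn ℝ ∞ (wirtBar k f) U := by
  rw [wirtBar_eq_dirD']; exact smoothOn_dirD _ _ _ hf hU

theorem wirtBar_conj_of_eqOn {f g : Cn n → ℂ} (hU : IsOpen U) (hz : z ∈ U)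
    (h : ∀ z ∈ U, f z = (starRingEnd ℂ) (g z)) (k : Fin n) :
    wirtBar k f z = (starRingEnd ℂ) (wirt k g z) := by
  rw [wirtBar_eq_dirD, dirD_congr_of_isOpen _ _ _ hU hz h, dirD_conj, wirt_eq_dirD, Complex.conj_I]

theorem wirt_wirtBar_comm {f : Cn n → ℂ} (hf : ContDiffOn ℝ ∞ f U) (hU : IsOpen U) (hz : z ∈ U)
    (k l : Fin n) : wirt k (wirtBar l f) z = wirtBar l (wirt k f) z := by
  rw [wirt_eq_dirD', wirtBar_eq_dirD', dirD_comm _ _ _ _ _ _ hf hU hz]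

theorem dirD_sum_mul (u v : Cn n) (c : ℂ) {A B : Fin n → Cn n → ℂ} (hU : IsOpen U) (hz : z ∈ U)
    (hA : ∀ q, ContDiffOn ℝ ∞ (A q) U) (hB : ∀ q, ContDiffOn ℝ ∞ (B q) U) :
    dirD u v c (fun z => ∑ q, A q z * B q z) z =
      ∑ q, (dirD u v c (A q) z * B q z + A q z * dirD u v c (B q) z) := by
  have dA := fun q => smoothOn_differentiableAt (hA q) hU hz
  have dB := fun q => smoothOn_differentiableAt (hB q) hU hz
  rw [dirD_sum _ _ _ _ fun q _ => (dA q).fun_mul (dB q)]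
  exact Finset.sum_congr rfl fun q _ => dirD_mul _ _ _ (dA q) (dB q)

namespace KahlerMat

variable {g : Fin n → Fin n → Cn n → ℂ}

theorem wirtBar_eq (hg : KahlerMat U g) (hU : IsOpen U) (hz : z ∈ U) (k i j : Fin n) :
    wirtBar k (g i j) z = (starRingEnd ℂ) (wirt k (g j i) z) :=
  wirtBar_conj_of_eqOn hU hz (fun z hz => hg.herm z hz j i) k

theorem closedBar (hg : KahlerMat U g) (hU : IsOpen U) (hz : z ∈ U) (k i j : Fin n) :
    wirtBar k (g i j) z = wirtBar j (g i k) z := by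
  rw [hg.wirtBar_eq hU hz, hg.wirtBar_eq hU hz, hg.closed z hz]

/-- Closedness is used once for each type of derivative. It converts the second derivatives
occurring in the Laplacian of a trace into those occurring in `∂∂̄ log det`. -/
theorem second (hg : KahlerMat U g) (hU : IsOpen U) (hz : z ∈ U) (k i : Fin n) :
    wirt k (wirtBar k (g i i)) z = wirt i (wirtBar i (g k k)) z := by
  have h1 : wirt k (wirtBar k (g i i)) z = wirt k (wirtBar i (g i k)) z := by
    rw [wirt_eq_dirD']
    exact dirD_congr_of_isOpen _ _ _ hU hz fun z hz => hg.closedBar hU hz _ _ _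
  rw [h1, wirt_wirtBar_comm (hg.smooth i k) hU hz, wirt_wirtBar_comm (hg.smooth k k) hU hz,
    wirtBar_eq_dirD']
  exact dirD_congr_of_isOpen _ _ _ hU hz fun z hz => hg.closed z hz _ _ _

end KahlerMat

/-! ### Laplacian identities at a point where two Kähler metrics are diagonal -/

variable {g h Z N : Fin n → Fin n → Cn n → ℂ} {d : Fin n → ℝ}

/-- The product rule is applied to `g Z = h`, so the inverse of `g` is never differentiated. The
coordinates are not normal for `g`, hence the term with the derivative of `g`. -/
theorem dirD_quotient_at (u v : Cn n) (c : ℂ) (hU : IsOpen U) (hz : z ∈ U)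
    (hg : ∀ i j, ContDiffOn ℝ ∞ (g i j) U) (hZ : ∀ i j, ContDiffOn ℝ ∞ (Z i j) U)
    (hgZ : ∀ z ∈ U, ∀ i j, ∑ q, g i q z * Z q j z = h i j z)
    (hg0 : ∀ i j, g i j z = if i = j then 1 else 0)
    (hZ0 : ∀ i j, Z i j z = if i = j then (d i : ℂ) else 0) (i j : Fin n) :
    dirD u v c (Z i j) z = dirD u v c (h i j) z - dirD u v c (g i j) z * d j := by
  have h1 := dirD_congr_of_isOpen u v c hU hz fun z hz => (hgZ z hz i j).symm
  rw [dirD_sum_mul u v c hU hz (hg i) (fun q => hZ q j), Finset.sum_add_distrib] at h1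
  simp only [hg0, hZ0, mul_ite, mul_zero, ite_mul, one_mul, zero_mul, Finset.sum_ite_eq,
    Finset.sum_ite_eq', Finset.mem_univ, if_true] at h1
  rw [h1]; ring

theorem quotient_at (hz : z ∈ U)
    (hgZ : ∀ z ∈ U, ∀ i j, ∑ q, g i q z * Z q j z = h i j z)
    (hg0 : ∀ i j, g i j z = if i = j then 1 else 0)
    (hh0 : ∀ i j, h i j z = if i = j then (d i : ℂ) else 0) (i j : Fin n) :
    Z i j z = if i = j then (d i : ℂ) else 0 := by
  have h1 := hgZ z hz i j
  simp only [hg0, ite_mul, one_mul, zero_mul, Finset.sum_ite_eq, Finset.mem_univ, if_true] at h1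
  rw [h1, hh0]

/-- The Laplacian of the trace of one Kähler metric with respect to another, in a frame in which
both metrics are diagonal. -/
theorem laplacian_trace_identity (hU : IsOpen U) (hz : z ∈ U) (hg : KahlerMat U g)
    (hh : KahlerMat U h) (hZ : ∀ i j, ContDiffOn ℝ ∞ (Z i j) U)
    (hgZ : ∀ z ∈ U, ∀ i j, ∑ q, g i q z * Z q j z = h i j z)
    (hg0 : ∀ i j, g i j z = if i = j then 1 else 0)
    (hh0 : ∀ i j, h i j z = if i = j then (d i : ℂ) else 0) (hd : ∀ i, d i ≠ 0) :
    ∑ k, (d k : ℂ)⁻¹ * ∑ i, wirt k (wirtBar k (Z i i)) z =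
      ∑ i, (∑ k, (d k : ℂ)⁻¹ * wirt i (wirtBar i (h k k)) z - ∑ k, ∑ q, (d k : ℂ)⁻¹ * (d q : ℂ)⁻¹ *
          (wirt i (h k q) z * (starRingEnd ℂ) (wirt i (h k q) z))) +
      ∑ k, ∑ i, (d i : ℂ) * (d k : ℂ)⁻¹ *
        (∑ q, wirt k (g i q) z * wirtBar k (g q i) z - wirt k (wirtBar k (g i i)) z) +
      ∑ k, ∑ i, ∑ q, (d k : ℂ)⁻¹ * (d q : ℂ)⁻¹ *
        (wirt k (Z i q) z * (starRingEnd ℂ) (wirt k (Z i q) z)) := by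
  have hZ0 := quotient_at hz hgZ hg0 hh0
  have hdc : ∀ i, (d i : ℂ) ≠ 0 := fun i => by exact_mod_cast hd i
  have hc : ∀ k i j, wirt k (Z i j) z = wirt k (h i j) z - wirt k (g i j) z * d j := by
    intro k i j
    rw [wirt_eq_dirD']
    exact dirD_quotient_at _ _ _ hU hz hg.smooth hZ hgZ hg0 hZ0 i j
  have hcb : ∀ k i j, wirtBar k (Z i j) z = wirtBar k (h i j) z - wirtBar k (g i j) z * d j := by
    intro k i j
    rw [wirtBar_eq_dirD']
    exact dirD_quotient_at _ _ _ hU hz hg.smooth hZ hgZ hg0 hZ0 i j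
  -- The equation `g Z = h` is differentiated twice and solved for `∂∂̄Z`, using that `g` is the
  -- identity and `Z` is diagonal at the point.
  have h2 : ∀ k i, wirt k (wirtBar k (Z i i)) z = wirt k (wirtBar k (h i i)) z -
      wirt k (wirtBar k (g i i)) z * d i -
      ∑ q, (wirtBar k (g i q) z * wirt k (Z q i) z + wirt k (g i q) z * wirtBar k (Z q i) z) := by
    intro k i
    have e1 : wirt k (wirtBar k (h i i)) z = wirt k (fun z => ∑ q, (wirtBar k (g i q) z * Z q i z +
        g i q z * wirtBar k (Z q i) z)) z := by
      rw [wirt_eq_dirD']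
      refine dirD_congr_of_isOpen _ _ _ hU hz fun y hy => ?_
      rw [wirtBar_eq_dirD', ← dirD_sum_mul _ _ _ hU hy (hg.smooth i) (fun q => hZ q i)]
      exact dirD_congr_of_isOpen _ _ _ hU hy fun y hy => (hgZ y hy i i).symm
    have s1 := fun q => smoothOn_wirtBar (hg.smooth i q) hU k
    have s2 := fun q => smoothOn_wirtBar (hZ q i) hU k
    have e2 : wirt k (fun z => ∑ q, (wirtBar k (g i q) z * Z q i z +
        g i q z * wirtBar k (Z q i) z)) z = ∑ q, (wirt k (wirtBar k (g i q)) z * Z q i z +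
          wirtBar k (g i q) z * wirt k (Z q i) z) + ∑ q, (wirt k (g i q) z * wirtBar k (Z q i) z +
          g i q z * wirt k (wirtBar k (Z q i)) z) := by
      have d1 := fun q => smoothOn_differentiableAt (s1 q) hU hz
      have d2 := fun q => smoothOn_differentiableAt (s2 q) hU hz
      have d3 := fun q => smoothOn_differentiableAt (hg.smooth i q) hU hz
      have d4 := fun q => smoothOn_differentiableAt (hZ q i) hU hz
      simp only [wirt_eq_dirD' k]
      rw [← dirD_sum_mul _ _ _ hU hz s1 (fun q => hZ q i),
        ← dirD_sum_mul _ _ _ hU hz (hg.smooth i) s2, ← dirD_add]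
      · simp only [Finset.sum_add_distrib]
      · exact DifferentiableAt.fun_sum fun q _ => (d1 q).fun_mul (d4 q)
      · exact DifferentiableAt.fun_sum fun q _ => (d3 q).fun_mul (d2 q)
    rw [e1, e2]
    simp only [Finset.sum_add_distrib]
    simp only [hg0, hZ0, mul_ite, mul_zero, ite_mul, one_mul, zero_mul, Finset.sum_ite_eq,
      Finset.sum_ite_eq', Finset.mem_univ, if_true]
    ring
  -- The second derivatives of `h` are exchanged by `KahlerMat.second`, and all first derivatives
  -- are expressed through `∂Z` and `∂g`.
  have h3 : ∀ k i, wirt k (wirtBar k (Z i i)) z = wirt i (wirtBar i (h k k)) z -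
      wirt k (wirtBar k (g i i)) z * d i -
      ∑ q, ((starRingEnd ℂ) (wirt k (g q i) z) * wirt k (Z q i) z + wirt k (g i q) z *
        ((starRingEnd ℂ) (wirt k (Z i q) z + wirt k (g i q) z * d q) -
          (starRingEnd ℂ) (wirt k (g i q) z) * d i)) := by
    intro k i
    rw [h2, hh.second hU hz]
    congr 1
    refine Finset.sum_congr rfl fun q _ => ?_
    rw [hcb, hg.wirtBar_eq hU hz, hh.wirtBar_eq hU hz, hg.wirtBar_eq hU hz, hc k i q]
    ring_nf
  have h4 : ∀ k, ∑ i, wirt k (wirtBar k (Z i i)) z = ∑ i, (wirt i (wirtBar i (h k k)) z -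
      wirt k (wirtBar k (g i i)) z * d i) - ∑ i, ∑ q, ((starRingEnd ℂ) (wirt k (g i q) z) *
        wirt k (Z i q) z + wirt k (g i q) z *
        ((starRingEnd ℂ) (wirt k (Z i q) z + wirt k (g i q) z * d q) -
          (starRingEnd ℂ) (wirt k (g i q) z) * d i)) := by
    intro k
    simp only [h3, Finset.sum_sub_distrib, Finset.sum_add_distrib]
    rw [Finset.sum_comm (f := fun i q => (starRingEnd ℂ) (wirt k (g q i) z) * wirt k (Z q i) z)]
  have h5 : ∑ i, (∑ k, (d k : ℂ)⁻¹ * wirt i (wirtBar i (h k k)) z - ∑ k, ∑ q, (d k : ℂ)⁻¹ *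
      (d q : ℂ)⁻¹ * (wirt i (h k q) z * (starRingEnd ℂ) (wirt i (h k q) z))) =
      ∑ k, ∑ i, ((d k : ℂ)⁻¹ * wirt i (wirtBar i (h k k)) z - ∑ q, (d k : ℂ)⁻¹ *
      (d q : ℂ)⁻¹ * ((wirt k (Z i q) z + wirt k (g i q) z * d q) *
        (starRingEnd ℂ) (wirt k (Z i q) z + wirt k (g i q) z * d q))) := by
    simp only [← Finset.sum_sub_distrib]
    rw [Finset.sum_comm]
    refine Finset.sum_congr rfl fun k _ => Finset.sum_congr rfl fun i _ => ?_
    congr 1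
    refine Finset.sum_congr rfl fun q _ => ?_
    rw [hh.closed z hz, hc, sub_add_cancel]
  rw [h5, ← Finset.sum_add_distrib, ← Finset.sum_add_distrib]
  refine Finset.sum_congr rfl fun k _ => ?_
  rw [h4, ← Finset.sum_sub_distrib, Finset.mul_sum, ← Finset.sum_add_distrib,
    ← Finset.sum_add_distrib]
  refine Finset.sum_congr rfl fun i _ => ?_
  have h6 : ∀ q, wirtBar k (g q i) z = (starRingEnd ℂ) (wirt k (g i q) z) := fun q =>
    hg.wirtBar_eq hU hz _ _ _
  simp only [h6]
  -- This reduces the claim to one algebraic identity for each `q`: the expansion of `|∂Z + ∂g·d|²`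
  -- into its squares and cross terms.
  have h7 : ∀ A B C : ℂ, ∀ f1 f2 f3 f4 : Fin n → ℂ,
      (∀ q, -(d k : ℂ)⁻¹ * f1 q = -f2 q + (d i : ℂ) * (d k : ℂ)⁻¹ * f3 q + f4 q) →
      (d k : ℂ)⁻¹ * (A - B * d i - ∑ q, f1 q) = ((d k : ℂ)⁻¹ * A - ∑ q, f2 q) +
        (d i : ℂ) * (d k : ℂ)⁻¹ * (∑ q, f3 q - B) + ∑ q, f4 q := by
    intro A B _ f1 f2 f3 f4 hf
    have : ∑ q, (-(d k : ℂ)⁻¹ * f1 q) = ∑ q, (-f2 q + (d i : ℂ) * (d k : ℂ)⁻¹ * f3 q + f4 q) :=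
      Finset.sum_congr rfl fun q _ => hf q
    simp only [Finset.sum_add_distrib, ← Finset.mul_sum, Finset.sum_neg_distrib] at this
    linear_combination this
  refine h7 _ _ 0 _ _ _ _ fun q => ?_
  have hk := hdc k
  have hq := hdc q
  simp only [map_add, map_mul, Complex.conj_ofReal]
  field_simp
  ring

/-- The complex Hessian of `log det h` in a frame in which `h` is diagonal. -/
theorem wirt_wirtBar_logDet {L : Cn n → ℂ} (hU : IsOpen U) (hz : z ∈ U) (hh : KahlerMat U h)
    (hN : ∀ i j, ContDiffOn ℝ ∞ (N i j) U)
    (hhN : ∀ z ∈ U, ∀ i j, ∑ q, h i q z * N q j z = if i = j then 1 else 0)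
    (hh0 : ∀ i j, h i j z = if i = j then (d i : ℂ) else 0) (hd : ∀ i, d i ≠ 0) (k : Fin n)
    (hL : ∀ z ∈ U, wirtBar k L z = ∑ i, ∑ j, N j i z * wirtBar k (h i j) z) :
    wirt k (wirtBar k L) z = ∑ i, (d i : ℂ)⁻¹ * wirt k (wirtBar k (h i i)) z -
      ∑ i, ∑ j, (d i : ℂ)⁻¹ * (d j : ℂ)⁻¹ *
        (wirt k (h i j) z * (starRingEnd ℂ) (wirt k (h i j) z)) := by
  have hdc : ∀ i, (d i : ℂ) ≠ 0 := fun i => by exact_mod_cast hd i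
  have hN0 : ∀ i j, N i j z = if i = j then (d i : ℂ)⁻¹ else 0 := by
    intro i j
    have h1 := hhN z hz i j
    simp only [hh0, ite_mul, zero_mul, Finset.sum_ite_eq, Finset.mem_univ, if_true] at h1
    split_ifs with hij
    · rw [if_pos hij] at h1
      exact eq_inv_of_mul_eq_one_right h1
    · rw [if_neg hij] at h1
      exact (mul_eq_zero.mp h1).resolve_left (hdc i)
  -- Differentiating `h N = 1` gives `∂N = -h⁻¹ ∂h h⁻¹`, and `h` is diagonal at the point.
  have hN1 : ∀ i j, wirt k (N i j) z = -((d i : ℂ)⁻¹ * (d j : ℂ)⁻¹ * wirt k (h i j) z) := by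
    intro i j
    have h1 : dirD (stdVec k) (cplxJ n (stdVec k)) (-Complex.I)
        (fun z => ∑ q, h i q z * N q j z) z = 0 := by
      rw [dirD_congr_of_isOpen _ _ _ hU hz fun z hz => hhN z hz i j]
      simp [dirD]
    rw [dirD_sum_mul _ _ _ hU hz (hh.smooth i) (fun q => hN q j), ← wirt_eq_dirD' k,
      Finset.sum_add_distrib] at h1
    simp only [hh0, hN0, mul_ite, mul_zero, ite_mul, zero_mul, Finset.sum_ite_eq,
      Finset.sum_ite_eq', Finset.mem_univ, if_true] at h1
    have hi := hdc i
    have hj := hdc j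
    field_simp
    field_simp at h1
    linear_combination h1
  have hdN := fun i j => smoothOn_differentiableAt (hN i j) hU hz
  have hdh := fun i j => smoothOn_differentiableAt (smoothOn_wirtBar (hh.smooth i j) hU k) hU hz
  have h1 : wirt k (wirtBar k L) z = ∑ i, ∑ j, (wirt k (N j i) z * wirtBar k (h i j) z +
      N j i z * wirt k (wirtBar k (h i j)) z) := by
    rw [wirt_eq_dirD', dirD_congr_of_isOpen _ _ _ hU hz hL, dirD_sum]
    · exact Finset.sum_congr rfl fun i _ => dirD_sum_mul _ _ _ hU hz (fun j => hN j i)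
        (fun j => smoothOn_wirtBar (hh.smooth i j) hU k)
    · exact fun i _ => DifferentiableAt.fun_sum fun j _ => (hdN j i).fun_mul (hdh i j)
  rw [h1]
  simp only [Finset.sum_add_distrib, hN0, hN1, ite_mul, zero_mul, Finset.sum_ite_eq',
    Finset.mem_univ, if_true]
  rw [add_comm, sub_eq_add_neg]
  congr 1
  rw [Finset.sum_comm]
  simp only [← Finset.sum_neg_distrib]
  refine Finset.sum_congr rfl fun i _ => Finset.sum_congr rfl fun j _ => ?_
  rw [hh.wirtBar_eq hU hz]
  ring

/-- The weighted terms in the Laplacian of the trace. -/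
theorem moment_laplacian_identity {m mX : Cn n → ℂ} (hU : IsOpen U) (hz : z ∈ U)
    (hg : KahlerMat U g) (hh : KahlerMat U h) (hZ : ∀ i j, ContDiffOn ℝ ∞ (Z i j) U)
    (hgZ : ∀ z ∈ U, ∀ i j, ∑ q, g i q z * Z q j z = h i j z)
    (hg0 : ∀ i j, g i j z = if i = j then 1 else 0)
    (hh0 : ∀ i j, h i j z = if i = j then (d i : ℂ) else 0) (hd : ∀ i, d i ≠ 0)
    (hmX : ContDiffOn ℝ ∞ mX U)
    (hm : ∀ z ∈ U, ∀ l, wirtBar l m z = ∑ q, wirtBar q mX z * Z q l z) :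
    ∑ j, wirt j (wirtBar j m) z = ∑ j, (d j : ℂ) * wirt j (wirtBar j mX) z +
      ∑ q, (d q : ℂ)⁻¹ * (wirt q (fun z => ∑ i, Z i i z) z * wirtBar q m z) := by
  have hZ0 := quotient_at hz hgZ hg0 hh0
  have hdc : ∀ i, (d i : ℂ) ≠ 0 := fun i => by exact_mod_cast hd i
  have hc : ∀ k i j, wirt k (Z i j) z = wirt k (h i j) z - wirt k (g i j) z * d j := by
    intro k i j
    rw [wirt_eq_dirD']
    exact dirD_quotient_at _ _ _ hU hz hg.smooth hZ hgZ hg0 hZ0 i j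
  -- At the point, `∂Z` inherits from `∂h` and `∂g` the symmetry in the first two indices, because
  -- the factor `d j` involves only the last one.
  have hsym : ∀ k i j, wirt k (Z i j) z = wirt i (Z k j) z := by
    intro k i j
    rw [hc, hc, hg.closed z hz, hh.closed z hz]
  have h1 : ∀ j, wirt j (wirtBar j m) z = (d j : ℂ) * wirt j (wirtBar j mX) z +
      ∑ q, wirtBar q mX z * wirt q (Z j j) z := by
    intro j
    rw [wirt_eq_dirD' j, dirD_congr_of_isOpen _ _ _ hU hz fun z hz => hm z hz j,
      dirD_sum_mul _ _ _ hU hz (fun q => smoothOn_wirtBar hmX hU q) (fun q => hZ q j),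
      ← wirt_eq_dirD' j, Finset.sum_add_distrib]
    simp only [hZ0, mul_ite, mul_zero, Finset.sum_ite_eq', Finset.mem_univ, if_true]
    rw [mul_comm]
    congr 1
    exact Finset.sum_congr rfl fun q _ => by rw [hsym]
  have h2 : ∀ q, (d q : ℂ)⁻¹ * (wirt q (fun z => ∑ i, Z i i z) z * wirtBar q m z) =
      ∑ j, wirtBar q mX z * wirt q (Z j j) z := by
    intro q
    have e1 : wirt q (fun z => ∑ i, Z i i z) z = ∑ i, wirt q (Z i i) z := by
      rw [wirt_eq_dirD']
      exact dirD_sum _ _ _ _ fun i _ => smoothOn_differentiableAt (hZ i i) hU hz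
    rw [e1, hm z hz]
    simp only [hZ0, mul_ite, mul_zero, Finset.sum_ite_eq', Finset.mem_univ, if_true]
    rw [← Finset.mul_sum]
    have := hdc q
    field_simp
  rw [Finset.sum_congr rfl fun j _ => h1 j, Finset.sum_congr rfl fun q _ => h2 q,
    Finset.sum_add_distrib]
  congr 1
  exact Finset.sum_comm

end

/-! ### Determinants and inverses -/

section det

variable {E : Type*} [NormedAddCommGroup E] [NormedSpace ℝ E] {U : Set E} {z : E}
  {A : E → Matrix (Fin n) (Fin n) ℂ}

theorem smoothOn_det (hA : ∀ i j, ContDiffOn ℝ ∞ (fun z => A z i j) U) :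
    ContDiffOn ℝ ∞ (fun z => (A z).det) U := by
  simp only [Matrix.det_apply]
  refine ContDiffOn.sum fun σ _ => ?_
  have : ContDiffOn ℝ ∞ (fun z => ∏ i, A z (σ i) i) U := contDiffOn_prod fun i _ => hA _ _
  rcases Int.units_eq_one_or (Equiv.Perm.sign σ) with h | h
  · simpa [h] using this
  · simpa [h] using this.neg

theorem smoothOn_adjugate (hA : ∀ i j, ContDiffOn ℝ ∞ (fun z => A z i j) U) (i j : Fin n) :
    ContDiffOn ℝ ∞ (fun z => (A z).adjugate i j) U := by
  simp only [Matrix.adjugate_apply]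
  refine smoothOn_det fun k l => ?_
  by_cases h : k = j
  · subst h; simp only [Matrix.updateRow_self]; exact contDiffOn_const
  · simp only [Matrix.updateRow_ne h]; exact hA k l

theorem smoothOn_inv (hA : ∀ i j, ContDiffOn ℝ ∞ (fun z => A z i j) U)
    (hdet : ∀ z ∈ U, (A z).det ≠ 0) (i j : Fin n) :
    ContDiffOn ℝ ∞ (fun z => (A z)⁻¹ i j) U := by
  have : ∀ z, (A z)⁻¹ i j = ((A z).det)⁻¹ * (A z).adjugate i j := fun z => by
    rw [Matrix.inv_def, Ring.inverse_eq_inv']; rfl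
  simp only [this]
  exact ((smoothOn_det hA).inv hdet).mul (smoothOn_adjugate hA i j)

/-- Jacobi's formula. The Leibniz expansion is grouped column by column; each group is the
determinant with that column replaced by its derivative, which Cramer's rule writes with the
adjugate. -/
theorem fderiv_det_apply (hA : ∀ i j, DifferentiableAt ℝ (fun z => A z i j) z) (v : E) :
    fderiv ℝ (fun z => (A z).det) z v =
      ∑ i, ∑ j, (A z).adjugate j i * fderiv ℝ (fun z => A z i j) z v := by
  have h1 : HasFDerivAt (fun z => (A z).det) (∑ σ : Equiv.Perm (Fin n),
      ((Equiv.Perm.sign σ : ℤ) : ℂ) • ∑ i, (∏ j ∈ Finset.univ.erase i, A z (σ j) j) •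
        fderiv ℝ (fun z => A z (σ i) i) z) z := by
    simp only [Matrix.det_apply']
    refine HasFDerivAt.fun_sum fun σ _ => ?_
    exact (HasFDerivAt.finsetProd fun i _ => (hA (σ i) i).hasFDerivAt).const_mul _
  rw [h1.fderiv]
  have h2 : ∀ j, ∑ i, (A z).adjugate j i * fderiv ℝ (fun z => A z i j) z v =
      ((A z).updateCol j fun i => fderiv ℝ (fun z => A z i j) z v).det := by
    intro j
    rw [← Matrix.cramer_apply, Matrix.cramer_eq_adjugate_mulVec]
    rfl
  rw [Finset.sum_comm, Finset.sum_congr rfl fun j _ => h2 j]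
  simp only [Matrix.det_apply']
  rw [Finset.sum_comm]
  simp only [sum_apply, smul_apply, smul_eq_mul]
  refine Finset.sum_congr rfl fun σ _ => ?_
  rw [← Finset.mul_sum]
  congr 1
  refine Finset.sum_congr rfl fun j _ => ?_
  rw [← Finset.mul_prod_erase _ _ (Finset.mem_univ j), Matrix.updateCol_self, mul_comm]
  congr 1
  refine Finset.prod_congr rfl fun k hk => ?_
  rw [Matrix.updateCol_ne (Finset.ne_of_mem_erase hk)]

end det

/-! ### Local Kähler forms -/

/-- A smooth closed real `(1,1)`-form on an open subset of `ℂⁿ`. -/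
structure LocClosed (U : Set (Cn n)) (α : Cn n → BilForm n) : Prop where
  smooth : ContDiffOn ℝ ∞ α U
  oneOne : ∀ z ∈ U, IsOneOne (α z)
  closed : ∀ z ∈ U, ∀ a b c : Cn n,
    fderiv ℝ α z a b c + fderiv ℝ α z b c a + fderiv ℝ α z c a b = 0

/-- A Kähler form on an open subset of `ℂⁿ`. -/
structure LocKahler (U : Set (Cn n)) (α : Cn n → BilForm n) : Prop extends LocClosed U α where
  pos : ∀ z ∈ U, ∀ a, a ≠ 0 → 0 < α z a (cplxJ n a)

section

variable {U : Set (Cn n)} {z : Cn n} {α : Cn n → BilForm n}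

theorem smoothOn_form_apply (hα : ContDiffOn ℝ ∞ α U) (a b : Cn n) :
    ContDiffOn ℝ ∞ (fun z => α z a b) U :=
  (hα.clm_apply contDiffOn_const).clm_apply contDiffOn_const

theorem smoothOn_form_iff :
    ContDiffOn ℝ ∞ α U ↔ ∀ a b, ContDiffOn ℝ ∞ (fun z => α z a b) U := by
  refine ⟨smoothOn_form_apply, fun h => ?_⟩
  rw [contDiffOn_clm_apply]
  intro a
  rw [contDiffOn_clm_apply]
  exact h a

theorem smoothOn_coeffMatrix (hα : ContDiffOn ℝ ∞ α U) (i j : Fin n) :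
    ContDiffOn ℝ ∞ (fun z => coeffMatrix (α z) i j) U :=
  contDiffOn_const.mul ((smoothOn_ofReal (smoothOn_form_apply hα _ _)).sub
    (contDiffOn_const.mul (smoothOn_ofReal (smoothOn_form_apply hα _ _))))

theorem fderiv_form_apply (hα : ContDiffOn ℝ ∞ α U) (hU : IsOpen U) (hz : z ∈ U) (a b v : Cn n) :
    fderiv ℝ (fun z => α z a b) z v = fderiv ℝ α z v a b := by
  have h := (((smoothOn_differentiableAt hα hU hz).hasFDerivAt.clm_apply
    (hasFDerivAt_const a z))).clm_apply (hasFDerivAt_const b z)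
  rw [h.fderiv]
  simp

theorem LocClosed.fderiv_J (hα : LocClosed U α) (hU : IsOpen U) (hz : z ∈ U) (v a b : Cn n) :
    fderiv ℝ α z v (cplxJ n a) b = -fderiv ℝ α z v a (cplxJ n b) := by
  rw [← fderiv_form_apply hα.smooth hU hz, ← fderiv_form_apply hα.smooth hU hz]
  have h : (fun z => α z (cplxJ n a) b) =ᶠ[𝓝 z] fun z => -α z a (cplxJ n b) := by
    filter_upwards [hU.mem_nhds hz] with y hy using (hα.oneOne y hy).apply_J_right a b
  rw [h.fderiv_eq, fderiv_fun_neg]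
  rfl

/-- The symmetry of `∂g` is the (2,1)-part of `dα = 0`. It is extracted by evaluating `dα` on all
eight triples obtained by applying or not applying `J` to each of three basis vectors. -/
theorem LocClosed.kahlerMat (hα : LocClosed U α) (hU : IsOpen U) :
    KahlerMat U (fun i j z => coeffMatrix (α z) i j) where
  smooth i j := smoothOn_coeffMatrix hα.smooth i j
  herm z hz i j := by
    rw [coeffMatrix_apply, coeffMatrix_apply, herm_conj (hα.oneOne z hz)]
  closed z hz k i j := by
    have hd : ∀ i j v, fderiv ℝ (fun z => coeffMatrix (α z) i j) z v = (1 / 2 : ℂ) *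
        ((fderiv ℝ α z v (stdVec i) (cplxJ n (stdVec j)) : ℂ) -
          Complex.I * (fderiv ℝ α z v (stdVec i) (stdVec j) : ℂ)) := by
      intro i j v
      have s := fun a b => smoothOn_differentiableAt
        (smoothOn_ofReal (smoothOn_form_apply hα.smooth a b)) hU hz
      have s' := fun a b => smoothOn_differentiableAt (smoothOn_form_apply hα.smooth a b) hU hz
      simp only [coeffMatrix]
      rw [fderiv_const_mul ((s _ _).fun_sub ((s _ _).const_mul _)), smul_apply,
        fderiv_fun_sub (s _ _) ((s _ _).const_mul _), sub_apply, fderiv_const_mul (s _ _),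
        smul_apply, fderiv_ofReal (s' _ _), fderiv_ofReal (s' _ _),
        fderiv_form_apply hα.smooth hU hz, fderiv_form_apply hα.smooth hU hz]
      rfl
    have hJ := fun v a b => hα.fderiv_J hU hz v a b
    have hJJ : ∀ v a b, fderiv ℝ α z v (cplxJ n a) (cplxJ n b) = fderiv ℝ α z v a b := by
      intro v a b; rw [hJ, cplxJ_cplxJ, map_neg, neg_neg]
    have hanti : ∀ v a b, fderiv ℝ α z v a b = -fderiv ℝ α z v b a := by
      intro v a b
      rw [← fderiv_form_apply hα.smooth hU hz, ← fderiv_form_apply hα.smooth hU hz]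
      have h : (fun z => α z a b) =ᶠ[𝓝 z] fun z => -α z b a := by
        filter_upwards [hU.mem_nhds hz] with y hy using (hα.oneOne y hy).1 a b
      rw [h.fderiv_eq, fderiv_fun_neg]
      rfl
    simp only [wirt, hd]
    set a := (stdVec k : Cn n)
    set b := (stdVec i : Cn n)
    set c := (stdVec j : Cn n)
    have e1 := hα.closed z hz a b (cplxJ n c)
    have e2 := hα.closed z hz a b c
    have e3 := hα.closed z hz (cplxJ n a) b (cplxJ n c)
    have e4 := hα.closed z hz (cplxJ n a) b c
    have e5 := hα.closed z hz a (cplxJ n b) (cplxJ n c)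
    have e6 := hα.closed z hz a (cplxJ n b) c
    have e7 := hα.closed z hz (cplxJ n a) (cplxJ n b) (cplxJ n c)
    have e8 := hα.closed z hz (cplxJ n a) (cplxJ n b) c
    rw [hanti b] at e1 e2 e3 e4
    rw [hanti (cplxJ n b)] at e5 e6 e7 e8
    simp only [hJJ, hJ, neg_neg] at e1 e2 e3 e4 e5 e6 e7 e8
    apply Complex.ext
    · simp
      linarith
    · simp
      linarith

theorem LocClosed.affine (hα : LocClosed U α) (hU : IsOpen U) (z₀ : Cn n) (P : Cn n →L[ℂ] Cn n) :
    LocClosed {w | z₀ + P w ∈ U} (fun w => pull (α (z₀ + P w)) P) := by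
  let A : Cn n → Cn n := fun w => z₀ + P w
  have hA : ContDiff ℝ ∞ A := contDiff_const.add (P.restrictScalars ℝ).contDiff
  have hAd : ∀ w, HasFDerivAt A (P.restrictScalars ℝ) w := fun w =>
    (P.restrictScalars ℝ).hasFDerivAt.const_add z₀
  have hmap : Set.MapsTo A {w | z₀ + P w ∈ U} U := fun w hw => hw
  have hs : ContDiffOn ℝ ∞ (fun w => pull (α (z₀ + P w)) P) {w | z₀ + P w ∈ U} :=
    smoothOn_form_iff.mpr fun a b =>
      (smoothOn_form_apply hα.smooth (P a) (P b)).comp hA.contDiffOn hmap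
  have hV : IsOpen {w | z₀ + P w ∈ U} := hU.preimage hA.continuous
  refine ⟨hs, fun w hw => (hα.oneOne _ hw).pull P, fun w hw a b c => ?_⟩
  have h1 : ∀ v a b, fderiv ℝ (fun w => pull (α (z₀ + P w)) P) w v a b =
      fderiv ℝ α (z₀ + P w) (P v) (P a) (P b) := by
    intro v a b
    rw [← fderiv_form_apply hs hV hw, ← fderiv_form_apply hα.smooth hU hw]
    have h2 := ((smoothOn_differentiableAt (smoothOn_form_apply hα.smooth (P a) (P b)) hU
      hw).hasFDerivAt.comp w (hAd w)).fderiv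
    change fderiv ℝ ((fun z => α z (P a) (P b)) ∘ A) w v = _
    rw [h2]
    rfl
  rw [h1, h1, h1]
  exact hα.closed _ hw (P a) (P b) (P c)

theorem LocClosed.add {β : Cn n → BilForm n} (hα : LocClosed U α) (hβ : LocClosed U β)
    (hU : IsOpen U) : LocClosed U (fun z => α z + β z) where
  smooth := hα.smooth.add hβ.smooth
  oneOne z hz := (hα.oneOne z hz).add (hβ.oneOne z hz)
  closed z hz a b c := by
    rw [fderiv_fun_add (smoothOn_differentiableAt hα.smooth hU hz)
      (smoothOn_differentiableAt hβ.smooth hU hz)]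
    simp only [add_apply]
    linear_combination hα.closed z hz a b c + hβ.closed z hz a b c

theorem smoothOn_ddcLocal {f : Cn n → ℝ} (hf : ContDiffOn ℝ ∞ f U) (hU : IsOpen U) :
    ContDiffOn ℝ ∞ (ddcLocal f) U := by
  have h := smoothOn_fderiv (smoothOn_fderiv hf hU) hU
  refine smoothOn_form_iff.mpr fun a b => ?_
  exact contDiffOn_const.mul ((smoothOn_form_apply h _ _).sub (smoothOn_form_apply h _ _))

/-- Closedness is the full symmetry of the third derivative: the six terms cancel in pairs. -/
theorem locClosed_ddcLocal {f : Cn n → ℝ} (hf : ContDiffOn ℝ ∞ f U) (hU : IsOpen U) :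
    LocClosed U (ddcLocal f) where
  smooth := smoothOn_ddcLocal hf hU
  oneOne z hz := isOneOne_ddcLocal hf hU hz
  closed z hz := by
    have hf1 := smoothOn_fderiv hf hU
    have hf2 := smoothOn_fderiv hf1 hU
    have h3 : ∀ a b c, fderiv ℝ (ddcLocal f) z a b c =
        1 / 2 * (fderiv ℝ (fderiv ℝ (fderiv ℝ f)) z a (cplxJ n b) c -
          fderiv ℝ (fderiv ℝ (fderiv ℝ f)) z a b (cplxJ n c)) := by
      intro a b c
      rw [← fderiv_form_apply (smoothOn_ddcLocal hf hU) hU hz,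
        ← fderiv_form_apply hf2 hU hz, ← fderiv_form_apply hf2 hU hz]
      simp only [ddcLocal_apply]
      have d := fun a b => smoothOn_differentiableAt (smoothOn_form_apply hf2 a b) hU hz
      rw [fderiv_const_mul ((d _ _).fun_sub (d _ _)), smul_apply, fderiv_fun_sub (d _ _) (d _ _)]
      rfl
    have s1 : ∀ a b c, fderiv ℝ (fderiv ℝ (fderiv ℝ f)) z a b c =
        fderiv ℝ (fderiv ℝ (fderiv ℝ f)) z b a c := by
      intro a b c
      rw [fderiv_fderiv_symm hf1 hU hz]
    have s2 : ∀ a b c, fderiv ℝ (fderiv ℝ (fderiv ℝ f)) z a b c =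
        fderiv ℝ (fderiv ℝ (fderiv ℝ f)) z a c b := by
      intro a b c
      rw [← fderiv_form_apply hf2 hU hz, ← fderiv_form_apply hf2 hU hz]
      congr 1
      apply Filter.EventuallyEq.fderiv_eq
      filter_upwards [hU.mem_nhds hz] with y hy using fderiv_fderiv_symm hf hU hy b c
    intro a b c
    rw [h3, h3, h3, s2 a (cplxJ n b) c, s1 a c (cplxJ n b), s2 b (cplxJ n c) a,
      s1 b a (cplxJ n c), s2 c (cplxJ n a) b, s1 c b (cplxJ n a)]
    ring

end

/-! ### The curvature tensor -/

/-- The curvature tensor of a local Kähler form. -/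
def locCurv (α : Cn n → BilForm n) (z : Cn n) (i j k l : Fin n) : ℂ :=
  (∑ p, ∑ q, (coeffMatrix (α z))⁻¹ q p * wirt k (fun z => coeffMatrix (α z) i q) z *
    wirtBar l (fun z => coeffMatrix (α z) p j) z) -
      wirt k (wirtBar l (fun z => coeffMatrix (α z) i j)) z

theorem sum_comm_four {M : Type*} [AddCommMonoid M] (f : Fin n → Fin n → Fin n → Fin n → M) :
    ∑ k, ∑ l, ∑ p, ∑ q, f k l p q = ∑ p, ∑ q, ∑ k, ∑ l, f k l p q := by
  calc ∑ k, ∑ l, ∑ p, ∑ q, f k l p q = ∑ k, ∑ p, ∑ l, ∑ q, f k l p q :=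
        Finset.sum_congr rfl fun k _ => Finset.sum_comm
    _ = ∑ p, ∑ k, ∑ l, ∑ q, f k l p q := Finset.sum_comm
    _ = ∑ p, ∑ k, ∑ q, ∑ l, f k l p q :=
        Finset.sum_congr rfl fun p _ => Finset.sum_congr rfl fun k _ => Finset.sum_comm
    _ = ∑ p, ∑ q, ∑ k, ∑ l, f k l p q := Finset.sum_congr rfl fun p _ => Finset.sum_comm

/-- The operator `½(∂_u - i∂_{Ju})` is complex linear in `u`, being the derivative along the
(1,0)-part of `u`. -/
theorem dirD_J_expand (f : Cn n → ℂ) (z u : Cn n) :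
    dirD u (cplxJ n u) (-Complex.I) f z = ∑ k, u k * wirt k f z := by
  conv_lhs => rw [← sum_coord_smul_stdVec u]
  simp only [dirD, wirt, map_sum, complex_smul_eq, map_add, map_smul, cplxJ_cplxJ]
  rw [Finset.mul_sum, ← Finset.sum_add_distrib, Finset.mul_sum]
  refine Finset.sum_congr rfl fun k _ => ?_
  conv_rhs => rw [← Complex.re_add_im (u k)]
  simp only [Complex.real_smul, map_neg]
  linear_combination ((1 / 2 : ℂ) * (u k).im * (fderiv ℝ f z (cplxJ n (stdVec k)))) * Complex.I_sq

theorem dirD_J_bar_expand (f : Cn n → ℂ) (z u : Cn n) :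
    dirD u (cplxJ n u) Complex.I f z = ∑ k, (starRingEnd ℂ) (u k) * wirtBar k f z := by
  conv_lhs => rw [← sum_coord_smul_stdVec u]
  simp only [dirD, wirtBar, map_sum, complex_smul_eq, map_add, map_smul, cplxJ_cplxJ]
  rw [Finset.mul_sum, ← Finset.sum_add_distrib, Finset.mul_sum]
  refine Finset.sum_congr rfl fun k _ => ?_
  have : (starRingEnd ℂ) (u k) = (u k).re - (u k).im * Complex.I := by
    apply Complex.ext <;> simp
  rw [this]
  simp only [Complex.real_smul, map_neg]
  linear_combination ((1 / 2 : ℂ) * (u k).im * (fderiv ℝ f z (cplxJ n (stdVec k)))) * Complex.I_sq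

section affine

variable {U : Set (Cn n)} {z₀ w : Cn n} {P : Cn n →L[ℂ] Cn n}

theorem dirD_affine {f : Cn n → ℂ} (hf : DifferentiableAt ℝ f (z₀ + P w)) (u v : Cn n) (c : ℂ) :
    dirD u v c (fun w => f (z₀ + P w)) w = dirD (P u) (P v) c f (z₀ + P w) := by
  have hAd : HasFDerivAt (fun w => z₀ + P w) (P.restrictScalars ℝ) w :=
    (P.restrictScalars ℝ).hasFDerivAt.const_add z₀
  have h := hf.hasFDerivAt.comp w hAd
  have h2 : fderiv ℝ (fun w => f (z₀ + P w)) w = _ := h.fderiv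
  simp only [dirD, h2]
  rfl

end affine

section contraction

variable {U : Set (Cn n)} {z : Cn n} {α : Cn n → BilForm n}

theorem dirD_herm (hα : LocClosed U α) (hU : IsOpen U) (hz : z ∈ U) (u v : Cn n) (c : ℂ)
    (ξ ζ : Cn n) :
    dirD u v c (fun z => herm (α z) ξ ζ) z =
      ∑ i, ∑ j, ξ i * dirD u v c (fun z => coeffMatrix (α z) i j) z * (starRingEnd ℂ) (ζ j) := by
  rw [dirD_congr_of_isOpen _ _ _ hU hz fun z hz => herm_expand (hα.oneOne z hz) ξ ζ]
  have d := fun i j => smoothOn_differentiableAt (smoothOn_coeffMatrix hα.smooth i j) hU hz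
  have dc : ∀ c : ℂ, DifferentiableAt ℝ (fun _ : Cn n => c) z := fun c => differentiableAt_const c
  rw [dirD_sum _ _ _ _ fun i _ => DifferentiableAt.fun_sum fun j _ =>
    ((dc _).fun_mul (d i j)).fun_mul (dc _)]
  refine Finset.sum_congr rfl fun i _ => ?_
  rw [dirD_sum _ _ _ _ fun j _ => ((dc _).fun_mul (d i j)).fun_mul (dc _)]
  refine Finset.sum_congr rfl fun j _ => ?_
  rw [dirD_mul _ _ _ ((dc _).fun_mul (d i j)) (dc _), dirD_mul _ _ _ (dc _) (d i j)]
  simp [dirD]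

theorem smoothOn_herm (hα : LocClosed U α) (ξ ζ : Cn n) :
    ContDiffOn ℝ ∞ (fun z => herm (α z) ξ ζ) U :=
  contDiffOn_const.mul ((smoothOn_ofReal (smoothOn_form_apply hα.smooth _ _)).sub
    (contDiffOn_const.mul (smoothOn_ofReal (smoothOn_form_apply hα.smooth _ _))))

theorem dirD_const_mul' (u v : Cn n) (c a : ℂ) {f : Cn n → ℂ} (hf : DifferentiableAt ℝ f z) :
    dirD u v c (fun z => a * f z) z = a * dirD u v c f z := by
  simp only [dirD, fderiv_const_mul hf, smul_apply, smul_eq_mul]; ring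

/-- The curvature in directions `ξ, η`, in a unitary frame `P`. -/
theorem locCurv_contraction (hα : LocClosed U α) (hU : IsOpen U) (hz : z ∈ U)
    {P : Cn n →L[ℂ] Cn n} (hP : coeffMatrix (pull (α z) P) = 1) (ξ η : Cn n) :
    ∑ i, ∑ j, ∑ k, ∑ l, locCurv α z i j k l * ξ i * (starRingEnd ℂ) (ξ j) * η k *
        (starRingEnd ℂ) (η l) =
      ∑ q, dirD η (cplxJ n η) (-Complex.I) (fun z => herm (α z) ξ (P (stdVec q))) z *
          dirD η (cplxJ n η) Complex.I (fun z => herm (α z) (P (stdVec q)) ξ) z -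
        dirD η (cplxJ n η) (-Complex.I) (dirD η (cplxJ n η) Complex.I fun z => herm (α z) ξ ξ) z := by
  -- A unitary frame factors the inverse metric as `P̄ Pᵗ`, which splits the quadratic part of the
  -- curvature into a sum over frame vectors.
  have hinv : (coeffMatrix (α z))⁻¹ = (matOf P).map (starRingEnd ℂ) * (matOf P).transpose := by
    rw [coeffMatrix_pull (hα.oneOne z hz)] at hP
    set C := (matOf P).map (starRingEnd ℂ)
    set A := (matOf P).transpose
    rw [Matrix.mul_assoc, mul_eq_one_comm, Matrix.mul_assoc] at hP
    exact Matrix.inv_eq_right_inv hP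
  set g : Fin n → Fin n → Cn n → ℂ := fun i j z => coeffMatrix (α z) i j with hgdef
  have hgs : ∀ i j, ContDiffOn ℝ ∞ (g i j) U := fun i j => smoothOn_coeffMatrix hα.smooth i j
  set a : Fin n → Fin n → ℂ := fun i j => ∑ k, η k * wirt k (g i j) z with ha
  set b : Fin n → Fin n → ℂ := fun i j => ∑ l, (starRingEnd ℂ) (η l) * wirtBar l (g i j) z with hb
  set H : Fin n → Fin n → ℂ := fun i j => ∑ k, ∑ l, η k * (starRingEnd ℂ) (η l) *
    wirt k (wirtBar l (g i j)) z with hH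
  have hL : ∑ i, ∑ j, ∑ k, ∑ l, locCurv α z i j k l * ξ i * (starRingEnd ℂ) (ξ j) * η k *
      (starRingEnd ℂ) (η l) = ∑ i, ∑ j, ξ i * (starRingEnd ℂ) (ξ j) *
        ((∑ p, ∑ q, (coeffMatrix (α z))⁻¹ q p * (a i q * b p j)) - H i j) := by
    refine Finset.sum_congr rfl fun i _ => Finset.sum_congr rfl fun j _ => ?_
    have e1 : ∑ p, ∑ q, (coeffMatrix (α z))⁻¹ q p * (a i q * b p j) = ∑ k, ∑ l, ∑ p, ∑ q,
        η k * (starRingEnd ℂ) (η l) * ((coeffMatrix (α z))⁻¹ q p * wirt k (g i q) z *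
          wirtBar l (g p j) z) := by
      rw [sum_comm_four]
      refine Finset.sum_congr rfl fun p _ => Finset.sum_congr rfl fun q _ => ?_
      change _ * ((∑ k, η k * wirt k (g i q) z) *
        ∑ l, (starRingEnd ℂ) (η l) * wirtBar l (g p j) z) = _
      rw [Finset.sum_mul_sum, Finset.mul_sum]
      refine Finset.sum_congr rfl fun k _ => ?_
      rw [Finset.mul_sum]
      refine Finset.sum_congr rfl fun l _ => ?_
      ring
    rw [e1, hH, ← Finset.sum_sub_distrib, Finset.mul_sum]
    refine Finset.sum_congr rfl fun k _ => ?_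
    rw [← Finset.sum_sub_distrib, Finset.mul_sum]
    refine Finset.sum_congr rfl fun l _ => ?_
    simp only [← Finset.mul_sum]
    rw [locCurv]
    ring
  have hD1 : ∀ q, dirD η (cplxJ n η) (-Complex.I) (fun z => herm (α z) ξ (P (stdVec q))) z =
      ∑ i, ∑ j, ξ i * a i j * (starRingEnd ℂ) (matOf P j q) := by
    intro q
    rw [dirD_herm hα hU hz]
    simp only [dirD_J_expand]
    rfl
  have hD2 : ∀ q, dirD η (cplxJ n η) Complex.I (fun z => herm (α z) (P (stdVec q)) ξ) z =
      ∑ p, ∑ j, matOf P p q * b p j * (starRingEnd ℂ) (ξ j) := by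
    intro q
    rw [dirD_herm hα hU hz]
    simp only [dirD_J_bar_expand]
    rfl
  have hD3 : dirD η (cplxJ n η) (-Complex.I) (dirD η (cplxJ n η) Complex.I fun z =>
      herm (α z) ξ ξ) z = ∑ i, ∑ j, ξ i * (starRingEnd ℂ) (ξ j) * H i j := by
    have e1 : ∀ y ∈ U, dirD η (cplxJ n η) Complex.I (fun z => herm (α z) ξ ξ) y =
        ∑ i, ∑ j, (ξ i * (starRingEnd ℂ) (ξ j)) *
          ∑ l, (starRingEnd ℂ) (η l) * wirtBar l (g i j) y := by
      intro y hy
      rw [dirD_herm hα hU hy]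
      refine Finset.sum_congr rfl fun i _ => Finset.sum_congr rfl fun j _ => ?_
      rw [dirD_J_bar_expand]; ring
    have d1 := fun i j l => smoothOn_differentiableAt (smoothOn_wirtBar (hgs i j) hU l) hU hz
    have d2 : ∀ i j, DifferentiableAt ℝ (fun y => ∑ l, (starRingEnd ℂ) (η l) *
        wirtBar l (g i j) y) z := fun i j =>
      DifferentiableAt.fun_sum fun l _ => (d1 i j l).const_mul _
    rw [dirD_congr_of_isOpen _ _ _ hU hz e1, dirD_sum _ _ _ _ fun i _ =>
      DifferentiableAt.fun_sum fun j _ => (d2 i j).const_mul _]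
    refine Finset.sum_congr rfl fun i _ => ?_
    rw [dirD_sum _ _ _ _ fun j _ => (d2 i j).const_mul _]
    refine Finset.sum_congr rfl fun j _ => ?_
    rw [dirD_const_mul' _ _ _ _ (d2 i j), dirD_sum _ _ _ _ fun l _ => (d1 i j l).const_mul _]
    congr 1
    have e3 : H i j = ∑ l, ∑ k, η k * (starRingEnd ℂ) (η l) * wirt k (wirtBar l (g i j)) z :=
      Finset.sum_comm
    rw [e3]
    refine Finset.sum_congr rfl fun l _ => ?_
    rw [dirD_const_mul' _ _ _ _ (d1 i j l), dirD_J_expand, Finset.mul_sum]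
    refine Finset.sum_congr rfl fun k _ => ?_
    ring
  rw [hL, hD3]
  simp only [mul_sub, Finset.sum_sub_distrib]
  congr 1
  set u : Fin n → ℂ := fun s => ∑ i, ξ i * a i s with hu
  set v : Fin n → ℂ := fun p => ∑ j, b p j * (starRingEnd ℂ) (ξ j) with hv
  have e1 : ∀ q, dirD η (cplxJ n η) (-Complex.I) (fun z => herm (α z) ξ (P (stdVec q))) z =
      ∑ s, u s * (starRingEnd ℂ) (matOf P s q) := by
    intro q
    rw [hD1, Finset.sum_comm]
    exact Finset.sum_congr rfl fun s _ => by rw [hu, Finset.sum_mul]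
  have e2 : ∀ q, dirD η (cplxJ n η) Complex.I (fun z => herm (α z) (P (stdVec q)) ξ) z =
      ∑ p, matOf P p q * v p := by
    intro q
    rw [hD2]
    refine Finset.sum_congr rfl fun s _ => ?_
    rw [hv, Finset.mul_sum]
    exact Finset.sum_congr rfl fun j _ => by ring
  have e3 : ∑ q, (∑ s, u s * (starRingEnd ℂ) (matOf P s q)) * ∑ p, matOf P p q * v p =
      ∑ p, ∑ s, (coeffMatrix (α z))⁻¹ s p * (u s * v p) := by
    have e4 : ∀ q, (∑ s, u s * (starRingEnd ℂ) (matOf P s q)) * ∑ p, matOf P p q * v p =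
        ∑ p, ∑ s, (starRingEnd ℂ) (matOf P s q) * matOf P p q * (u s * v p) := by
      intro q
      rw [Finset.sum_mul_sum, Finset.sum_comm]
      exact Finset.sum_congr rfl fun p _ => Finset.sum_congr rfl fun s _ => by ring
    rw [Finset.sum_congr rfl fun q _ => e4 q, Finset.sum_comm]
    refine Finset.sum_congr rfl fun p _ => ?_
    rw [Finset.sum_comm]
    refine Finset.sum_congr rfl fun s _ => ?_
    rw [hinv, Matrix.mul_apply]
    exact (Finset.sum_mul _ _ _).symm
  simp only [e1, e2]
  rw [e3]
  simp only [Finset.mul_sum]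
  rw [sum_comm_four]
  refine Finset.sum_congr rfl fun p _ => Finset.sum_congr rfl fun s _ => ?_
  rw [hu, hv, Finset.sum_mul_sum, Finset.mul_sum]
  refine Finset.sum_congr rfl fun i _ => ?_
  rw [Finset.mul_sum]
  refine Finset.sum_congr rfl fun j _ => ?_
  ring

end contraction

/-! ### Laplacian estimates in a frame -/

theorem formTrace_ofReal {om th : BilForm n} (hom : IsOneOne om) (hth : IsOneOne th) :
    ((formTrace om th : ℝ) : ℂ) = ((coeffMatrix om)⁻¹ * coeffMatrix th).trace := by
  have h : (starRingEnd ℂ) ((coeffMatrix om)⁻¹ * coeffMatrix th).trace =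
      ((coeffMatrix om)⁻¹ * coeffMatrix th).trace := by
    have h1 := Matrix.trace_conjTranspose ((coeffMatrix om)⁻¹ * coeffMatrix th)
    rw [Matrix.conjTranspose_mul, (coeffMatrix_isHermitian hom).inv.eq,
      (coeffMatrix_isHermitian hth).eq, Matrix.trace_mul_comm] at h1
    exact h1.symm
  exact Complex.conj_eq_iff_re.mp h

theorem pull_pos {β : BilForm n} (pβ : ∀ a, a ≠ 0 → 0 < β a (cplxJ n a)) {P : Cn n →L[ℂ] Cn n}
    (hP : IsUnit (matOf P)) (a : Cn n) (ha : a ≠ 0) : 0 < pull β P a (cplxJ n a) := by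
  rw [pull_apply, map_cplxJ]
  refine pβ _ fun h => ha ?_
  obtain ⟨Q, -, hQ⟩ := exists_inverse_of_isUnit_matOf hP
  have h1 : Q (P a) = a := by rw [← ContinuousLinearMap.comp_apply, hQ]; rfl
  rw [← h1, h, map_zero]

theorem herm_pull (β : BilForm n) (P : Cn n →L[ℂ] Cn n) (a b : Cn n) :
    herm (pull β P) a b = herm β (P a) (P b) := by
  simp only [herm, pull_apply, map_cplxJ]

section

variable {U : Set (Cn n)} {z₀ : Cn n} {f : Cn n → ℝ} {P : Cn n →L[ℂ] Cn n}

theorem isOpen_affine (hU : IsOpen U) (z₀ : Cn n) (P : Cn n →L[ℂ] Cn n) :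
    IsOpen {w | z₀ + P w ∈ U} :=
  hU.preimage (continuous_const.add P.continuous)

theorem zero_mem_affine (hz : z₀ ∈ U) (P : Cn n →L[ℂ] Cn n) : (0 : Cn n) ∈ {w | z₀ + P w ∈ U} := by
  simpa using hz

theorem contDiff_affine {F : Type*} [NormedAddCommGroup F] [NormedSpace ℝ F] {f : Cn n → F}
    (hf : ContDiffOn ℝ ∞ f U) :
    ContDiffOn ℝ ∞ (fun w => f (z₀ + P w)) {w | z₀ + P w ∈ U} :=
  hf.comp (contDiff_const.add (P.restrictScalars ℝ).contDiff).contDiffOn fun _ hw => hw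

theorem fderiv_complex_affine (z₀ w : Cn n) (P : Cn n →L[ℂ] Cn n) :
    fderiv ℂ (fun w => z₀ + P w) w = P := (P.hasFDerivAt.const_add z₀).fderiv

theorem wirt_wirtBar_affine (hU : IsOpen U) (hz : z₀ ∈ U) (hf : ContDiffOn ℝ ∞ f U) (k : Fin n) :
    wirt k (wirtBar k (fun w => ((f (z₀ + P w) : ℝ) : ℂ))) 0 =
      ((1 / 2 * ddcLocal f z₀ (P (stdVec k)) (cplxJ n (P (stdVec k))) : ℝ) : ℂ) := by
  have hV := isOpen_affine hU z₀ P
  have h0 := zero_mem_affine hz P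
  rw [wirt_wirtBar_eq_coeffMatrix (f := fun w => f (z₀ + P w)) (contDiff_affine hf) hV h0,
    ddcLocal_comp hU hV h0 (contDiff_const.add P.contDiff).contDiffOn (fun _ hw => hw) hf,
    fderiv_complex_affine, coeffMatrix_apply, herm_pull]
  simp only [map_zero, add_zero]
  rw [herm_self (isOneOne_ddcLocal hf hU hz)]

theorem wirt_mul_wirtBar_affine {m : Cn n → ℝ} (hU : IsOpen U) (hz : z₀ ∈ U)
    (hf : ContDiffOn ℝ ∞ f U) (hm : ContDiffOn ℝ ∞ m U) (k : Fin n) :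
    (wirt k (fun w => ((f (z₀ + P w) : ℝ) : ℂ)) 0 *
        wirtBar k (fun w => ((m (z₀ + P w) : ℝ) : ℂ)) 0).re =
      1 / 2 * gradForm (fderiv ℝ f z₀) (fderiv ℝ m z₀) (P (stdVec k)) (cplxJ n (P (stdVec k))) := by
  have e : z₀ + P 0 = z₀ := by simp
  have hz' : z₀ + P 0 ∈ U := by rwa [e]
  have hfd := smoothOn_differentiableAt hf hU hz
  have hmd := smoothOn_differentiableAt hm hU hz
  have hfc : DifferentiableAt ℝ (fun z => (f z : ℂ)) (z₀ + P 0) :=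
    smoothOn_differentiableAt (smoothOn_ofReal hf) hU hz'
  have hmc : DifferentiableAt ℝ (fun z => (m z : ℂ)) (z₀ + P 0) :=
    smoothOn_differentiableAt (smoothOn_ofReal hm) hU hz'
  rw [wirt_eq_dirD, wirtBar_eq_dirD, dirD_affine (f := fun z => (f z : ℂ)) hfc,
    dirD_affine (f := fun z => (m z : ℂ)) hmc, gradForm_self]
  simp only [dirD, e, fderiv_ofReal hfd, fderiv_ofReal hmd, map_cplxJ]
  simp
  ring

theorem conj_wirt_ofReal (f : Cn n → ℝ) (w : Cn n) (k : Fin n) :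
    (starRingEnd ℂ) (wirt k (fun w => ((f w : ℝ) : ℂ)) w) =
      wirtBar k (fun w => ((f w : ℝ) : ℂ)) w := by
  rw [wirtBar_conj_of_eqOn isOpen_univ (Set.mem_univ w)
    (fun z _ => (Complex.conj_ofReal (f z)).symm)]

theorem re_sum_mul_inv (d : Fin n → ℝ) (a : Fin n → ℂ) :
    (∑ k, (d k : ℂ)⁻¹ * a k).re = ∑ k, (d k)⁻¹ * (a k).re := by
  rw [Complex.re_sum]
  refine Finset.sum_congr rfl fun k _ => ?_
  rw [← Complex.ofReal_inv, Complex.re_ofReal_mul]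

end

/-- The coefficient matrix in the affine frame given by `P` at `z₀`. -/
def frameMat (α : Cn n → BilForm n) (z₀ : Cn n) (P : Cn n →L[ℂ] Cn n) (w : Cn n) :
    Matrix (Fin n) (Fin n) ℂ := coeffMatrix (pull (α (z₀ + P w)) P)

section frameMat

variable {U : Set (Cn n)} {z₀ : Cn n} {P : Cn n →L[ℂ] Cn n} {d : Fin n → ℝ}
  {g h : Cn n → BilForm n}

theorem LocKahler.posDef_frameMat (hg : LocKahler U g) (hP : IsUnit (matOf P)) {w : Cn n}
    (hw : z₀ + P w ∈ U) : (frameMat g z₀ P w).PosDef :=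
  coeffMatrix_posDef ((hg.oneOne _ hw).pull P) (pull_pos (hg.pos _ hw) hP)

theorem LocKahler.isUnit_det_frameMat (hg : LocKahler U g) (hP : IsUnit (matOf P)) {w : Cn n}
    (hw : z₀ + P w ∈ U) : IsUnit (frameMat g z₀ P w).det :=
  (hg.posDef_frameMat hP hw).det_pos.ne'.isUnit

theorem LocClosed.kahlerMat_frameMat (hg : LocClosed U g) (hU : IsOpen U) :
    KahlerMat {w | z₀ + P w ∈ U} (fun i j w => frameMat g z₀ P w i j) :=
  (hg.affine hU z₀ P).kahlerMat (isOpen_affine hU z₀ P)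

theorem smoothOn_frameMat_inv (hg : LocKahler U g) (hU : IsOpen U) (hP : IsUnit (matOf P))
    (i j : Fin n) : ContDiffOn ℝ ∞ (fun w => (frameMat g z₀ P w)⁻¹ i j) {w | z₀ + P w ∈ U} :=
  smoothOn_inv (fun i j => (hg.toLocClosed.kahlerMat_frameMat hU).smooth i j)
    (fun _ hw => (hg.isUnit_det_frameMat hP hw).ne_zero) i j

theorem smoothOn_frameMat_quotient (hg : LocKahler U g) (hh : LocClosed U h) (hU : IsOpen U)
    (hP : IsUnit (matOf P)) (i j : Fin n) :
    ContDiffOn ℝ ∞ (fun w => ((frameMat g z₀ P w)⁻¹ * frameMat h z₀ P w) i j)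
      {w | z₀ + P w ∈ U} := by
  simp only [Matrix.mul_apply]
  exact ContDiffOn.sum fun q _ => (smoothOn_frameMat_inv hg hU hP i q).mul
    ((hh.kahlerMat_frameMat hU).smooth q j)

theorem frameMat_quotient_spec (hg : LocKahler U g) (hP : IsUnit (matOf P)) {w : Cn n}
    (hw : z₀ + P w ∈ U) (i j : Fin n) :
    ∑ q, frameMat g z₀ P w i q * ((frameMat g z₀ P w)⁻¹ * frameMat h z₀ P w) q j =
      frameMat h z₀ P w i j := by
  rw [← Matrix.mul_apply, Matrix.mul_nonsing_inv_cancel_left _ _ (hg.isUnit_det_frameMat hP hw)]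

theorem formTrace_eq_trace_frameMat (hg : LocKahler U g) (hh : LocClosed U h)
    (hP : IsUnit (matOf P)) {w : Cn n} (hw : z₀ + P w ∈ U) :
    ((formTrace (g (z₀ + P w)) (h (z₀ + P w)) : ℝ) : ℂ) =
      ∑ i, ((frameMat g z₀ P w)⁻¹ * frameMat h z₀ P w) i i := by
  rw [← formTrace_pull (hg.oneOne _ hw) (hh.oneOne _ hw) hP,
    formTrace_ofReal ((hg.oneOne _ hw).pull P) ((hh.oneOne _ hw).pull P)]
  rfl

theorem smoothOn_formTrace (hg : LocKahler U g) (hh : LocClosed U h) :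
    ContDiffOn ℝ ∞ (fun z => formTrace (g z) (h z)) U := by
  have h1 : ContDiffOn ℝ ∞ (fun z => ((coeffMatrix (g z))⁻¹ * coeffMatrix (h z)).trace) U := by
    refine ContDiffOn.sum fun i _ => ?_
    simp only [Matrix.diag_apply, Matrix.mul_apply]
    refine ContDiffOn.sum fun q _ => ContDiffOn.mul (smoothOn_inv
      (fun i j => smoothOn_coeffMatrix hg.smooth i j) (fun z hz => ?_) i q)
      (smoothOn_coeffMatrix hh.smooth q i)
    exact (coeffMatrix_posDef (hg.oneOne z hz) (hg.pos z hz)).det_pos.ne'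
  exact Complex.reCLM.contDiff.comp_contDiffOn h1

theorem smoothOn_formDet (hh : ContDiffOn ℝ ∞ h U) :
    ContDiffOn ℝ ∞ (fun z => formDet (h z)) U :=
  Complex.reCLM.contDiff.comp_contDiffOn (smoothOn_det fun i j => smoothOn_coeffMatrix hh i j)

theorem smoothOn_log_formDet (hh : LocKahler U h) :
    ContDiffOn ℝ ∞ (fun z => Real.log (formDet (h z))) U :=
  (smoothOn_formDet hh.smooth).log fun z hz => (formDet_pos (hh.oneOne z hz) (hh.pos z hz)).ne'

theorem IsFrame.frameMat_left (hF : IsFrame (g z₀) (h z₀) P d) (i j : Fin n) :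
    frameMat g z₀ P 0 i j = if i = j then 1 else 0 := by
  rw [frameMat, map_zero, add_zero, hF.left, Matrix.one_apply]

theorem IsFrame.frameMat_right (hF : IsFrame (g z₀) (h z₀) P d) (i j : Fin n) :
    frameMat h z₀ P 0 i j = if i = j then (d i : ℂ) else 0 := by
  rw [frameMat, map_zero, add_zero, hF.right, Matrix.diagonal_apply]

/-- This is Jacobi's formula. The determinant in the frame differs from the original one by the
constant `|det P|²`, which drops out of a logarithmic derivative. -/
theorem wirtBar_log_formDet (hh : LocKahler U h) (hU : IsOpen U) (hP : IsUnit (matOf P)) {w : Cn n}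
    (hw : z₀ + P w ∈ U) (k : Fin n) :
    wirtBar k (fun w => ((Real.log (formDet (h (z₀ + P w))) : ℝ) : ℂ)) w =
      ∑ i, ∑ j, (frameMat h z₀ P w)⁻¹ j i * wirtBar k (fun w => frameMat h z₀ P w i j) w := by
  have hV := isOpen_affine hU z₀ P
  set V := {w | z₀ + P w ∈ U}
  have hK := hh.toLocClosed.kahlerMat_frameMat (z₀ := z₀) (P := P) hU
  set κ := Complex.normSq (matOf P).det with hκ
  have hκ0 : κ ≠ 0 := by
    rw [hκ, Ne, Complex.normSq_eq_zero]
    exact ((Matrix.isUnit_iff_isUnit_det _).mp hP).ne_zero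
  have hdet : ∀ w ∈ V, (frameMat h z₀ P w).det = ((κ * formDet (h (z₀ + P w)) : ℝ) : ℂ) := by
    intro w hw
    rw [frameMat, coeffMatrix_det_eq ((hh.oneOne _ hw).pull P) (pull_pos (hh.pos _ hw) hP),
      formDet_pull (hh.oneOne _ hw)]
  set D : Cn n → ℝ := fun w => formDet (h (z₀ + P w)) with hD
  have hDs : ContDiffOn ℝ ∞ D V := contDiff_affine (smoothOn_formDet hh.smooth)
  have hDpos : ∀ w ∈ V, 0 < D w := fun w hw => formDet_pos (hh.oneOne _ hw) (hh.pos _ hw)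
  have hDd := smoothOn_differentiableAt hDs hV hw
  have hdir : ∀ v, fderiv ℝ (fun w => ((Real.log (D w) : ℝ) : ℂ)) w v =
      ∑ i, ∑ j, (frameMat h z₀ P w)⁻¹ j i * fderiv ℝ (fun w => frameMat h z₀ P w i j) w v := by
    intro v
    have e1 : fderiv ℝ (fun w => Real.log (D w)) w v = (D w)⁻¹ * fderiv ℝ D w v := by
      rw [fderiv.log hDd (hDpos w hw).ne']; rfl
    rw [fderiv_ofReal (hDd.log (hDpos w hw).ne'), e1]
    have e2 := fderiv_det_apply (A := frameMat h z₀ P) (z := w)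
      (fun i j => smoothOn_differentiableAt (hK.smooth i j) hV hw) v
    have e3 : fderiv ℝ (fun w => (frameMat h z₀ P w).det) w v = ((κ * fderiv ℝ D w v : ℝ) : ℂ) := by
      have : (fun w => (frameMat h z₀ P w).det) =ᶠ[𝓝 w] fun w => ((κ * D w : ℝ) : ℂ) :=
        Filter.eventuallyEq_of_mem (hV.mem_nhds hw) hdet
      rw [this.fderiv_eq, fderiv_ofReal (hDd.const_mul κ), fderiv_const_mul hDd]
      rfl
    rw [e3] at e2
    have hD0 : (D w : ℂ) ≠ 0 := by exact_mod_cast (hDpos w hw).ne'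
    have hκc : (κ : ℂ) ≠ 0 := by exact_mod_cast hκ0
    have e4 : (((D w)⁻¹ * fderiv ℝ D w v : ℝ) : ℂ) =
        ((frameMat h z₀ P w).det)⁻¹ * ((κ * fderiv ℝ D w v : ℝ) : ℂ) := by
      rw [hdet w hw, show formDet (h (z₀ + P w)) = D w from rfl]
      push_cast
      field_simp
    rw [e4, e2, Finset.mul_sum]
    refine Finset.sum_congr rfl fun i _ => ?_
    rw [Finset.mul_sum]
    refine Finset.sum_congr rfl fun j _ => ?_
    rw [Matrix.inv_def, Ring.inverse_eq_inv', Matrix.smul_apply, smul_eq_mul, mul_assoc]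
  rw [wirtBar, hdir, hdir, Finset.mul_sum, ← Finset.sum_add_distrib, Finset.mul_sum]
  refine Finset.sum_congr rfl fun i _ => ?_
  rw [Finset.mul_sum, ← Finset.sum_add_distrib, Finset.mul_sum]
  refine Finset.sum_congr rfl fun j _ => ?_
  rw [wirtBar]
  ring

/-- The coordinates are only affine, so the first derivatives of the metric do not vanish; they are
exactly the quadratic part of the curvature, contracted with frame vectors as in
`locCurv_contraction`. -/
theorem frame_curvature (hg : LocKahler U g) (hU : IsOpen U) (hz : z₀ ∈ U)
    (hF : IsFrame (g z₀) (h z₀) P d) (i k : Fin n) :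
    ∑ q, wirt k (fun w => frameMat g z₀ P w i q) 0 * wirtBar k (fun w => frameMat g z₀ P w q i) 0 -
        wirt k (wirtBar k (fun w => frameMat g z₀ P w i i)) 0 =
      ∑ i', ∑ j', ∑ k', ∑ l', locCurv g z₀ i' j' k' l' * P (stdVec i) i' *
        (starRingEnd ℂ) (P (stdVec i) j') * P (stdVec k) k' * (starRingEnd ℂ) (P (stdVec k) l') := by
  have e : z₀ + P 0 = z₀ := by simp
  have hV := isOpen_affine hU z₀ P
  have h0 := zero_mem_affine hz P
  rw [locCurv_contraction hg.toLocClosed hU hz hF.left]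
  have hs := fun a b => smoothOn_herm hg.toLocClosed a b
  have hfr : ∀ i j, (fun w => frameMat g z₀ P w i j) =
      fun w => herm (g (z₀ + P w)) (P (stdVec i)) (P (stdVec j)) := by
    intro i j; ext w; rw [frameMat, coeffMatrix_apply, herm_pull]
  have h1 : ∀ (c : ℂ) (w : Cn n), w ∈ {w | z₀ + P w ∈ U} → ∀ i j,
      dirD (stdVec k) (cplxJ n (stdVec k)) c (fun w => frameMat g z₀ P w i j) w =
        dirD (P (stdVec k)) (cplxJ n (P (stdVec k))) c
          (fun z => herm (g z) (P (stdVec i)) (P (stdVec j))) (z₀ + P w) := by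
    intro c w hw i j
    rw [hfr, dirD_affine (f := fun z => herm (g z) (P (stdVec i)) (P (stdVec j)))
      (smoothOn_differentiableAt (hs _ _) hU hw), map_cplxJ]
  congr 1
  · refine Finset.sum_congr rfl fun q _ => ?_
    rw [wirt_eq_dirD, wirtBar_eq_dirD, h1 _ 0 h0, h1 _ 0 h0, e]
  · rw [wirt_eq_dirD, wirtBar_eq_dirD',
      dirD_congr_of_isOpen _ _ _ hV h0 fun w hw => h1 Complex.I w hw i i,
      dirD_affine (f := dirD (P (stdVec k)) (cplxJ n (P (stdVec k))) Complex.I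
        (fun z => herm (g z) (P (stdVec i)) (P (stdVec i)))), e, map_cplxJ]
    rw [e]
    exact smoothOn_differentiableAt (smoothOn_dirD _ _ _ (hs _ _) hU) hU hz

/-- The Yau-Siu inequality for `Δ_h tr_g h`. -/
theorem formTrace_laplacian_ge [NeZero n] (hU : IsOpen U) (hz : z₀ ∈ U) (hg : LocKahler U g)
    (hh : LocKahler U h) {B : ℝ}
    (hB : ∀ ξ η : Cn n, -B * (herm (g z₀) ξ ξ).re * (herm (g z₀) η η).re ≤
      (∑ i, ∑ j, ∑ k, ∑ l, locCurv g z₀ i j k l * ξ i * (starRingEnd ℂ) (ξ j) * η k *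
        (starRingEnd ℂ) (η l)).re) :
    formTrace (g z₀) (ddcLocal (fun z => Real.log (formDet (h z))) z₀) -
        B * formTrace (g z₀) (h z₀) * formTrace (h z₀) (g z₀) +
        formTrace (h z₀) (gradForm (fderiv ℝ (fun z => formTrace (g z) (h z)) z₀)
          (fderiv ℝ (fun z => formTrace (g z) (h z)) z₀)) / formTrace (g z₀) (h z₀) ≤
      formTrace (h z₀) (ddcLocal (fun z => formTrace (g z) (h z)) z₀) := by
  have og := hg.oneOne z₀ hz
  have oh := hh.oneOne z₀ hz
  obtain ⟨P, d, hF⟩ := exists_isFrame og oh (hg.pos z₀ hz) (hh.pos z₀ hz)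
  set V := {w | z₀ + P w ∈ U} with hVdef
  have hV : IsOpen V := isOpen_affine hU z₀ P
  have h0 : (0 : Cn n) ∈ V := zero_mem_affine hz P
  set Y : Cn n → ℝ := fun z => formTrace (g z) (h z) with hYdef
  set L : Cn n → ℝ := fun z => Real.log (formDet (h z)) with hLdef
  have hYs : ContDiffOn ℝ ∞ Y U := smoothOn_formTrace hg hh.toLocClosed
  have hLs : ContDiffOn ℝ ∞ L U := smoothOn_log_formDet hh
  have hdp := hF.pos
  have hY0 : Y z₀ = ∑ k, d k := hF.trace_eq og oh
  have hYpos : 0 < ∑ k, d k := Finset.sum_pos (fun k _ => hdp k) Finset.univ_nonempty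
  set Z : Fin n → Fin n → Cn n → ℂ := fun i j w =>
    ((frameMat g z₀ P w)⁻¹ * frameMat h z₀ P w) i j with hZdef
  have hZs : ∀ i j, ContDiffOn ℝ ∞ (Z i j) V := fun i j =>
    smoothOn_frameMat_quotient hg hh.toLocClosed hU hF.isUnit i j
  have hYZ : ∀ w ∈ V, ((Y (z₀ + P w) : ℝ) : ℂ) = ∑ i, Z i i w := fun w hw =>
    formTrace_eq_trace_frameMat hg hh.toLocClosed hF.isUnit hw
  have hw1 : ∀ k, wirt k (fun w => ((Y (z₀ + P w) : ℝ) : ℂ)) 0 = ∑ i, wirt k (Z i i) 0 := by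
    intro k
    rw [wirt_eq_dirD', dirD_congr_of_isOpen _ _ _ hV h0 hYZ, dirD_sum]
    exact fun i _ => smoothOn_differentiableAt (hZs i i) hV h0
  have hw2 : ∀ k, wirt k (wirtBar k (fun w => ((Y (z₀ + P w) : ℝ) : ℂ))) 0 =
      ∑ i, wirt k (wirtBar k (Z i i)) 0 := by
    intro k
    have : ∀ w ∈ V, wirtBar k (fun w => ((Y (z₀ + P w) : ℝ) : ℂ)) w = ∑ i, wirtBar k (Z i i) w := by
      intro w hw
      rw [wirtBar_eq_dirD', dirD_congr_of_isOpen _ _ _ hV hw hYZ, dirD_sum]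
      exact fun i _ => smoothOn_differentiableAt (hZs i i) hV hw
    rw [wirt_eq_dirD', dirD_congr_of_isOpen _ _ _ hV h0 this, dirD_sum]
    exact fun i _ => smoothOn_differentiableAt (smoothOn_wirtBar (hZs i i) hV k) hV h0
  have main := laplacian_trace_identity hV h0 (hg.toLocClosed.kahlerMat_frameMat hU)
    (hh.toLocClosed.kahlerMat_frameMat hU) hZs
    (fun w hw i j => frameMat_quotient_spec hg hF.isUnit hw i j) hF.frameMat_left
    hF.frameMat_right (fun i => (hdp i).ne')
  have hlog : ∀ i, wirt i (wirtBar i (fun w => ((L (z₀ + P w) : ℝ) : ℂ))) 0 = _ := fun i =>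
    wirt_wirtBar_logDet hV h0 (hh.toLocClosed.kahlerMat_frameMat hU)
      (N := fun i j w => (frameMat h z₀ P w)⁻¹ i j)
      (fun i j => smoothOn_frameMat_inv hh hU hF.isUnit i j)
      (fun w hw i j => by
        rw [← Matrix.mul_apply, Matrix.mul_nonsing_inv _ (hh.isUnit_det_frameMat hF.isUnit hw),
          Matrix.one_apply])
      hF.frameMat_right (fun i => (hdp i).ne') i
      (fun w hw => wirtBar_log_formDet hh hU hF.isUnit hw i)
  simp only [← hlog, frame_curvature hg hU hz hF, ← hw2] at main
  have hre := congrArg Complex.re main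
  simp only [Complex.add_re] at hre
  rw [re_sum_mul_inv] at hre
  simp only [wirt_wirtBar_affine hU hz hYs, wirt_wirtBar_affine hU hz hLs, Complex.re_sum,
    Complex.ofReal_re] at hre
  rw [← hF.formTrace_right oh (isOneOne_ddcLocal hYs hU hz),
    ← hF.formTrace_left og (isOneOne_ddcLocal hLs hU hz)] at hre
  -- The weights `d_i / d_k` sum to the product of the two traces, and each multiplies the
  -- bisectional curvature of a pair of unit vectors.
  have hRic : -(B * Y z₀ * formTrace (h z₀) (g z₀)) ≤ ∑ k, ∑ i, ((d i : ℂ) * (d k : ℂ)⁻¹ *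
      ∑ i', ∑ j', ∑ k', ∑ l', locCurv g z₀ i' j' k' l' * P (stdVec i) i' *
        (starRingEnd ℂ) (P (stdVec i) j') * P (stdVec k) k' *
          (starRingEnd ℂ) (P (stdVec k) l')).re := by
    have e1 : -(B * Y z₀ * formTrace (h z₀) (g z₀)) = ∑ k, ∑ i, d i * (d k)⁻¹ * -B := by
      rw [hY0, hF.trace_inv_eq og oh, mul_assoc, Finset.sum_mul_sum, ← mul_neg_one, Finset.sum_comm,
        mul_comm, ← mul_assoc, Finset.mul_sum]
      refine Finset.sum_congr rfl fun k _ => ?_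
      rw [Finset.mul_sum]
      exact Finset.sum_congr rfl fun i _ => by ring
    rw [e1]
    refine Finset.sum_le_sum fun k _ => Finset.sum_le_sum fun i _ => ?_
    rw [← Complex.ofReal_inv, ← Complex.ofReal_mul, Complex.re_ofReal_mul]
    refine mul_le_mul_of_nonneg_left ?_ (mul_nonneg (hdp i).le (inv_pos.mpr (hdp k)).le)
    have hone : ∀ i, (herm (g z₀) (P (stdVec i)) (P (stdVec i))).re = 1 := by
      intro i
      rw [herm_self og, hF.left_apply og]; simp
    have := hB (P (stdVec i)) (P (stdVec k))
    rw [hone, hone, mul_one, mul_one] at this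
    exact this
  -- Only the diagonal entries of `∂Z` are kept. Cauchy–Schwarz with weights `d_i` gives `|∂ tr Z|²
  -- ≤ (∑ d_i⁻¹ |∂Z_ii|²) ∑ d_i`.
  have hgrad : formTrace (h z₀) (gradForm (fderiv ℝ Y z₀) (fderiv ℝ Y z₀)) / Y z₀ ≤
      ∑ k, ∑ i, ∑ q, ((d k : ℂ)⁻¹ * (d q : ℂ)⁻¹ *
        (wirt k (Z i q) 0 * (starRingEnd ℂ) (wirt k (Z i q) 0))).re := by
    rw [div_le_iff₀ (by rw [hY0]; exact hYpos), hF.formTrace_right oh (isOneOne_gradForm _ _),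
      Finset.sum_mul]
    refine Finset.sum_le_sum fun k _ => ?_
    have e1 : ∀ i q, ((d k : ℂ)⁻¹ * (d q : ℂ)⁻¹ *
        (wirt k (Z i q) 0 * (starRingEnd ℂ) (wirt k (Z i q) 0))).re =
        (d k)⁻¹ * ((d q)⁻¹ * ‖wirt k (Z i q) 0‖ ^ 2) := by
      intro i q
      rw [Complex.mul_conj, Complex.normSq_eq_norm_sq]
      norm_cast
      ring
    have e2 : 1 / 2 * gradForm (fderiv ℝ Y z₀) (fderiv ℝ Y z₀) (P (stdVec k))
        (cplxJ n (P (stdVec k))) = ‖∑ i, wirt k (Z i i) 0‖ ^ 2 := by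
      rw [← wirt_mul_wirtBar_affine hU hz hYs hYs, ← conj_wirt_ofReal, hw1, Complex.mul_conj,
        Complex.normSq_eq_norm_sq, Complex.ofReal_re]
    rw [e2]
    simp only [e1]
    have e3 : ‖∑ i, wirt k (Z i i) 0‖ ^ 2 ≤
        (∑ i, (d i)⁻¹ * ‖wirt k (Z i i) 0‖ ^ 2) * ∑ i, d i := by
      calc ‖∑ i, wirt k (Z i i) 0‖ ^ 2 ≤ (∑ i, ‖wirt k (Z i i) 0‖) ^ 2 :=
            pow_le_pow_left₀ (norm_nonneg _) (norm_sum_le _ _) 2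
        _ ≤ _ := Finset.sum_sq_le_sum_mul_sum_of_sq_le_mul _
            (fun i _ => mul_nonneg (inv_pos.mpr (hdp i)).le (sq_nonneg _))
            (fun i _ => (hdp i).le) (fun i _ => by
              have := (hdp i).ne'
              field_simp
              rfl)
    have e4 : ∑ i, (d i)⁻¹ * ‖wirt k (Z i i) 0‖ ^ 2 ≤
        ∑ i, ∑ q, (d q)⁻¹ * ‖wirt k (Z i q) 0‖ ^ 2 :=
      Finset.sum_le_sum fun i _ => Finset.single_le_sum
        (f := fun q => (d q)⁻¹ * ‖wirt k (Z i q) 0‖ ^ 2)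
        (fun q _ => mul_nonneg (inv_pos.mpr (hdp q)).le (sq_nonneg _)) (Finset.mem_univ i)
    rw [hY0]
    simp only [← Finset.mul_sum]
    rw [mul_assoc]
    exact mul_le_mul_of_nonneg_left (e3.trans (mul_le_mul_of_nonneg_right e4 hYpos.le))
      (inv_pos.mpr (hdp k)).le
  rw [hre]
  linarith

/-- The identity `Δ_g m - Γ_h(tr_g h, m) = tr_g(h, dd^c m_X)` for moment maps, in a frame. -/
theorem moment_laplacian_bound {m mX : Cn n → ℝ} {C : ℝ} (hU : IsOpen U) (hz : z₀ ∈ U)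
    (hg : LocKahler U g) (hh : LocKahler U h) (hm : ContDiffOn ℝ ∞ m U)
    (hmX : ContDiffOn ℝ ∞ mX U) (ξ : Cn n → Cn n)
    (h1 : ∀ z ∈ U, ∀ b, -fderiv ℝ m z b = h z (ξ z) b)
    (h2 : ∀ z ∈ U, ∀ b, -fderiv ℝ mX z b = g z (ξ z) b)
    (hC : ∀ a, |ddcLocal mX z₀ a (cplxJ n a)| ≤ C * g z₀ a (cplxJ n a)) :
    |formTrace (g z₀) (ddcLocal m z₀) -
        formTrace (h z₀) (gradForm (fderiv ℝ (fun z => formTrace (g z) (h z)) z₀)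
          (fderiv ℝ m z₀))| ≤ C * formTrace (g z₀) (h z₀) := by
  have og := hg.oneOne z₀ hz
  have oh := hh.oneOne z₀ hz
  obtain ⟨P, d, hF⟩ := exists_isFrame og oh (hg.pos z₀ hz) (hh.pos z₀ hz)
  set V := {w | z₀ + P w ∈ U} with hVdef
  have hV : IsOpen V := isOpen_affine hU z₀ P
  have h0 : (0 : Cn n) ∈ V := zero_mem_affine hz P
  set Y : Cn n → ℝ := fun z => formTrace (g z) (h z) with hYdef
  have hYs : ContDiffOn ℝ ∞ Y U := smoothOn_formTrace hg hh.toLocClosed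
  have hdp := hF.pos
  set Z : Fin n → Fin n → Cn n → ℂ := fun i j w =>
    ((frameMat g z₀ P w)⁻¹ * frameMat h z₀ P w) i j with hZdef
  have hZs : ∀ i j, ContDiffOn ℝ ∞ (Z i j) V := fun i j =>
    smoothOn_frameMat_quotient hg hh.toLocClosed hU hF.isUnit i j
  have hYZ : ∀ w ∈ V, ((Y (z₀ + P w) : ℝ) : ℂ) = ∑ i, Z i i w := fun w hw =>
    formTrace_eq_trace_frameMat hg hh.toLocClosed hF.isUnit hw
  -- The (0,1)-part of the Hamiltonian equation: `∂̄μ` is `-i` times the contraction of the metric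
  -- with the vector field.
  have hgrad : ∀ {μ : Cn n → ℝ} {β : Cn n → BilForm n}, ContDiffOn ℝ ∞ μ U → LocKahler U β →
      (∀ z ∈ U, ∀ b, -fderiv ℝ μ z b = β z (ξ z) b) → ∀ w ∈ V, ∀ l (η : Cn n),
      P η = ξ (z₀ + P w) → wirtBar l (fun w => ((μ (z₀ + P w) : ℝ) : ℂ)) w =
        ∑ q, (-Complex.I * η q) * frameMat β z₀ P w q l := by
    intro μ β hμ hβ hμβ w hw l η hη
    have hd : DifferentiableAt ℝ μ (z₀ + P w) := smoothOn_differentiableAt hμ hU hw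
    rw [wirtBar_eq_dirD, dirD_affine (f := fun z => (μ z : ℂ))
      (smoothOn_differentiableAt (smoothOn_ofReal hμ) hU hw)]
    have e1 : ∀ b, fderiv ℝ μ (z₀ + P w) b = -β (z₀ + P w) (ξ (z₀ + P w)) b := fun b => by
      rw [← hμβ _ hw, neg_neg]
    simp only [dirD, fderiv_ofReal hd, e1, ← hη]
    have e2 : ∑ q, (-Complex.I * η q) * frameMat β z₀ P w q l =
        -Complex.I * herm (pull (β (z₀ + P w)) P) η (stdVec l) := by
      rw [herm_expand_left ((hβ.oneOne _ hw).pull P), Finset.mul_sum]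
      exact Finset.sum_congr rfl fun q _ => by rw [frameMat, coeffMatrix_apply, mul_assoc]
    rw [e2, herm]
    simp only [pull_apply]
    push_cast
    linear_combination (-(1 / 2 : ℂ) * (β (z₀ + P w) (P η) (P (stdVec l)))) * Complex.I_sq
  obtain ⟨Q, hQ, -⟩ := exists_inverse_of_isUnit_matOf hF.isUnit
  -- Both moment maps generate the same vector field; eliminating it gives `∂̄m = ∂̄mX · g⁻¹h`.
  have hmm : ∀ w ∈ V, ∀ l, wirtBar l (fun w => ((m (z₀ + P w) : ℝ) : ℂ)) w =
      ∑ q, wirtBar q (fun w => ((mX (z₀ + P w) : ℝ) : ℂ)) w * Z q l w := by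
    intro w hw l
    have hη : P (Q (ξ (z₀ + P w))) = ξ (z₀ + P w) := by
      rw [← ContinuousLinearMap.comp_apply, hQ]; rfl
    rw [hgrad hm hh h1 w hw l _ hη]
    simp only [hgrad hmX hg h2 w hw _ _ hη, Finset.sum_mul]
    rw [Finset.sum_comm]
    refine Finset.sum_congr rfl fun q _ => ?_
    rw [← frameMat_quotient_spec (h := h) hg hF.isUnit hw q l, Finset.mul_sum]
    exact Finset.sum_congr rfl fun j _ => (mul_assoc _ _ _).symm
  have main := moment_laplacian_identity hV h0 (hg.toLocClosed.kahlerMat_frameMat hU)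
    (hh.toLocClosed.kahlerMat_frameMat hU) hZs
    (fun w hw i j => frameMat_quotient_spec hg hF.isUnit hw i j) hF.frameMat_left
    hF.frameMat_right (fun i => (hdp i).ne')
    (mX := fun w => ((mX (z₀ + P w) : ℝ) : ℂ)) (m := fun w => ((m (z₀ + P w) : ℝ) : ℂ))
    (smoothOn_ofReal (contDiff_affine hmX)) hmm
  have hw1 : ∀ k, wirt k (fun w => ∑ i, Z i i w) 0 =
      wirt k (fun w => ((Y (z₀ + P w) : ℝ) : ℂ)) 0 := by
    intro k
    rw [wirt_eq_dirD']
    exact (dirD_congr_of_isOpen _ _ _ hV h0 hYZ).symm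
  simp only [hw1] at main
  have hre := congrArg Complex.re main
  rw [Complex.add_re, re_sum_mul_inv] at hre
  simp only [wirt_wirtBar_affine hU hz hm, wirt_wirtBar_affine hU hz hmX, Complex.re_sum,
    Complex.re_ofReal_mul, Complex.ofReal_re, wirt_mul_wirtBar_affine hU hz hYs hm] at hre
  rw [← hF.formTrace_left og (isOneOne_ddcLocal hm hU hz),
    ← hF.formTrace_right oh (isOneOne_gradForm _ _)] at hre
  rw [hre, add_sub_cancel_right, hF.trace_eq og oh, Finset.mul_sum]
  refine (Finset.abs_sum_le_sum_abs _ _).trans (Finset.sum_le_sum fun k _ => ?_)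
  have e1 := hC (P (stdVec k))
  have e2 := hF.left_apply og k
  rw [abs_mul, abs_mul, abs_of_pos (hdp k), mul_comm C]
  refine mul_le_mul_of_nonneg_left ?_ (hdp k).le
  rw [abs_of_pos (by norm_num : (0 : ℝ) < 1 / 2)]
  rw [show g z₀ (P (stdVec k)) (cplxJ n (P (stdVec k))) = 2 by linarith] at e1
  linarith

end frameMat

/-! ### Functions and forms in charts -/

section Charts

variable {n : ℕ} {X : Type*} [TopologicalSpace X] [ChartedSpace (Cn n) X]

/-- Functions that are smooth in all preferred charts. -/
def IsSmoothInCharts (n : ℕ) {X : Type*} [TopologicalSpace X] [ChartedSpace (Cn n) X]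
    (f : X → ℝ) : Prop :=
  ∀ x₀ : X, ContDiffOn ℝ ∞ (inChart n x₀ f) (chartAt (Cn n) x₀).target

/-- `Δ_α f = tr_α (dd^c f)`. -/
def lap (α : FormField n X) (f : X → ℝ) (x : X) : ℝ := formTrace (α x) (ddcX f x)

/-- `Γ_α(f, k) = tr_α (i ∂f ∧ ∂̄k)`, symmetrised. -/
def gradTrace (α : FormField n X) (f k : X → ℝ) (x : X) : ℝ :=
  formTrace (α x) (gradForm (dX f x) (dX k x))

theorem chart_mem (x : X) : chartAt (Cn n) x x ∈ (chartAt (Cn n) x).target :=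
  mem_chart_target _ x

theorem isOpen_chart (x : X) : IsOpen (chartAt (Cn n) x).target := (chartAt (Cn n) x).open_target

/-- The domain in the chart at `x` of the change of coordinates to the chart at `y`. -/
def overlap (n : ℕ) {X : Type*} [TopologicalSpace X] [ChartedSpace (Cn n) X] (x y : X) :
    Set (Cn n) :=
  (chartAt (Cn n) x).target ∩ (chartAt (Cn n) x).symm ⁻¹' (chartAt (Cn n) y).source

/-- The change of coordinates from the chart at `x` to the chart at `y`. -/
def chartChange (n : ℕ) {X : Type*} [TopologicalSpace X] [ChartedSpace (Cn n) X] (x y : X) :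
    Cn n → Cn n :=
  fun z => chartAt (Cn n) y ((chartAt (Cn n) x).symm z)

theorem isOpen_overlap (x y : X) : IsOpen (overlap n x y) :=
  (chartAt (Cn n) x).symm.isOpen_inter_preimage (chartAt (Cn n) y).open_source

theorem mem_overlap {x y : X} {w : X} (hx : w ∈ (chartAt (Cn n) x).source)
    (hy : w ∈ (chartAt (Cn n) y).source) : chartAt (Cn n) x w ∈ overlap n x y := by
  refine ⟨(chartAt (Cn n) x).map_source hx, ?_⟩
  rw [Set.mem_preimage, (chartAt (Cn n) x).left_inv hx]
  exact hy

theorem mem_overlap_self {x₀ : X} {z : Cn n} (hz : z ∈ (chartAt (Cn n) x₀).target) :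
    z ∈ overlap n x₀ ((chartAt (Cn n) x₀).symm z) :=
  ⟨hz, mem_chart_source _ _⟩

theorem mapsTo_chartChange (x y : X) :
    Set.MapsTo (chartChange n x y) (overlap n x y) (chartAt (Cn n) y).target :=
  fun _ hz => (chartAt (Cn n) y).map_source hz.2

theorem chartChange_mem_overlap {x y : X} {z : Cn n} (hz : z ∈ overlap n x y) :
    chartChange n x y z ∈ overlap n y x :=
  mem_overlap hz.2 ((chartAt (Cn n) x).map_target hz.1)

theorem chartChange_chartChange {x y : X} {z : Cn n} (hz : z ∈ overlap n x y) :
    chartChange n y x (chartChange n x y z) = z := by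
  rw [chartChange, chartChange, (chartAt (Cn n) y).left_inv hz.2, (chartAt (Cn n) x).right_inv hz.1]

theorem inChart_eq_comp {Y : Type*} (f : X → Y) {x y : X} {z : Cn n} (hz : z ∈ overlap n x y) :
    inChart n x f z = inChart n y f (chartChange n x y z) := by
  rw [inChart, inChart, chartChange, (chartAt (Cn n) y).left_inv hz.2]

theorem transition_eq (x₀ : X) (z : Cn n) :
    transition x₀ z = fderiv ℂ (chartChange n x₀ ((chartAt (Cn n) x₀).symm z)) z := rfl

theorem coordForm_eq_pull (α : FormField n X) (x₀ : X) (z : Cn n) :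
    coordForm α x₀ z = pull (α ((chartAt (Cn n) x₀).symm z)) (transition x₀ z) := rfl

theorem transition_center (x : X) :
    transition x (chartAt (Cn n) x x) = ContinuousLinearMap.id ℂ (Cn n) := by
  rw [transition_eq, (chartAt (Cn n) x).left_inv (mem_chart_source _ x)]
  have : chartChange n x x =ᶠ[𝓝 (chartAt (Cn n) x x)] id :=
    Filter.eventuallyEq_of_mem ((isOpen_chart x).mem_nhds (chart_mem x))
      fun z hz => (chartAt (Cn n) x).right_inv hz
  rw [this.fderiv_eq, fderiv_id]

theorem coordForm_center (α : FormField n X) (x : X) :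
    coordForm α x (chartAt (Cn n) x x) = α x := by
  rw [coordForm_eq_pull, transition_center, pull_id,
    (chartAt (Cn n) x).left_inv (mem_chart_source _ x)]

theorem IsSmoothInCharts.continuous {f : X → ℝ} (hf : IsSmoothInCharts n f) : Continuous f := by
  rw [continuous_iff_continuousAt]
  intro x
  have h1 : ContinuousAt (inChart n x f) (chartAt (Cn n) x x) :=
    ((hf x).contDiffAt ((isOpen_chart x).mem_nhds (chart_mem x))).continuousAt
  have h2 := h1.comp ((chartAt (Cn n) x).continuousAt (mem_chart_source _ x))
  refine h2.congr ?_
  filter_upwards [(chartAt (Cn n) x).open_source.mem_nhds (mem_chart_source _ x)] with y hy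
  simp [inChart, (chartAt (Cn n) x).left_inv hy]

theorem IsSmoothInCharts.comp {f : X → ℝ} (hf : IsSmoothInCharts n f) {S : Set ℝ} {χ : ℝ → ℝ}
    (hχ : ContDiffOn ℝ ∞ χ S) (h : ∀ x, f x ∈ S) : IsSmoothInCharts n (fun x => χ (f x)) :=
  fun x₀ => hχ.comp (hf x₀) fun _ _ => h _

theorem IsSmoothInCharts.add {f g : X → ℝ} (hf : IsSmoothInCharts n f)
    (hg : IsSmoothInCharts n g) : IsSmoothInCharts n (fun x => f x + g x) :=
  fun x₀ => (hf x₀).add (hg x₀)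

theorem IsSmoothInCharts.mul {f g : X → ℝ} (hf : IsSmoothInCharts n f)
    (hg : IsSmoothInCharts n g) : IsSmoothInCharts n (fun x => f x * g x) :=
  fun x₀ => (hf x₀).mul (hg x₀)

theorem isSmoothInCharts_const (c : ℝ) : IsSmoothInCharts n (fun _ : X => c) :=
  fun _ => contDiffOn_const

theorem IsSmoothInCharts.const_mul {f : X → ℝ} (hf : IsSmoothInCharts n f) (c : ℝ) :
    IsSmoothInCharts n (fun x => c * f x) := (isSmoothInCharts_const c).mul hf

theorem IsSmoothInCharts.sub {f g : X → ℝ} (hf : IsSmoothInCharts n f)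
    (hg : IsSmoothInCharts n g) : IsSmoothInCharts n (fun x => f x - g x) :=
  fun x₀ => (hf x₀).sub (hg x₀)

theorem IsSmoothInCharts.exp {f : X → ℝ} (hf : IsSmoothInCharts n f) :
    IsSmoothInCharts n (fun x => Real.exp (f x)) :=
  hf.comp (S := Set.univ) Real.contDiff_exp.contDiffOn fun _ => trivial

theorem IsSmoothInCharts.log {f : X → ℝ} (hf : IsSmoothInCharts n f) (h : ∀ x, 0 < f x) :
    IsSmoothInCharts n (fun x => Real.log (f x)) :=
  fun x₀ => (hf x₀).log fun _ _ => (h _).ne'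

theorem isSmoothInCharts_of_eq {f g : X → ℝ} (h : ∀ x, f x = g x) (hf : IsSmoothInCharts n f) :
    IsSmoothInCharts n g := by rwa [← funext h]

/-! ### Pointwise calculus rules -/

section Rules

variable {f g : X → ℝ} (α : FormField n X) (x : X)

theorem IsSmoothInCharts.isOneOne_ddcX (hf : IsSmoothInCharts n f) (x : X) : IsOneOne (ddcX (n := n) f x) :=
  isOneOne_ddcLocal (hf x) (isOpen_chart x) (chart_mem x)

theorem IsSmoothInCharts.differentiableAt (hf : IsSmoothInCharts n f) (x : X) :
    DifferentiableAt ℝ (inChart n x f) (chartAt (Cn n) x x) :=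
  smoothOn_differentiableAt (hf x) (isOpen_chart x) (chart_mem x)

theorem inChart_center {Y : Type*} (f : X → Y) (x : X) :
    inChart n x f (chartAt (Cn n) x x) = f x := by
  rw [inChart, (chartAt (Cn n) x).left_inv (mem_chart_source _ x)]

theorem dX_add (hf : IsSmoothInCharts n f) (hg : IsSmoothInCharts n g) :
    dX (n := n) (fun x => f x + g x) x = dX f x + dX g x :=
  fderiv_add (hf.differentiableAt x) (hg.differentiableAt x)

theorem dX_const_mul (c : ℝ) (hf : IsSmoothInCharts n f) :
    dX (n := n) (fun x => c * f x) x = c • dX f x :=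
  fderiv_const_mul (hf.differentiableAt x) c

theorem dX_comp (hf : IsSmoothInCharts n f) {χ : ℝ → ℝ} (hχ : DifferentiableAt ℝ χ (f x)) :
    dX (n := n) (fun x => χ (f x)) x = deriv χ (f x) • dX f x := by
  rw [← inChart_center (n := n) f x] at hχ
  have := (hχ.hasDerivAt.comp_hasFDerivAt (chartAt (Cn n) x x)
    (hf.differentiableAt x).hasFDerivAt).fderiv
  rw [inChart_center] at this
  exact this

theorem ddcX_add (hf : IsSmoothInCharts n f) (hg : IsSmoothInCharts n g) :
    ddcX (n := n) (fun x => f x + g x) x = ddcX f x + ddcX g x :=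
  ddcLocal_add (isOpen_chart x) (chart_mem x) (hf x) (hg x)

theorem ddcX_const_mul (c : ℝ) (hf : IsSmoothInCharts n f) :
    ddcX (n := n) (fun x => c * f x) x = c • ddcX f x :=
  ddcLocal_const_mul c (isOpen_chart x) (chart_mem x) (hf x)

theorem ddcX_comp (hf : IsSmoothInCharts n f) {S : Set ℝ} {χ : ℝ → ℝ} (hS : IsOpen S)
    (hm : ∀ x, f x ∈ S) (hχ : ContDiffOn ℝ ∞ χ S) :
    ddcX (n := n) (fun x => χ (f x)) x =
      deriv χ (f x) • ddcX f x + deriv (deriv χ) (f x) • gradForm (dX f x) (dX f x) := by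
  have := ddcLocal_comp_real (isOpen_chart x) (chart_mem x) (hf x) hS (fun z _ => hm _) hχ
  rw [inChart_center] at this
  exact this

theorem lap_add (hf : IsSmoothInCharts n f) (hg : IsSmoothInCharts n g) :
    lap α (fun x => f x + g x) x = lap α f x + lap α g x := by
  rw [lap, ddcX_add x hf hg, formTrace_add]; rfl

theorem lap_const_mul (c : ℝ) (hf : IsSmoothInCharts n f) :
    lap α (fun x => c * f x) x = c * lap α f x := by
  rw [lap, ddcX_const_mul x c hf, formTrace_smul]; rfl

theorem lap_comp (hf : IsSmoothInCharts n f) {S : Set ℝ} {χ : ℝ → ℝ} (hS : IsOpen S)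
    (hm : ∀ x, f x ∈ S) (hχ : ContDiffOn ℝ ∞ χ S) :
    lap α (fun x => χ (f x)) x =
      deriv χ (f x) * lap α f x + deriv (deriv χ) (f x) * gradTrace α f f x := by
  rw [lap, ddcX_comp x hf hS hm hχ, formTrace_add, formTrace_smul, formTrace_smul]; rfl

theorem gradTrace_comm (f g : X → ℝ) : gradTrace α f g x = gradTrace α g f x := by
  rw [gradTrace, gradForm_comm]; rfl

theorem gradTrace_add_left {k : X → ℝ} (hf : IsSmoothInCharts n f) (hg : IsSmoothInCharts n g) :
    gradTrace α (fun x => f x + g x) k x = gradTrace α f k x + gradTrace α g k x := by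
  rw [gradTrace, dX_add x hf hg, gradForm_add_left, formTrace_add]; rfl

theorem gradTrace_const_mul_left {k : X → ℝ} (c : ℝ) (hf : IsSmoothInCharts n f) :
    gradTrace α (fun x => c * f x) k x = c * gradTrace α f k x := by
  rw [gradTrace, dX_const_mul x c hf, gradForm_smul_left, formTrace_smul]; rfl

theorem gradTrace_comp_left {k : X → ℝ} (hf : IsSmoothInCharts n f) {χ : ℝ → ℝ}
    (hχ : DifferentiableAt ℝ χ (f x)) :
    gradTrace α (fun x => χ (f x)) k x = deriv χ (f x) * gradTrace α f k x := by
  rw [gradTrace, dX_comp x hf hχ, gradForm_smul_left, formTrace_smul]; rfl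

theorem gradTrace_self_nonneg (hα : IsOneOne (α x)) (pα : ∀ a, a ≠ 0 → 0 < α x a (cplxJ n a)) :
    0 ≤ gradTrace α f f x :=
  formTrace_nonneg hα pα (isOneOne_gradForm _ _) fun a => by
    rw [gradForm_self]; nlinarith [sq_nonneg (dX f x (cplxJ n a)), sq_nonneg (dX f x a)]

end Rules

/-! ### Transformation between charts -/

theorem IsClosedOneOne.locClosed {α : FormField n X} (hα : IsClosedOneOne α) (x₀ : X) :
    LocClosed (chartAt (Cn n) x₀).target (coordForm α x₀) :=
  ⟨hα.smooth x₀, fun _ _ => (hα.oneOne _).pull _, hα.closed x₀⟩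

theorem isClosedOneOne_iff {α : FormField n X} (h : ∀ x, IsOneOne (α x)) :
    IsClosedOneOne α ↔ ∀ x₀ : X, LocClosed (chartAt (Cn n) x₀).target (coordForm α x₀) :=
  ⟨fun hα x₀ => hα.locClosed x₀, fun hα => ⟨h, fun x₀ => (hα x₀).smooth, fun x₀ => (hα x₀).closed⟩⟩

variable [IsManifold 𝓘(ℂ, Cn n) (⊤ : WithTop ℕ∞) X]

theorem contDiffOn_chartChange (x y : X) :
    ContDiffOn ℂ ∞ (chartChange n x y) (overlap n x y) := by
  have h := HasGroupoid.compatible (G := contDiffGroupoid (⊤ : WithTop ℕ∞) 𝓘(ℂ, Cn n))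
    (chart_mem_atlas (Cn n) x) (chart_mem_atlas (Cn n) y)
  rw [contDiffGroupoid, mem_groupoid_of_pregroupoid] at h
  have h1 := h.1
  simp only [contDiffPregroupoid, mfld_simps] at h1
  exact h1.of_le le_top

theorem chartChange_fderiv_comp {x y : X} {z : Cn n} (hz : z ∈ overlap n x y) :
    (fderiv ℂ (chartChange n x y) z).comp
      (fderiv ℂ (chartChange n y x) (chartChange n x y z)) = ContinuousLinearMap.id ℂ (Cn n) := by
  have hw := chartChange_mem_overlap hz
  have h1 : DifferentiableAt ℂ (chartChange n x y)
      (chartChange n y x (chartChange n x y z)) := by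
    rw [chartChange_chartChange hz]
    exact ((contDiffOn_chartChange x y).contDiffAt
      ((isOpen_overlap x y).mem_nhds hz)).differentiableAt (by simp)
  have h2 : DifferentiableAt ℂ (chartChange n y x) (chartChange n x y z) :=
    ((contDiffOn_chartChange y x).contDiffAt
      ((isOpen_overlap y x).mem_nhds hw)).differentiableAt (by simp)
  have h3 := fderiv_comp (chartChange n x y z) h1 h2
  rw [chartChange_chartChange hz] at h3
  rw [← h3]
  have : chartChange n x y ∘ chartChange n y x =ᶠ[𝓝 (chartChange n x y z)] id :=
    Filter.eventuallyEq_of_mem ((isOpen_overlap y x).mem_nhds hw)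
      fun w hw => chartChange_chartChange hw
  rw [this.fderiv_eq, fderiv_id]

theorem isUnit_transition {x₀ : X} {z : Cn n} (hz : z ∈ (chartAt (Cn n) x₀).target) :
    IsUnit (matOf (transition x₀ z)) :=
  isUnit_matOf_of_equiv (chartChange_fderiv_comp (mem_overlap_self hz))

/-- Smoothness on the manifold is tested in the preferred chart of the point itself; a holomorphic
change of coordinates carries it to the chart at `x₀`. -/
theorem contDiffAt_inChart {f : X → ℝ} {x₀ : X} {z : Cn n} (hz : z ∈ (chartAt (Cn n) x₀).target)
    (hf : ContMDiffAt 𝓘(ℝ, Cn n) 𝓘(ℝ, ℝ) ∞ f ((chartAt (Cn n) x₀).symm z)) :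
    ContDiffAt ℝ ∞ (inChart n x₀ f) z := by
  set y := (chartAt (Cn n) x₀).symm z with hy
  have h1 : ContDiffAt ℝ ∞ (inChart n y f) (chartChange n x₀ y z) := by
    have := (contMDiffAt_iff.mp hf).2
    simp only [mfld_simps] at this
    exact contDiffWithinAt_univ.mp this
  have h2 : ContDiffAt ℝ ∞ (chartChange n x₀ y) z :=
    ((contDiffOn_chartChange x₀ y).contDiffAt
      ((isOpen_overlap x₀ y).mem_nhds (mem_overlap_self hz))).restrict_scalars ℝ
  refine (h1.comp z h2).congr_of_eventuallyEq ?_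
  exact Filter.eventuallyEq_of_mem ((isOpen_overlap x₀ y).mem_nhds (mem_overlap_self hz))
    fun w hw => inChart_eq_comp f hw

theorem IsSmooth.inCharts {f : X → ℝ} (hf : IsSmooth n f) : IsSmoothInCharts n f :=
  fun _ _ hz => (contDiffAt_inChart hz (hf _)).contDiffWithinAt

section OneFunction

variable {f k : X → ℝ} {x₀ : X} {z : Cn n}

theorem fderiv_inChart (hf : IsSmoothInCharts n f) (hz : z ∈ (chartAt (Cn n) x₀).target) :
    fderiv ℝ (inChart n x₀ f) z =
      (dX f ((chartAt (Cn n) x₀).symm z)).comp ((transition x₀ z).restrictScalars ℝ) := by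
  set y := (chartAt (Cn n) x₀).symm z with hy
  have hev : inChart n x₀ f =ᶠ[𝓝 z] fun w => inChart n y f (chartChange n x₀ y w) :=
    Filter.eventuallyEq_of_mem ((isOpen_overlap x₀ y).mem_nhds (mem_overlap_self hz))
      fun w hw => inChart_eq_comp f hw
  rw [hev.fderiv_eq, fderiv_comp_of_holomorphic (isOpen_chart y) (isOpen_overlap x₀ y)
    (mem_overlap_self hz) (contDiffOn_chartChange x₀ y) (mapsTo_chartChange x₀ y) (hf y)]
  rfl

/-- `ddcX` reads the function in a chart that varies with the point. The holomorphic invariance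
`ddcLocal_comp` shows that one fixed chart gives the same form. -/
theorem coordForm_ddcX (hf : IsSmoothInCharts n f) (hz : z ∈ (chartAt (Cn n) x₀).target) :
    coordForm (ddcX f) x₀ z = ddcLocal (inChart n x₀ f) z := by
  set y := (chartAt (Cn n) x₀).symm z with hy
  rw [ddcLocal_congr (isOpen_overlap x₀ y) (mem_overlap_self hz)
    (fun w hw => inChart_eq_comp f hw), ddcLocal_comp (isOpen_chart y) (isOpen_overlap x₀ y)
    (mem_overlap_self hz) (contDiffOn_chartChange x₀ y) (mapsTo_chartChange x₀ y) (hf y)]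
  rfl

theorem coordForm_gradForm (hf : IsSmoothInCharts n f) (hk : IsSmoothInCharts n k)
    (hz : z ∈ (chartAt (Cn n) x₀).target) :
    coordForm (fun x => gradForm (dX f x) (dX k x)) x₀ z =
      gradForm (fderiv ℝ (inChart n x₀ f) z) (fderiv ℝ (inChart n x₀ k) z) := by
  rw [coordForm_eq_pull, pull_gradForm, fderiv_inChart hf hz, fderiv_inChart hk hz]

theorem formTrace_coordForm {α β : FormField n X}
    (hα : IsOneOne (α ((chartAt (Cn n) x₀).symm z))) (hβ : IsOneOne (β ((chartAt (Cn n) x₀).symm z)))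
    (hz : z ∈ (chartAt (Cn n) x₀).target) :
    inChart n x₀ (fun x => formTrace (α x) (β x)) z =
      formTrace (coordForm α x₀ z) (coordForm β x₀ z) :=
  (formTrace_pull hα hβ (isUnit_transition hz)).symm

theorem inChart_lap {α : FormField n X} (hα : ∀ x, IsOneOne (α x)) (hf : IsSmoothInCharts n f)
    (hz : z ∈ (chartAt (Cn n) x₀).target) :
    inChart n x₀ (lap α f) z =
      formTrace (coordForm α x₀ z) (ddcLocal (inChart n x₀ f) z) := by
  rw [← coordForm_ddcX hf hz, ← formTrace_coordForm (hα _) (hf.isOneOne_ddcX _) hz]; rfl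

theorem inChart_gradTrace {α : FormField n X} (hα : ∀ x, IsOneOne (α x))
    (hf : IsSmoothInCharts n f) (hk : IsSmoothInCharts n k)
    (hz : z ∈ (chartAt (Cn n) x₀).target) :
    inChart n x₀ (gradTrace α f k) z = formTrace (coordForm α x₀ z)
      (gradForm (fderiv ℝ (inChart n x₀ f) z) (fderiv ℝ (inChart n x₀ k) z)) := by
  rw [← coordForm_gradForm hf hk hz, ← formTrace_coordForm (hα _) (isOneOne_gradForm _ _) hz]; rfl

end OneFunction

theorem IsKahler.locKahler {α : FormField n X} (hα : IsKahler α) (x₀ : X) :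
    LocKahler (chartAt (Cn n) x₀).target (coordForm α x₀) :=
  { hα.toIsClosedOneOne.locClosed x₀ with
    pos := fun _ hz => pull_pos (hα.pos _) (isUnit_transition hz) }

theorem isClosedOneOne_twist {α : FormField n X} (hα : IsClosedOneOne α) {f : X → ℝ}
    (hf : IsSmoothInCharts n f) : IsClosedOneOne (twist α f) := by
  have h1 : ∀ x, IsOneOne (twist α f x) := fun x => (hα.oneOne x).add (hf.isOneOne_ddcX x)
  rw [isClosedOneOne_iff h1]
  intro x₀
  have h2 := (hα.locClosed x₀).add (locClosed_ddcLocal (hf x₀) (isOpen_chart x₀)) (isOpen_chart x₀)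
  have h3 : Set.EqOn (coordForm (twist α f) x₀)
      (fun z => coordForm α x₀ z + ddcLocal (inChart n x₀ f) z) (chartAt (Cn n) x₀).target := by
    intro z hz
    simp only
    rw [← coordForm_ddcX hf hz, coordForm_eq_pull, twist, pull_add]
    rfl
  refine ⟨h2.smooth.congr h3, fun z _ => (h1 _).pull _, fun z hz a b c => ?_⟩
  have h4 : coordForm (twist α f) x₀ =ᶠ[𝓝 z]
      (fun z => coordForm α x₀ z + ddcLocal (inChart n x₀ f) z) :=
    Filter.eventuallyEq_of_mem ((isOpen_chart x₀).mem_nhds hz) h3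
  rw [h4.fderiv_eq]
  exact h2.closed z hz a b c

theorem isKahler_twist {α : FormField n X} (hα : IsClosedOneOne α) {f : X → ℝ}
    (hf : IsSmoothInCharts n f) (hpos : IsPositive (twist α f)) : IsKahler (twist α f) :=
  { isClosedOneOne_twist hα hf with pos := hpos }

theorem isSmoothInCharts_formTrace {α β : FormField n X} (hα : IsKahler α)
    (hβ : IsClosedOneOne β) : IsSmoothInCharts n (fun x => formTrace (α x) (β x)) :=
  fun x₀ => (smoothOn_formTrace (hα.locKahler x₀) (hβ.locClosed x₀)).congr fun _ hz =>
    formTrace_coordForm (hα.oneOne _) (hβ.oneOne _) hz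

theorem isSmoothInCharts_lap {α : FormField n X} (hα : IsKahler α) {f : X → ℝ}
    (hf : IsSmoothInCharts n f) : IsSmoothInCharts n (lap α f) :=
  fun x₀ => (smoothOn_formTrace (hα.locKahler x₀)
    (locClosed_ddcLocal (hf x₀) (isOpen_chart x₀))).congr fun _ hz => inChart_lap hα.oneOne hf hz

/-- The ratio `α^n / β^n`. -/
def detRatio (α β : FormField n X) (x : X) : ℝ := formDet (α x) / formDet (β x)

theorem inChart_detRatio {α β : FormField n X} (hα : ∀ x, IsOneOne (α x)) (hβ : ∀ x, IsOneOne (β x))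
    {x₀ : X} {z : Cn n} (hz : z ∈ (chartAt (Cn n) x₀).target) :
    inChart n x₀ (detRatio α β) z = formDet (coordForm α x₀ z) / formDet (coordForm β x₀ z) := by
  rw [coordForm_eq_pull, coordForm_eq_pull, formDet_pull (hα _), formDet_pull (hβ _),
    mul_div_mul_left]
  · rfl
  · rw [Ne, Complex.normSq_eq_zero]
    exact ((Matrix.isUnit_iff_isUnit_det _).mp (isUnit_transition hz)).ne_zero

theorem isSmoothInCharts_detRatio {α β : FormField n X} (hα : IsKahler α) (hβ : IsKahler β) :
    IsSmoothInCharts n (detRatio α β) := fun x₀ =>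
  ((smoothOn_formDet (hα.locKahler x₀).smooth).div (smoothOn_formDet (hβ.locKahler x₀).smooth)
    fun z hz => (formDet_pos ((hβ.locKahler x₀).oneOne z hz) ((hβ.locKahler x₀).pos z hz)).ne').congr
    fun _ hz => inChart_detRatio hα.oneOne hβ.oneOne hz

end Charts

/-! ### The vector fields of the torus action in charts -/

section TorusFields

variable {n r : ℕ} {X : Type*} [TopologicalSpace X] [ChartedSpace (Cn n) X]
  [MulAction (Torus r) X]

theorem torusExp_zero : torusExp (0 : Fin r → ℝ) = 1 := by
  ext i; simp [torusExp]

/-- The action read in the chart at `x` (source) and the chart at `y` (target). -/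
def actChart (n r : ℕ) {X : Type*} [TopologicalSpace X] [ChartedSpace (Cn n) X]
    [MulAction (Torus r) X] (x y : X) (q : (Fin r → ℝ) × Cn n) : Cn n :=
  chartAt (Cn n) y (torusExp q.1 • (chartAt (Cn n) x).symm q.2)

/-- The domain of the action read in charts. -/
def actDomain (n r : ℕ) {X : Type*} [TopologicalSpace X] [ChartedSpace (Cn n) X]
    [MulAction (Torus r) X] (x y : X) : Set ((Fin r → ℝ) × Cn n) :=
  {q | q.2 ∈ (chartAt (Cn n) x).target ∧
    torusExp q.1 • (chartAt (Cn n) x).symm q.2 ∈ (chartAt (Cn n) y).source}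

/-- The vector field of the `i`-th generator in the chart at `x₀`. -/
def locField (n r : ℕ) {X : Type*} [TopologicalSpace X] [ChartedSpace (Cn n) X]
    [MulAction (Torus r) X] (x₀ : X) (i : Fin r) (z : Cn n) : Cn n :=
  fderiv ℝ (actChart n r x₀ x₀) (0, z) (Pi.single i 1, 0)

theorem zero_mem_actDomain {x₀ : X} {z : Cn n} (hz : z ∈ (chartAt (Cn n) x₀).target) :
    ((0 : Fin r → ℝ), z) ∈ actDomain n r x₀ x₀ := by
  refine ⟨hz, ?_⟩
  rw [torusExp_zero, one_smul]
  exact (chartAt (Cn n) x₀).map_target hz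

variable (hT : IsReducedTorusAction n r X)
include hT

theorem continuous_torus_action :
    Continuous (fun q : (Fin r → ℝ) × X => torusExp q.1 • q.2) := hT.smooth.continuous

theorem isOpen_actDomain (x y : X) : IsOpen (actDomain n r x y) := by
  have h1 : ContinuousOn (fun q : (Fin r → ℝ) × Cn n =>
      torusExp q.1 • (chartAt (Cn n) x).symm q.2) {q | q.2 ∈ (chartAt (Cn n) x).target} :=
    (continuous_torus_action hT).comp_continuousOn (continuousOn_fst.prodMk
      ((chartAt (Cn n) x).continuousOn_symm.comp continuousOn_snd fun q hq => hq))
  exact h1.isOpen_inter_preimage ((isOpen_chart x).preimage continuous_snd)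
    (chartAt (Cn n) y).open_source

theorem eventually_act_mem_source (y x₀ : X) (hy : y ∈ (chartAt (Cn n) x₀).source) (i : Fin r) :
    ∀ᶠ s : ℝ in 𝓝 0, torusExp (s • (Pi.single i 1 : Fin r → ℝ)) • y ∈ (chartAt (Cn n) x₀).source := by
  have h1 : Continuous (fun s : ℝ => torusExp (s • (Pi.single i 1 : Fin r → ℝ)) • y) :=
    (continuous_torus_action hT).comp
      ((continuous_id.smul continuous_const).prodMk continuous_const)
  refine h1.continuousAt.eventually_mem ((chartAt (Cn n) x₀).open_source.mem_nhds ?_)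
  rwa [zero_smul, torusExp_zero, one_smul]

variable [IsManifold 𝓘(ℂ, Cn n) (⊤ : WithTop ℕ∞) X]

/-- The action is known to be smooth in the preferred charts of a point and of its image; changes of
coordinates before and after give arbitrary charts. -/
theorem contDiffOn_actChart (x y : X) : ContDiffOn ℝ ∞ (actChart n r x y) (actDomain n r x y) := by
  intro q hq
  set w := (chartAt (Cn n) x).symm q.2 with hw
  set w' := torusExp q.1 • w with hw'
  have h1 : ContDiffAt ℝ ∞ (actChart n r w w') (q.1, chartChange n x w q.2) := by
    have := (contMDiffAt_iff.mp (hT.smooth (q.1, w))).2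
    simp only [mfld_simps, Prod.map_id, Set.range_id] at this
    exact contDiffWithinAt_univ.mp this
  have hx : q.2 ∈ overlap n x w := mem_overlap_self hq.1
  have h2 : ContDiffAt ℝ ∞ (fun p : (Fin r → ℝ) × Cn n => (p.1, chartChange n x w p.2)) q :=
    contDiffAt_fst.prodMk ((((contDiffOn_chartChange x w).contDiffAt
      ((isOpen_overlap x w).mem_nhds hx)).restrict_scalars ℝ).comp q contDiffAt_snd)
  have hy : actChart n r w w' (q.1, chartChange n x w q.2) ∈ overlap n w' y := by
    rw [actChart, chartChange, (chartAt (Cn n) w).left_inv (mem_chart_source _ w)]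
    exact mem_overlap (mem_chart_source _ w') hq.2
  have h3 : ContDiffAt ℝ ∞ (chartChange n w' y) (actChart n r w w' (q.1, chartChange n x w q.2)) :=
    ((contDiffOn_chartChange w' y).contDiffAt ((isOpen_overlap w' y).mem_nhds hy)).restrict_scalars ℝ
  refine ((h3.comp (q.1, chartChange n x w q.2) h1).comp q h2).congr_of_eventuallyEq ?_
    |>.contDiffWithinAt
  have e1 : ∀ᶠ p in 𝓝 q, p ∈ actDomain n r x w' :=
    (isOpen_actDomain hT x w').mem_nhds ⟨hq.1, mem_chart_source _ w'⟩
  have e2 : ∀ᶠ p : (Fin r → ℝ) × Cn n in 𝓝 q, p.2 ∈ overlap n x w :=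
    ((isOpen_overlap x w).preimage continuous_snd).mem_nhds hx
  filter_upwards [e1, e2] with p hp1 hp2
  simp only [Function.comp_apply, actChart, chartChange]
  rw [(chartAt (Cn n) w).left_inv hp2.2, (chartAt (Cn n) w').left_inv hp1.2]

theorem actChart_fderiv_J (x y : X) {q : (Fin r → ℝ) × Cn n} (hq : q ∈ actDomain n r x y)
    (b : Cn n) : fderiv ℝ (actChart n r x y) q (0, cplxJ n b) =
      cplxJ n (fderiv ℝ (actChart n r x y) q (0, b)) := by
  set w := (chartAt (Cn n) x).symm q.2 with hw
  set w' := torusExp q.1 • w with hw'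
  have hC : DifferentiableAt ℂ (fun z => actChart n r x y (q.1, z)) q.2 := by
    have hx : q.2 ∈ overlap n x w := mem_overlap_self hq.1
    have h1 : DifferentiableAt ℂ (fun z => actChart n r w w' (q.1, z)) (chartChange n x w q.2) := by
      have := (mdifferentiableAt_iff _ _ |>.mp (hT.holomorphic (torusExp q.1) w)).2
      simp only [mfld_simps] at this
      exact differentiableWithinAt_univ.mp this
    have h2 : DifferentiableAt ℂ (chartChange n x w) q.2 :=
      ((contDiffOn_chartChange x w).contDiffAt
        ((isOpen_overlap x w).mem_nhds hx)).differentiableAt (by simp)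
    have hy : actChart n r w w' (q.1, chartChange n x w q.2) ∈ overlap n w' y := by
      rw [actChart, chartChange, (chartAt (Cn n) w).left_inv (mem_chart_source _ w)]
      exact mem_overlap (mem_chart_source _ w') hq.2
    have h3 : DifferentiableAt ℂ (chartChange n w' y)
        (actChart n r w w' (q.1, chartChange n x w q.2)) :=
      ((contDiffOn_chartChange w' y).contDiffAt
        ((isOpen_overlap w' y).mem_nhds hy)).differentiableAt (by simp)
    refine ((h3.comp (chartChange n x w q.2) h1).comp q.2 h2).congr_of_eventuallyEq ?_
    have e1 : ∀ᶠ z in 𝓝 q.2, (q.1, z) ∈ actDomain n r x w' :=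
      (Continuous.prodMk_right q.1).continuousAt.eventually
        ((isOpen_actDomain hT x w').mem_nhds ⟨hq.1, mem_chart_source _ w'⟩)
    filter_upwards [e1, (isOpen_overlap x w).mem_nhds hx] with p hp1 hp2
    simp only [Function.comp_apply, actChart, chartChange]
    rw [(chartAt (Cn n) w).left_inv hp2.2, (chartAt (Cn n) w').left_inv hp1.2]
  have hd := smoothOn_differentiableAt (contDiffOn_actChart hT x y) (isOpen_actDomain hT x y) hq
  have key : ∀ c, fderiv ℝ (actChart n r x y) q (0, c) =
      fderiv ℂ (fun z => actChart n r x y (q.1, z)) q.2 c := by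
    intro c
    have h1 := (hC.hasFDerivAt.restrictScalars ℝ).fderiv
    have h2 : HasFDerivAt (fun z : Cn n => (q.1, z)) (ContinuousLinearMap.inr ℝ (Fin r → ℝ) (Cn n)) q.2 :=
      hasFDerivAt_prodMk_right q.1 q.2
    have h3 := (HasFDerivAt.comp (g := actChart n r x y) q.2 hd.hasFDerivAt h2).fderiv
    have h4 := h1.symm.trans h3
    exact (DFunLike.congr_fun h4 c).symm
  rw [key, key, map_cplxJ]

variable {x₀ : X} {z : Cn n}

theorem smoothOn_locField (x₀ : X) (i : Fin r) :
    ContDiffOn ℝ ∞ (locField n r x₀ i) (chartAt (Cn n) x₀).target :=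
  (smoothOn_fderiv_apply (contDiffOn_actChart hT x₀ x₀) (isOpen_actDomain hT x₀ x₀) _).comp
    (contDiff_prodMk_right (0 : Fin r → ℝ)).contDiffOn fun _ hz => zero_mem_actDomain hz

/-- The generators are holomorphic vector fields: the derivative in the torus direction commutes
with the spatial derivative, which is complex linear for each fixed torus element
(`actChart_fderiv_J`). -/
theorem locField_fderiv_J (hz : z ∈ (chartAt (Cn n) x₀).target) (i : Fin r) (b : Cn n) :
    fderiv ℝ (locField n r x₀ i) z (cplxJ n b) = cplxJ n (fderiv ℝ (locField n r x₀ i) z b) := by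
  set W := actDomain n r x₀ x₀
  have hW := isOpen_actDomain hT x₀ x₀
  have hs := contDiffOn_actChart hT x₀ x₀
  have hq := zero_mem_actDomain (r := r) hz
  set e : (Fin r → ℝ) × Cn n := (Pi.single i 1, 0) with he
  have key : ∀ c, fderiv ℝ (locField n r x₀ i) z c =
      fderiv ℝ (fun q => fderiv ℝ (actChart n r x₀ x₀) q (0, c)) (0, z) e := by
    intro c
    rw [fderiv_fderiv_apply hs hW hq, fderiv_fderiv_symm hs hW hq, ← fderiv_fderiv_apply hs hW hq]
    have h2 : HasFDerivAt (fun z : Cn n => ((0 : Fin r → ℝ), z))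
        (ContinuousLinearMap.inr ℝ (Fin r → ℝ) (Cn n)) z := hasFDerivAt_prodMk_right _ _
    have h1 := smoothOn_differentiableAt (smoothOn_fderiv_apply hs hW e) hW hq
    have h3 := (HasFDerivAt.comp (g := fun q => fderiv ℝ (actChart n r x₀ x₀) q e) z
      h1.hasFDerivAt h2).fderiv
    exact DFunLike.congr_fun h3 c
  rw [key, key]
  have h4 : (fun q => fderiv ℝ (actChart n r x₀ x₀) q (0, cplxJ n b)) =ᶠ[𝓝 (0, z)]
      fun q => cplxJ n (fderiv ℝ (actChart n r x₀ x₀) q (0, b)) :=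
    Filter.eventuallyEq_of_mem (hW.mem_nhds hq) fun q hq => actChart_fderiv_J hT x₀ x₀ hq b
  rw [h4.fderiv_eq]
  have h1 := smoothOn_differentiableAt (smoothOn_fderiv_apply hs hW (0, b)) hW hq
  exact DFunLike.congr_fun (((cplxJ n).hasFDerivAt.comp _ h1.hasFDerivAt).fderiv) e

theorem hasDerivAt_actChart (hz : z ∈ (chartAt (Cn n) x₀).target) (i : Fin r) :
    HasDerivAt (fun s : ℝ => chartAt (Cn n) x₀
      (torusExp (s • (Pi.single i 1 : Fin r → ℝ)) • (chartAt (Cn n) x₀).symm z))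
      (locField n r x₀ i z) 0 := by
  have hd := smoothOn_differentiableAt (contDiffOn_actChart hT x₀ x₀) (isOpen_actDomain hT x₀ x₀)
    (zero_mem_actDomain (r := r) hz)
  have h1 : HasDerivAt (fun s : ℝ => (s • (Pi.single i 1 : Fin r → ℝ), z))
      ((Pi.single i 1 : Fin r → ℝ), (0 : Cn n)) 0 := by
    have := ((hasDerivAt_id (0 : ℝ)).smul_const (Pi.single i 1 : Fin r → ℝ)).prodMk
      (hasDerivAt_const (0 : ℝ) z)
    simpa using this
  have hd' := hd.hasFDerivAt
  rw [show ((0 : Fin r → ℝ), z) = ((0 : ℝ) • (Pi.single i 1 : Fin r → ℝ), z) by simp] at hd'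
  have h2 := hd'.comp_hasDerivAt (0 : ℝ) h1
  simp only [zero_smul] at h2
  exact h2

/-- The invariant field is defined in a chart that moves with the point; `locField` is its smooth
expression in one chart, to which calculus applies. -/
theorem fundField_eq (hz : z ∈ (chartAt (Cn n) x₀).target) (i : Fin r) :
    fundField n r i ((chartAt (Cn n) x₀).symm z) = transition x₀ z (locField n r x₀ i z) := by
  set y := (chartAt (Cn n) x₀).symm z with hy
  have h1 := hasDerivAt_actChart hT hz i
  have h2 := (((contDiffOn_chartChange x₀ y).contDiffAt ((isOpen_overlap x₀ y).mem_nhds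
    (mem_overlap_self hz))).differentiableAt (by simp)).hasFDerivAt.restrictScalars ℝ
  have e0 : chartAt (Cn n) x₀ (torusExp ((0 : ℝ) • (Pi.single i 1 : Fin r → ℝ)) •
      (chartAt (Cn n) x₀).symm z) = z := by
    rw [zero_smul, torusExp_zero, one_smul, (chartAt (Cn n) x₀).right_inv hz]
  rw [← e0] at h2
  have h3 := h2.comp_hasDerivAt (0 : ℝ) h1
  rw [e0] at h3
  refine (h3.congr_of_eventuallyEq ?_).deriv
  filter_upwards [eventually_act_mem_source hT y x₀ ((chartAt (Cn n) x₀).map_target hz) i] with s hs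
  simp only [Function.comp_apply, chartChange]
  rw [(chartAt (Cn n) x₀).left_inv hs]

theorem fderiv_locField_eq_zero {f : X → ℝ} (hf : IsSmoothInCharts n f) (hi : InvariantFun r f)
    (hz : z ∈ (chartAt (Cn n) x₀).target) (i : Fin r) :
    fderiv ℝ (inChart n x₀ f) z (locField n r x₀ i z) = 0 := by
  have h1 := hasDerivAt_actChart hT hz i
  have h2 := (smoothOn_differentiableAt (hf x₀) (isOpen_chart x₀) hz).hasFDerivAt
  have e0 : chartAt (Cn n) x₀ (torusExp ((0 : ℝ) • (Pi.single i 1 : Fin r → ℝ)) •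
      (chartAt (Cn n) x₀).symm z) = z := by
    rw [zero_smul, torusExp_zero, one_smul, (chartAt (Cn n) x₀).right_inv hz]
  rw [← e0] at h2
  have h3 := h2.comp_hasDerivAt (0 : ℝ) h1
  rw [e0] at h3
  have h4 : HasDerivAt (fun _ : ℝ => f ((chartAt (Cn n) x₀).symm z))
      (fderiv ℝ (inChart n x₀ f) z (locField n r x₀ i z)) 0 := by
    refine h3.congr_of_eventuallyEq ?_
    filter_upwards [eventually_act_mem_source hT _ x₀ ((chartAt (Cn n) x₀).map_target hz) i]
      with s hs
    simp only [Function.comp_apply, inChart]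
    rw [(chartAt (Cn n) x₀).left_inv hs, hi]
  exact h4.unique (hasDerivAt_const _ _)

/-! ### Moment maps in charts -/

theorem inChart_ddcMoment {f : X → ℝ} (hf : IsSmoothInCharts n f)
    (hz : z ∈ (chartAt (Cn n) x₀).target) (i : Fin r) :
    inChart n x₀ (fun x => ddcMoment n r f x i) z =
      -(1 / 2) * fderiv ℝ (inChart n x₀ f) z (cplxJ n (locField n r x₀ i z)) := by
  rw [fderiv_inChart hf hz, inChart, ddcMoment, fundField_eq hT hz]
  simp only [dcX, dcLocal, smul_apply, ContinuousLinearMap.comp_apply,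
    ContinuousLinearMap.coe_restrictScalars', map_cplxJ, smul_eq_mul]
  rfl

theorem isSmoothInCharts_ddcMoment {f : X → ℝ} (hf : IsSmoothInCharts n f) (i : Fin r) :
    IsSmoothInCharts n (fun x => ddcMoment n r f x i) := fun x₀ =>
  (contDiffOn_const.mul ((smoothOn_fderiv (hf x₀) (isOpen_chart x₀)).clm_apply
    ((cplxJ n).contDiff.comp_contDiffOn (smoothOn_locField hT x₀ i)))).congr fun _ hz =>
      inChart_ddcMoment hT hf hz i

/-- Cartan's formula for `d^c f`: its Lie derivative along the field vanishes because `f` is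
invariant and the field is holomorphic. -/
theorem fderiv_ddcMoment {f : X → ℝ} (hf : IsSmoothInCharts n f) (hi : InvariantFun r f)
    (hz : z ∈ (chartAt (Cn n) x₀).target) (i : Fin r) (b : Cn n) :
    -fderiv ℝ (inChart n x₀ (fun x => ddcMoment n r f x i)) z b =
      ddcLocal (inChart n x₀ f) z (locField n r x₀ i z) b := by
  have hU := isOpen_chart (n := n) x₀
  have hDf := smoothOn_differentiableAt (smoothOn_fderiv (hf x₀) hU) hU hz
  have hξ := smoothOn_differentiableAt (smoothOn_locField hT x₀ i) hU hz
  have h1 : inChart n x₀ (fun x => ddcMoment n r f x i) =ᶠ[𝓝 z] fun z =>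
      -(1 / 2) * fderiv ℝ (inChart n x₀ f) z (cplxJ n (locField n r x₀ i z)) :=
    Filter.eventuallyEq_of_mem (hU.mem_nhds hz) fun z hz => inChart_ddcMoment hT hf hz i
  have hJξ : HasFDerivAt (fun z => cplxJ n (locField n r x₀ i z))
      ((cplxJ n).comp (fderiv ℝ (locField n r x₀ i) z)) z :=
    (cplxJ n).hasFDerivAt.comp z hξ.hasFDerivAt
  have h2 := ((hDf.hasFDerivAt.clm_apply hJξ).const_mul (-(1 / 2) : ℝ)).fderiv
  have h3 := (hDf.hasFDerivAt.clm_apply hξ.hasFDerivAt).fderiv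
  have h4 : fderiv ℝ (fun z => fderiv ℝ (inChart n x₀ f) z (locField n r x₀ i z)) z = 0 := by
    have : (fun z => fderiv ℝ (inChart n x₀ f) z (locField n r x₀ i z)) =ᶠ[𝓝 z] fun _ => 0 :=
      Filter.eventuallyEq_of_mem (hU.mem_nhds hz) fun z hz => fderiv_locField_eq_zero hT hf hi hz i
    rw [this.fderiv_eq]
    exact fderiv_const_apply _
  -- The relation `df(ξ) = 0` is differentiated in the direction `Jb`. Holomorphy gives `Dξ(Jb) = J
  -- Dξ(b)`, which eliminates the term with the first derivative of `f`.
  have h5 := DFunLike.congr_fun (h3.symm.trans h4) (cplxJ n b)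
  rw [h1.fderiv_eq, h2, ddcLocal_apply]
  simp only [smul_apply, add_apply, ContinuousLinearMap.comp_apply, smul_eq_mul,
    ContinuousLinearMap.flip_apply, zero_apply] at h5 ⊢
  rw [locField_fderiv_J hT hz] at h5
  rw [fderiv_fderiv_symm (hf x₀) hU hz b, fderiv_fderiv_symm (hf x₀) hU hz (locField n r x₀ i z)]
  linarith

theorem isSmoothInCharts_momentTwist {m : X → Fin r → ℝ}
    (hm : ∀ i, IsSmoothInCharts n fun x => m x i) {f : X → ℝ} (hf : IsSmoothInCharts n f)
    (i : Fin r) : IsSmoothInCharts n (fun x => momentTwist n m f x i) :=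
  (hm i).add (isSmoothInCharts_ddcMoment hT hf i)

theorem IsMomentMap.fderiv_inChart {om : FormField n X} {m : X → Fin r → ℝ}
    (hm : IsMomentMap om m) (hz : z ∈ (chartAt (Cn n) x₀).target) (i : Fin r) (b : Cn n) :
    -fderiv ℝ (inChart n x₀ fun x => m x i) z b =
      coordForm om x₀ z (locField n r x₀ i z) b := by
  rw [WCscK.fderiv_inChart (hm.smooth i).inCharts hz, coordForm_eq_pull, pull_apply,
    ← fundField_eq hT hz, ← hm.hamiltonian]
  rfl

theorem momentTwist_fderiv_inChart {om : FormField n X} {m : X → Fin r → ℝ}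
    (hm : IsMomentMap om m) {f : X → ℝ} (hf : IsSmoothInCharts n f) (hi : InvariantFun r f)
    (hz : z ∈ (chartAt (Cn n) x₀).target) (i : Fin r) (b : Cn n) :
    -fderiv ℝ (inChart n x₀ fun x => momentTwist n m f x i) z b =
      coordForm (twist om f) x₀ z (locField n r x₀ i z) b := by
  have hU := isOpen_chart (n := n) x₀
  have h1 := fderiv_add (smoothOn_differentiableAt ((hm.smooth i).inCharts x₀) hU hz)
    (smoothOn_differentiableAt (isSmoothInCharts_ddcMoment hT hf i x₀) hU hz)
  have h2 : coordForm (twist om f) x₀ z = coordForm om x₀ z + ddcLocal (inChart n x₀ f) z := by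
    rw [← coordForm_ddcX hf hz, coordForm_eq_pull, twist, pull_add]; rfl
  rw [show (inChart n x₀ fun x => momentTwist n m f x i) =
    (inChart n x₀ fun x => m x i) + inChart n x₀ fun x => ddcMoment n r f x i from rfl, h1, h2,
    add_apply, add_apply, add_apply, ← hm.fderiv_inChart hT hz, ← fderiv_ddcMoment hT hf hi hz]
  ring

theorem momentTwist_dX {om : FormField n X} {m : X → Fin r → ℝ}
    (hm : IsMomentMap om m) {f : X → ℝ} (hf : IsSmoothInCharts n f) (hi : InvariantFun r f)
    (x : X) (i : Fin r) (b : Cn n) :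
    -dX (fun y => momentTwist n m f y i) x b = twist om f x (fundField n r i x) b := by
  have h1 := momentTwist_fderiv_inChart hT hm hf hi (chart_mem x) i b
  have h2 := fundField_eq hT (chart_mem x) i
  rw [(chartAt (Cn n) x).left_inv (mem_chart_source _ x), transition_center] at h2
  rw [coordForm_center] at h1
  rw [h2]
  exact h1

end TorusFields

/-! ### Gradients of Hamiltonians -/

/-- In a unitary frame the Hamiltonian equation determines the components of `ξ` from `v`. Applied
to `u = df`, the result says that pairing `∂f` with the gradient of a moment map gives `d^c f(ξ)`.
-/
theorem formTrace_gradForm_hamiltonian {n : ℕ} {om : BilForm n} (hom : IsOneOne om)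
    (pom : ∀ a, a ≠ 0 → 0 < om a (cplxJ n a)) (u : Cn n →L[ℝ] ℝ) {v : Cn n →L[ℝ] ℝ} {ξ : Cn n}
    (hv : ∀ b, -v b = om ξ b) : formTrace om (gradForm u v) = -(1 / 2) * u (cplxJ n ξ) := by
  obtain ⟨P, d, hF⟩ := exists_isFrame hom hom pom pom
  obtain ⟨Q, hQ, -⟩ := exists_inverse_of_isUnit_matOf hF.isUnit
  set η := Q ξ with hη
  have hPη : P η = ξ := by rw [hη, ← ContinuousLinearMap.comp_apply, hQ]; rfl
  have h1 : ∀ l, η l = 1 / 2 * (-(v (cplxJ n (P (stdVec l))) : ℂ) + Complex.I * v (P (stdVec l))) := by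
    intro l
    have h2 : herm (pull om P) η (stdVec l) = η l := by
      rw [herm_expand_left (hom.pull P)]
      simp only [← coeffMatrix_apply, hF.left, Matrix.one_apply]
      simp
    rw [← h2, herm, pull_apply, pull_apply, hPη, ← hv, ← hv, map_cplxJ]
    push_cast; ring
  have hre : ∀ l, (η l).re = -(1 / 2) * v (cplxJ n (P (stdVec l))) := fun l => by
    rw [h1]; simp
  have him : ∀ l, (η l).im = 1 / 2 * v (P (stdVec l)) := fun l => by
    rw [h1]; simp
  have hξ : ξ = ∑ l, η l • P (stdVec l) := by
    conv_lhs => rw [← hPη, ← sum_coord_smul_stdVec η, map_sum]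
    simp only [map_smul]
  rw [hF.formTrace_left hom (isOneOne_gradForm u v), hξ, map_sum, map_sum, Finset.mul_sum]
  refine Finset.sum_congr rfl fun l _ => ?_
  rw [gradForm_self, complex_smul_eq, map_add, map_smul, map_smul, cplxJ_cplxJ, map_add, map_smul,
    map_smul, map_neg, hre, him, smul_eq_mul, smul_eq_mul]
  ring

/-- The Hessian at a maximum is nonpositive. -/
theorem fderiv_fderiv_nonpos_of_max {E : Type*} [NormedAddCommGroup E] [NormedSpace ℝ E]
    {U : Set E} {f : E → ℝ} {z : E} (hf : ContDiffOn ℝ ∞ f U) (hU : IsOpen U) (hz : z ∈ U)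
    (hmax : ∀ w ∈ U, f w ≤ f z) (a : E) : fderiv ℝ (fderiv ℝ f) z a a ≤ 0 := by
  by_contra! hpos
  set g : ℝ → ℝ := fun s => f (z + s • a) with hg
  have hline : ∀ s : ℝ, HasDerivAt (fun s : ℝ => z + s • a) a s := fun s => by
    simpa using ((hasDerivAt_id s).smul_const a).const_add z
  have hz0 : z + (0 : ℝ) • a = z := by simp
  have hev : ∀ᶠ s : ℝ in 𝓝 0, z + s • a ∈ U := by
    refine (hline 0).continuousAt.eventually_mem (hU.mem_nhds ?_)
    rwa [hz0]
  have hd : ∀ᶠ s : ℝ in 𝓝 0, deriv g s = fderiv ℝ f (z + s • a) a := by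
    filter_upwards [hev] with s hs
    exact ((smoothOn_differentiableAt hf hU hs).hasFDerivAt.comp_hasDerivAt s (hline s)).deriv
  have hdd : deriv (deriv g) 0 = fderiv ℝ (fderiv ℝ f) z a a := by
    rw [Filter.EventuallyEq.deriv_eq hd, ← fderiv_fderiv_apply hf hU hz]
    have h1 := (smoothOn_differentiableAt (smoothOn_fderiv_apply hf hU a) hU hz).hasFDerivAt
    rw [← hz0] at h1
    have h2 := h1.comp_hasDerivAt (0 : ℝ) (hline 0)
    rw [hz0] at h2
    exact h2.deriv
  have hmaxg : IsLocalMax g 0 := by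
    filter_upwards [hev] with s hs
    simp only [hg, hz0]
    exact hmax _ hs
  have hcont : ContinuousAt g 0 := by
    have h1 := (smoothOn_differentiableAt hf hU hz).continuousAt
    rw [← hz0] at h1
    exact ContinuousAt.comp (g := f) h1 (hline 0).continuousAt
  -- A positive second derivative would make the maximum also a local minimum, hence the function
  -- locally constant on the line, with vanishing second derivative.
  have hmin : IsLocalMin g 0 :=
    isLocalMin_of_deriv_deriv_pos (hdd ▸ hpos) hmaxg.deriv_eq_zero hcont
  have hconst : g =ᶠ[𝓝 0] fun _ => g 0 := by
    filter_upwards [hmaxg, hmin] with s h1 h2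
    exact le_antisymm h1 h2
  have h0 : deriv (deriv g) 0 = 0 := by
    rw [hconst.deriv.deriv_eq]
    simp
  rw [hdd] at h0
  exact hpos.ne' h0

/-! ### Concave functions of moment maps -/

section Weights

variable {n r : ℕ} {X : Type*} [TopologicalSpace X] [ChartedSpace (Cn n) X]

theorem fderiv_eq_sum_partialV (ℓ : (Fin r → ℝ) → ℝ) (q w : Fin r → ℝ) :
    fderiv ℝ ℓ q w = ∑ i, partialV ℓ i q * w i := by
  conv_lhs => rw [pi_eq_sum_univ' w, map_sum]
  refine Finset.sum_congr rfl fun i _ => ?_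
  rw [map_smul, smul_eq_mul, mul_comm, partialV]

theorem concave_le_tangent {ℓ : (Fin r → ℝ) → ℝ} (hℓ : Differentiable ℝ ℓ)
    (hc : ConcaveOn ℝ Set.univ ℓ) (p q : Fin r → ℝ) :
    ℓ q ≤ ℓ p + ∑ i, partialV ℓ i p * (q i - p i) := by
  have hline : ∀ s : ℝ, HasDerivAt (fun s : ℝ => p + s • (q - p)) (q - p) s := fun s => by
    simpa using ((hasDerivAt_id s).smul_const (q - p)).const_add p
  have h1 : HasDerivAt (fun s : ℝ => ℓ (p + s • (q - p))) (fderiv ℝ ℓ p (q - p)) 0 := by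
    have h2 := (hℓ (p + (0 : ℝ) • (q - p))).hasFDerivAt.comp_hasDerivAt (0 : ℝ) (hline 0)
    rw [zero_smul, add_zero] at h2
    exact h2
  have hconc : ConcaveOn ℝ Set.univ (fun s : ℝ => ℓ (p + s • (q - p))) := by
    have := hc.comp_affineMap (AffineMap.lineMap p q)
    simp only [Set.preimage_univ] at this
    refine this.congr fun s _ => ?_
    simp only [Function.comp_apply, AffineMap.lineMap_apply, vsub_eq_sub, vadd_eq_add]
    rw [add_comm]
  have h3 := hconc.slope_le_of_hasDerivAt (Set.mem_univ 0) (Set.mem_univ 1) one_pos h1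
  rw [slope_def_field] at h3
  simp only [zero_smul, add_zero, one_smul, add_sub_cancel, sub_zero, div_one] at h3
  rw [fderiv_eq_sum_partialV] at h3
  simp only [Pi.sub_apply] at h3
  linarith

variable {ℓ : (Fin r → ℝ) → ℝ} {m : X → Fin r → ℝ}

theorem isSmoothInCharts_weight (hℓ : ContDiff ℝ ∞ ℓ)
    (hm : ∀ i, IsSmoothInCharts n fun x => m x i) : IsSmoothInCharts n fun x => ℓ (m x) :=
  fun x₀ => hℓ.comp_contDiffOn (contDiffOn_pi.mpr fun i => hm i x₀)

theorem dX_weight (hℓ : ContDiff ℝ ∞ ℓ) (hm : ∀ i, IsSmoothInCharts n fun x => m x i) (x : X)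
    (b : Cn n) :
    dX (n := n) (fun x => ℓ (m x)) x b = ∑ i, partialV ℓ i (m x) * dX (fun x => m x i) x b := by
  have h1 : HasFDerivAt (inChart n x m)
      (ContinuousLinearMap.pi fun i => dX (n := n) (fun x => m x i) x) (chartAt (Cn n) x x) :=
    hasFDerivAt_pi.mpr fun i => ((hm i).differentiableAt x).hasFDerivAt
  have h2 := (hℓ.differentiable (by simp) (inChart n x m (chartAt (Cn n) x x))).hasFDerivAt
  have h3 := (h2.comp _ h1).fderiv
  rw [inChart_center] at h3
  rw [dX]
  change fderiv ℝ (ℓ ∘ inChart n x m) _ b = _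
  rw [h3, ContinuousLinearMap.comp_apply, fderiv_eq_sum_partialV]
  rfl

theorem gradTrace_weight (hℓ : ContDiff ℝ ∞ ℓ) (hm : ∀ i, IsSmoothInCharts n fun x => m x i)
    (α : FormField n X) (f : X → ℝ) (x : X) :
    gradTrace α f (fun x => ℓ (m x)) x =
      ∑ i, partialV ℓ i (m x) * gradTrace α f (fun x => m x i) x := by
  have h1 : gradForm (dX f x) (dX (n := n) (fun x => ℓ (m x)) x) =
      ∑ i, partialV ℓ i (m x) • gradForm (dX f x) (dX (fun x => m x i) x) := by
    ext a b
    simp only [gradForm_apply, dX_weight hℓ hm, sum_apply, smul_apply, smul_eq_mul, Finset.mul_sum,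
      Finset.sum_mul, ← Finset.sum_add_distrib, ← Finset.sum_sub_distrib]
    exact Finset.sum_congr rfl fun i _ => by ring
  rw [gradTrace, h1, formTrace_sum]
  exact Finset.sum_congr rfl fun i _ => formTrace_smul _ _ _

theorem isSmoothInCharts_sum {ι : Type*} (s : Finset ι) {f : ι → X → ℝ}
    (hf : ∀ i ∈ s, IsSmoothInCharts n (f i)) : IsSmoothInCharts n fun x => ∑ i ∈ s, f i x :=
  fun x₀ => ContDiffOn.sum fun i hi => hf i hi x₀

theorem ddcX_sum_const_mul {ι : Type*} (s : Finset ι) {f : ι → X → ℝ} (c : ι → ℝ)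
    (hf : ∀ i, IsSmoothInCharts n (f i)) (x : X) :
    ddcX (n := n) (fun x => ∑ i ∈ s, c i * f i x) x = ∑ i ∈ s, c i • ddcX (f i) x := by
  classical
  induction s using Finset.induction_on with
  | empty =>
    ext a b
    simp only [Finset.sum_empty, ddcX, zero_apply]
    rw [show inChart n x (fun _ : X => (0 : ℝ)) = fun _ => 0 from rfl, ddcLocal_apply]
    simp
  | insert i s hi ih =>
    simp only [Finset.sum_insert hi]
    rw [ddcX_add x ((hf i).const_mul (c i))
      (isSmoothInCharts_sum s fun j _ => (hf j).const_mul (c j)), ih, ddcX_const_mul x _ (hf i)]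

/-- By concavity, `ℓ ∘ m` minus the linearisation of `ℓ` at `m x` has a maximum at `x`, so its
Hessian there is nonpositive. No second derivative of `ℓ` has to be computed. -/
theorem ddcX_weight_le (hℓ : ContDiff ℝ ∞ ℓ) (hc : ConcaveOn ℝ Set.univ ℓ)
    (hm : ∀ i, IsSmoothInCharts n fun x => m x i) (x : X) (a : Cn n) :
    ddcX (n := n) (fun x => ℓ (m x)) x a (cplxJ n a) ≤
      (∑ i, partialV ℓ i (m x) • ddcX (n := n) (fun x => m x i) x) a (cplxJ n a) := by
  have hV := isSmoothInCharts_weight hℓ hm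
  have hs : IsSmoothInCharts n fun y => ∑ i, -partialV ℓ i (m x) * m y i :=
    isSmoothInCharts_sum _ fun i _ => (hm i).const_mul _
  have hf := hV.add hs
  have h1 := ddcX_add x hV hs
  rw [ddcX_sum_const_mul _ (fun i => -partialV ℓ i (m x)) hm] at h1
  have hmax : ∀ w ∈ (chartAt (Cn n) x).target,
      inChart n x (fun y => ℓ (m y) + ∑ i, -partialV ℓ i (m x) * m y i) w ≤
      inChart n x (fun y => ℓ (m y) + ∑ i, -partialV ℓ i (m x) * m y i) (chartAt (Cn n) x x) := by
    intro w _
    rw [inChart_center]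
    simp only [inChart]
    have := concave_le_tangent (hℓ.differentiable (by simp)) hc (m x)
      (m ((chartAt (Cn n) x).symm w))
    simp only [mul_sub, Finset.sum_sub_distrib] at this
    simp only [neg_mul, Finset.sum_neg_distrib]
    linarith
  have h2 := fun b => fderiv_fderiv_nonpos_of_max (hf x) (isOpen_chart x) (chart_mem x) hmax b
  have h3 : ddcX (n := n) (fun y => ℓ (m y) + ∑ i, -partialV ℓ i (m x) * m y i) x a (cplxJ n a) ≤
      0 := by
    rw [ddcX, ddcLocal_self]
    have := h2 a
    have := h2 (cplxJ n a)
    linarith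
  rw [h1] at h3
  simp only [add_apply, sum_apply, smul_apply, smul_eq_mul, neg_mul, Finset.sum_neg_distrib] at h3 ⊢
  linarith

theorem lap_weight_le {α : FormField n X} (hα : ∀ x, IsOneOne (α x)) (pα : IsPositive α)
    (hℓ : ContDiff ℝ ∞ ℓ) (hc : ConcaveOn ℝ Set.univ ℓ)
    (hm : ∀ i, IsSmoothInCharts n fun x => m x i) (x : X) :
    lap α (fun x => ℓ (m x)) x ≤ ∑ i, partialV ℓ i (m x) * lap α (fun x => m x i) x := by
  have h0 : IsOneOne (∑ i, partialV ℓ i (m x) • ddcX (n := n) (fun x => m x i) x) := by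
    rw [← ddcX_sum_const_mul _ _ hm]
    exact (isSmoothInCharts_sum _ fun i _ => (hm i).const_mul _).isOneOne_ddcX x
  have h1 := formTrace_mono (hα x) (pα x) ((isSmoothInCharts_weight hℓ hm).isOneOne_ddcX x) h0
    (ddcX_weight_le hℓ hc hm x)
  rw [formTrace_sum] at h1
  refine h1.trans (Finset.sum_le_sum fun i _ => ?_)
  rw [formTrace_smul]; rfl

end Weights

/-! ### Consequences of the Hamiltonian property -/

section Hamiltonian

variable {n r : ℕ} {X : Type*} [TopologicalSpace X] [ChartedSpace (Cn n) X]
  [MulAction (Torus r) X]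

theorem gradTrace_hamiltonian {α : FormField n X} (hα : ∀ x, IsOneOne (α x)) (pα : IsPositive α)
    {m : X → Fin r → ℝ} {i : Fin r} {x : X}
    (hm : ∀ b, -dX (n := n) (fun y => m y i) x b = α x (fundField n r i x) b) (f : X → ℝ) :
    gradTrace α f (fun y => m y i) x = ddcMoment n r f x i := by
  rw [gradTrace, formTrace_gradForm_hamiltonian (hα x) (pα x) _ hm]
  rfl

/-- The moment map of `dd^c f` is the gradient pairing of `f` with the moment map of `α`, so the
weight term is the pairing of `f` with `log v(m)`. -/
theorem weightedLaplacian_eq {α : FormField n X} (hα : ∀ x, IsOneOne (α x)) (pα : IsPositive α)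
    {v : (Fin r → ℝ) → ℝ} (hℓ : ContDiff ℝ ∞ fun p => Real.log (v p)) {m : X → Fin r → ℝ}
    (hms : ∀ i, IsSmoothInCharts n fun x => m x i)
    (hm : ∀ i x b, -dX (n := n) (fun y => m y i) x b = α x (fundField n r i x) b) (f : X → ℝ)
    (x : X) : weightedLaplacian v α m f x =
      lap α f x + gradTrace α f (fun x => Real.log (v (m x))) x := by
  rw [gradTrace_weight (ℓ := fun p => Real.log (v p)) hℓ hms, weightedLaplacian, weightedTrace]
  congr 1
  exact Finset.sum_congr rfl fun i _ => by rw [gradTrace_hamiltonian hα pα (hm i x)]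

variable [IsManifold 𝓘(ℂ, Cn n) (⊤ : WithTop ℕ∞) X]

/-- The moment map of `ω + dd^c f ≥ 0` takes its values in the image of the moment map of `ω`. -/
theorem range_momentTwist_subset [CompactSpace X] (hT : IsReducedTorusAction n r X)
    {om : FormField n X} (hom : IsKahler om) {m : X → Fin r → ℝ} (hm : IsMomentMap om m) {f : X → ℝ}
    (hf : IsSmoothInCharts n f) (hi : InvariantFun r f)
    (hpos : ∀ x a, 0 ≤ twist om f x a (cplxJ n a)) :
    Set.range (momentTwist n m f) ⊆ Set.range m := by
  rintro q ⟨x₁, rfl⟩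
  set q := momentTwist n m f x₁ with hq
  have hms : ∀ i, IsSmoothInCharts n fun x => m x i := fun i => (hm.smooth i).inCharts
  set η : Fin r → X → ℝ := fun i x => ddcMoment n r f x i with hη
  have hηs : ∀ i, IsSmoothInCharts n (η i) := isSmoothInCharts_ddcMoment hT hf
  -- Squared distance from `q` to the moment map of `ω + t dd^c f`. Its minimum over `X` is zero at
  -- `t = 1`; the argument shows that the minimum does not change to first order in `t`, so it is
  -- also zero at `t = 0`.
  let D : ℝ → X → ℝ := fun t y => ∑ i, (m y i + t * η i y - q i) ^ 2
  have hbase : ∀ t i, IsSmoothInCharts n fun y => m y i + t * η i y + -q i := fun t i =>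
    ((hms i).add ((hηs i).const_mul t)).add (isSmoothInCharts_const _)
  have hDs : ∀ t, IsSmoothInCharts n (D t) := fun t => by
    refine isSmoothInCharts_of_eq (fun y => ?_) (isSmoothInCharts_sum Finset.univ fun i _ =>
      (hbase t i).mul (hbase t i))
    exact Finset.sum_congr rfl fun i _ => by ring
  obtain ⟨N, hN⟩ : ∃ N : ℝ, ∀ y, ∑ i, η i y ^ 2 ≤ N := by
    have hc : Continuous fun y => ∑ i, η i y ^ 2 :=
      continuous_finsetSum _ fun i _ => (hηs i).continuous.pow 2
    obtain ⟨N, hN⟩ := (isCompact_range hc).bddAbove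
    exact ⟨N, fun y => hN ⟨y, rfl⟩⟩
  have hmin : ∀ t, ∃ y, ∀ y', D t y ≤ D t y' := fun t => by
    obtain ⟨y, -, hy⟩ := isCompact_univ.exists_isMinOn ⟨x₁, trivial⟩ (hDs t).continuous.continuousOn
    exact ⟨y, fun y' => hy trivial⟩
  choose Y hY using hmin
  -- At a minimum point the derivative of `D` in `t` vanishes. At `t = 1` the distance itself is
  -- zero; for `t < 1` criticality in `y` puts the field `ζ` in the kernel of `ω + t dd^c f`.
  have hcrit : ∀ t, 0 ≤ t → t ≤ 1 → ∑ i, (m (Y t) i + t * η i (Y t) - q i) * η i (Y t) = 0 := by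
    intro t ht0 ht1
    rcases ht1.eq_or_lt with rfl | ht1
    · have h0 : D 1 (Y 1) = 0 := by
        refine le_antisymm ((hY 1 x₁).trans (le_of_eq ?_)) (Finset.sum_nonneg fun i _ => sq_nonneg _)
        refine Finset.sum_eq_zero fun i _ => ?_
        simp only [hq, momentTwist, hη]
        ring
      rw [Finset.sum_eq_zero_iff_of_nonneg fun i _ => sq_nonneg _] at h0
      refine Finset.sum_eq_zero fun i hi => ?_
      rw [pow_eq_zero_iff two_ne_zero |>.mp (h0 i hi), zero_mul]
    set y := Y t
    have hD0 : dX (n := n) (D t) y = 0 := by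
      have : IsLocalMin (inChart n y (D t)) (chartAt (Cn n) y y) :=
        Filter.Eventually.of_forall fun w => by
          rw [inChart_center]; exact hY t _
      exact this.fderiv_eq_zero
    have hDd : ∀ b, dX (n := n) (D t) y b = ∑ i, 2 * (m y i + t * η i y - q i) *
        (dX (n := n) (fun y => m y i) y b + t * dX (n := n) (η i) y b) := by
      intro b
      have h1 : ∀ i, HasFDerivAt (inChart n y fun y => (m y i + t * η i y - q i) ^ 2)
          ((2 * (m y i + t * η i y - q i)) •
            (dX (n := n) (fun y => m y i) y + t • dX (n := n) (η i) y)) (chartAt (Cn n) y y) := by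
        intro i
        have h2 := ((((hms i).differentiableAt y).hasFDerivAt.add
          (((hηs i).differentiableAt y).hasFDerivAt.const_mul t)).sub_const (q i)).pow 2
        have h3 := h2
        simp only [Pi.add_apply, inChart_center, Nat.cast_ofNat, Nat.reduceSub, pow_one,
          nsmul_eq_mul] at h3
        exact h3
      have h4 := (HasFDerivAt.fun_sum (u := Finset.univ) fun i _ => h1 i).fderiv
      have h5 : dX (n := n) (D t) y = ∑ i, (2 * (m y i + t * η i y - q i)) •
            (dX (n := n) (fun y => m y i) y + t • dX (n := n) (η i) y) := h4
      rw [h5]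
      simp only [sum_apply, smul_apply, add_apply, smul_eq_mul]
    set c : Fin r → ℝ := fun i => m y i + t * η i y - q i with hc
    set ζ : Cn n := ∑ i, c i • fundField n r i y with hζ
    have hham : ∀ b, (om y ζ + t • ddcX f y ζ) b = 0 := by
      intro b
      have h1 : ∀ i, dX (n := n) (fun y => m y i) y b = -om y (fundField n r i y) b := fun i => by
        rw [← hm.hamiltonian, neg_neg]
      have h2 : ∀ i, dX (n := n) (η i) y b = -ddcX f y (fundField n r i y) b := fun i => by
        have h3 := momentTwist_dX hT hm hf hi y i b
        have h4 : dX (n := n) (fun y => momentTwist n m f y i) y = dX (n := n) (fun y => m y i) y +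
          dX (n := n) (η i) y := dX_add y (hms i) (hηs i)
        rw [h4, add_apply, h1, twist, add_apply, add_apply] at h3
        linarith
      have h5 := hDd b
      rw [hD0] at h5
      simp only [h1, h2, zero_apply] at h5
      simp only [hζ, map_sum, map_smul, add_apply, smul_apply, sum_apply, smul_eq_mul]
      rw [Finset.mul_sum, ← Finset.sum_add_distrib]
      have h6 : ∑ i, (c i * om y (fundField n r i y) b + t * (c i * ddcX f y (fundField n r i y) b)) =
          -(1 / 2) * ∑ i, 2 * (m y i + t * η i y - q i) *
            (-om y (fundField n r i y) b + t * -ddcX f y (fundField n r i y) b) := by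
        rw [Finset.mul_sum]
        exact Finset.sum_congr rfl fun i _ => by simp only [hc]; ring
      rw [h6, ← h5, mul_zero]
    -- The form `ω + t dd^c f = (1 - t) ω + t (ω + dd^c f)` is positive definite for `t < 1`.
    have hζ0 : ζ = 0 := by
      by_contra hne
      have h1 := hom.pos y ζ hne
      have h2 := hpos y ζ
      have h3 := hham (cplxJ n ζ)
      rw [twist, add_apply, add_apply] at h2
      rw [add_apply, smul_apply, smul_eq_mul] at h3
      nlinarith
    have h7 : ∑ i, c i * η i y = dcX f y ζ := by
      rw [hζ, map_sum]
      exact Finset.sum_congr rfl fun i _ => by rw [map_smul]; rfl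
    rw [h7, hζ0, map_zero]
  -- `D` is quadratic in the parameter, so testing at the minimiser for `t` costs only a
  -- second-order error.
  have hstep : ∀ t t', 0 ≤ t → t ≤ 1 → D t' (Y t') ≤ D t (Y t) + (t' - t) ^ 2 * N := by
    intro t t' ht0 ht1
    refine (hY t' (Y t)).trans ?_
    have h1 : D t' (Y t) = D t (Y t) + (t' - t) ^ 2 * ∑ i, η i (Y t) ^ 2 +
        2 * (t' - t) * ∑ i, (m (Y t) i + t * η i (Y t) - q i) * η i (Y t) := by
      simp only [D]
      rw [Finset.mul_sum, Finset.mul_sum, ← Finset.sum_add_distrib, ← Finset.sum_add_distrib]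
      exact Finset.sum_congr rfl fun i _ => by ring
    rw [h1, hcrit t ht0 ht1, mul_zero, add_zero]
    have := mul_le_mul_of_nonneg_left (hN (Y t)) (sq_nonneg (t' - t))
    linarith
  -- Going from 1 down to 0 takes `k + 1` steps, each costing `N / (k + 1)²`.
  have hbound : ∀ k : ℕ, D 0 (Y 0) ≤ N / (k + 1) := by
    intro k
    have h1 : ∀ j : ℕ, j ≤ k + 1 → D 0 (Y 0) ≤
        D ((j : ℝ) / (k + 1)) (Y ((j : ℝ) / (k + 1))) + j * (N / (k + 1) ^ 2) := by
      intro j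
      induction j with
      | zero => intro _; simp
      | succ j ih =>
        intro hj
        have hk : (0 : ℝ) < k + 1 := by positivity
        have h2 := hstep (((j + 1 : ℕ) : ℝ) / (k + 1)) ((j : ℝ) / (k + 1)) (by positivity)
          ((div_le_one hk).mpr (by exact_mod_cast hj))
        have h3 : ((j : ℝ) / (k + 1) - ((j + 1 : ℕ) : ℝ) / (k + 1)) ^ 2 * N = N / (k + 1) ^ 2 := by
          push_cast
          field_simp
          ring
        rw [h3] at h2
        have h4 := ih (by omega)
        push_cast at h2 ⊢
        linarith
    have h2 := h1 (k + 1) le_rfl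
    have hk : ((k : ℝ) + 1) ≠ 0 := by positivity
    have h3 : D 1 (Y 1) ≤ 0 := (hY 1 x₁).trans (le_of_eq (Finset.sum_eq_zero fun i _ => by
      simp only [hq, momentTwist, hη]
      ring))
    push_cast at h2
    rw [div_self hk] at h2
    have h4 : ((k : ℝ) + 1) * (N / (k + 1) ^ 2) = N / (k + 1) := by field_simp
    linarith
  have hD0 : D 0 (Y 0) = 0 := by
    refine le_antisymm ?_ (Finset.sum_nonneg fun i _ => sq_nonneg _)
    have hlim : Filter.Tendsto (fun k : ℕ => N / ((k : ℝ) + 1)) Filter.atTop (𝓝 0) :=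
      tendsto_const_div_atTop_nhds_zero_nat N |>.comp (Filter.tendsto_add_atTop_nat 1) |>.congr
        fun k => by simp
    exact ge_of_tendsto' hlim hbound
  refine ⟨Y 0, funext fun i => ?_⟩
  simp only [D] at hD0
  rw [Finset.sum_eq_zero_iff_of_nonneg fun i _ => sq_nonneg _] at hD0
  have := pow_eq_zero_iff two_ne_zero |>.mp (hD0 i (Finset.mem_univ i))
  linarith

end Hamiltonian

/-! ### The volume measure -/

/-- The real determinant of a complex linear map is the norm from `ℂ` to `ℝ` of its complex
determinant. -/
theorem abs_det_restrictScalars {n : ℕ} (P : Cn n →L[ℂ] Cn n) :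
    |(P.restrictScalars ℝ).det| = Complex.normSq (matOf P).det := by
  have h1 : (P.restrictScalars ℝ).det = Algebra.norm ℝ (LinearMap.det (P : Cn n →ₗ[ℂ] Cn n)) :=
    LinearMap.det_restrictScalars
  have h2 : LinearMap.det (P : Cn n →ₗ[ℂ] Cn n) = (matOf P).det := by
    rw [← LinearMap.det_toMatrix (EuclideanSpace.basisFun (Fin n) ℂ).toBasis]
    congr 1
  rw [h1, h2, Algebra.norm_complex_apply, abs_of_nonneg (Complex.normSq_nonneg _)]

section Volume

open MeasureTheory

variable {n : ℕ} {X : Type*} [TopologicalSpace X] [ChartedSpace (Cn n) X]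

/-- The density of `ω^n` in the chart at `x₀`. -/
def volDensity (om : FormField n X) (x₀ : X) (z : Cn n) : ℝ :=
  n.factorial * 2 ^ n * formDet (coordForm om x₀ z)

theorem coordForm_chartChange [IsManifold 𝓘(ℂ, Cn n) (⊤ : WithTop ℕ∞) X]
    (α : FormField n X) {x y : X} {z : Cn n} (hz : z ∈ overlap n x y) :
    coordForm α x z =
      pull (coordForm α y (chartChange n x y z)) (fderiv ℂ (chartChange n x y) z) := by
  set w := (chartAt (Cn n) x).symm z with hw
  have e1 : (chartAt (Cn n) y).symm (chartChange n x y z) = w := (chartAt (Cn n) y).left_inv hz.2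
  rw [coordForm_eq_pull, coordForm_eq_pull, e1, pull_pull]
  congr 1
  rw [transition_eq, transition_eq, e1]
  have hy : chartChange n x y z ∈ overlap n y w := mem_overlap hz.2 (mem_chart_source _ w)
  have h1 := ((contDiffOn_chartChange y w).contDiffAt ((isOpen_overlap y w).mem_nhds hy)).differentiableAt
    (n := ∞) (by simp)
  have h2 := ((contDiffOn_chartChange x y).contDiffAt ((isOpen_overlap x y).mem_nhds hz)).differentiableAt
    (n := ∞) (by simp)
  rw [← fderiv_comp z h1 h2]
  refine Filter.EventuallyEq.fderiv_eq ?_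
  filter_upwards [(isOpen_overlap x y).mem_nhds hz] with p hp
  simp only [Function.comp_apply, chartChange]
  rw [(chartAt (Cn n) y).left_inv hp.2]

theorem continuousOn_volDensity {om : FormField n X} (hom : IsKahler om) (x : X) :
    ContinuousOn (volDensity om x) (chartAt (Cn n) x).target :=
  continuousOn_const.mul (smoothOn_formDet (hom.smooth x)).continuousOn

theorem volDensity_pos [IsManifold 𝓘(ℂ, Cn n) (⊤ : WithTop ℕ∞) X]
    {om : FormField n X} (hom : IsKahler om) {x : X} {z : Cn n}
    (hz : z ∈ (chartAt (Cn n) x).target) : 0 < volDensity om x z :=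
  mul_pos (by positivity) (formDet_pos ((hom.locKahler x).oneOne z hz) ((hom.locKahler x).pos z hz))

variable [MeasurableSpace X]

/-- The measure `ω^n` on the domain of the chart at `x₀`. -/
def chartMeasure (om : FormField n X) (x₀ : X) : Measure X :=
  Measure.map (chartAt (Cn n) x₀).symm (((volume : Measure (Cn n)).restrict
    (chartAt (Cn n) x₀).target).withDensity fun z => ENNReal.ofReal (volDensity om x₀ z))

theorem volumeMeasure_eq (om : FormField n X) : volumeMeasure om = ⨆ x₀, chartMeasure om x₀ := rfl

variable [BorelSpace X]

theorem aemeasurable_chart_symm (x₀ : X) :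
    AEMeasurable (chartAt (Cn n) x₀).symm
      ((volume : Measure (Cn n)).restrict (chartAt (Cn n) x₀).target) :=
  (chartAt (Cn n) x₀).continuousOn_symm.aemeasurable (isOpen_chart x₀).measurableSet

theorem chartMeasure_apply (om : FormField n X) (x₀ : X) {A : Set X} (hA : MeasurableSet A) :
    chartMeasure om x₀ A = ∫⁻ z in (chartAt (Cn n) x₀).target ∩ (chartAt (Cn n) x₀).symm ⁻¹' A,
      ENNReal.ofReal (volDensity om x₀ z) := by
  have h1 := aemeasurable_chart_symm (n := n) x₀
  have h2 : NullMeasurableSet ((chartAt (Cn n) x₀).symm ⁻¹' A)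
      ((volume : Measure (Cn n)).restrict (chartAt (Cn n) x₀).target) :=
    h1.nullMeasurableSet_preimage hA
  rw [chartMeasure, Measure.map_apply_of_aemeasurable
    (h1.mono_ac (withDensity_absolutelyContinuous _ _)) hA, withDensity_apply₀ _ h2,
    Measure.restrict_restrict₀ h2, Set.inter_comm]

theorem chartMeasure_compl_source (om : FormField n X) (x₀ : X) :
    chartMeasure om x₀ (chartAt (Cn n) x₀).sourceᶜ = 0 := by
  rw [chartMeasure_apply om x₀ (chartAt (Cn n) x₀).open_source.measurableSet.compl]
  have : (chartAt (Cn n) x₀).target ∩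
      (chartAt (Cn n) x₀).symm ⁻¹' (chartAt (Cn n) x₀).sourceᶜ = ∅ := by
    ext z
    simp only [Set.mem_inter_iff, Set.mem_preimage, Set.mem_compl_iff, Set.mem_empty_iff_false,
      iff_false, not_and, not_not]
    exact fun hz => (chartAt (Cn n) x₀).map_target hz
  rw [this]
  simp

theorem measurableSet_chart_preimage (x₀ : X) {A : Set X} (hA : MeasurableSet A) :
    MeasurableSet ((chartAt (Cn n) x₀).target ∩ (chartAt (Cn n) x₀).symm ⁻¹' A) := by
  have h2 : Measurable ((chartAt (Cn n) x₀).target.domRestrict (chartAt (Cn n) x₀).symm) :=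
    (continuousOn_iff_continuous_domRestrict.mp (chartAt (Cn n) x₀).continuousOn_symm).measurable
  have h3 := (isOpen_chart x₀).measurableSet.subtype_image (h2 hA)
  convert h3 using 1
  ext z
  simp [Set.domRestrict, and_comm]

variable [IsManifold 𝓘(ℂ, Cn n) (⊤ : WithTop ℕ∞) X]

/-- Change of variables: the real Jacobian of the holomorphic transition is exactly the factor in
`formDet_pull`. -/
theorem chartMeasure_eq_of_subset {om : FormField n X} (hom : ∀ x, IsOneOne (om x)) {x y : X}
    {A : Set X} (hA : MeasurableSet A) (hx : A ⊆ (chartAt (Cn n) x).source)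
    (hy : A ⊆ (chartAt (Cn n) y).source) : chartMeasure om x A = chartMeasure om y A := by
  rw [chartMeasure_apply om x hA, chartMeasure_apply om y hA]
  set S := (chartAt (Cn n) x).target ∩ (chartAt (Cn n) x).symm ⁻¹' A with hS
  have hSo : S ⊆ overlap n x y := fun z hz => ⟨hz.1, hy hz.2⟩
  have himg : (chartAt (Cn n) y).target ∩ (chartAt (Cn n) y).symm ⁻¹' A = chartChange n x y '' S := by
    ext w
    constructor
    · intro hw
      have hw' : w ∈ overlap n y x := ⟨hw.1, hx hw.2⟩
      refine ⟨chartChange n y x w, ⟨mapsTo_chartChange y x hw', ?_⟩, chartChange_chartChange hw'⟩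
      rw [Set.mem_preimage, chartChange, (chartAt (Cn n) x).left_inv hw'.2]
      exact hw.2
    · rintro ⟨z, hz, rfl⟩
      refine ⟨mapsTo_chartChange x y (hSo hz), ?_⟩
      rw [Set.mem_preimage, chartChange, (chartAt (Cn n) y).left_inv (hSo hz).2]
      exact hz.2
  have hinj : Set.InjOn (chartChange n x y) S := fun a ha b hb hab => by
    rw [← chartChange_chartChange (hSo ha), hab, chartChange_chartChange (hSo hb)]
  have hderiv : ∀ z ∈ S, HasFDerivWithinAt (chartChange n x y)
      ((fderiv ℂ (chartChange n x y) z).restrictScalars ℝ) S z := fun z hz =>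
    ((((contDiffOn_chartChange x y).contDiffAt ((isOpen_overlap x y).mem_nhds (hSo hz))).differentiableAt
      (n := ∞) (by simp)).hasFDerivAt.restrictScalars ℝ).hasFDerivWithinAt
  rw [himg, lintegral_image_eq_lintegral_abs_det_fderiv_mul volume
    (measurableSet_chart_preimage x hA) hderiv hinj]
  refine setLIntegral_congr_fun (measurableSet_chart_preimage x hA) fun z hz => ?_
  have hone : IsOneOne (coordForm om y (chartChange n x y z)) := (hom _).pull _
  simp only
  rw [← ENNReal.ofReal_mul (abs_nonneg _), abs_det_restrictScalars, volDensity, volDensity,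
    coordForm_chartChange om (hSo hz), formDet_pull hone]
  congr 1
  ring

theorem volumeMeasure_apply_of_subset {om : FormField n X} (hom : ∀ x, IsOneOne (om x)) {x : X}
    {A : Set X} (hA : MeasurableSet A) (hx : A ⊆ (chartAt (Cn n) x).source) :
    volumeMeasure om A = chartMeasure om x A := by
  refine le_antisymm ?_ (Measure.le_iff'.mp
    ((le_iSup (fun x₀ => chartMeasure om x₀) x).trans_eq (volumeMeasure_eq om).symm) A)
  -- `M` is infinite off the chart domain, so dominating every chart measure only needs to be
  -- checked inside it; the supremum then lies below `M`.
  set M : Measure X := chartMeasure om x + (⊤ : Measure X).restrict (chartAt (Cn n) x).sourceᶜ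
  have hsrc := (chartAt (Cn n) x).open_source.measurableSet
  have hle : volumeMeasure om ≤ M := by
    rw [volumeMeasure_eq]
    refine iSup_le fun y => Measure.le_iff.mpr fun s hs => ?_
    have hys := (chartAt (Cn n) y).open_source.measurableSet
    have h1 : chartMeasure om y s ≤ chartMeasure om y (s ∩ (chartAt (Cn n) x).source) +
        chartMeasure om y (s ∩ (chartAt (Cn n) x).sourceᶜ) := by
      rw [← Set.sdiff_eq, measure_inter_add_sdiff _ hsrc]
    refine h1.trans ?_
    rw [Measure.add_apply, Measure.restrict_apply hs]
    refine add_le_add ?_ (Measure.le_iff'.mp le_top _)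
    have h2 : chartMeasure om y (s ∩ (chartAt (Cn n) x).source) ≤
        chartMeasure om y (s ∩ (chartAt (Cn n) x).source ∩ (chartAt (Cn n) y).source) +
        chartMeasure om y (chartAt (Cn n) y).sourceᶜ := by
      rw [← measure_inter_add_sdiff (s ∩ (chartAt (Cn n) x).source) hys]
      exact add_le_add le_rfl (measure_mono fun z hz => hz.2)
    rw [chartMeasure_compl_source, add_zero] at h2
    refine h2.trans ?_
    rw [← chartMeasure_eq_of_subset hom ((hs.inter hsrc).inter hys)
      (Set.inter_subset_left.trans Set.inter_subset_right) Set.inter_subset_right]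
    exact measure_mono (Set.inter_subset_left.trans Set.inter_subset_left)
  refine (Measure.le_iff'.mp hle A).trans_eq ?_
  rw [Measure.add_apply, Measure.restrict_apply hA]
  have : A ∩ (chartAt (Cn n) x).sourceᶜ = ∅ := by
    rw [← Set.sdiff_eq, Set.sdiff_eq_empty]; exact hx
  rw [this]
  simp

theorem volumeMeasure_restrict_source {om : FormField n X} (hom : ∀ x, IsOneOne (om x)) (x : X) :
    (volumeMeasure om).restrict (chartAt (Cn n) x).source = chartMeasure om x := by
  have hsrc := (chartAt (Cn n) x).open_source.measurableSet
  ext s hs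
  rw [Measure.restrict_apply hs, volumeMeasure_apply_of_subset hom (hs.inter hsrc)
    Set.inter_subset_right]
  refine le_antisymm (measure_mono Set.inter_subset_left) ?_
  rw [← measure_inter_add_sdiff s hsrc]
  have h2 : chartMeasure om x (s \ (chartAt (Cn n) x).source) = 0 :=
    measure_mono_null (fun z hz => hz.2) (chartMeasure_compl_source om x)
  rw [h2, add_zero]

theorem isFiniteMeasure_volumeMeasure [CompactSpace X] {om : FormField n X} (hom : IsKahler om) :
    IsFiniteMeasure (volumeMeasure om) := by
  refine ⟨isCompact_univ.measure_lt_top_of_nhdsWithin fun x _ => ?_⟩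
  set e := chartAt (Cn n) x with he
  obtain ⟨ε, hε, hball⟩ := Metric.nhds_basis_closedBall.mem_iff.mp
    ((isOpen_chart (n := n) x).mem_nhds (chart_mem x))
  set O : Set X := e.source ∩ e ⁻¹' Metric.ball (e x) ε with hO
  have hOo : IsOpen O := e.isOpen_inter_preimage Metric.isOpen_ball
  refine ⟨O, nhdsWithin_le_nhds (hOo.mem_nhds ⟨mem_chart_source _ x, Metric.mem_ball_self hε⟩), ?_⟩
  rw [volumeMeasure_apply_of_subset hom.oneOne hOo.measurableSet Set.inter_subset_left,
    chartMeasure_apply om x hOo.measurableSet]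
  have hsub : e.target ∩ e.symm ⁻¹' O ⊆ Metric.closedBall (e x) ε := by
    rintro z ⟨hz, hz2⟩
    have := hz2.2
    rw [Set.mem_preimage, e.right_inv hz] at this
    exact Metric.ball_subset_closedBall this
  obtain ⟨C, hC⟩ := (isCompact_closedBall (e x) ε).exists_bound_of_continuousOn
    ((continuousOn_volDensity hom x).mono hball)
  calc ∫⁻ z in e.target ∩ e.symm ⁻¹' O, ENNReal.ofReal (volDensity om x z)
      ≤ ∫⁻ z in Metric.closedBall (e x) ε, ENNReal.ofReal (volDensity om x z) :=
        lintegral_mono_set hsub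
    _ ≤ ∫⁻ z in Metric.closedBall (e x) ε, ENNReal.ofReal C :=
        setLIntegral_mono measurable_const fun z hz => ENNReal.ofReal_le_ofReal
          ((le_abs_self _).trans (hC z hz))
    _ < ⊤ := by
        rw [setLIntegral_const]
        exact ENNReal.mul_lt_top ENNReal.ofReal_lt_top (isCompact_closedBall _ _).measure_lt_top

theorem integral_volumeMeasure_of_support {om : FormField n X} (hom : IsKahler om) {x : X}
    {f : X → ℝ} (hf : Continuous f) (hs : ∀ y ∉ (chartAt (Cn n) x).source, f y = 0) :
    ∫ y, f y ∂(volumeMeasure om) =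
      ∫ z in (chartAt (Cn n) x).target, volDensity om x z * inChart n x f z := by
  have h1 := aemeasurable_chart_symm (n := n) x
  have h2 : AEMeasurable (fun z => ENNReal.ofReal (volDensity om x z))
      ((volume : Measure (Cn n)).restrict (chartAt (Cn n) x).target) :=
    ((continuousOn_volDensity hom x).aemeasurable (isOpen_chart x).measurableSet).ennreal_ofReal
  rw [← setIntegral_eq_integral_of_forall_compl_eq_zero hs,
    volumeMeasure_restrict_source hom.oneOne, chartMeasure,
    integral_map (h1.mono_ac (withDensity_absolutelyContinuous _ _)) hf.aestronglyMeasurable,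
    integral_withDensity_eq_integral_toReal_smul₀ h2 (Filter.Eventually.of_forall fun _ =>
      ENNReal.ofReal_lt_top)]
  refine setIntegral_congr_fun (isOpen_chart x).measurableSet fun z hz => ?_
  simp only [smul_eq_mul]
  rw [ENNReal.toReal_ofReal (volDensity_pos hom hz).le]
  rfl

end Volume

/-! ### Green's formula in a chart -/

section LocalGreen

open MeasureTheory

variable {n : ℕ} {U : Set (Cn n)} {α : Cn n → BilForm n} {z : Cn n}

/-- This is the closedness of `ω^{n-1}` in coordinates. The adjugate is `det` times the inverse, and
after closedness exchanges two indices the derivatives of the two factors cancel. -/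
theorem sum_wirt_adjugate (hα : LocKahler U α) (hU : IsOpen U) (hz : z ∈ U) (l : Fin n) :
    ∑ j, wirt j (fun z => (coeffMatrix (α z)).adjugate l j) z = 0 := by
  have hK := hα.toLocClosed.kahlerMat hU
  have hAs : ∀ i j, ContDiffOn ℝ ∞ (fun z => coeffMatrix (α z) i j) U := hK.smooth
  have hdet : ∀ z ∈ U, (coeffMatrix (α z)).det ≠ 0 := fun z hz => by
    rw [coeffMatrix_det_eq (hα.oneOne z hz) (hα.pos z hz)]
    exact_mod_cast (formDet_pos (hα.oneOne z hz) (hα.pos z hz)).ne'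
  have hNs := smoothOn_inv (U := U) hAs hdet
  set A : Cn n → Matrix (Fin n) (Fin n) ℂ := fun z => coeffMatrix (α z) with hA
  set N : Cn n → Matrix (Fin n) (Fin n) ℂ := fun z => (A z)⁻¹ with hN
  have hEs : ContDiffOn ℝ ∞ (fun z => (A z).det) U := smoothOn_det hAs
  have hadj : ∀ z ∈ U, ∀ i j, (A z).adjugate i j = (A z).det * N z i j := fun z hz i j => by
    rw [hN]
    simp only
    rw [Matrix.inv_def, Matrix.smul_apply, Ring.inverse_eq_inv', smul_eq_mul,
      mul_inv_cancel_left₀ (hdet z hz)]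
  have hAd := fun i j => smoothOn_differentiableAt (hAs i j) hU hz
  have hNd := fun i j => smoothOn_differentiableAt (hNs i j) hU hz
  have hEd := smoothOn_differentiableAt hEs hU hz
  have hunit : IsUnit (A z).det := isUnit_iff_ne_zero.mpr (hdet z hz)
  have hNderiv : ∀ j i k, wirt j (fun z => N z i k) z =
      -∑ a, ∑ b, N z i a * wirt j (fun z => A z a b) z * N z b k := by
    intro j i k
    have h1 : ∀ b, ∑ a, (wirt j (fun z => N z i a) z * A z a b +
        N z i a * wirt j (fun z => A z a b) z) = 0 := by
      intro b
      have h2 : ∀ w ∈ U, ∑ a, N w i a * A w a b = (1 : Matrix (Fin n) (Fin n) ℂ) i b := by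
        intro w hw
        rw [← Matrix.mul_apply, hN]
        simp only
        rw [Matrix.nonsing_inv_mul _ (isUnit_iff_ne_zero.mpr (hdet w hw))]
      have h3 := dirD_sum_mul (stdVec j) (cplxJ n (stdVec j)) (-Complex.I) hU hz
        (fun a => hNs i a) (fun a => hAs a b)
      simp only [wirt_eq_dirD]
      rw [← h3, dirD_congr_of_isOpen _ _ _ hU hz h2]
      simp [dirD]
    have h4 : ∀ b, ∑ a, wirt j (fun z => N z i a) z * A z a b =
        -∑ a, N z i a * wirt j (fun z => A z a b) z := fun b => by
      have := h1 b
      rw [Finset.sum_add_distrib] at this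
      linear_combination this
    have h5 : wirt j (fun z => N z i k) z =
        ∑ b, (∑ a, wirt j (fun z => N z i a) z * A z a b) * N z b k := by
      simp only [Finset.sum_mul]
      rw [Finset.sum_comm]
      have h6 : ∀ a, ∑ b, wirt j (fun z => N z i a) z * A z a b * N z b k =
          wirt j (fun z => N z i a) z * (1 : Matrix (Fin n) (Fin n) ℂ) a k := by
        intro a
        rw [← Matrix.mul_nonsing_inv (A z) hunit, Matrix.mul_apply, Finset.mul_sum]
        exact Finset.sum_congr rfl fun b _ => mul_assoc _ _ _
      simp only [h6, Matrix.one_apply]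
      simp
    rw [h5]
    simp only [h4, neg_mul, Finset.sum_neg_distrib, Finset.sum_mul]
    rw [Finset.sum_comm]
  have hEderiv : ∀ j, wirt j (fun z => (A z).det) z =
      (A z).det * ∑ a, ∑ b, N z b a * wirt j (fun z => A z a b) z := by
    intro j
    rw [wirt, fderiv_det_apply hAd, fderiv_det_apply hAd]
    simp only [Finset.mul_sum, ← Finset.sum_sub_distrib]
    refine Finset.sum_congr rfl fun a _ => Finset.sum_congr rfl fun b _ => ?_
    rw [hadj z hz, wirt]
    ring
  have h7 : ∀ j, wirt j (fun z => (A z).adjugate l j) z =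
      wirt j (fun z => (A z).det) z * N z l j + (A z).det * wirt j (fun z => N z l j) z := by
    intro j
    simp only [wirt_eq_dirD]
    rw [dirD_congr_of_isOpen _ _ _ hU hz fun w hw => hadj w hw l j, dirD_mul _ _ _ hEd (hNd l j)]
  rw [Finset.sum_congr rfl fun j _ => h7 j]
  simp only [hEderiv, hNderiv]
  rw [Finset.sum_add_distrib]
  have h8 : ∑ j, (A z).det * -∑ a, ∑ b, N z l a * wirt j (fun z => A z a b) z * N z b j =
      -∑ j, (A z).det * (∑ a, ∑ b, N z b a * wirt j (fun z => A z a b) z) * N z l j := by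
    rw [← Finset.sum_neg_distrib]
    simp only [mul_neg, Finset.sum_neg_distrib, neg_inj, Finset.mul_sum, Finset.sum_mul]
    rw [Finset.sum_comm]
    refine Finset.sum_congr rfl fun a _ => Finset.sum_congr rfl fun j _ =>
      Finset.sum_congr rfl fun b _ => ?_
    rw [show wirt j (fun z => A z a b) z = wirt a (fun z => A z j b) z from hK.closed z hz j a b]
    ring
  rw [h8, add_neg_cancel]

theorem integral_wirt_eq_zero {Φ : Cn n → ℂ} (hΦ : ContDiff ℝ ∞ Φ) (hc : HasCompactSupport Φ)
    (j : Fin n) : Integrable (wirt j Φ) ∧ ∫ z, wirt j Φ z = 0 := by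
  have hcont : ∀ v, Continuous fun z => fderiv ℝ Φ z v := fun v =>
    (hΦ.continuous_fderiv (by simp)).clm_apply continuous_const
  have hint : ∀ v, Integrable fun z => fderiv ℝ Φ z v := fun v =>
    (hcont v).integrable_of_hasCompactSupport (hc.fderiv_apply (𝕜 := ℝ) v)
  have hzero : ∀ v, ∫ z, fderiv ℝ Φ z v = 0 := by
    intro v
    have h := integral_mul_fderiv_eq_neg_fderiv_mul_of_integrable (μ := (volume : Measure (Cn n)))
      (f := fun _ => (1 : ℂ)) (g := Φ) (v := v) (by simp) (by simpa using hint v)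
      (by simpa using hΦ.continuous.integrable_of_hasCompactSupport hc)
      (fun _ _ => differentiableAt_const _) (fun z _ => hΦ.differentiable (by simp) z)
    simpa using h
  have h1 := hint (stdVec j)
  have h2 := (hint (cplxJ n (stdVec j))).const_mul Complex.I
  refine ⟨(h1.sub h2).const_mul (1 / 2 : ℂ), ?_⟩
  simp only [wirt]
  rw [integral_const_mul, integral_sub h1 h2, integral_const_mul, hzero, hzero]
  simp

/-- Extension by zero is smooth because the function already vanishes near the boundary of `U`, off
the compact set `K`. -/
theorem contDiff_indicator_of_compact {F : Type*} [NormedAddCommGroup F] [NormedSpace ℝ F]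
    {Φ : Cn n → F} {K : Set (Cn n)} (hU : IsOpen U) (hK : IsCompact K) (hKU : K ⊆ U)
    (hΦ : ContDiffOn ℝ ∞ Φ U) (h0 : ∀ z ∈ U, z ∉ K → Φ z = 0) :
    ContDiff ℝ ∞ (U.indicator Φ) ∧ HasCompactSupport (U.indicator Φ) := by
  have hzero : ∀ z ∉ K, U.indicator Φ z = 0 := fun z hz => by
    by_cases hzU : z ∈ U
    · rw [Set.indicator_of_mem hzU, h0 z hzU hz]
    · rw [Set.indicator_of_notMem hzU]
  refine ⟨contDiff_iff_contDiffAt.mpr fun z => ?_, HasCompactSupport.intro hK hzero⟩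
  by_cases hz : z ∈ K
  · refine (hΦ.contDiffAt (hU.mem_nhds (hKU hz))).congr_of_eventuallyEq ?_
    exact Filter.eventuallyEq_of_mem (hU.mem_nhds (hKU hz)) fun w hw => Set.indicator_of_mem hw _
  · refine (contDiffAt_const (c := (0 : F))).congr_of_eventuallyEq ?_
    exact Filter.eventuallyEq_of_mem (hK.isClosed.isOpen_compl.mem_nhds hz) fun w hw => hzero w hw

theorem coeffMatrix_gradForm {f k : Cn n → ℝ} (hU : IsOpen U) (hz : z ∈ U)
    (hf : ContDiffOn ℝ ∞ f U) (hk : ContDiffOn ℝ ∞ k U) (j l : Fin n) :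
    coeffMatrix (gradForm (fderiv ℝ k z) (fderiv ℝ f z)) j l = 1 / 2 *
      (wirt j (fun z => ((k z : ℝ) : ℂ)) z * wirtBar l (fun z => ((f z : ℝ) : ℂ)) z +
        wirt j (fun z => ((f z : ℝ) : ℂ)) z * wirtBar l (fun z => ((k z : ℝ) : ℂ)) z) := by
  have hfd := smoothOn_differentiableAt hf hU hz
  have hkd := smoothOn_differentiableAt hk hU hz
  simp only [coeffMatrix, wirt, wirtBar, gradForm_apply, fderiv_ofReal hfd, fderiv_ofReal hkd,
    cplxJ_cplxJ, map_neg]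
  push_cast
  linear_combination (1 / 8 : ℂ) * ((fderiv ℝ k z (cplxJ n (stdVec j)) : ℂ) *
    (fderiv ℝ f z (cplxJ n (stdVec l)) : ℂ) + (fderiv ℝ f z (cplxJ n (stdVec j)) : ℂ) *
    (fderiv ℝ k z (cplxJ n (stdVec l)) : ℂ)) * Complex.I_sq

/-- By `sum_wirt_adjugate` no derivative falls on the adjugate. Taking the real part symmetrises `∂k
⊗ ∂̄f`, which is how `gradForm` is defined. -/
theorem re_divergence {f k : Cn n → ℝ} (hα : LocKahler U α) (hU : IsOpen U) (hz : z ∈ U)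
    (hf : ContDiffOn ℝ ∞ f U) (hk : ContDiffOn ℝ ∞ k U) :
    (∑ l, ∑ j, wirt j (fun z => ((k z : ℝ) : ℂ) * ((coeffMatrix (α z)).adjugate l j *
      wirtBar l (fun z => ((f z : ℝ) : ℂ)) z)) z).re =
    (k z * formTrace (α z) (ddcLocal f z) +
      formTrace (α z) (gradForm (fderiv ℝ k z) (fderiv ℝ f z))) * formDet (α z) := by
  have hone := hα.oneOne z hz
  have hAs : ∀ i j, ContDiffOn ℝ ∞ (fun z => coeffMatrix (α z) i j) U :=
    fun i j => smoothOn_coeffMatrix hα.smooth i j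
  have hWs := smoothOn_adjugate (U := U) hAs
  have hfc := smoothOn_ofReal hf
  have hkc := smoothOn_ofReal hk
  set W : Matrix (Fin n) (Fin n) ℂ := (coeffMatrix (α z)).adjugate with hW
  set fc : Cn n → ℂ := fun z => ((f z : ℝ) : ℂ) with hfcd
  set kc : Cn n → ℂ := fun z => ((k z : ℝ) : ℂ) with hkcd
  have hdet0 : (coeffMatrix (α z)).det ≠ 0 := by
    rw [coeffMatrix_det_eq hone (hα.pos z hz)]
    exact_mod_cast (formDet_pos hone (hα.pos z hz)).ne'
  have hWeq : W = (coeffMatrix (α z)).det • (coeffMatrix (α z))⁻¹ := by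
    rw [Matrix.inv_def, smul_smul, Ring.inverse_eq_inv', mul_inv_cancel₀ hdet0, one_smul]
  have h1 : ∀ l j, wirt j (fun z => kc z * ((coeffMatrix (α z)).adjugate l j * wirtBar l fc z)) z =
      wirt j kc z * (W l j * wirtBar l fc z) + kc z * (wirt j (fun z =>
        (coeffMatrix (α z)).adjugate l j) z * wirtBar l fc z + W l j * wirt j (wirtBar l fc) z) := by
    intro l j
    have d1 := smoothOn_differentiableAt hkc hU hz
    have d2 := smoothOn_differentiableAt (hWs l j) hU hz
    have d3 := smoothOn_differentiableAt (smoothOn_wirtBar hfc hU l) hU hz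
    simp only [wirt_eq_dirD j]
    rw [dirD_mul (f := kc) (g := fun z => (coeffMatrix (α z)).adjugate l j * wirtBar l fc z) _ _ _ d1
      (d2.mul d3), dirD_mul (f := fun z => (coeffMatrix (α z)).adjugate l j) _ _ _ d2 d3]
  have htr : ∀ M : Matrix (Fin n) (Fin n) ℂ,
      ∑ l, ∑ j, W l j * M j l = (formDet (α z) : ℂ) * ((coeffMatrix (α z))⁻¹ * M).trace := by
    intro M
    rw [← coeffMatrix_det_eq hone (hα.pos z hz), hWeq, ← smul_eq_mul, ← Matrix.trace_smul, ← Matrix.smul_mul]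
    rfl
  set G : Matrix (Fin n) (Fin n) ℂ := fun j l => wirt j kc z * wirtBar l fc z with hG
  have h2 : ∑ l, ∑ j, wirt j (fun z => kc z * ((coeffMatrix (α z)).adjugate l j * wirtBar l fc z)) z =
      ∑ l, ∑ j, W l j * G j l + kc z * ∑ l, ∑ j, W l j * coeffMatrix (ddcLocal f z) j l := by
    have h3 : ∀ l, ∑ j, kc z * (wirt j (fun z => (coeffMatrix (α z)).adjugate l j) z *
        wirtBar l fc z) = 0 := fun l => by
      rw [← Finset.mul_sum, ← Finset.sum_mul, sum_wirt_adjugate hα hU hz, zero_mul, mul_zero]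
    have h4 : ∀ j l, coeffMatrix (ddcLocal f z) j l = wirt j (wirtBar l fc) z := fun j l =>
      (wirt_wirtBar_eq_coeffMatrix hf hU hz j l).symm
    rw [Finset.mul_sum, ← Finset.sum_add_distrib]
    refine Finset.sum_congr rfl fun l _ => ?_
    rw [Finset.mul_sum, ← Finset.sum_add_distrib, ← add_zero (∑ j, (_ + _)), ← h3 l,
      ← Finset.sum_add_distrib]
    refine Finset.sum_congr rfl fun j _ => ?_
    rw [h1, h4, hG]
    ring
  have h5 : (coeffMatrix (gradForm (fderiv ℝ k z) (fderiv ℝ f z))) =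
      (1 / 2 : ℂ) • (G + G.conjTranspose) := by
    ext j l
    rw [coeffMatrix_gradForm hU hz hf hk, Matrix.smul_apply, Matrix.add_apply,
      Matrix.conjTranspose_apply, smul_eq_mul, hG]
    congr 2
    simp only [star_mul']
    rw [mul_comm]
    congr 1
    · exact (conj_wirt_ofReal k z l).symm
    · have := conj_wirt_ofReal f z j
      rw [← Complex.conj_conj (wirt j fc z)]
      exact congrArg _ this
  have h6 : ((coeffMatrix (α z))⁻¹ * G.conjTranspose).trace.re =
      ((coeffMatrix (α z))⁻¹ * G).trace.re := by
    have h7 := Matrix.trace_conjTranspose (G * (coeffMatrix (α z))⁻¹)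
    rw [Matrix.conjTranspose_mul, (coeffMatrix_isHermitian hone).inv.eq] at h7
    rw [h7, Matrix.trace_mul_comm]
    simp
  rw [h2, htr, htr, Complex.add_re, Complex.re_ofReal_mul, Complex.re_ofReal_mul,
    Complex.re_ofReal_mul, formTrace, formTrace, h5, Matrix.mul_smul, Matrix.mul_add,
    Matrix.trace_smul, Matrix.trace_add]
  simp only [smul_eq_mul]
  rw [show (1 / 2 : ℂ) = ((1 / 2 : ℝ) : ℂ) by push_cast; rfl, Complex.re_ofReal_mul, Complex.add_re, h6]
  ring

theorem integral_green_local {f k : Cn n → ℝ} {K : Set (Cn n)} (hα : LocKahler U α) (hU : IsOpen U)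
    (hf : ContDiffOn ℝ ∞ f U) (hk : ContDiffOn ℝ ∞ k U) (hK : IsCompact K) (hKU : K ⊆ U)
    (h0 : ∀ z ∈ U, z ∉ K → k z = 0) :
    ∫ z in U, (k z * formTrace (α z) (ddcLocal f z) +
      formTrace (α z) (gradForm (fderiv ℝ k z) (fderiv ℝ f z))) * formDet (α z) = 0 := by
  have hAs : ∀ i j, ContDiffOn ℝ ∞ (fun z => coeffMatrix (α z) i j) U :=
    fun i j => smoothOn_coeffMatrix hα.smooth i j
  let Φ : Fin n → Fin n → Cn n → ℂ := fun l j z => ((k z : ℝ) : ℂ) *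
    ((coeffMatrix (α z)).adjugate l j * wirtBar l (fun z => ((f z : ℝ) : ℂ)) z)
  have hΦ : ∀ l j, ContDiffOn ℝ ∞ (Φ l j) U := fun l j =>
    (smoothOn_ofReal hk).mul ((smoothOn_adjugate (U := U) hAs l j).mul
      (smoothOn_wirtBar (smoothOn_ofReal hf) hU l))
  have hext := fun l j => contDiff_indicator_of_compact hU hK hKU (hΦ l j) fun z hz hzK => by
    simp only [Φ, h0 z hz hzK, Complex.ofReal_zero, zero_mul]
  have hint := fun l j => integral_wirt_eq_zero (hext l j).1 (hext l j).2 j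
  have hin : ∀ z ∈ U, ∀ l j, wirt j (U.indicator (Φ l j)) z = wirt j (Φ l j) z := by
    intro z hz l j
    rw [wirt_eq_dirD, wirt_eq_dirD]
    exact dirD_congr_of_isOpen _ _ _ hU hz fun w hw => Set.indicator_of_mem hw _
  have hout : ∀ z ∉ U, ∀ l j, wirt j (U.indicator (Φ l j)) z = 0 := by
    intro z hz l j
    have h1 : ∀ w ∈ Kᶜ, U.indicator (Φ l j) w = 0 := fun w hw => by
      by_cases hwU : w ∈ U
      · rw [Set.indicator_of_mem hwU]
        simp only [Φ, h0 w hwU hw, Complex.ofReal_zero, zero_mul]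
      · exact Set.indicator_of_notMem hwU _
    rw [wirt_eq_dirD, dirD_congr_of_isOpen _ _ _ hK.isClosed.isOpen_compl
      (fun h => hz (hKU h)) h1]
    simp [dirD]
  have h2 : ∫ z in U, (k z * formTrace (α z) (ddcLocal f z) +
      formTrace (α z) (gradForm (fderiv ℝ k z) (fderiv ℝ f z))) * formDet (α z) =
      ∫ z in U, (∑ l, ∑ j, wirt j (U.indicator (Φ l j)) z).re := by
    refine setIntegral_congr_fun hU.measurableSet fun z hz => ?_
    simp only [hin z hz]
    exact (re_divergence hα hU hz hf hk).symm
  rw [h2, setIntegral_eq_integral_of_forall_compl_eq_zero fun z hz => by simp [hout z hz]]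
  have h3 : Integrable fun z => ∑ l, ∑ j, wirt j (U.indicator (Φ l j)) z :=
    integrable_finsetSum _ fun l _ => integrable_finsetSum _ fun j _ => (hint l j).1
  have h4 : ∫ z, (∑ l, ∑ j, wirt j (U.indicator (Φ l j)) z).re =
      (∫ z, ∑ l, ∑ j, wirt j (U.indicator (Φ l j)) z).re := integral_re h3
  rw [h4, integral_finsetSum _ fun l _ => integrable_finsetSum _ fun j _ => (hint l j).1]
  rw [Finset.sum_eq_zero]
  · simp
  · intro l _
    rw [integral_finsetSum _ fun j _ => (hint l j).1]
    exact Finset.sum_eq_zero fun j _ => (hint l j).2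

end LocalGreen

/-! ### Green's formula on the manifold -/

section Green

open MeasureTheory

variable {n : ℕ} {X : Type*} [TopologicalSpace X] [ChartedSpace (Cn n) X]
  [IsManifold 𝓘(ℂ, Cn n) (⊤ : WithTop ℕ∞) X]

/-- The real smooth structure is what smooth partitions of unity require. -/
theorem isManifold_real : IsManifold 𝓘(ℝ, Cn n) ∞ X := by
  refine isManifold_of_contDiffOn _ _ _ fun e e' he he' => ?_
  have h := HasGroupoid.compatible (G := contDiffGroupoid (⊤ : WithTop ℕ∞) 𝓘(ℂ, Cn n)) he he'
  rw [contDiffGroupoid, mem_groupoid_of_pregroupoid] at h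
  have h1 := h.1
  simp only [contDiffPregroupoid, mfld_simps] at h1 ⊢
  exact (h1.of_le le_top).restrict_scalars ℝ

/-- `Γ(u, u) = ½ Δ(u²) - u Δu`, and polarisation handles two functions, so smoothness reduces to
that of the Laplacian. -/
theorem isSmoothInCharts_gradTrace {α : FormField n X} (hα : IsKahler α) {f k : X → ℝ}
    (hf : IsSmoothInCharts n f) (hk : IsSmoothInCharts n k) :
    IsSmoothInCharts n (gradTrace α f k) := by
  have hsq : ∀ {u : X → ℝ}, IsSmoothInCharts n u → ∀ x,
      gradTrace α u u x = 1 / 2 * lap α (fun x => u x ^ 2) x + -1 * (u x * lap α u x) := by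
    intro u hu x
    rw [lap_comp (χ := fun t => t ^ 2) α x hu isOpen_univ (fun _ => trivial)
      (contDiff_id.pow 2).contDiffOn]
    have h1 : deriv (fun t : ℝ => t ^ 2) = fun t => 2 * t := by
      ext t; simp
    have h2 : deriv (fun t : ℝ => 2 * t) = fun _ => 2 := by
      ext t; rw [deriv_const_mul_field]; simp
    rw [h1, h2]
    ring
  have hself : ∀ {u : X → ℝ}, IsSmoothInCharts n u → IsSmoothInCharts n (gradTrace α u u) := by
    intro u hu
    refine isSmoothInCharts_of_eq (fun x => (hsq hu x).symm) ?_
    exact ((isSmoothInCharts_lap hα (isSmoothInCharts_of_eq (fun x => (sq (u x)).symm)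
      (hu.mul hu))).const_mul _).add ((hu.mul (isSmoothInCharts_lap hα hu)).const_mul _)
  refine isSmoothInCharts_of_eq (f := fun x => 1 / 2 * (gradTrace α (fun x => f x + k x)
    (fun x => f x + k x) x - gradTrace α f f x - gradTrace α k k x)) (fun x => ?_) ?_
  · rw [gradTrace_add_left α x hf hk, gradTrace_comm α x f, gradTrace_comm α x k,
      gradTrace_add_left α x hf hk, gradTrace_add_left α x hf hk, gradTrace_comm α x k f]
    ring
  · exact (((hself (hf.add hk)).sub (hself hf)).sub (hself hk)).const_mul _

/-- Multiplying by the ratio `α^n / g^n` turns integration against `g^n` into integration against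
`α^n`; both Green formulas can then be stated for one measure. -/
theorem lap_volDensity_eq {α g : FormField n X} (hα : IsKahler α) (hg : IsKahler g) {x : X}
    {z : Cn n} (hz : z ∈ (chartAt (Cn n) x).target) :
    volDensity g x z * inChart n x (detRatio α g) z =
      n.factorial * 2 ^ n * formDet (coordForm α x z) := by
  have h0 := (formDet_pos ((hg.locKahler x).oneOne z hz) ((hg.locKahler x).pos z hz)).ne'
  rw [inChart_detRatio hα.oneOne hg.oneOne hz, volDensity]
  field_simp

variable [MeasurableSpace X] [BorelSpace X]

theorem integral_green_of_tsupport [CompactSpace X] {α g : FormField n X} (hα : IsKahler α)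
    (hg : IsKahler g) {f k : X → ℝ} (hf : IsSmoothInCharts n f) (hk : IsSmoothInCharts n k) {x : X}
    (hs : tsupport k ⊆ (chartAt (Cn n) x).source) :
    ∫ y, (k y * lap α f y + gradTrace α k f y) * detRatio α g y ∂(volumeMeasure g) = 0 := by
  have hcont : Continuous fun y => (k y * lap α f y + gradTrace α k f y) * detRatio α g y :=
    ((hk.mul (isSmoothInCharts_lap hα hf)).add (isSmoothInCharts_gradTrace hα hk hf)).mul
      (isSmoothInCharts_detRatio hα hg) |>.continuous
  have hk0 : ∀ y ∉ tsupport k, k y = 0 := fun y hy => image_eq_zero_of_notMem_tsupport hy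
  have hd0 : ∀ y ∉ tsupport k, dX (n := n) k y = 0 := by
    intro y hy
    have hopen : IsOpen (overlap n y y ∩ (chartAt (Cn n) y).symm ⁻¹' (tsupport k)ᶜ) := by
      rw [overlap, Set.inter_assoc, ← Set.preimage_inter]
      exact (chartAt (Cn n) y).symm.isOpen_inter_preimage
        ((chartAt (Cn n) y).open_source.inter (isClosed_tsupport k).isOpen_compl)
    have hev : inChart n y k =ᶠ[𝓝 (chartAt (Cn n) y y)] fun _ => 0 := by
      refine Filter.eventuallyEq_of_mem (hopen.mem_nhds ⟨mem_overlap (mem_chart_source _ y)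
        (mem_chart_source _ y), ?_⟩) fun w hw => hk0 _ hw.2
      rw [Set.mem_preimage, (chartAt (Cn n) y).left_inv (mem_chart_source _ y)]
      exact hy
    rw [dX, hev.fderiv_eq]
    exact fderiv_const_apply _
  have hsupp : ∀ y ∉ (chartAt (Cn n) x).source,
      (k y * lap α f y + gradTrace α k f y) * detRatio α g y = 0 := by
    intro y hy
    have hy' : y ∉ tsupport k := fun h => hy (hs h)
    have h1 : gradForm (dX (n := n) k y) (dX f y) = (0 : ℝ) • gradForm (dX (n := n) f y) (dX f y) := by
      rw [hd0 y hy', ← gradForm_smul_left, zero_smul]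
    rw [hk0 y hy', gradTrace, h1, formTrace_smul]
    ring
  rw [integral_volumeMeasure_of_support hg hcont hsupp]
  have hcomp : IsCompact (chartAt (Cn n) x '' tsupport k) :=
    (isClosed_tsupport k).isCompact.image_of_continuousOn ((chartAt (Cn n) x).continuousOn.mono hs)
  have hsub : chartAt (Cn n) x '' tsupport k ⊆ (chartAt (Cn n) x).target := by
    rintro _ ⟨y, hy, rfl⟩
    exact (chartAt (Cn n) x).map_source (hs hy)
  have hz0 : ∀ z ∈ (chartAt (Cn n) x).target, z ∉ chartAt (Cn n) x '' tsupport k →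
      inChart n x k z = 0 := by
    intro z hz hzK
    refine hk0 _ fun h => hzK ⟨_, h, (chartAt (Cn n) x).right_inv hz⟩
  have hgreen := integral_green_local (hα.locKahler x) (isOpen_chart x) (hf x) (hk x) hcomp hsub hz0
  have h2 : ∀ z ∈ (chartAt (Cn n) x).target, volDensity g x z *
      inChart n x (fun y => (k y * lap α f y + gradTrace α k f y) * detRatio α g y) z =
      n.factorial * 2 ^ n * ((inChart n x k z * formTrace (coordForm α x z)
        (ddcLocal (inChart n x f) z) + formTrace (coordForm α x z)
          (gradForm (fderiv ℝ (inChart n x k) z) (fderiv ℝ (inChart n x f) z))) *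
        formDet (coordForm α x z)) := by
    intro z hz
    have e1 := inChart_lap hα.oneOne hf hz
    have e2 := inChart_gradTrace hα.oneOne hk hf hz
    have e3 := lap_volDensity_eq hα hg hz
    rw [← e1, ← e2]
    calc _ = (inChart n x k z * inChart n x (lap α f) z + inChart n x (gradTrace α k f) z) *
          (volDensity g x z * inChart n x (detRatio α g) z) := by
          simp only [inChart]; ring
      _ = _ := by rw [e3]; ring
  rw [setIntegral_congr_fun (isOpen_chart x).measurableSet h2, integral_const_mul, hgreen, mul_zero]

/-- The identity is linear in `k`, so a partition of unity subordinate to finitely many charts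
reduces it to the case of support in one chart. -/
theorem integral_green [CompactSpace X] [T2Space X] {α g : FormField n X} (hα : IsKahler α)
    (hg : IsKahler g) {f k : X → ℝ} (hf : IsSmoothInCharts n f) (hk : IsSmoothInCharts n k) :
    ∫ y, (k y * lap α f y + gradTrace α k f y) * detRatio α g y ∂(volumeMeasure g) = 0 := by
  have : IsManifold 𝓘(ℝ, Cn n) ∞ X := isManifold_real
  have := isFiniteMeasure_volumeMeasure hg
  obtain ⟨t, ht⟩ := CompactSpace.elim_nhds_subcover (fun x : X => (chartAt (Cn n) x).source)
    fun x => (chartAt (Cn n) x).open_source.mem_nhds (mem_chart_source _ x)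
  obtain ⟨ρ, hρ⟩ := SmoothPartitionOfUnity.exists_isSubordinate 𝓘(ℝ, Cn n) (s := (Set.univ : Set X))
    isClosed_univ (fun i : t => (chartAt (Cn n) (i : X)).source)
    (fun i => (chartAt (Cn n) (i : X)).open_source) (fun x _ => by
      have : x ∈ ⋃ y ∈ t, (chartAt (Cn n) y).source := by rw [ht]; trivial
      simpa using this)
  have hρs : ∀ i, IsSmoothInCharts n (ρ i) := fun i => IsSmooth.inCharts (ρ i).contMDiff
  have hsum : ∀ x, ∑ i, ρ i x = 1 := fun x => by
    rw [← finsum_eq_sum_of_fintype]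
    exact ρ.sum_eq_one (Set.mem_univ x)
  have hki : ∀ i, IsSmoothInCharts n (fun y => ρ i y * k y) := fun i => (hρs i).mul hk
  have hzero : ∀ i, ∫ y, (ρ i y * k y * lap α f y + gradTrace α (fun y => ρ i y * k y) f y) *
      detRatio α g y ∂(volumeMeasure g) = 0 := by
    intro i
    refine integral_green_of_tsupport hα hg hf (hki i) (x := i) ?_
    exact (tsupport_mul_subset_left).trans (hρ i)
  have hkeq : k = fun y => ∑ i, ρ i y * k y := by
    ext y; rw [← Finset.sum_mul, hsum, one_mul]
  have hgrad : ∀ (s : Finset t) y, gradTrace α (fun y => ∑ i ∈ s, ρ i y * k y) f y =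
      ∑ i ∈ s, gradTrace α (fun y => ρ i y * k y) f y := by
    classical
    intro s y
    induction s using Finset.induction_on with
    | empty =>
      have h1 := gradTrace_const_mul_left α y (k := f) 0 hk
      simp only [zero_mul] at h1
      simpa using h1
    | insert i s hi ih =>
      simp only [Finset.sum_insert hi]
      rw [gradTrace_add_left α y (hki i) (isSmoothInCharts_sum s fun j _ => hki j), ih]
  have hint : ∀ i, Integrable (fun y => (ρ i y * k y * lap α f y +
      gradTrace α (fun y => ρ i y * k y) f y) * detRatio α g y) (volumeMeasure g) := by
    intro i
    have hc : Continuous fun y => (ρ i y * k y * lap α f y +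
        gradTrace α (fun y => ρ i y * k y) f y) * detRatio α g y :=
      (((hki i).mul (isSmoothInCharts_lap hα hf)).add
        (isSmoothInCharts_gradTrace hα (hki i) hf)).mul (isSmoothInCharts_detRatio hα hg) |>.continuous
    exact hc.integrable_of_hasCompactSupport (HasCompactSupport.of_compactSpace _)
  have h1 : ∀ y, (k y * lap α f y + gradTrace α k f y) * detRatio α g y =
      ∑ i, (ρ i y * k y * lap α f y + gradTrace α (fun y => ρ i y * k y) f y) *
        detRatio α g y := by
    intro y
    rw [← Finset.sum_mul, Finset.sum_add_distrib, ← hgrad, ← hkeq, ← Finset.sum_mul,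
      ← Finset.sum_mul, hsum, one_mul]
  simp only [h1]
  rw [integral_finsetSum _ fun i _ => hint i]
  exact Finset.sum_eq_zero fun i _ => hzero i

end Green

/-! ### Plurisubharmonic functions at smooth points -/

/-- The remainder has derivative `o(‖w‖)`; the mean value inequality on the ball of radius `‖y‖`
bounds it by `δ‖y‖²`. -/
theorem exists_taylor_two_bound {E : Type*} [NormedAddCommGroup E] [NormedSpace ℝ E] {U : Set E}
    {f : E → ℝ} {z : E} (hf : ContDiffOn ℝ ∞ f U) (hU : IsOpen U) (hz : z ∈ U) {δ : ℝ} (hδ : 0 < δ) :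
    ∃ ε > 0, ∀ y, ‖y‖ ≤ ε → z + y ∈ U ∧
      |f (z + y) - (f z + fderiv ℝ f z y + 1 / 2 * fderiv ℝ (fderiv ℝ f) z y y)| ≤ δ * ‖y‖ ^ 2 := by
  set D2 := fderiv ℝ (fderiv ℝ f) z with hD2
  have h1 : HasFDerivAt (fderiv ℝ f) D2 z :=
    (smoothOn_differentiableAt (smoothOn_fderiv hf hU) hU hz).hasFDerivAt
  have h2 := (hasFDerivAt_iff_isLittleO_nhds_zero.mp h1).def hδ
  have h3 : ∀ᶠ y in 𝓝 (0 : E), z + y ∈ U := by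
    have hc : ContinuousAt (fun y : E => z + y) 0 := (continuous_const.add continuous_id).continuousAt
    exact hc.eventually_mem (hU.mem_nhds (by simpa using hz))
  obtain ⟨ε, hε, hball⟩ := Metric.nhds_basis_closedBall.mem_iff.mp (h2.and h3)
  refine ⟨ε, hε, fun y hy => ?_⟩
  have hin : ∀ w, ‖w‖ ≤ ε → ‖fderiv ℝ f (z + w) - fderiv ℝ f z - D2 w‖ ≤ δ * ‖w‖ ∧ z + w ∈ U :=
    fun w hw => hball (by simpa using hw)
  refine ⟨(hin y hy).2, ?_⟩
  set G : E → ℝ := fun w => f (z + w) - (f z + fderiv ℝ f z w + 1 / 2 * D2 w w) with hG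
  have hGd : ∀ w, ‖w‖ ≤ ε → HasFDerivAt G (fderiv ℝ f (z + w) - fderiv ℝ f z - D2 w) w := by
    intro w hw
    have e1 : HasFDerivAt (fun w => f (z + w)) (fderiv ℝ f (z + w)) w := by
      have := (smoothOn_differentiableAt hf hU (hin w hw).2).hasFDerivAt.comp w
        ((hasFDerivAt_id w).const_add z)
      rw [ContinuousLinearMap.comp_id] at this
      exact this
    have e2 : HasFDerivAt (fun w => D2 w w) (D2 w + D2.flip w) w := by
      have := (D2.hasFDerivAt (x := w)).clm_apply (hasFDerivAt_id w)
      refine this.congr_fderiv ?_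
      ext v
      simp
    have e3 : D2.flip w = D2 w := by
      ext v
      rw [ContinuousLinearMap.flip_apply, hD2, fderiv_fderiv_symm hf hU hz]
    have e4 := e1.sub ((((fderiv ℝ f z).hasFDerivAt (x := w)).const_add (f z)).add
      (e2.const_mul (1 / 2 : ℝ)))
    refine e4.congr_fderiv ?_
    rw [e3]
    ext v
    simp only [sub_apply, add_apply, smul_apply, smul_eq_mul]
    ring
  have h4 := (convex_closedBall (0 : E) ‖y‖).norm_image_sub_le_of_norm_hasFDerivWithin_le
    (f := G) (f' := fun w => fderiv ℝ f (z + w) - fderiv ℝ f z - D2 w) (C := δ * ‖y‖) (x := 0) (y := y)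
    (fun w hw => (hGd w ((by simpa using hw : ‖w‖ ≤ ‖y‖).trans hy)).hasFDerivWithinAt)
    (fun w hw => by
      have hw' : ‖w‖ ≤ ‖y‖ := by simpa using hw
      exact (hin w (hw'.trans hy)).1.trans (mul_le_mul_of_nonneg_left hw' hδ.le))
    (by simp) (by simp)
  have hG0 : G 0 = 0 := by simp [hG]
  rw [hG0, sub_zero, sub_zero, Real.norm_eq_abs] at h4
  calc |G y| ≤ δ * ‖y‖ * ‖y‖ := h4
    _ = δ * ‖y‖ ^ 2 := by ring

/-- The linear terms and the mixed term average to zero, and each pure square averages to one half.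
-/
theorem circleAverage_quadratic (c a₁ a₂ b₁ b₂ b₃ : ℝ) :
    Real.circleAverage (fun ζ : ℂ => c + ζ.re * a₁ + ζ.im * a₂ + ζ.re ^ 2 * b₁ +
      ζ.re * ζ.im * b₂ + ζ.im ^ 2 * b₃) 0 1 = c + (b₁ + b₃) / 2 := by
  have hre : ∀ θ : ℝ, (circleMap 0 1 θ).re = Real.cos θ := fun θ => by
    simp [circleMap, Complex.exp_re]
  have him : ∀ θ : ℝ, (circleMap 0 1 θ).im = Real.sin θ := fun θ => by
    simp [circleMap, Complex.exp_im]
  have ii : ∀ g : ℝ → ℝ, Continuous g → IntervalIntegrable g MeasureTheory.volume 0 (2 * Real.pi) :=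
    fun g hg => hg.intervalIntegrable _ _
  simp only [Real.circleAverage, hre, him]
  rw [intervalIntegral.integral_add (ii _ (by fun_prop)) (ii _ (by fun_prop)),
    intervalIntegral.integral_add (ii _ (by fun_prop)) (ii _ (by fun_prop)),
    intervalIntegral.integral_add (ii _ (by fun_prop)) (ii _ (by fun_prop)),
    intervalIntegral.integral_add (ii _ (by fun_prop)) (ii _ (by fun_prop)),
    intervalIntegral.integral_add (ii _ (by fun_prop)) (ii _ (by fun_prop))]
  simp only [intervalIntegral.integral_mul_const, intervalIntegral.integral_const, integral_cos,
    integral_sin, integral_cos_sq, integral_sin_sq]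
  have h : ∫ θ in (0 : ℝ)..(2 * Real.pi), Real.cos θ * Real.sin θ = 0 := by
    simp_rw [mul_comm (Real.cos _)]
    rw [integral_sin_mul_cos₁]
    simp
  rw [h]
  simp
  have := Real.pi_pos
  field_simp
  ring

/-- On a small circle the Taylor polynomial raised by `δ‖w‖²` majorises `F`, and its average exceeds
`F z` by half of `dd^c F(w, Jw)` plus that error. Letting `δ` tend to zero gives the sign. -/
theorem ddcLocal_nonneg_of_submean {n : ℕ} {O : Set (Cn n)} {F : Cn n → ℝ} {z : Cn n}
    (hF : ContDiffOn ℝ ∞ F O) (hO : IsOpen O) (hz : z ∈ O)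
    (hsub : ∀ w : Cn n, (∀ ζ : ℂ, ‖ζ‖ ≤ 1 → z + ζ • w ∈ O) → ∀ h : ℂ → ℝ, Continuous h →
      (∀ ζ : ℂ, ‖ζ‖ = 1 → F (z + ζ • w) ≤ h ζ) → F z ≤ Real.circleAverage h 0 1) (a : Cn n) :
    0 ≤ ddcLocal F z a (cplxJ n a) := by
  have key : ∀ δ > 0, 0 ≤ 1 / 2 * ddcLocal F z a (cplxJ n a) + δ * ‖a‖ ^ 2 := by
    intro δ hδ
    obtain ⟨ε, hε, hT⟩ := exists_taylor_two_bound hF hO hz hδ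
    -- Rescaling `a` puts the whole disc inside the ball where the Taylor bound holds; both terms of
    -- the conclusion scale by `t²`.
    set t : ℝ := ε / (‖a‖ + 1) with ht
    have ha1 : 0 < ‖a‖ + 1 := by positivity
    have ht0 : 0 < t := div_pos hε ha1
    obtain ⟨w, hwdef⟩ : ∃ w, w = t • a := ⟨_, rfl⟩
    have hw : ‖w‖ ≤ ε := by
      rw [hwdef, norm_smul, Real.norm_of_nonneg ht0.le, ht, div_mul_eq_mul_div, div_le_iff₀ ha1]
      nlinarith [norm_nonneg a]
    set D := fderiv ℝ F z
    set D2 := fderiv ℝ (fderiv ℝ F) z with hD2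
    have hsm : ∀ ζ : ℂ, ζ • w = ζ.re • w + ζ.im • cplxJ n w := fun ζ => complex_smul_eq ζ w
    have hsym : D2 (cplxJ n w) w = D2 w (cplxJ n w) := fderiv_fderiv_symm hF hO hz _ _
    set h : ℂ → ℝ := fun ζ => (F z + δ * ‖w‖ ^ 2) + ζ.re * D w + ζ.im * D (cplxJ n w) +
      ζ.re ^ 2 * (1 / 2 * D2 w w) + ζ.re * ζ.im * D2 w (cplxJ n w) +
      ζ.im ^ 2 * (1 / 2 * D2 (cplxJ n w) (cplxJ n w)) with hh
    have hcont : Continuous h := by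
      have := Complex.continuous_re
      have := Complex.continuous_im
      fun_prop
    have h1 := hsub w (fun ζ hζ => (hT (ζ • w) ?_).1) h hcont fun ζ hζ => ?_
    · rw [hh, circleAverage_quadratic] at h1
      have h2 : ddcLocal F z w (cplxJ n w) = t ^ 2 * ddcLocal F z a (cplxJ n a) := by
        simp only [hwdef, map_smul, smul_apply, smul_eq_mul]
        ring
      have h3 : ‖w‖ ^ 2 = t ^ 2 * ‖a‖ ^ 2 := by
        rw [hwdef, norm_smul, mul_pow, Real.norm_eq_abs, sq_abs]
      rw [ddcLocal_self, ← hD2] at h2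
      have h4 : 0 ≤ t ^ 2 * (1 / 2 * ddcLocal F z a (cplxJ n a) + δ * ‖a‖ ^ 2) := by
        rw [h3] at h1
        nlinarith
      exact nonneg_of_mul_nonneg_right h4 (by positivity)
    · rw [norm_smul]
      exact (mul_le_of_le_one_left (norm_nonneg _) hζ).trans hw
    · have hn : ‖ζ • w‖ = ‖w‖ := by rw [norm_smul, hζ, one_mul]
      have h2 := (abs_le.mp (hT (ζ • w) (hn ▸ hw)).2).2
      rw [hn] at h2
      have h3 : D (ζ • w) = ζ.re * D w + ζ.im * D (cplxJ n w) := by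
        rw [hsm, map_add, map_smul, map_smul, smul_eq_mul, smul_eq_mul]
      have h4 : D2 (ζ • w) (ζ • w) = ζ.re ^ 2 * D2 w w + 2 * (ζ.re * ζ.im * D2 w (cplxJ n w)) +
          ζ.im ^ 2 * D2 (cplxJ n w) (cplxJ n w) := by
        rw [hsm]
        simp only [map_add, map_smul, add_apply, smul_apply, smul_eq_mul, hsym]
        ring
      rw [h3, h4] at h2
      simp only [hh]
      linarith
  by_contra! hneg
  rcases (sq_nonneg ‖a‖).eq_or_lt with h0 | hpos
  · have := key 1 one_pos
    rw [← h0] at this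
    linarith
  · have := key (-ddcLocal F z a (cplxJ n a) / (4 * ‖a‖ ^ 2)) (div_pos (by linarith) (by positivity))
    rw [show -ddcLocal F z a (cplxJ n a) / (4 * ‖a‖ ^ 2) * ‖a‖ ^ 2 =
      -ddcLocal F z a (cplxJ n a) / 4 by
        rw [← div_div, div_mul_cancel₀ _ hpos.ne']] at this
    linarith

section Psh

variable {n : ℕ} {X : Type*} [TopologicalSpace X] [ChartedSpace (Cn n) X]

/-- The part of a chart over an open set. -/
theorem isOpen_chart_preimage (x : X) {O : Set X} (hO : IsOpen O) :
    IsOpen ((chartAt (Cn n) x).target ∩ (chartAt (Cn n) x).symm ⁻¹' O) :=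
  (chartAt (Cn n) x).symm.isOpen_inter_preimage hO

theorem chart_mem_preimage {x : X} {O : Set X} (hx : x ∈ O) :
    chartAt (Cn n) x x ∈ (chartAt (Cn n) x).target ∩ (chartAt (Cn n) x).symm ⁻¹' O := by
  refine ⟨chart_mem x, ?_⟩
  rwa [Set.mem_preimage, (chartAt (Cn n) x).left_inv (mem_chart_source _ x)]

/-- Upper semicontinuity holds for `ρ + u`; continuity of the local potential `u` transfers it to
`ρ` near a pole. -/
theorem eventually_lt_of_pole {th : FormField n X} {ρ : X → EReal} (hq : IsQuasiPsh th ρ) {x : X}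
    (hx : ρ x = ⊥) (c : ℝ) : ∀ᶠ y in 𝓝 x, ρ y < c := by
  obtain ⟨U, u, hU, hxU, hu, -, husc, -, -⟩ := hq.2 x
  have h1 : ρ x + (u x : EReal) < ((c + u x - 1 : ℝ) : EReal) := by
    rw [hx, EReal.bot_add]; exact EReal.bot_lt_coe _
  have h2 := husc x hxU _ h1
  rw [hU.nhdsWithin_eq hxU] at h2
  have h3 : ∀ᶠ y in 𝓝 x, u x - 1 < u y :=
    (hu.continuousOn.continuousAt (hU.mem_nhds hxU)).eventually (lt_mem_nhds (by linarith))
  filter_upwards [h2, h3] with y hy1 hy2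
  induction hρ : ρ y with
  | bot => exact EReal.bot_lt_coe c
  | top =>
    rw [hρ, EReal.top_add_coe] at hy1
    exact absurd hy1 not_top_lt
  | coe t =>
    rw [hρ, ← EReal.coe_add, EReal.coe_lt_coe_iff] at hy1
    rw [EReal.coe_lt_coe_iff]
    linarith

variable [IsManifold 𝓘(ℂ, Cn n) (⊤ : WithTop ℕ∞) X]

theorem contDiffOn_inChart_of_contMDiffOn {f : X → ℝ} {O : Set X} (hO : IsOpen O)
    (hf : ContMDiffOn 𝓘(ℝ, Cn n) 𝓘(ℝ, ℝ) ∞ f O) (x : X) : ContDiffOn ℝ ∞ (inChart n x f)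
      ((chartAt (Cn n) x).target ∩ (chartAt (Cn n) x).symm ⁻¹' O) := fun _ hz =>
  (contDiffAt_inChart hz.1 (hf.contMDiffAt (hO.mem_nhds hz.2))).contDiffWithinAt

/-- At a point where `ρ` is smooth, the submean inequality for `ρ + u` is an inequality for real
functions, and `u` contributes `th`. -/
theorem IsQuasiPsh.form_nonneg {th : FormField n X} {ρ : X → EReal} (hq : IsQuasiPsh th ρ)
    (hs : SmoothOffPoles n ρ) {x : X} (hx : ρ x ≠ ⊥) (a : Cn n) :
    0 ≤ th x a (cplxJ n a) + ddcX (n := n) (fun x => (ρ x).toReal) x a (cplxJ n a) := by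
  obtain ⟨U, u, hU, hxU, hu, hth, -, htop, hmean⟩ := hq.2 x
  have hO := isOpen_chart_preimage (n := n) x (hU.inter hs.1)
  have hz := chart_mem_preimage (n := n) (x := x) (O := U ∩ {x | ρ x ≠ ⊥}) ⟨hxU, hx⟩
  set O := (chartAt (Cn n) x).target ∩ (chartAt (Cn n) x).symm ⁻¹' (U ∩ {x | ρ x ≠ ⊥}) with hOdef
  have h1 : ContDiffOn ℝ ∞ (inChart n x u) O :=
    (contDiffOn_inChart_of_contMDiffOn hU hu x).mono fun z hz => ⟨hz.1, hz.2.1⟩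
  have h2 : ContDiffOn ℝ ∞ (inChart n x fun x => (ρ x).toReal) O :=
    (contDiffOn_inChart_of_contMDiffOn hs.1 hs.2 x).mono fun z hz => ⟨hz.1, hz.2.2⟩
  have hreal : ∀ z ∈ O, ρ ((chartAt (Cn n) x).symm z) + (u ((chartAt (Cn n) x).symm z) : EReal) =
      ((inChart n x u z + inChart n x (fun x => (ρ x).toReal) z : ℝ) : EReal) := by
    intro z hz
    have h3 := htop _ hz.2.1
    have h4 : ρ ((chartAt (Cn n) x).symm z) ≠ ⊤ := fun h => h3 (by
      simp only [h, EReal.top_add_coe])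
    rw [EReal.coe_add, add_comm]
    simp only [inChart]
    rw [EReal.coe_toReal h4 hz.2.2]
  have h5 := ddcLocal_nonneg_of_submean (h1.add h2) hO hz (fun w hw h hc hle => ?_) a
  · have h6 := ddcLocal_add hO hz h1 h2
    have h7 : ddcLocal (inChart n x u) (chartAt (Cn n) x x) = th x := hth x hxU
    rw [h6, h7] at h5
    exact h5
  · have h8 := hmean x (chartAt (Cn n) x x) w (fun ζ hζ => ⟨(hw ζ hζ).1, (hw ζ hζ).2.1⟩) h hc
      fun ζ hζ => by
        refine (hreal _ (hw ζ hζ.le)).trans_le ?_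
        exact EReal.coe_le_coe_iff.mpr (hle ζ hζ)
    exact EReal.coe_le_coe_iff.mp ((hreal _ hz).symm.trans_le h8)

end Psh

/-! ### Regularised truncation -/

/-- A smooth convex nondecreasing function, `0` on `(-∞, 0]` and affine of slope `1` on `[1, ∞)`. -/
def smoothRamp (t : ℝ) : ℝ := ∫ s in (0 : ℝ)..t, Real.smoothTransition s

theorem hasDerivAt_smoothRamp (t : ℝ) : HasDerivAt smoothRamp (Real.smoothTransition t) t :=
  intervalIntegral.integral_hasDerivAt_right
    (Real.smoothTransition.continuous.intervalIntegrable _ _)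
    (Real.smoothTransition.continuous.stronglyMeasurableAtFilter _ _)
    Real.smoothTransition.continuous.continuousAt

theorem deriv_smoothRamp : deriv smoothRamp = Real.smoothTransition :=
  funext fun t => (hasDerivAt_smoothRamp t).deriv

theorem contDiff_smoothRamp : ContDiff ℝ ∞ smoothRamp := by
  rw [contDiff_infty_iff_deriv]
  refine ⟨fun t => (hasDerivAt_smoothRamp t).differentiableAt, ?_⟩
  rw [deriv_smoothRamp]
  exact Real.smoothTransition.contDiff

theorem smoothRamp_of_nonpos {t : ℝ} (ht : t ≤ 0) : smoothRamp t = 0 := by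
  rw [smoothRamp, intervalIntegral.integral_symm, neg_eq_zero]
  rw [intervalIntegral.integral_congr (g := fun _ => (0 : ℝ))]
  · simp
  · intro s hs
    rw [Set.uIcc_of_le ht] at hs
    exact Real.smoothTransition.zero_of_nonpos hs.2

theorem monotone_smoothRamp : Monotone smoothRamp :=
  monotone_of_deriv_nonneg (fun t => (hasDerivAt_smoothRamp t).differentiableAt) fun t => by
    rw [deriv_smoothRamp]; exact Real.smoothTransition.nonneg t

theorem antitone_smoothRamp_sub : Antitone fun t => smoothRamp t - t :=
  antitone_of_deriv_nonpos (fun t => ((hasDerivAt_smoothRamp t).sub (hasDerivAt_id t)).differentiableAt)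
    fun t => by
      have h1 : deriv (fun t => smoothRamp t - t) t = Real.smoothTransition t - 1 :=
        ((hasDerivAt_smoothRamp t).sub (hasDerivAt_id t)).deriv
      rw [h1]
      have := Real.smoothTransition.le_one t
      linarith

theorem smoothRamp_le {t : ℝ} (ht : 0 ≤ t) : smoothRamp t ≤ t := by
  have := antitone_smoothRamp_sub ht
  simp only [smoothRamp_of_nonpos le_rfl] at this
  linarith

theorem sub_one_le_smoothRamp (t : ℝ) : t - 1 ≤ smoothRamp t := by
  have h1 : 0 ≤ smoothRamp 1 := by
    rw [← smoothRamp_of_nonpos le_rfl]; exact monotone_smoothRamp zero_le_one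
  rcases le_total t 1 with h | h
  · have := antitone_smoothRamp_sub h
    simp only at this
    linarith
  · have h3 : smoothRamp t - smoothRamp 1 = t - 1 := by
      rw [smoothRamp, smoothRamp, intervalIntegral.integral_interval_sub_left
        (Real.smoothTransition.continuous.intervalIntegrable _ _)
        (Real.smoothTransition.continuous.intervalIntegrable _ _),
        intervalIntegral.integral_congr (g := fun _ => (1 : ℝ))]
      · simp
      · intro s hs
        rw [Set.uIcc_of_le h] at hs
        exact Real.smoothTransition.one_of_one_le hs.1
    linarith

section Truncation

variable {n r : ℕ} {X : Type*}

/-- The regularisation of `max(ρ, -N)`. -/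
def truncation (ρ : X → EReal) (N : ℝ) (x : X) : ℝ :=
  if ρ x = ⊥ then -N else smoothRamp ((ρ x).toReal + N) - N

variable {ρ : X → EReal} {N : ℝ} {x : X}

theorem truncation_of_ne_bot (hx : ρ x ≠ ⊥) :
    truncation ρ N x = smoothRamp ((ρ x).toReal + N) - N := if_neg hx

theorem truncation_of_lt (hx : ρ x < ((-N : ℝ) : EReal)) : truncation ρ N x = -N := by
  by_cases h : ρ x = ⊥
  · exact if_pos h
  · have h1 : ρ x ≠ ⊤ := ne_top_of_lt hx
    rw [← EReal.coe_toReal h1 h, EReal.coe_lt_coe_iff] at hx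
    rw [truncation_of_ne_bot h, smoothRamp_of_nonpos (by linarith), zero_sub]

theorem truncation_le (hx : ρ x ≠ ⊥) (h : -N ≤ (ρ x).toReal) : truncation ρ N x ≤ (ρ x).toReal := by
  rw [truncation_of_ne_bot hx]
  have := smoothRamp_le (t := (ρ x).toReal + N) (by linarith)
  linarith

theorem le_truncation (hx : ρ x ≠ ⊥) : (ρ x).toReal - 1 ≤ truncation ρ N x := by
  rw [truncation_of_ne_bot hx]
  have := sub_one_le_smoothRamp ((ρ x).toReal + N)
  linarith

theorem truncation_le_of_bad (h : ρ x = ⊥ ∨ (ρ x).toReal < 1 - N) : truncation ρ N x ≤ 1 - N := by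
  by_cases hx : ρ x = ⊥
  · rw [truncation, if_pos hx]; linarith
  · have h1 := h.resolve_left hx
    rw [truncation_of_ne_bot hx]
    have h2 : smoothRamp ((ρ x).toReal + N) ≤ smoothRamp 1 := monotone_smoothRamp (by linarith)
    have h3 := smoothRamp_le zero_le_one
    linarith

theorem invariantFun_truncation [MulAction (Torus r) X] (hρ : InvariantFun r ρ) (N : ℝ) :
    InvariantFun r (truncation ρ N) := fun t x => by
  simp only [truncation, hρ t x]

variable [TopologicalSpace X] [ChartedSpace (Cn n) X] [IsManifold 𝓘(ℂ, Cn n) (⊤ : WithTop ℕ∞) X]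

/-- Near a pole `ρ < -N`, so the truncation is constant there; away from poles it is a smooth
function of the smooth function `ρ`. -/
theorem isSmoothInCharts_truncation {th : FormField n X} (hq : IsQuasiPsh th ρ)
    (hs : SmoothOffPoles n ρ) (N : ℝ) : IsSmoothInCharts n (truncation ρ N) := by
  intro x₀ z hz
  set x := (chartAt (Cn n) x₀).symm z with hx
  by_cases hpole : ρ x = ⊥
  · have h1 := eventually_lt_of_pole hq hpole (-N)
    have h2 : ContinuousAt (chartAt (Cn n) x₀).symm z := (chartAt (Cn n) x₀).continuousAt_symm hz
    have h3 : inChart n x₀ (truncation ρ N) =ᶠ[𝓝 z] fun _ => -N := by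
      filter_upwards [h2.eventually h1] with w hw
      exact truncation_of_lt hw
    exact (contDiffAt_const.congr_of_eventuallyEq h3).contDiffWithinAt
  · have hO := isOpen_chart_preimage (n := n) x₀ hs.1
    have hzO : z ∈ (chartAt (Cn n) x₀).target ∩ (chartAt (Cn n) x₀).symm ⁻¹' {x | ρ x ≠ ⊥} :=
      ⟨hz, hpole⟩
    have h1 := (contDiffOn_inChart_of_contMDiffOn hs.1 hs.2 x₀).contDiffAt (hO.mem_nhds hzO)
    have h2 : ContDiffAt ℝ ∞ (fun z => smoothRamp
        (inChart n x₀ (fun x => (ρ x).toReal) z + N) - N) z :=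
      (contDiff_smoothRamp.contDiffAt.comp z (h1.add contDiffAt_const)).sub contDiffAt_const
    refine (h2.congr_of_eventuallyEq ?_).contDiffWithinAt
    exact Filter.eventuallyEq_of_mem (hO.mem_nhds hzO) fun w hw => truncation_of_ne_bot hw.2

/-- `c` and `d` are the first and second derivatives of `t ↦ smoothRamp (t + N) - N` at `ρ x`: a
slope in `[0, 1]`, equal to 1 from `1 - N` on, and nonnegative by convexity. -/
theorem ddcX_truncation (hs : SmoothOffPoles n ρ) (hx : ρ x ≠ ⊥) :
    ∃ c d : ℝ, 0 ≤ c ∧ c ≤ 1 ∧ 0 ≤ d ∧ (1 - N ≤ (ρ x).toReal → c = 1) ∧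
      ddcX (n := n) (truncation ρ N) x = c • ddcX (fun x => (ρ x).toReal) x +
        d • gradForm (dX (fun x => (ρ x).toReal) x) (dX (fun x => (ρ x).toReal) x) := by
  have hO := isOpen_chart_preimage (n := n) x hs.1
  have hz := chart_mem_preimage (n := n) (x := x) (O := {x | ρ x ≠ ⊥}) hx
  have h1 := contDiffOn_inChart_of_contMDiffOn hs.1 hs.2 x
  set χ : ℝ → ℝ := fun t => smoothRamp (t + N) - N with hχ
  have hχd : deriv χ = fun t => Real.smoothTransition (t + N) := by
    ext t
    have := (((hasDerivAt_smoothRamp (t + N)).comp_add_const t N).sub_const N).deriv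
    exact this
  have hχs : ContDiff ℝ ∞ χ :=
    (contDiff_smoothRamp.comp (contDiff_id.add contDiff_const)).sub contDiff_const
  have h2 := ddcLocal_comp_real hO hz h1 isOpen_univ (Set.mapsTo_univ _ _) hχs.contDiffOn
  have h3 : ddcX (n := n) (truncation ρ N) x =
      ddcLocal (fun z => χ (inChart n x (fun x => (ρ x).toReal) z)) (chartAt (Cn n) x x) :=
    ddcLocal_congr hO hz fun w hw => truncation_of_ne_bot hw.2
  refine ⟨deriv χ (ρ x).toReal, deriv (deriv χ) (ρ x).toReal, ?_, ?_, ?_, ?_, ?_⟩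
  · rw [hχd]; exact Real.smoothTransition.nonneg _
  · rw [hχd]; exact Real.smoothTransition.le_one _
  · rw [hχd]
    refine Monotone.deriv_nonneg fun s t hst => Real.smoothTransition.monotone (by linarith)
  · intro h
    rw [hχd]
    exact Real.smoothTransition.one_of_one_le (by linarith)
  · rw [h3, h2, inChart_center]
    rfl

/-- Off the poles the form is at least `(1 - c) ω + c (ω + dd^c ρ)`; at a pole the truncation is
locally constant. -/
theorem twist_truncation_nonneg {om : FormField n X} (hom : IsPositive om) (hq : IsQuasiPsh om ρ)
    (hs : SmoothOffPoles n ρ) (N : ℝ) (x : X) (a : Cn n) :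
    0 ≤ twist om (truncation ρ N) x a (cplxJ n a) := by
  have hpos : 0 ≤ om x a (cplxJ n a) := by
    rcases eq_or_ne a 0 with rfl | ha
    · simp
    · exact (hom x a ha).le
  rw [twist, add_apply, add_apply]
  by_cases hx : ρ x = ⊥
  · have h1 := eventually_lt_of_pole hq hx (-N)
    have h2 : ContinuousAt (chartAt (Cn n) x).symm (chartAt (Cn n) x x) :=
      (chartAt (Cn n) x).continuousAt_symm (chart_mem x)
    have h3 : inChart n x (truncation ρ N) =ᶠ[𝓝 (chartAt (Cn n) x x)] fun _ => -N := by
      rw [ContinuousAt, (chartAt (Cn n) x).left_inv (mem_chart_source _ x)] at h2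
      filter_upwards [h2.eventually h1] with w hw
      exact truncation_of_lt hw
    have h4 : ddcX (n := n) (truncation ρ N) x a (cplxJ n a) = 0 := by
      rw [ddcX, ddcLocal_apply, h3.fderiv.fderiv_eq]
      simp
    rw [h4, add_zero]
    exact hpos
  · obtain ⟨c, d, hc0, hc1, hd, -, h⟩ := ddcX_truncation (N := N) hs hx
    have h1 := hq.form_nonneg hs hx a
    rw [h, add_apply, add_apply, smul_apply, smul_apply, smul_apply, smul_apply, gradForm_self,
      smul_eq_mul, smul_eq_mul]
    have h2 := mul_nonneg hc0 h1
    have h3 := mul_nonneg (sub_nonneg.mpr hc1) hpos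
    have h4 : 0 ≤ d * (1 / 2 * (dX (n := n) (fun x => (ρ x).toReal) x (cplxJ n a) *
        dX (n := n) (fun x => (ρ x).toReal) x (cplxJ n a) + dX (n := n) (fun x => (ρ x).toReal) x a *
        dX (n := n) (fun x => (ρ x).toReal) x a)) :=
    mul_nonneg hd (mul_nonneg (by norm_num) (add_nonneg (mul_self_nonneg _) (mul_self_nonneg _)))
    linarith

/-- Where the ramp has slope 1 the truncation keeps all of `dd^c ρ`, so the lower bound by `C_ρ ω_X`
survives. -/
theorem twist_truncation_ge {om omX : FormField n X} {C : ℝ}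
    (hq : IsQuasiPsh (fun x => om x - C • omX x) ρ) (hs : SmoothOffPoles n ρ) {N : ℝ} {x : X}
    (hx : ρ x ≠ ⊥) (hN : 1 - N ≤ (ρ x).toReal) (a : Cn n) :
    C * omX x a (cplxJ n a) ≤ twist om (truncation ρ N) x a (cplxJ n a) := by
  obtain ⟨c, d, -, -, hd, hc, h⟩ := ddcX_truncation (N := N) hs hx
  have h1 := hq.form_nonneg hs hx a
  rw [sub_apply, sub_apply, smul_apply, smul_apply, smul_eq_mul] at h1
  rw [twist, add_apply, add_apply, h, add_apply, add_apply, smul_apply, smul_apply, smul_apply,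
    smul_apply, gradForm_self, smul_eq_mul, smul_eq_mul, hc hN]
  have h4 : 0 ≤ d * (1 / 2 * (dX (n := n) (fun x => (ρ x).toReal) x (cplxJ n a) *
        dX (n := n) (fun x => (ρ x).toReal) x (cplxJ n a) + dX (n := n) (fun x => (ρ x).toReal) x a *
        dX (n := n) (fun x => (ρ x).toReal) x a)) :=
    mul_nonneg hd (mul_nonneg (by norm_num) (add_nonneg (mul_self_nonneg _) (mul_self_nonneg _)))
  linarith

end Truncation

/-! ### Bounds by compactness -/

theorem exists_pos_lower_bound {n : ℕ} {α : BilForm n} (hα : IsOneOne α)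
    (pα : ∀ a, a ≠ 0 → 0 < α a (cplxJ n a)) : ∃ c > 0, ∀ a, c * ‖a‖ ^ 2 ≤ α a (cplxJ n a) := by
  obtain ⟨P, d, hF⟩ := exists_isFrame hα hα pα pα
  obtain ⟨Q, hQ, -⟩ := exists_inverse_of_isUnit_matOf hF.isUnit
  -- In a unitary frame `α(a, Ja) = 2‖Qa‖²` and `‖a‖ ≤ ‖P‖‖Qa‖`; the `+ 1` keeps the denominator
  -- positive in every dimension.
  refine ⟨2 / (‖P‖ ^ 2 + 1), by positivity, fun a => ?_⟩
  have h1 : P (Q a) = a := by rw [← ContinuousLinearMap.comp_apply, hQ]; rfl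
  have h2 : α a (cplxJ n a) = 2 * ‖Q a‖ ^ 2 := by
    have h3 := herm_expand (hα.pull P) (Q a) (Q a)
    rw [herm_self (hα.pull P), pull_apply, map_cplxJ, h1] at h3
    simp only [hF.left, Matrix.one_apply] at h3
    have h4 : ((1 / 2 * α a (cplxJ n a) : ℝ) : ℂ) = ((‖Q a‖ ^ 2 : ℝ) : ℂ) := by
      rw [h3, EuclideanSpace.norm_sq_eq]
      push_cast
      refine Finset.sum_congr rfl fun i _ => ?_
      rw [Finset.sum_eq_single i]
      · rw [if_pos rfl, mul_one, Complex.mul_conj, Complex.normSq_eq_norm_sq]; push_cast; rfl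
      · intro j _ hj; rw [if_neg hj.symm, mul_zero, zero_mul]
      · simp
    have h5 := Complex.ofReal_injective h4
    linarith
  have h3 : ‖a‖ ≤ ‖P‖ * ‖Q a‖ := by
    conv_lhs => rw [← h1]
    exact P.le_opNorm _
  have h4 : ‖a‖ ^ 2 ≤ (‖P‖ * ‖Q a‖) ^ 2 := pow_le_pow_left₀ (norm_nonneg _) h3 2
  rw [h2, div_mul_eq_mul_div, div_le_iff₀ (by positivity)]
  nlinarith [sq_nonneg ‖Q a‖]

theorem abs_apply_J_le {n : ℕ} (β : BilForm n) (a : Cn n) :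
    |β a (cplxJ n a)| ≤ ‖β‖ * ‖a‖ ^ 2 := by
  have h1 : ‖cplxJ n a‖ = ‖a‖ := by rw [cplxJ_apply, norm_smul, Complex.norm_I, one_mul]
  have h2 := β.le_opNorm₂ a (cplxJ n a)
  rw [h1] at h2
  rw [← Real.norm_eq_abs]
  linarith [sq ‖a‖]

section Compactness

variable {n : ℕ} {X : Type*} [TopologicalSpace X] [ChartedSpace (Cn n) X]
  [IsManifold 𝓘(ℂ, Cn n) (⊤ : WithTop ℕ∞) X]

/-- In a chart around each point the metric stays above half of its lower bound and the Hessian form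
stays bounded; compactness makes finitely many such neighbourhoods suffice, with constants added. -/
theorem exists_ddcX_bound [CompactSpace X] {g : FormField n X} (hg : IsKahler g) {f : X → ℝ}
    (hf : IsSmoothInCharts n f) :
    ∃ C, 0 ≤ C ∧ ∀ x a, |ddcX f x a (cplxJ n a)| ≤ C * g x a (cplxJ n a) := by
  have hg0 : ∀ x a, 0 ≤ g x a (cplxJ n a) := fun x a => by
    rcases eq_or_ne a 0 with rfl | ha
    · simp
    · exact (hg.pos x a ha).le
  suffices H : ∃ C, 0 ≤ C ∧ ∀ x ∈ (Set.univ : Set X), ∀ a,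
      |ddcX f x a (cplxJ n a)| ≤ C * g x a (cplxJ n a) by
    obtain ⟨C, hC, h⟩ := H
    exact ⟨C, hC, fun x => h x trivial⟩
  refine isCompact_univ.induction_on (p := fun s => ∃ C, 0 ≤ C ∧ ∀ x ∈ s, ∀ a,
      |ddcX f x a (cplxJ n a)| ≤ C * g x a (cplxJ n a)) ⟨0, le_rfl, fun x hx => hx.elim⟩
    (fun s t hst ⟨C, hC, h⟩ => ⟨C, hC, fun x hx => h x (hst hx)⟩) ?_ fun x₀ _ => ?_
  · rintro s t ⟨C, hC, h⟩ ⟨C', hC', h'⟩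
    refine ⟨C + C', add_nonneg hC hC', fun x hx a => ?_⟩
    have h0 := hg0 x a
    rcases hx with hx | hx
    · nlinarith [h x hx a]
    · nlinarith [h' x hx a]
  · have hU := isOpen_chart (n := n) x₀
    have hz := chart_mem (n := n) x₀
    set z₀ := chartAt (Cn n) x₀ x₀
    have hK := hg.locKahler x₀
    have cα := (smoothOn_contDiffAt hK.smooth hU hz).continuousAt
    have cβ :=
      (smoothOn_contDiffAt (smoothOn_ddcLocal (hf x₀) hU) hU hz).continuousAt
    obtain ⟨c, hc, hcα⟩ := exists_pos_lower_bound (hK.oneOne z₀ hz) (hK.pos z₀ hz)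
    set b := ‖ddcLocal (inChart n x₀ f) z₀‖
    have e1 : ∀ᶠ z in 𝓝 z₀, ‖coordForm g x₀ z - coordForm g x₀ z₀‖ < c / 2 := by
      have := Metric.continuousAt_iff'.mp cα (c / 2) (by positivity)
      simpa only [dist_eq_norm] using this
    have e2 : ∀ᶠ z in 𝓝 z₀, ‖ddcLocal (inChart n x₀ f) z‖ < b + 1 := by
      filter_upwards [Metric.continuousAt_iff'.mp cβ 1 one_pos] with z hz
      rw [dist_eq_norm] at hz
      have h1 := norm_sub_norm_le (ddcLocal (inChart n x₀ f) z) (ddcLocal (inChart n x₀ f) z₀)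
      change ‖ddcLocal (inChart n x₀ f) z‖ - b ≤ _ at h1
      linarith
    have e3 := ((chartAt (Cn n) x₀).continuousAt (mem_chart_source _ x₀)).eventually (e1.and e2)
    have e4 := (chartAt (Cn n) x₀).open_source.mem_nhds (mem_chart_source (Cn n) x₀)
    refine ⟨_, nhdsWithin_le_nhds (Filter.inter_mem e4 e3), (b + 1) * (2 / c), by positivity, ?_⟩
    rintro y ⟨hy, hy1, hy2⟩ a
    set z := chartAt (Cn n) x₀ y
    have hzt : z ∈ (chartAt (Cn n) x₀).target := (chartAt (Cn n) x₀).map_source hy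
    have hyz : (chartAt (Cn n) x₀).symm z = y := (chartAt (Cn n) x₀).left_inv hy
    obtain ⟨Q, hQ, -⟩ := exists_inverse_of_isUnit_matOf (isUnit_transition hzt)
    have h1 : transition x₀ z (Q a) = a := by rw [← ContinuousLinearMap.comp_apply, hQ]; rfl
    have h2 : ddcX f y a (cplxJ n a) = ddcLocal (inChart n x₀ f) z (Q a) (cplxJ n (Q a)) := by
      rw [← coordForm_ddcX hf hzt, coordForm_eq_pull, pull_apply, map_cplxJ, h1, hyz]
    have h3 : g y a (cplxJ n a) = coordForm g x₀ z (Q a) (cplxJ n (Q a)) := by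
      rw [coordForm_eq_pull, pull_apply, map_cplxJ, h1, hyz]
    have h4 := abs_apply_J_le (ddcLocal (inChart n x₀ f) z) (Q a)
    have h5 := abs_apply_J_le (coordForm g x₀ z - coordForm g x₀ z₀) (Q a)
    rw [sub_apply, sub_apply] at h5
    have h6 := hcα (Q a)
    have h7 := (abs_le.mp h5).1
    have h8 := sq_nonneg ‖Q a‖
    have h9 : c / 2 * ‖Q a‖ ^ 2 ≤ coordForm g x₀ z (Q a) (cplxJ n (Q a)) := by nlinarith
    rw [h2, h3]
    calc |ddcLocal (inChart n x₀ f) z (Q a) (cplxJ n (Q a))| ≤ (b + 1) * ‖Q a‖ ^ 2 := by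
          nlinarith
      _ = (b + 1) * (2 / c) * (c / 2 * ‖Q a‖ ^ 2) := by field_simp
      _ ≤ _ := mul_le_mul_of_nonneg_left h9 (by positivity)

end Compactness

/-! ### Laplacian estimates on the manifold -/

section Estimates

variable {n r : ℕ} {X : Type*} [TopologicalSpace X] [ChartedSpace (Cn n) X]
  [IsManifold 𝓘(ℂ, Cn n) (⊤ : WithTop ℕ∞) X] {g h : FormField n X}

theorem ddcX_trace (hg : IsKahler g) (hh : IsKahler h) (x : X) :
    ddcX (n := n) (fun x => formTrace (g x) (h x)) x =
      ddcLocal (fun z => formTrace (coordForm g x z) (coordForm h x z)) (chartAt (Cn n) x x) :=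
  ddcLocal_congr (isOpen_chart x) (chart_mem x) fun _ hz =>
    formTrace_coordForm (hg.oneOne _) (hh.oneOne _) hz

theorem dX_trace (hg : IsKahler g) (hh : IsKahler h) (x : X) :
    dX (n := n) (fun x => formTrace (g x) (h x)) x =
      fderiv ℝ (fun z => formTrace (coordForm g x z) (coordForm h x z)) (chartAt (Cn n) x x) := by
  refine Filter.EventuallyEq.fderiv_eq ?_
  exact Filter.eventuallyEq_of_mem ((isOpen_chart x).mem_nhds (chart_mem x)) fun _ hz =>
    formTrace_coordForm (hg.oneOne _) (hh.oneOne _) hz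

theorem isOneOne_ricci (hg : IsKahler g) (x : X) : IsOneOne (ricci g x) := by
  have h1 := isOneOne_ddcLocal (smoothOn_log_formDet (hg.locKahler x)) (isOpen_chart x) (chart_mem x)
  have h2 := h1.smul (-1 : ℝ)
  have h3 : ricci g x = (-1 : ℝ) •
      ddcLocal (fun z => Real.log (formDet (coordForm g x z))) (chartAt (Cn n) x x) :=
    ContinuousLinearMap.ext fun a => ContinuousLinearMap.ext fun b => by
      rw [ricci, neg_apply, neg_apply, smul_apply, smul_apply, neg_one_smul]
  rwa [h3]

/-- The logarithm of the Monge–Ampère equation expresses `dd^c log det h` as `dd^c F - dd^c V -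
Ric(g)`, which is inserted in `formTrace_laplacian_ge`. -/
theorem lap_trace_ge [NeZero n] (hg : IsKahler g) (hh : IsKahler h) {B : ℝ} (hB : BisecGE g B)
    {F V : X → ℝ} (hF : IsSmoothInCharts n F) (hV : IsSmoothInCharts n V)
    (hMA : ∀ x, Real.exp (V x) * formDet (h x) = Real.exp (F x) * formDet (g x)) (x : X) :
    lap g F x - lap g V x - formTrace (g x) (ricci g x) -
        B * formTrace (g x) (h x) * formTrace (h x) (g x) +
        gradTrace h (fun x => formTrace (g x) (h x)) (fun x => formTrace (g x) (h x)) x /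
          formTrace (g x) (h x) ≤
      lap h (fun x => formTrace (g x) (h x)) x := by
  have hU := isOpen_chart (n := n) x
  have hz := chart_mem (n := n) x
  have kg := hg.locKahler x
  have kh := hh.locKahler x
  have h1 := formTrace_laplacian_ge hU hz kg kh (B := B) fun ξ η => by
    have h2 := hB x ξ η
    have h3 : ∀ ζ : Cn n, hermNormSq g x ζ =
        (herm (coordForm g x (chartAt (Cn n) x x)) ζ ζ).re := fun ζ => by
      rw [coordForm_center, herm_expand (hg.oneOne x), hermNormSq]
      simp only [mul_comm (ζ _)]
    rw [h3, h3] at h2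
    exact h2
  have hlog : ∀ z ∈ (chartAt (Cn n) x).target, Real.log (formDet (coordForm h x z)) =
      inChart n x F z + (-1 * inChart n x V z + Real.log (formDet (coordForm g x z))) := by
    intro z hz
    have p1 := formDet_pos (kg.oneOne z hz) (kg.pos z hz)
    have e1 : Real.exp (inChart n x V z) * formDet (coordForm h x z) =
        Real.exp (inChart n x F z) * formDet (coordForm g x z) := by
      rw [coordForm_eq_pull, coordForm_eq_pull, formDet_pull (hh.oneOne _),
        formDet_pull (hg.oneOne _)]
      have := hMA ((chartAt (Cn n) x).symm z)
      simp only [inChart]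
      linear_combination Complex.normSq (matOf (transition x z)).det * this
    have e2 : formDet (coordForm h x z) =
        Real.exp (inChart n x F z - inChart n x V z) * formDet (coordForm g x z) := by
      rw [Real.exp_sub, div_mul_eq_mul_div, ← e1, mul_div_cancel_left₀ _ (Real.exp_pos _).ne']
    rw [e2, Real.log_mul (Real.exp_pos _).ne' p1.ne', Real.log_exp]
    ring
  have hl := smoothOn_log_formDet kg
  have h4 : ddcLocal (fun z => Real.log (formDet (coordForm h x z))) (chartAt (Cn n) x x) =
      ddcX F x + ((-1 : ℝ) • ddcX V x + -ricci g x) := by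
    have hV1 : ContDiffOn ℝ ∞ (fun z => -1 * inChart n x V z) (chartAt (Cn n) x).target :=
      contDiffOn_const.mul (hV x)
    rw [ddcLocal_congr hU hz hlog, ddcLocal_add hU hz (hF x) (hV1.add hl),
      ddcLocal_add hU hz hV1 hl, ddcLocal_const_mul _ hU hz (hV x)]
    refine ContinuousLinearMap.ext fun a => ContinuousLinearMap.ext fun b => ?_
    simp only [add_apply, ricci, neg_apply, neg_neg, ddcX]
  rw [h4, formTrace_add, formTrace_add, formTrace_smul, formTrace_neg, ← dX_trace hg hh,
    ← ddcX_trace hg hh] at h1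
  simp only [coordForm_center] at h1
  rw [lap, lap, lap, gradTrace]
  linarith

variable [MulAction (Torus r) X]

theorem abs_lap_moment_sub_le (hT : IsReducedTorusAction n r X) (hg : IsKahler g) {om : FormField n X}
    {m mX : X → Fin r → ℝ} (hm : IsMomentMap om m) (hmX : IsMomentMap g mX) {φ : X → ℝ}
    (hφ : IsSmoothInCharts n φ) (hφi : InvariantFun r φ) (hh : IsKahler (twist om φ)) {C : ℝ}
    {i : Fin r} (hC : ∀ x a, |ddcX (n := n) (fun x => mX x i) x a (cplxJ n a)| ≤
      C * g x a (cplxJ n a)) (x : X) :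
    |lap g (fun x => momentTwist n m φ x i) x -
      gradTrace (twist om φ) (fun x => formTrace (g x) (twist om φ x))
        (fun x => momentTwist n m φ x i) x| ≤ C * formTrace (g x) (twist om φ x) := by
  have hU := isOpen_chart (n := n) x
  have hz := chart_mem (n := n) x
  have h1 := moment_laplacian_bound hU hz (hg.locKahler x) (hh.locKahler x)
    (isSmoothInCharts_momentTwist hT (fun i => (hm.smooth i).inCharts) hφ i x)
    ((hmX.smooth i).inCharts x) (locField n r x i)
    (fun z hz b => momentTwist_fderiv_inChart hT hm hφ hφi hz i b)
    (fun z hz b => hmX.fderiv_inChart hT hz i b) (C := C) (fun a => by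
      rw [coordForm_center]; exact hC x a)
  rw [← dX_trace hg hh] at h1
  simp only [coordForm_center] at h1
  exact h1

/-- The squared-gradient term in the Laplacian of the logarithm is exactly compensated by the one
that the Yau–Siu inequality provides. -/
theorem weighted_lap_log_trace_ge [NeZero n] (hT : IsReducedTorusAction n r X) (hg : IsKahler g)
    {A B : ℝ} (hRic : FormLE (ricci g) (fun x => A • g x)) (hB : BisecGE g B)
    {om : FormField n X} {m mX : X → Fin r → ℝ} (hm : IsMomentMap om m) (hmX : IsMomentMap g mX)
    {φ F : X → ℝ} (hφ : IsSmoothInCharts n φ) (hφi : InvariantFun r φ) (hF : IsSmoothInCharts n F)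
    (hh : IsKahler (twist om φ)) {C D : ℝ}
    (hC : ∀ i x a, |ddcX (n := n) (fun x => mX x i) x a (cplxJ n a)| ≤ C * g x a (cplxJ n a))
    {ℓ : (Fin r → ℝ) → ℝ} (hℓ : ContDiff ℝ ∞ ℓ) (hc : ConcaveOn ℝ Set.univ ℓ)
    (hD : ∀ i x, |partialV ℓ i (momentTwist n m φ x)| ≤ D)
    (hMA : ∀ x, Real.exp (ℓ (momentTwist n m φ x)) * formDet (twist om φ x) =
      Real.exp (F x) * formDet (g x)) (x : X) :
    lap g F x / formTrace (g x) (twist om φ x) - r * (D * C) -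
        (n * |A| + |B|) * formTrace (twist om φ x) (g x) ≤
      lap (twist om φ) (fun x => Real.log (formTrace (g x) (twist om φ x))) x +
        gradTrace (twist om φ) (fun x => Real.log (formTrace (g x) (twist om φ x)))
          (fun x => ℓ (momentTwist n m φ x)) x := by
  set h := twist om φ with hhdef
  set μ := momentTwist n m φ with hμ
  have hμs : ∀ i, IsSmoothInCharts n fun x => μ x i :=
    isSmoothInCharts_momentTwist hT (fun i => (hm.smooth i).inCharts) hφ
  set Y : X → ℝ := fun x => formTrace (g x) (h x) with hYdef
  set V : X → ℝ := fun x => ℓ (μ x) with hVdef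
  have hY : IsSmoothInCharts n Y := isSmoothInCharts_formTrace hg hh.toIsClosedOneOne
  have hV : IsSmoothInCharts n V := isSmoothInCharts_weight hℓ hμs
  have hYpos : ∀ x, 0 < Y x := fun x => formTrace_pos (hg.oneOne x) (hg.pos x) (hh.oneOne x) (hh.pos x)
  have hYT : 1 ≤ Y x * formTrace (h x) (g x) :=
    one_le_formTrace_mul (hg.oneOne x) (hg.pos x) (hh.oneOne x) (hh.pos x)
  have hTpos : 0 < formTrace (h x) (g x) :=
    formTrace_pos (hh.oneOne x) (hh.pos x) (hg.oneOne x) (hg.pos x)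
  have h1 := lap_trace_ge hg hh hB hF hV hMA x
  have h2 : formTrace (g x) (ricci g x) ≤ n * |A| := by
    have e1 := formTrace_mono (hg.oneOne x) (hg.pos x) (isOneOne_ricci hg x)
      ((hg.oneOne x).smul A) (hRic x)
    rw [formTrace_smul, formTrace_self (hg.oneOne x) (hg.pos x)] at e1
    have := mul_le_mul_of_nonneg_right (le_abs_self A) (Nat.cast_nonneg (α := ℝ) n)
    linarith
  -- Concavity bounds `Δ_g V` by the Laplacians of the components of the moment map; each of these,
  -- corrected by its pairing with `Y`, is at most `C Y`.
  have h3 : lap g V x - gradTrace h Y V x ≤ r * (D * C) * Y x := by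
    have e1 := lap_weight_le hg.oneOne hg.pos hℓ hc hμs x
    have e2 := gradTrace_weight hℓ hμs h Y x
    have e3 : ∑ i, partialV ℓ i (μ x) * lap g (fun x => μ x i) x -
        ∑ i, partialV ℓ i (μ x) * gradTrace h Y (fun x => μ x i) x ≤ ∑ _i : Fin r, D * C * Y x := by
      rw [← Finset.sum_sub_distrib]
      refine Finset.sum_le_sum fun i _ => ?_
      rw [← mul_sub]
      refine (le_abs_self _).trans ?_
      rw [abs_mul, mul_assoc]
      have e4 := abs_lap_moment_sub_le hT hg hm hmX hφ hφi hh (hC i) x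
      exact mul_le_mul (hD i x) e4 (abs_nonneg _) ((abs_nonneg _).trans (hD i x))
    rw [Finset.sum_const, Finset.card_univ, Fintype.card_fin, nsmul_eq_mul] at e3
    rw [e2]
    linarith
  have h4 : lap h (fun x => Real.log (Y x)) x =
      (Y x)⁻¹ * lap h Y x + -((Y x) ^ 2)⁻¹ * gradTrace h Y Y x := by
    rw [lap_comp h x hY isOpen_Ioi (fun x => hYpos x) (S := Set.Ioi 0) (fun y hy =>
      (Real.contDiffAt_log.mpr (ne_of_gt hy)).contDiffWithinAt), Real.deriv_log',
      deriv_inv']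
  have h5 : gradTrace h (fun x => Real.log (Y x)) V x = (Y x)⁻¹ * gradTrace h Y V x := by
    rw [gradTrace_comp_left h x hY (Real.differentiableAt_log (hYpos x).ne'), Real.deriv_log']
  rw [h4, h5]
  have hy := hYpos x
  -- The Ricci term carries no factor of the trace; `1 ≤ Y T` puts it in the same form as the
  -- curvature term.
  have h6 : lap g F x - r * (D * C) * Y x - (n * |A| + |B|) * (Y x * formTrace (h x) (g x)) ≤
      lap h Y x - gradTrace h Y Y x / Y x + gradTrace h Y V x := by
    have e1 : B * Y x * formTrace (h x) (g x) ≤ |B| * (Y x * formTrace (h x) (g x)) := by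
      rw [mul_assoc]
      exact mul_le_mul_of_nonneg_right (le_abs_self B) (by positivity)
    have e2 : (n : ℝ) * |A| ≤ n * |A| * (Y x * formTrace (h x) (g x)) :=
      le_mul_of_one_le_right (by positivity) hYT
    linarith
  have h7 := mul_le_mul_of_nonneg_left h6 (inv_pos.mpr hy).le
  have e3 : (Y x)⁻¹ * (lap g F x - r * (D * C) * Y x -
      (n * |A| + |B|) * (Y x * formTrace (h x) (g x))) =
      lap g F x / Y x - r * (D * C) - (n * |A| + |B|) * formTrace (h x) (g x) := by
    field_simp
  have e4 : (Y x)⁻¹ * (lap h Y x - gradTrace h Y Y x / Y x + gradTrace h Y V x) =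
      (Y x)⁻¹ * lap h Y x + -((Y x) ^ 2)⁻¹ * gradTrace h Y Y x + (Y x)⁻¹ * gradTrace h Y V x := by
    field_simp
    ring
  rw [e3, e4] at h7
  exact h7

/-- Only one-sided information is needed: `S` bounded below and the Ricci form bounded above. The
canonical moment map of the Ricci form is a Laplacian of `mX`, hence bounded. -/
theorem weighted_lap_F_le [NeZero n] (hg : IsKahler g) {A : ℝ}
    (hRic : FormLE (ricci g) (fun x => A • g x)) (hh : IsKahler h) {m mX : X → Fin r → ℝ}
    (hmX : IsMomentMap g mX) {C D s : ℝ}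
    (hC : ∀ i x a, |ddcX (n := n) (fun x => mX x i) x a (cplxJ n a)| ≤ C * g x a (cplxJ n a))
    {v : (Fin r → ℝ) → ℝ} (hD : ∀ i x, |partialV (fun p => Real.log (v p)) i (m x)| ≤ D)
    {F S : X → ℝ} (hS : ∀ x, s ≤ S x) (x : X)
    (heq : weightedLaplacian v h m F x = -S x + weightedTrace v h m (ricci g) (ricciMoment g mX) x) :
    weightedLaplacian v h m F x ≤ r * (D * (C * n)) - s + |A| * formTrace (h x) (g x) := by
  rw [heq, weightedTrace]
  have hTpos : 0 < formTrace (h x) (g x) :=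
    formTrace_pos (hh.oneOne x) (hh.pos x) (hg.oneOne x) (hg.pos x)
  have h1 : formTrace (h x) (ricci g x) ≤ |A| * formTrace (h x) (g x) := by
    have e1 := formTrace_mono (hh.oneOne x) (hh.pos x) (isOneOne_ricci hg x)
      ((hg.oneOne x).smul A) (hRic x)
    rw [formTrace_smul] at e1
    exact e1.trans (mul_le_mul_of_nonneg_right (le_abs_self A) hTpos.le)
  have h2 : ∑ i, partialV (fun p => Real.log (v p)) i (m x) * ricciMoment g mX x i ≤
      ∑ _i : Fin r, D * (C * n) := by
    refine Finset.sum_le_sum fun i _ => (le_abs_self _).trans ?_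
    rw [abs_mul]
    refine mul_le_mul (hD i x) ?_ (abs_nonneg _) ((abs_nonneg _).trans (hD i x))
    have hone := (hmX.smooth i).inCharts.isOneOne_ddcX x
    have hself := formTrace_self (hg.oneOne x) (hg.pos x)
    have e1 := formTrace_mono (hg.oneOne x) (hg.pos x) hone ((hg.oneOne x).smul C)
      fun a => (le_abs_self _).trans (hC i x a)
    have e2 := formTrace_mono (hg.oneOne x) (hg.pos x) ((hg.oneOne x).smul (-C)) hone
      fun a => by
        have := (abs_le.mp (hC i x a)).1
        rw [smul_apply, smul_apply, smul_eq_mul]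
        linarith
    rw [formTrace_smul, hself] at e1 e2
    rw [ricciMoment, abs_neg, abs_le]
    exact ⟨by linarith, e1⟩
  rw [Finset.sum_const, Finset.card_univ, Fintype.card_fin, nsmul_eq_mul] at h2
  have := hS x
  linarith

/-- `dd^c(φ - f)` is `ω_φ - (ω + dd^c f)`: the first form has trace `n`, and the second is bounded
below by `c g`. -/
theorem lap_potential_le [NeZero n] {om : FormField n X} (hom : IsClosedOneOne om) {φ f : X → ℝ}
    (hφ : IsSmoothInCharts n φ) (hf : IsSmoothInCharts n f) (hh : IsKahler (twist om φ))
    {c : ℝ} (hg : IsKahler g) {x : X} (hc : ∀ a, c * g x a (cplxJ n a) ≤ twist om f x a (cplxJ n a)) :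
    lap (twist om φ) (fun x => φ x + -1 * f x) x ≤ n - c * formTrace (twist om φ x) (g x) := by
  rw [lap_add _ x hφ (hf.const_mul _), lap_const_mul _ x _ hf]
  have h1 := formTrace_self (hh.oneOne x) (hh.pos x)
  have h2 : formTrace (twist om φ x) (twist om φ x) =
      formTrace (twist om φ x) (om x) + lap (twist om φ) φ x := formTrace_add _ _ _
  have h3 := formTrace_mono (hh.oneOne x) (hh.pos x) ((hg.oneOne x).smul c)
    ((hom.oneOne x).add (hf.isOneOne_ddcX x)) hc
  rw [formTrace_smul, formTrace_add] at h3
  change _ ≤ _ + lap (twist om φ) f x at h3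
  linarith

/-- The pairing is `∑ ℓ_i(m_φ)(m_φ - m_f)_i`, at most `ℓ(m_φ) - ℓ(m_f)` by concavity. Both arguments
lie in the image of `m`, where `ℓ` is bounded; no gradient bound on the potentials is needed. -/
theorem gradTrace_potential_le [CompactSpace X] (hT : IsReducedTorusAction n r X)
    {om : FormField n X} (hom : IsKahler om) {m : X → Fin r → ℝ} (hm : IsMomentMap om m) {φ f : X → ℝ}
    (hφ : IsSmoothInCharts n φ) (hφi : InvariantFun r φ) (hh : IsKahler (twist om φ))
    (hf : IsSmoothInCharts n f) (hfi : InvariantFun r f)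
    (hpos : ∀ x a, 0 ≤ twist om f x a (cplxJ n a)) {ℓ : (Fin r → ℝ) → ℝ} (hℓ : ContDiff ℝ ∞ ℓ)
    (hc : ConcaveOn ℝ Set.univ ℓ) {L : ℝ} (hL : ∀ x, |ℓ (m x)| ≤ L) (x : X) :
    gradTrace (twist om φ) (fun x => φ x + -1 * f x) (fun x => ℓ (momentTwist n m φ x)) x ≤
      2 * L := by
  have hμs : ∀ i, IsSmoothInCharts n fun x => momentTwist n m φ x i :=
    isSmoothInCharts_momentTwist hT (fun i => (hm.smooth i).inCharts) hφ
  have hr : ∀ {f : X → ℝ}, IsSmoothInCharts n f → InvariantFun r f →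
      (∀ x a, 0 ≤ twist om f x a (cplxJ n a)) → |ℓ (momentTwist n m f x)| ≤ L := by
    intro f hf hfi hpos
    obtain ⟨y, hy⟩ := range_momentTwist_subset hT hom hm hf hfi hpos ⟨x, rfl⟩
    rw [← hy]
    exact hL y
  have h1 := hr hf hfi hpos
  have h2 := hr hφ hφi fun x a => by
    rcases eq_or_ne a 0 with rfl | ha
    · simp
    · exact (hh.pos x a ha).le
  rw [gradTrace_weight hℓ hμs]
  have h3 := concave_le_tangent (hℓ.differentiable (by simp)) hc (momentTwist n m φ x)
    (momentTwist n m f x)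
  have h4 : ∀ i, gradTrace (twist om φ) (fun x => φ x + -1 * f x)
      (fun x => momentTwist n m φ x i) x = momentTwist n m φ x i - momentTwist n m f x i := by
    intro i
    have e1 : ∀ u : X → ℝ, gradTrace (twist om φ) u (fun x => momentTwist n m φ x i) x =
        ddcMoment n r u x i :=
      gradTrace_hamiltonian hh.oneOne hh.pos (momentTwist_dX hT hm hφ hφi x i)
    rw [gradTrace_add_left _ x hφ (hf.const_mul _), gradTrace_const_mul_left _ x _ hf, e1, e1]
    simp only [momentTwist]
    ring
  simp only [h4]
  have h5 : ∑ i, partialV ℓ i (momentTwist n m φ x) *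
      (momentTwist n m φ x i - momentTwist n m f x i) =
      -∑ i, partialV ℓ i (momentTwist n m φ x) *
        (momentTwist n m f x i - momentTwist n m φ x i) := by
    rw [← Finset.sum_neg_distrib]
    exact Finset.sum_congr rfl fun i _ => by ring
  rw [h5]
  have := abs_le.mp h1
  have := abs_le.mp h2
  linarith

end Estimates

/-! ### The integral identity and the integrand bound -/

section Integrand

variable {n : ℕ} {X : Type*} [TopologicalSpace X] [ChartedSpace (Cn n) X]
  [IsManifold 𝓘(ℂ, Cn n) (⊤ : WithTop ℕ∞) X] {g h : FormField n X}

theorem gradTrace_exp_left (α : FormField n X) {f : X → ℝ} (hf : IsSmoothInCharts n f) (k : X → ℝ)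
    (x : X) :
    gradTrace α (fun x => Real.exp (f x)) k x = Real.exp (f x) * gradTrace α f k x := by
  rw [gradTrace_comp_left α x hf Real.differentiableAt_exp, Real.deriv_exp]

/-- The integrand obtained by testing `Δ_{h,v} Θ` against `e^{qΘ}` and `Δ_g G` against
`e^{(q-1)Θ - G}`. -/
def testIntegrand (g h : FormField n X) (q : ℝ) (V F Θ G : X → ℝ) (x : X) : ℝ :=
  Real.exp (q * Θ x + F x) * (lap h Θ x + gradTrace h Θ V x + q * gradTrace h Θ Θ x) -
    1 / q * (Real.exp ((q - 1) * Θ x + -1 * G x) *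
      (lap g G x + (q - 1) * gradTrace g Θ G x - gradTrace g G G x))

variable {V F Θ G : X → ℝ} (q : ℝ)

theorem continuous_testIntegrand (hg : IsKahler g) (hh : IsKahler h) (hV : IsSmoothInCharts n V)
    (hF : IsSmoothInCharts n F) (hΘ : IsSmoothInCharts n Θ) (hG : IsSmoothInCharts n G) :
    Continuous (testIntegrand g h q V F Θ G) := by
  have c1 := (isSmoothInCharts_lap hh hΘ).continuous
  have c2 := (isSmoothInCharts_gradTrace hh hΘ hV).continuous
  have c3 := (isSmoothInCharts_gradTrace hh hΘ hΘ).continuous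
  have c4 := (isSmoothInCharts_lap hg hG).continuous
  have c5 := (isSmoothInCharts_gradTrace hg hΘ hG).continuous
  have c6 := (isSmoothInCharts_gradTrace hg hG hG).continuous
  have c7 := hΘ.continuous
  have c8 := hG.continuous
  have c9 := hF.continuous
  unfold testIntegrand
  fun_prop

/-- Two Green formulas: for `h` with test function `e^{qΘ+V}`, where `e^V h^n = e^F g^n`, and for
`g` with test function `e^{(q-1)Θ-G}`. -/
theorem integral_testIntegrand [CompactSpace X] [T2Space X] [MeasurableSpace X] [BorelSpace X]
    (hg : IsKahler g) (hh : IsKahler h) (hV : IsSmoothInCharts n V)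
    (hF : IsSmoothInCharts n F) (hΘ : IsSmoothInCharts n Θ) (hG : IsSmoothInCharts n G)
    (hMA : ∀ x, Real.exp (V x) * formDet (h x) = Real.exp (F x) * formDet (g x)) :
    ∫ x, testIntegrand g h q V F Θ G x ∂(volumeMeasure g) = 0 := by
  have hμ := isFiniteMeasure_volumeMeasure hg
  have hdet : ∀ x, formDet (g x) ≠ 0 := fun x => (formDet_pos (hg.oneOne x) (hg.pos x)).ne'
  have k1 : IsSmoothInCharts n fun x => q * Θ x + V x := (hΘ.const_mul q).add hV
  have k2 : IsSmoothInCharts n fun x => (q - 1) * Θ x + -1 * G x :=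
    (hΘ.const_mul (q - 1)).add (hG.const_mul (-1))
  have g1 := integral_green hh hg hΘ k1.exp
  have g2 := integral_green hg hg hG k2.exp
  have e1 : ∀ x, (Real.exp (q * Θ x + V x) * lap h Θ x +
      gradTrace h (fun x => Real.exp (q * Θ x + V x)) Θ x) * detRatio h g x =
      Real.exp (q * Θ x + F x) * (lap h Θ x + gradTrace h Θ V x + q * gradTrace h Θ Θ x) := by
    intro x
    rw [gradTrace_exp_left h k1, gradTrace_add_left h x (hΘ.const_mul q) hV,
      gradTrace_const_mul_left h x q hΘ, gradTrace_comm h x V Θ, Real.exp_add, Real.exp_add]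
    have e2 : Real.exp (V x) * detRatio h g x = Real.exp (F x) := by
      rw [detRatio, ← mul_div_assoc, hMA, mul_div_cancel_right₀ _ (hdet x)]
    linear_combination Real.exp (q * Θ x) *
      (lap h Θ x + gradTrace h Θ V x + q * gradTrace h Θ Θ x) * e2
  have e2 : ∀ x, (Real.exp ((q - 1) * Θ x + -1 * G x) * lap g G x +
      gradTrace g (fun x => Real.exp ((q - 1) * Θ x + -1 * G x)) G x) * detRatio g g x =
      Real.exp ((q - 1) * Θ x + -1 * G x) *
        (lap g G x + (q - 1) * gradTrace g Θ G x - gradTrace g G G x) := by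
    intro x
    rw [gradTrace_exp_left g k2, gradTrace_add_left g x (hΘ.const_mul _) (hG.const_mul _),
      gradTrace_const_mul_left g x _ hΘ, gradTrace_const_mul_left g x _ hG, detRatio,
      div_self (hdet x)]
    ring
  simp only [e1] at g1
  simp only [e2] at g2
  have c1 := (isSmoothInCharts_lap hh hΘ).continuous
  have c2 := (isSmoothInCharts_gradTrace hh hΘ hV).continuous
  have c3 := (isSmoothInCharts_gradTrace hh hΘ hΘ).continuous
  have c4 := (isSmoothInCharts_lap hg hG).continuous
  have c5 := (isSmoothInCharts_gradTrace hg hΘ hG).continuous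
  have c6 := (isSmoothInCharts_gradTrace hg hG hG).continuous
  have c7 := hΘ.continuous
  have c8 := hG.continuous
  have c9 := hF.continuous
  have i1 : MeasureTheory.Integrable (fun x => Real.exp (q * Θ x + F x) *
      (lap h Θ x + gradTrace h Θ V x + q * gradTrace h Θ Θ x)) (volumeMeasure g) :=
    Continuous.integrable_of_hasCompactSupport (by fun_prop) (HasCompactSupport.of_compactSpace _)
  have i2 : MeasureTheory.Integrable (fun x => Real.exp ((q - 1) * Θ x + -1 * G x) *
        (lap g G x + (q - 1) * gradTrace g Θ G x - gradTrace g G G x)) (volumeMeasure g) :=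
    Continuous.integrable_of_hasCompactSupport (by fun_prop) (HasCompactSupport.of_compactSpace _)
  simp only [testIntegrand]
  rw [MeasureTheory.integral_sub i1 (i2.const_mul _), MeasureTheory.integral_const_mul, g1, g2]
  ring

theorem gradTrace_quadratic_nonneg {q : ℝ} (hq : 1 ≤ q) (hg : IsKahler g)
    (hΘ : IsSmoothInCharts n Θ) (hG : IsSmoothInCharts n G) (x : X) :
    0 ≤ q * gradTrace g Θ Θ x - 1 / q * ((q - 1) * gradTrace g Θ G x - gradTrace g G G x) := by
  have hq0 : 0 < q := by linarith
  -- Completing the square: `2qs = (q - 1)/q` matches the cross term, and the rest `1/q - q s²` is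
  -- nonnegative because `(q - 1)² ≤ 4q²`.
  set s := (q - 1) / (2 * q ^ 2) with hs
  have h1 : 0 ≤ gradTrace g (fun x => Θ x + -s * G x) (fun x => Θ x + -s * G x) x :=
    gradTrace_self_nonneg g x (hg.oneOne x) (hg.pos x)
  have h2 : 0 ≤ gradTrace g G G x := gradTrace_self_nonneg g x (hg.oneOne x) (hg.pos x)
  have hsG := hG.const_mul (-s)
  rw [gradTrace_add_left g x hΘ hsG, gradTrace_const_mul_left g x _ hG,
    gradTrace_comm g x Θ, gradTrace_comm g x G, gradTrace_add_left g x hΘ hsG,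
    gradTrace_add_left g x hΘ hsG, gradTrace_const_mul_left g x _ hG,
    gradTrace_const_mul_left g x _ hG, gradTrace_comm g x G Θ] at h1
  have h3 : s * q * 2 = (q - 1) / q := by rw [hs]; field_simp
  have h4 : s ^ 2 * q ≤ 1 / q := by
    rw [hs, div_pow, div_mul_eq_mul_div, div_le_div_iff₀ (by positivity) hq0]
    nlinarith [sq_nonneg q, pow_pos hq0 2, pow_pos hq0 3, pow_pos hq0 4]
  have h5 := mul_le_mul_of_nonneg_right h4 h2
  have h6 := mul_nonneg hq0.le h1
  have h7 : 1 / q * ((q - 1) * gradTrace g Θ G x - gradTrace g G G x) =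
      (q - 1) / q * gradTrace g Θ G x - 1 / q * gradTrace g G G x := by ring
  rw [h7, ← h3]
  linarith

/-- The uncontrolled `Δ_g F / Y` from the Laplacian of `log Y` cancels against the one in `Δ_g G`;
what remains is bounded by the hypotheses and a nonnegative quadratic in `∂Θ`, `∂G`. -/
theorem testIntegrand_ge [NeZero n] {q lam a₁ a₂ a₃ : ℝ} (hq : 1 ≤ q) (hlam : 0 ≤ lam)
    (hg : IsKahler g) (hh : IsKahler h) (hF : IsSmoothInCharts n F)
    {ψ : X → ℝ} (hψ : IsSmoothInCharts n ψ) {x : X}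
    (h₁ : lap g F x / formTrace (g x) (h x) - a₁ ≤
      lap h (fun x => Real.log (formTrace (g x) (h x))) x +
        gradTrace h (fun x => Real.log (formTrace (g x) (h x))) V x)
    (h₂ : lap h F x + gradTrace h F V x ≤ a₂) (h₃ : lap h ψ x + gradTrace h ψ V x ≤ a₃)
    (h₄ : lap g ψ x ≤ formTrace (g x) (h x))
    (hΘ : ∀ x, Θ x = Real.log (formTrace (g x) (h x)) + (-(1 + q) * F x + -((1 + q) * lam) * ψ x))
    (hG : ∀ x, G x = q * F x + (1 + q) * lam * ψ x) :
    -Real.exp (q * Θ x + F x) * (a₁ + (1 + q) * a₂ + (1 + q) * lam * (a₃ + 1 / q)) ≤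
      testIntegrand g h q V F Θ G x := by
  have hq0 : 0 < q := by linarith
  have hY : IsSmoothInCharts n fun x => formTrace (g x) (h x) :=
    isSmoothInCharts_formTrace hg hh.toIsClosedOneOne
  have hYpos : ∀ x, 0 < formTrace (g x) (h x) := fun x =>
    formTrace_pos (hg.oneOne x) (hg.pos x) (hh.oneOne x) (hh.pos x)
  have hl := hY.log hYpos
  have hF' := hF.const_mul (-(1 + q))
  have hψ' := hψ.const_mul (-((1 + q) * lam))
  have hΘ' := funext hΘ
  have hG' := funext hG
  have sΘ : IsSmoothInCharts n Θ := hΘ' ▸ hl.add (hF'.add hψ')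
  have sG : IsSmoothInCharts n G :=
    hG' ▸ (hF.const_mul q).add (hψ.const_mul ((1 + q) * lam))
  have hquad := gradTrace_quadratic_nonneg hq hg sΘ sG x
  have hcmp : gradTrace g Θ Θ x ≤ formTrace (g x) (h x) * gradTrace h Θ Θ x :=
    formTrace_le_mul (hg.oneOne x) (hg.pos x) (hh.oneOne x) (hh.pos x) (isOneOne_gradForm _ _)
      fun a => by rw [gradForm_self]; nlinarith [sq_nonneg (dX Θ x (cplxJ n a)), sq_nonneg (dX Θ x a)]
  have eLΘ : lap h Θ x + gradTrace h Θ V x =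
      (lap h (fun x => Real.log (formTrace (g x) (h x))) x +
        gradTrace h (fun x => Real.log (formTrace (g x) (h x))) V x) -
      (1 + q) * (lap h F x + gradTrace h F V x) -
      (1 + q) * lam * (lap h ψ x + gradTrace h ψ V x) := by
    rw [hΘ', lap_add h x hl (hF'.add hψ'), lap_add h x hF' hψ', lap_const_mul h x _ hF,
      lap_const_mul h x _ hψ, gradTrace_add_left h x hl (hF'.add hψ'),
      gradTrace_add_left h x hF' hψ', gradTrace_const_mul_left h x _ hF,
      gradTrace_const_mul_left h x _ hψ]
    ring
  have eLG : lap g G x = q * lap g F x + (1 + q) * lam * lap g ψ x := by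
    rw [hG', lap_add g x (hF.const_mul q) (hψ.const_mul _), lap_const_mul g x _ hF,
      lap_const_mul g x _ hψ]
  have hYx := hYpos x
  set Y := formTrace (g x) (h x)
  -- The coefficients of `Θ` and `G` are chosen for this: `(q - 1)Θ - G = qΘ + F - log Y`, so the
  -- two parts of the integrand share one exponential.
  have hexp : Real.exp ((q - 1) * Θ x + -1 * G x) = Real.exp (q * Θ x + F x) / Y := by
    rw [eq_div_iff hYx.ne', ← Real.exp_log hYx, ← Real.exp_add, hΘ, hG]
    congr 1
    ring
  have hlow : -(a₁ + (1 + q) * a₂ + (1 + q) * lam * (a₃ + 1 / q)) ≤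
      lap h Θ x + gradTrace h Θ V x + q * gradTrace h Θ Θ x -
        1 / q * ((lap g G x + (q - 1) * gradTrace g Θ G x - gradTrace g G G x) / Y) := by
    have e1 : 1 / q * ((lap g G x + (q - 1) * gradTrace g Θ G x - gradTrace g G G x) / Y) =
        lap g F x / Y + (1 + q) * lam * (1 / q * (lap g ψ x / Y)) +
          1 / q * ((q - 1) * gradTrace g Θ G x - gradTrace g G G x) / Y := by
      rw [eLG]
      field_simp
      ring
    -- Trading the gradient in `h` for the gradient in `g` divided by `Y` allows the cross term in
    -- `g` to be absorbed.
    have e2 : q * gradTrace g Θ Θ x / Y ≤ q * gradTrace h Θ Θ x := by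
      rw [div_le_iff₀ hYx]
      nlinarith
    have e3 := div_nonneg hquad hYx.le
    rw [sub_div] at e3
    have e4 : (1 + q) * lam * (1 / q * (lap g ψ x / Y)) ≤ (1 + q) * lam * (1 / q) := by
      refine mul_le_mul_of_nonneg_left ?_ (by positivity)
      exact mul_le_of_le_one_right (by positivity) ((div_le_one hYx).mpr h₄)
    have e5 := mul_le_mul_of_nonneg_left h₂ (show 0 ≤ 1 + q by positivity)
    have e6 := mul_le_mul_of_nonneg_left h₃ (show 0 ≤ (1 + q) * lam by positivity)
    rw [e1, eLΘ]
    linarith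
  have hfin := mul_le_mul_of_nonneg_left hlow (Real.exp_pos (q * Θ x + F x)).le
  rw [testIntegrand, hexp]
  calc _ = _ := by ring
    _ ≤ _ := hfin
    _ = _ := by ring

end Integrand

/-- On `K` the power of `Y` is at most `(J + C)/c`, and this nonnegative function has total integral
`C μ(X)/c` because `J` has mean zero. -/
theorem eLpNorm_le_of_integral_eq_zero {X : Type*} [MeasurableSpace X]
    {μ : MeasureTheory.Measure X} [MeasureTheory.IsFiniteMeasure μ] {K : Set X} {Y J : X → ℝ}
    {q c C : ℝ} (hq : 0 < q) (hc : 0 < c) (hY : ∀ x, 0 ≤ Y x) (hK : MeasurableSet K)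
    (hJ : MeasureTheory.Integrable J μ) (h0 : ∫ x, J x ∂μ = 0) (hnonneg : ∀ x, 0 ≤ J x + C)
    (hle : ∀ x ∈ K, c * Y x ^ q ≤ J x + C) :
    MeasureTheory.eLpNorm Y (ENNReal.ofReal q) (μ.restrict K) ≤
      ENNReal.ofReal ((C * μ.real Set.univ / c) ^ (1 / q)) := by
  have hi : MeasureTheory.Integrable (fun x => (J x + C) / c) μ :=
    (hJ.add (MeasureTheory.integrable_const C)).div_const c
  have hnn : ∀ x, 0 ≤ (J x + C) / c := fun x => div_nonneg (hnonneg x) hc.le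
  have hint : ∫ x, (J x + C) / c ∂μ = C * μ.real Set.univ / c := by
    rw [MeasureTheory.integral_div, MeasureTheory.integral_add hJ (MeasureTheory.integrable_const C),
      h0, MeasureTheory.integral_const, smul_eq_mul, zero_add, mul_comm]
  rw [MeasureTheory.eLpNorm_eq_lintegral_rpow_enorm_toReal (by simpa using hq) ENNReal.ofReal_ne_top,
    ENNReal.toReal_ofReal hq.le, ← hint,
    ← ENNReal.ofReal_rpow_of_nonneg (MeasureTheory.integral_nonneg hnn) (by positivity)]
  refine ENNReal.rpow_le_rpow ?_ (by positivity)
  rw [MeasureTheory.ofReal_integral_eq_lintegral_ofReal hi (Filter.Eventually.of_forall hnn)]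
  refine le_trans (MeasureTheory.setLIntegral_mono' hK fun x hx => ?_)
    (MeasureTheory.setLIntegral_le_lintegral K _)
  rw [Real.enorm_of_nonneg (hY x), ENNReal.ofReal_rpow_of_nonneg (hY x) hq.le]
  refine ENNReal.ofReal_le_ofReal ?_
  rw [le_div_iff₀ hc, mul_comm]
  exact hle x hx

/-! ### Weights -/

section Weights

variable {r : ℕ} {v : (Fin r → ℝ) → ℝ} {C : ℝ} {P : Set (Fin r → ℝ)} {p : Fin r → ℝ}

theorem WeightBound.le (h : WeightBound v C P) (hp : p ∈ P) : v p ≤ C := by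
  have h1 := (h p hp).2
  have h2 : 0 ≤ ∑ i, |partialV v i p| := Finset.sum_nonneg fun i _ => abs_nonneg _
  have h3 : 0 ≤ ∑ i, ∑ j, |partialV (partialV v i) j p| :=
    Finset.sum_nonneg fun i _ => Finset.sum_nonneg fun j _ => abs_nonneg _
  linarith

theorem WeightBound.inv_le (h : WeightBound v C P) (hv : ∀ q, 0 < v q) (hp : p ∈ P) :
    (v p)⁻¹ ≤ C :=
  inv_le_of_inv_le₀ ((hv p).trans_le (h.le hp)) (h p hp).1

theorem WeightBound.abs_partialV_le (h : WeightBound v C P) (hv : ∀ q, 0 < v q) (hp : p ∈ P)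
    (i : Fin r) : |partialV v i p| ≤ C := by
  have h1 := (h p hp).2
  have h2 : |partialV v i p| ≤ ∑ i, |partialV v i p| :=
    Finset.single_le_sum (f := fun i => |partialV v i p|) (fun i _ => abs_nonneg _)
      (Finset.mem_univ i)
  have h3 : 0 ≤ ∑ i, ∑ j, |partialV (partialV v i) j p| :=
    Finset.sum_nonneg fun i _ => Finset.sum_nonneg fun j _ => abs_nonneg _
  linarith [hv p]

theorem WeightBound.abs_partialV_log_le (h : WeightBound v C P) (hv : ∀ q, 0 < v q)
    (hd : ContDiff ℝ ∞ v) (hp : p ∈ P) (i : Fin r) :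
    |partialV (fun q => Real.log (v q)) i p| ≤ C * C := by
  have h1 : partialV (fun q => Real.log (v q)) i p = (v p)⁻¹ * partialV v i p := by
    rw [partialV, fderiv.log ((hd.differentiable (by simp)) p) (hv p).ne']
    rfl
  have h2 := h.inv_le hv hp
  rw [h1, abs_mul, abs_of_pos (inv_pos.mpr (hv p))]
  exact mul_le_mul h2 (h.abs_partialV_le hv hp i) (abs_nonneg _)
    ((inv_pos.mpr (hv p)).le.trans h2)

theorem WeightBound.abs_log_le (h : WeightBound v C P) (hv : ∀ q, 0 < v q) (hp : p ∈ P) :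
    |Real.log (v p)| ≤ |Real.log C| := by
  have h1 := Real.log_le_log (hv p) (h.le hp)
  have h2 := Real.log_le_log (inv_pos.mpr (hv p)) (h.inv_le hv hp)
  rw [Real.log_inv] at h2
  exact (abs_le.mpr ⟨by linarith, h1⟩).trans (le_abs_self _)

end Weights

/-! ### The test functions -/

section TestFunctions

variable {n r : ℕ} {X : Type*} [TopologicalSpace X] [ChartedSpace (Cn n) X]
  [IsManifold 𝓘(ℂ, Cn n) (⊤ : WithTop ℕ∞) X]

/-- The function `log tr_g h - (1 + q)(F + λψ)`. -/
def testPotential (q lam : ℝ) (g h : FormField n X) (F ψ : X → ℝ) (x : X) : ℝ :=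
  Real.log (formTrace (g x) (h x)) + (-(1 + q) * F x + -((1 + q) * lam) * ψ x)

/-- The function `qF + (1 + q)λψ`. -/
def testWeight (q lam : ℝ) (F ψ : X → ℝ) (x : X) : ℝ := q * F x + (1 + q) * lam * ψ x

/-- The exponent is separated into the contributions of the trace, `F`, `φ` and `f`, each of which
has its own bound. -/
theorem testExponent_eq (q lam : ℝ) (g h : FormField n X) (F φ f : X → ℝ) (x : X) :
    q * testPotential q lam g h F (fun x => φ x + -1 * f x) x + F x =
      Real.log (formTrace (g x) (h x)) * q - (q * (1 + q) - 1) * F x -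
        q * (1 + q) * lam * φ x + q * (1 + q) * lam * f x := by
  rw [testPotential]
  ring

variable [MulAction (Torus r) X] [CompactSpace X]

/-- `c` is any lower bound for `ω + dd^c f` by `g` at the given point, so that the same estimate
serves with `c = C_ρ` above the truncation level and with `c = 0` below it. -/
theorem testIntegrand_potential_ge [NeZero n] (hT : IsReducedTorusAction n r X) {g : FormField n X}
    (hg : IsKahler g) {mX : X → Fin r → ℝ} (hmX : IsMomentMap g mX) {A B : ℝ}
    (hRic : FormLE (ricci g) (fun x => A • g x)) (hB : BisecGE g B) {C D L s : ℝ}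
    (hC : ∀ i x a, |ddcX (n := n) (fun x => mX x i) x a (cplxJ n a)| ≤ C * g x a (cplxJ n a))
    {v : (Fin r → ℝ) → ℝ} (hv : ContDiff ℝ ∞ v) (vpos : ∀ p, 0 < v p)
    (hc : ConcaveOn ℝ Set.univ fun p => Real.log (v p)) {om : FormField n X} {m : X → Fin r → ℝ}
    (hom : IsKahler om) (hm : IsMomentMap om m)
    (hD : ∀ i x, |partialV (fun p => Real.log (v p)) i (m x)| ≤ D)
    (hL : ∀ x, |Real.log (v (m x))| ≤ L) {φ F S : X → ℝ} (hφ : IsSmoothInCharts n φ)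
    (hφi : InvariantFun r φ) (hF : IsSmoothInCharts n F) (hh : IsKahler (twist om φ))
    (hsol : SolvesWcscK v om m g mX φ F S) (hS : ∀ x, s ≤ S x) {f : X → ℝ}
    (hf : IsSmoothInCharts n f) (hfi : InvariantFun r f)
    (hfpos : ∀ x a, 0 ≤ twist om f x a (cplxJ n a)) {q lam : ℝ} (hq : 1 ≤ q) (hlam : 0 ≤ lam)
    {c : ℝ} {x : X} (hcx : ∀ a, c * g x a (cplxJ n a) ≤ twist om f x a (cplxJ n a)) :
    -Real.exp (q * testPotential q lam g (twist om φ) F (fun x => φ x + -1 * f x) x + F x) *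
      (r * (D * C) + (1 + q) * (r * (D * (C * n)) - s) + (1 + q) * lam * (n + 2 * L + 1 / q) +
        (n * |A| + |B| + (1 + q) * |A| - (1 + q) * lam * c) * formTrace (twist om φ x) (g x)) ≤
      testIntegrand g (twist om φ) q (fun x => Real.log (v (momentTwist n m φ x))) F
        (testPotential q lam g (twist om φ) F fun x => φ x + -1 * f x)
        (testWeight q lam F fun x => φ x + -1 * f x) x := by
  have hℓ : ContDiff ℝ ∞ fun p => Real.log (v p) := hv.log fun p => (vpos p).ne'
  have hsub := range_momentTwist_subset hT hom hm hφ hφi fun x a => by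
    rcases eq_or_ne a 0 with rfl | ha
    · simp
    · exact (hh.pos x a ha).le
  have hDφ : ∀ i x, |partialV (fun p => Real.log (v p)) i (momentTwist n m φ x)| ≤ D := by
    intro i x
    obtain ⟨y, hy⟩ := hsub ⟨x, rfl⟩
    rw [← hy]
    exact hD i y
  have hμs := isSmoothInCharts_momentTwist hT (fun i => (hm.smooth i).inCharts) hφ
  have hMA : ∀ x, Real.exp (Real.log (v (momentTwist n m φ x))) * formDet (twist om φ x) =
      Real.exp (F x) * formDet (g x) := fun x => by
    rw [Real.exp_log (vpos _)]; exact hsol.mongeAmpere x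
  have h1 := weighted_lap_log_trace_ge hT hg hRic hB hm hmX hφ hφi hF hh hC hℓ hc hDφ hMA x
  have h2 := weighted_lap_F_le hg hRic hh hmX hC hDφ hS x (hsol.laplace x)
  rw [weightedLaplacian_eq hh.oneOne hh.pos hℓ hμs
    (fun i x b => momentTwist_dX hT hm hφ hφi x i b)] at h2
  have h3 := lap_potential_le hom.toIsClosedOneOne hφ hf hh hg hcx
  have h4 := gradTrace_potential_le hT hom hm hφ hφi hh hf hfi hfpos hℓ hc hL x
  -- The contributions of `ω` to the two traces cancel, and `tr_g(ω + dd^c f)` is nonnegative.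
  have h5 : lap g (fun x => φ x + -1 * f x) x ≤ formTrace (g x) (twist om φ x) := by
    have e1 : formTrace (g x) (twist om φ x) = formTrace (g x) (om x) + lap g φ x :=
      formTrace_add _ _ _
    have e2 : formTrace (g x) (twist om f x) = formTrace (g x) (om x) + lap g f x :=
      formTrace_add _ _ _
    have e3 : 0 ≤ formTrace (g x) (twist om f x) :=
      formTrace_nonneg (hg.oneOne x) (hg.pos x) ((hom.oneOne x).add (hf.isOneOne_ddcX x)) (hfpos x)
    rw [lap_add g x hφ (hf.const_mul _), lap_const_mul g x _ hf]
    linarith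
  have h6 := testIntegrand_ge (q := q) (lam := lam) hq hlam hg hh hF (hφ.add (hf.const_mul (-1)))
    (V := fun x => Real.log (v (momentTwist n m φ x))) (x := x)
    (a₁ := r * (D * C) + (n * |A| + |B|) * formTrace (twist om φ x) (g x)) (a₂ := _)
    (a₃ := n - c * formTrace (twist om φ x) (g x) + 2 * L) (by linarith) h2 (by linarith) h5
    (fun _ => rfl) (fun _ => rfl)
  refine le_trans (le_of_eq ?_) h6
  simp only [testPotential]
  ring

/-- The equation bounds the relative determinant by `e^{C₀} C`; with a bound on the inverse
eigenvalues this bounds every eigenvalue. -/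
theorem trace_le_of_mongeAmpere {g h : BilForm n} (hg : IsOneOne g)
    (pg : ∀ a, a ≠ 0 → 0 < g a (cplxJ n a)) (hh : IsOneOne h)
    (ph : ∀ a, a ≠ 0 → 0 < h a (cplxJ n a)) {w F C C₀ T : ℝ} (hw : 0 < w) (hwC : w⁻¹ ≤ C)
    (hF : F ≤ C₀) (hMA : w * formDet h = Real.exp F * formDet g) (hT : formTrace h g ≤ T) :
    formTrace g h ≤ n * (Real.exp C₀ * C * T ^ (n - 1)) := by
  refine formTrace_le_of_inverse_le hg pg hh ph hT ?_
  have h1 : formDet h = w⁻¹ * (Real.exp F * formDet g) := by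
    rw [← hMA, ← mul_assoc, inv_mul_cancel₀ hw.ne', one_mul]
  have h2 := formDet_pos hg pg
  rw [h1, mul_comm (Real.exp C₀), mul_assoc]
  have h3 : Real.exp F * formDet g ≤ Real.exp C₀ * formDet g :=
    mul_le_mul_of_nonneg_right (Real.exp_le_exp.mpr hF) h2.le
  exact mul_le_mul hwC h3 (by positivity) ((inv_pos.mpr hw).le.trans hwC)

end TestFunctions

/-! ### The integral estimate -/

/-- `F` may tend to `-∞` with multiples of `ρ`. Since `lam ≥ |K₂|`, the coefficient of `ρ` after
inserting `F ≥ K₂ρ - C₀` is nonnegative, so the upper bound on `ρ` suffices. -/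
theorem exponent_le {q lam K₂ C₀ M ℓ y F φ t u : ℝ} (hq : 1 ≤ q) (hlam : |K₂| ≤ lam)
    (hy : y ≤ ℓ) (hφ : |φ| ≤ C₀) (hF : K₂ * t - C₀ ≤ F) (ht : t ≤ M) (hM : 0 ≤ M) (hu : u ≤ t) :
    y * q - (q * (1 + q) - 1) * F - q * (1 + q) * lam * φ + q * (1 + q) * lam * u ≤
      ℓ * q + (q * (1 + q) - 1) * C₀ + q * (1 + q) * lam * C₀ +
        (q * (1 + q) * lam + (q * (1 + q) - 1) * |K₂|) * M := by
  have hlam0 : 0 ≤ lam := (abs_nonneg _).trans hlam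
  have hb : 0 ≤ q * (1 + q) - 1 := by nlinarith
  have ha : 0 ≤ q * (1 + q) * lam := by positivity
  have h1 := mul_le_mul_of_nonneg_right hy (by linarith : 0 ≤ q)
  have h2 := mul_le_mul_of_nonneg_left hF hb
  have h3 := mul_le_mul_of_nonneg_left (abs_le.mp hφ).1 ha
  have h4 := mul_le_mul_of_nonneg_left hu ha
  have h5 : 0 ≤ q * (1 + q) * lam - (q * (1 + q) - 1) * K₂ := by
    nlinarith [le_abs_self K₂]
  have h6 := mul_le_mul_of_nonneg_left ht h5
  have h7 : -K₂ * ((q * (1 + q) - 1) * M) ≤ |K₂| * ((q * (1 + q) - 1) * M) :=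
    mul_le_mul_of_nonneg_right (neg_le_abs K₂) (by positivity)
  linarith

theorem le_exponent {q lam C₀ M y F φ u : ℝ} (hq : 1 ≤ q) (hlam : 0 ≤ lam)
    (hφ : |φ| ≤ C₀) (hF : F ≤ C₀) (hu : -M - 1 ≤ u) :
    y * q + (-((q * (1 + q) - 1) * C₀) - q * (1 + q) * lam * (C₀ + M + 1)) ≤
      y * q - (q * (1 + q) - 1) * F - q * (1 + q) * lam * φ + q * (1 + q) * lam * u := by
  have hb : 0 ≤ q * (1 + q) - 1 := by nlinarith
  have ha : 0 ≤ q * (1 + q) * lam := by positivity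
  have h1 := mul_le_mul_of_nonneg_left hF hb
  have h2 := mul_le_mul_of_nonneg_left (abs_le.mp hφ).2 ha
  have h3 := mul_le_mul_of_nonneg_left hu ha
  linarith

theorem exists_cutoff (W M : ℝ) {a : ℝ} (ha : 0 < a) :
    ∃ N, M + 1 ≤ N ∧ W * Real.exp (a * (1 - N)) ≤ 1 := by
  -- This `N` makes the exponent at most `-|W|`, and `|W| e^{-|W|} ≤ 1`.
  refine ⟨|M| + 1 + |W| / a, by linarith [le_abs_self M, div_nonneg (abs_nonneg W) ha.le], ?_⟩
  have h1 : a * (1 - (|M| + 1 + |W| / a)) ≤ -|W| := by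
    have e1 : a * (|W| / a) = |W| := mul_div_cancel₀ _ ha.ne'
    nlinarith [mul_nonneg ha.le (abs_nonneg M)]
  have h2 := Real.add_one_le_exp |W|
  have h3 := Real.exp_le_exp.mpr h1
  rw [Real.exp_neg] at h3
  calc W * Real.exp (a * (1 - (|M| + 1 + |W| / a)))
      ≤ |W| * Real.exp (a * (1 - (|M| + 1 + |W| / a))) :=
        mul_le_mul_of_nonneg_right (le_abs_self W) (Real.exp_pos _).le
    _ ≤ |W| * (Real.exp |W|)⁻¹ := mul_le_mul_of_nonneg_left h3 (abs_nonneg W)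
    _ ≤ 1 := by
        rw [← div_eq_mul_inv, div_le_one (Real.exp_pos _)]
        linarith

theorem exists_uniform_ddcX_bound {n : ℕ} {X : Type*} [TopologicalSpace X] [ChartedSpace (Cn n) X]
    [IsManifold 𝓘(ℂ, Cn n) (⊤ : WithTop ℕ∞) X] [CompactSpace X] {ι : Type*} [Fintype ι]
    {g : FormField n X} (hg : IsKahler g) {f : X → ι → ℝ}
    (hf : ∀ i, IsSmoothInCharts n fun x => f x i) :
    ∃ C, ∀ i x a, |ddcX (n := n) (fun x => f x i) x a (cplxJ n a)| ≤ C * g x a (cplxJ n a) := by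
  choose C hC0 hC using fun i => exists_ddcX_bound hg (hf i)
  refine ⟨∑ i, C i, fun i x a => (hC i x a).trans ?_⟩
  refine mul_le_mul_of_nonneg_right
    (Finset.single_le_sum (fun i _ => hC0 i) (Finset.mem_univ i)) ?_
  rcases eq_or_ne a 0 with rfl | ha
  · simp
  · exact (hg.pos x a ha).le

/-- The constants are chosen before the solution. The truncation level is chosen after it, and
affects them only through the additive 1 in `C`. -/
theorem exists_trace_lower_bound (n r : ℕ) [NeZero n] (X : Type*) [TopologicalSpace X] [T2Space X]
    [CompactSpace X] [Nonempty X] [ChartedSpace (Cn n) X]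
    [IsManifold 𝓘(ℂ, Cn n) (⊤ : WithTop ℕ∞) X] [MeasurableSpace X] [BorelSpace X]
    [MulAction (Torus r) X] (hT : IsReducedTorusAction n r X)
    {g : FormField n X} (hg : IsKahler g) {mX : X → Fin r → ℝ} (hmX : IsMomentMap g mX)
    {A B : ℝ} (hRic : FormLE (ricci g) (fun x => A • g x)) (hB : BisecGE g B)
    (K : Set X) {q : ℝ} (hq : 1 ≤ q) {Cρ : ℝ} (C₀ K₂ Cv s M : ℝ) (hCρ : 0 < Cρ) :
    ∃ c > 0, ∃ C, ∀ (v : (Fin r → ℝ) → ℝ), ContDiff ℝ ∞ v → (∀ q, 0 < v q) →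
        ConcaveOn ℝ Set.univ (fun q => Real.log (v q)) →
      ∀ (om : FormField n X) (m : X → Fin r → ℝ), IsKahler om → IsMomentMap om m →
        WeightBound v Cv (Set.range m) →
      ∀ (ρ : X → EReal), SmoothOffPoles n ρ → InvariantFun r ρ → IsQuasiPsh om ρ →
        IsQuasiPsh (fun x => om x - Cρ • g x) ρ →
        (∀ x, ρ x ≤ (M : EReal)) → (∀ x ∈ K, (-M : EReal) ≤ ρ x) →
      ∀ (φ F S : X → ℝ), IsSmoothInCharts n φ → InvariantFun r φ → IsPositive (twist om φ) →
        IsSmoothInCharts n F → SolvesWcscK v om m g mX φ F S →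
        (∀ x, s ≤ S x) → (∀ x, |φ x| ≤ C₀) → (∀ x, F x ≤ C₀) →
        (∀ x, ρ x ≠ ⊥ → K₂ * (ρ x).toReal - C₀ ≤ F x) →
        ∃ J : X → ℝ, Continuous J ∧ ∫ x, J x ∂(volumeMeasure g) = 0 ∧ (∀ x, 0 ≤ J x + C) ∧
          ∀ x ∈ K, c * formTrace (g x) (twist om φ x) ^ q ≤ J x + C := by
  obtain ⟨Cm, hCm⟩ := exists_uniform_ddcX_bound hg fun i => (hmX.smooth i).inCharts
  have hq0 : 0 < q := by linarith
  set P := n * |A| + |B| + (1 + q) * |A| with hP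
  have hP0 : 0 ≤ P := by positivity
  -- The first summand makes the exponent bounded above; the second makes the negative multiple of
  -- the inverse trace outweigh all the others by at least 1.
  set lam := |K₂| + (P + 1) / ((1 + q) * Cρ) with hlam
  have hlamK : |K₂| ≤ lam := le_add_of_nonneg_right (by positivity)
  have hlam0 : 0 < lam := add_pos_of_nonneg_of_pos (abs_nonneg _) (by positivity)
  have hlamC : P + 1 ≤ (1 + q) * lam * Cρ := by
    have e1 : (1 + q) * lam * Cρ = (1 + q) * |K₂| * Cρ + (P + 1) := by
      rw [hlam]; field_simp
    rw [e1]
    exact le_add_of_nonneg_left (by positivity)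
  set R := r * (Cv * Cv * Cm) + (1 + q) * (r * (Cv * Cv * (Cm * n)) - s) +
    (1 + q) * lam * (n + 2 * |Real.log Cv| + 1 / q) with hR
  set C₃ := |R| with hC₃
  have hC₃0 : 0 ≤ C₃ := abs_nonneg R
  -- The bound on the trace wherever the inverse trace is below `C₃ + 1`; `E₀` is the resulting
  -- bound on the exponential.
  set Ymax := n * (Real.exp C₀ * Cv * (C₃ + 1) ^ (n - 1)) with hYmax
  set E₀ := Real.exp (Real.log Ymax * q + (q * (1 + q) - 1) * C₀ + q * (1 + q) * lam * C₀ +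
        (q * (1 + q) * lam + (q * (1 + q) - 1) * |K₂|) * |M|) with hE₀
  have hE₀pos : 0 < E₀ := Real.exp_pos _
  refine ⟨Real.exp (-((q * (1 + q) - 1) * C₀) - q * (1 + q) * lam * (C₀ + |M| + 1)),
    Real.exp_pos _, E₀ * (1 + C₃) + 1, ?_⟩
  intro v hv vpos hc om m hom hm hw ρ hs hρi hpsh hpshC hρM hρK φ F S hφ hφi hpos hF hsol hS hφC hFC
    hFK
  set h := twist om φ with hhdef
  have hh : IsKahler h := isKahler_twist hom.toIsClosedOneOne hφ hpos
  have hμ := isSmoothInCharts_momentTwist hT (fun i => (hm.smooth i).inCharts) hφ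
  have hℓ : ContDiff ℝ ∞ fun p => Real.log (v p) := hv.log fun p => (vpos p).ne'
  have hV := isSmoothInCharts_weight hℓ hμ
  have hMA : ∀ x, Real.exp (Real.log (v (momentTwist n m φ x))) * formDet (h x) =
      Real.exp (F x) * formDet (g x) := fun x => by
    rw [Real.exp_log (vpos _)]; exact hsol.mongeAmpere x
  have hYs : IsSmoothInCharts n fun x => formTrace (g x) (h x) :=
    isSmoothInCharts_formTrace hg hh.toIsClosedOneOne
  have hTs : IsSmoothInCharts n fun x => formTrace (h x) (g x) :=
    isSmoothInCharts_formTrace hh hg.toIsClosedOneOne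
  have hYpos : ∀ x, 0 < formTrace (g x) (h x) := fun x =>
    formTrace_pos (hg.oneOne x) (hg.pos x) (hh.oneOne x) (hh.pos x)
  have hTpos : ∀ x, 0 < formTrace (h x) (g x) := fun x =>
    formTrace_pos (hh.oneOne x) (hh.pos x) (hg.oneOne x) (hg.pos x)
  -- `W` depends on the solution and is used only to select `N`. The factor `e^{q(1+q)λf}` is left
  -- out here, so that `W` does not depend on `N` in turn.
  obtain ⟨W, hW⟩ : ∃ W, ∀ x, Real.exp (Real.log (formTrace (g x) (h x)) * q -
      (q * (1 + q) - 1) * F x - q * (1 + q) * lam * φ x) *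
        (C₃ + P * formTrace (h x) (g x)) ≤ W := by
    have c1 := (hYs.log hYpos).continuous
    have c2 := hTs.continuous
    have c3 := hF.continuous
    have c4 := hφ.continuous
    obtain ⟨W, hW⟩ := (isCompact_range (f := fun x => Real.exp
      (Real.log (formTrace (g x) (h x)) * q - (q * (1 + q) - 1) * F x - q * (1 + q) * lam * φ x) *
        (C₃ + P * formTrace (h x) (g x))) (by fun_prop)).bddAbove
    exact ⟨W, fun x => hW ⟨x, rfl⟩⟩
  obtain ⟨N, hMN, hN⟩ := exists_cutoff W |M| (show 0 < q * (1 + q) * lam by positivity)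
  set f := truncation ρ N with hfdef
  have hf : IsSmoothInCharts n f := isSmoothInCharts_truncation hpsh hs N
  have hfpos := twist_truncation_nonneg hom.pos hpsh hs N
  have hψ : IsSmoothInCharts n fun x => φ x + -1 * f x := hφ.add (hf.const_mul (-1))
  set Θ := testPotential q lam g h F fun x => φ x + -1 * f x with hΘ
  set G := testWeight q lam F fun x => φ x + -1 * f x with hG
  have sΘ : IsSmoothInCharts n Θ := (hYs.log hYpos).add ((hF.const_mul _).add (hψ.const_mul _))
  have sG : IsSmoothInCharts n G := (hF.const_mul _).add (hψ.const_mul _)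
  set J := testIntegrand g h q (fun x => Real.log (v (momentTwist n m φ x))) F Θ G with hJ
  have hlow : ∀ (x : X) (c : ℝ), (∀ a, c * g x a (cplxJ n a) ≤ twist om f x a (cplxJ n a)) →
      -Real.exp (q * Θ x + F x) * (C₃ + (P - (1 + q) * lam * c) * formTrace (h x) (g x)) ≤ J x := by
    intro x c hcx
    refine le_trans ?_ (testIntegrand_potential_ge hT hg hmX hRic hB hCm hv vpos hc hom hm
      (fun i x => hw.abs_partialV_log_le vpos hv ⟨x, rfl⟩ i)
      (fun x => hw.abs_log_le vpos ⟨x, rfl⟩) hφ hφi hF hh hsol hS hf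
      (invariantFun_truncation hρi N) hfpos hq hlam0.le hcx)
    rw [neg_mul, neg_mul, neg_le_neg_iff]
    refine mul_le_mul_of_nonneg_left ?_ (Real.exp_pos _).le
    exact add_le_add_left (le_abs_self R) _
  have hexp : ∀ x, q * Θ x + F x = Real.log (formTrace (g x) (h x)) * q -
      (q * (1 + q) - 1) * F x - q * (1 + q) * lam * φ x + q * (1 + q) * lam * f x :=
    testExponent_eq q lam g h F φ f
  have hρtop : ∀ x, ρ x ≠ ⊤ := fun x => ((hρM x).trans_lt (EReal.coe_lt_top M)).ne
  have hρle : ∀ x, ρ x ≠ ⊥ → (ρ x).toReal ≤ |M| := fun x hx => by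
    have h1 := hρM x
    rw [← EReal.coe_toReal (hρtop x) hx, EReal.coe_le_coe_iff] at h1
    exact h1.trans (le_abs_self M)
  -- Above the truncation level `J ≥ E (T - C₃)`, with `E` the exponential and `T` the inverse
  -- trace.
  have hgood : ∀ x, ρ x ≠ ⊥ → 1 - N ≤ (ρ x).toReal →
      Real.exp (q * Θ x + F x) ≤ J x + E₀ * (1 + C₃) := by
    intro x hx hxN
    have h1 := hlow x Cρ (twist_truncation_ge hpshC hs hx hxN)
    have hE := Real.exp_pos (q * Θ x + F x)
    have hTx := hTpos x
    set T := formTrace (h x) (g x)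
    have h2 : Real.exp (q * Θ x + F x) * (T - C₃) ≤ J x := by
      refine le_trans ?_ h1
      rw [neg_mul, ← mul_neg]
      refine mul_le_mul_of_nonneg_left ?_ hE.le
      nlinarith
    -- For large `T` the lower bound itself dominates `E`. For small `T` the Monge–Ampère equation
    -- bounds the trace, hence `E ≤ E₀`, and the loss `C₃ E` is absorbed by the constant.
    rcases le_or_gt (C₃ + 1) T with hT1 | hT1
    · have h3 := le_mul_of_one_le_right hE.le (show 1 ≤ T - C₃ by linarith)
      have h4 : 0 ≤ E₀ * (1 + C₃) := by positivity
      linarith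
    · have hY : formTrace (g x) (h x) ≤ Ymax := by
        obtain ⟨y, hy⟩ := range_momentTwist_subset hT hom hm hφ hφi (fun x a => by
          rcases eq_or_ne a 0 with rfl | ha
          · simp
          · exact (hh.pos x a ha).le) ⟨x, rfl⟩
        exact trace_le_of_mongeAmpere (hg.oneOne x) (hg.pos x) (hh.oneOne x) (hh.pos x) (vpos _)
          (hw.inv_le vpos ⟨y, hy⟩) (hFC x) (hsol.mongeAmpere x) hT1.le
      have h3 : Real.exp (q * Θ x + F x) ≤ E₀ := by
        rw [hexp]
        exact Real.exp_le_exp.mpr (exponent_le hq hlamK (Real.log_le_log (hYpos x) hY) (hφC x)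
          (hFK x hx) (hρle x hx) (abs_nonneg M) (truncation_le hx (by linarith)))
      have h4 : Real.exp (q * Θ x + F x) * (1 + C₃) ≤ E₀ * (1 + C₃) :=
        mul_le_mul_of_nonneg_right h3 (by linarith)
      have h5 := mul_pos hE hTx
      linarith
  -- Below the truncation level only nonnegativity of `ω + dd^c f` is available, but `f ≤ 1 - N`
  -- makes the exponential factor small enough to offset `W`.
  have hbad : ∀ x, (ρ x = ⊥ ∨ (ρ x).toReal < 1 - N) → -1 ≤ J x := by
    intro x hx
    have h1 := hlow x 0 fun a => by rw [zero_mul]; exact hfpos x a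
    rw [mul_zero, sub_zero, hexp, Real.exp_add] at h1
    have h2 : Real.exp (q * (1 + q) * lam * f x) ≤ Real.exp (q * (1 + q) * lam * (1 - N)) :=
      Real.exp_le_exp.mpr (mul_le_mul_of_nonneg_left (truncation_le_of_bad hx) (by positivity))
    have h3 : 0 ≤ C₃ + P * formTrace (h x) (g x) :=
      add_nonneg hC₃0 (mul_nonneg hP0 (hTpos x).le)
    have h4 := mul_le_mul (hW x) h2 (Real.exp_pos _).le
      ((mul_nonneg (Real.exp_pos _).le h3).trans (hW x))
    linarith
  refine ⟨J, continuous_testIntegrand q hg hh hV hF sΘ sG,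
    integral_testIntegrand q hg hh hV hF sΘ sG hMA, fun x => ?_, fun x hx => ?_⟩
  · by_cases hx : ρ x ≠ ⊥ ∧ 1 - N ≤ (ρ x).toReal
    · have h1 := hgood x hx.1 hx.2
      have := Real.exp_pos (q * Θ x + F x)
      linarith
    · have h1 := hbad x (by
        by_contra! h'
        exact hx h')
      have h4 : 0 ≤ E₀ * (1 + C₃) := by positivity
      linarith
  -- Points of `K` lie above the truncation level because `N ≥ |M| + 1`, and there `F`, `φ` and `f`
  -- are bounded on the side that bounds the exponent from below.
  · have hxb : ρ x ≠ ⊥ := fun h' => by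
      have h1 := hρK x hx
      rw [h', ← EReal.coe_neg] at h1
      exact absurd h1 (not_le.mpr (EReal.bot_lt_coe _))
    have hxM : -|M| ≤ (ρ x).toReal := by
      have h1 := hρK x hx
      rw [← EReal.coe_toReal (hρtop x) hxb, ← EReal.coe_neg, EReal.coe_le_coe_iff] at h1
      linarith [le_abs_self M]
    have h1 := hgood x hxb (by linarith)
    have h2 := le_truncation (N := N) hxb
    refine le_trans ?_ (h1.trans (by linarith))
    rw [hexp, Real.rpow_def_of_pos (hYpos x), ← Real.exp_add, add_comm]
    exact Real.exp_le_exp.mpr (le_exponent hq hlam0.le (hφC x) (hFC x) (by linarith))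

end
end WCscK

end

theorem mainTheorem5
    (n r : ℕ) (X : Type*) [TopologicalSpace X] [T2Space X] [CompactSpace X] [ConnectedSpace X]
    [ChartedSpace (WCscK.Cn n) X] [IsManifold 𝓘(ℂ, WCscK.Cn n) (⊤ : WithTop ℕ∞) X]
    [MeasurableSpace X] [BorelSpace X]
    -- the torus `T ⊂ Aut_red(X)`
    [MulAction (WCscK.Torus r) X] (hT : WCscK.IsReducedTorusAction n r X)
    -- the fixed reference Kähler metric `ω_X`, with its moment map
    (omX : WCscK.FormField n X) (homX : WCscK.IsKahler omX) (homX_inv : WCscK.InvariantForm r omX)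
    (mX : X → Fin r → ℝ) (hmX : WCscK.IsMomentMap omX mX)
    (A B : ℝ) (hRic : WCscK.FormLE (WCscK.ricci omX) (fun x => A • omX x))
    (hBisec : WCscK.BisecGE omX B)
    -- the compact set, the exponent and the constants
    (K : Set X) (hK : IsCompact K) (p : ℝ) (hp : 1 < p)
    (Com Cρ C₀ K₂ Cv s M : ℝ) (hCρ : 0 < Cρ) :
    ∃ C₁ : ℝ,
      ∀ (v : (Fin r → ℝ) → ℝ), ContDiff ℝ ∞ v → (∀ q, 0 < v q) →
        ConcaveOn ℝ Set.univ (fun q => Real.log (v q)) →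
      ∀ (om : WCscK.FormField n X) (m : X → Fin r → ℝ), WCscK.IsKahler om →
        WCscK.InvariantForm r om → WCscK.IsMomentMap om m →
        WCscK.WeightBound v Cv (Set.range m ∪ Set.range mX) →
        WCscK.FormLE om (fun x => Com • omX x) →
      ∀ (ρ : X → EReal), WCscK.SmoothOffPoles n ρ → WCscK.InvariantFun r ρ →
        WCscK.IsQuasiPsh om ρ →
        -- `ω + dd^c ρ ≥ C_ρ ω_X` as currents
        WCscK.IsQuasiPsh (fun x => om x - Cρ • omX x) ρ →
        (∀ x, ρ x ≤ (M : EReal)) → (∀ x ∈ K, (-M : EReal) ≤ ρ x) →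
      ∀ (φ F S : X → ℝ), WCscK.IsSmooth n φ → WCscK.InvariantFun r φ →
        WCscK.IsPositive (WCscK.twist om φ) →
        WCscK.IsSmooth n F → WCscK.InvariantFun r F →
        WCscK.IsSmooth n S → WCscK.InvariantFun r S →
        WCscK.SolvesWcscK v om m omX mX φ F S →
        (∀ x, s ≤ S x) →
        (∀ x, |φ x| ≤ C₀) → (∀ x, F x ≤ C₀) →
        (∀ x, ρ x ≠ ⊥ → K₂ * (ρ x).toReal - C₀ ≤ F x) →
        MeasureTheory.eLpNorm (fun x => WCscK.formTrace (omX x) (WCscK.twist om φ x))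
          (ENNReal.ofReal (2 * p + 2)) ((WCscK.volumeMeasure omX).restrict K)
          ≤ ENNReal.ofReal C₁ := by
  have hnonempty : Nonempty X := ConnectedSpace.toNonempty
  rcases Nat.eq_zero_or_pos n with rfl | hn
  -- In dimension zero the trace is that of an empty matrix, so the norm is zero.
  · refine ⟨0, fun v _ _ _ om m _ _ _ _ _ ρ _ _ _ _ _ _ φ F S _ _ _ _ _ _ _ _ _ _ _ _ => ?_⟩
    have h0 : (fun x => WCscK.formTrace (omX x) (WCscK.twist om φ x)) = 0 :=
      funext fun x => by simp [WCscK.formTrace, Matrix.trace]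
    rw [h0, MeasureTheory.eLpNorm_zero]
    exact bot_le
  have hne : NeZero n := ⟨hn.ne'⟩
  -- The integral estimate works for every exponent at least 1.
  have hq : 1 ≤ 2 * p + 2 := by linarith
  obtain ⟨c, hc, C, H⟩ := WCscK.exists_trace_lower_bound n r X hT homX hmX hRic hBisec K hq C₀ K₂ Cv
    s M hCρ
  have hfin := WCscK.isFiniteMeasure_volumeMeasure homX
  -- The bound comes from integrating `J + C` over `X`: total mass `C` times the volume, divided by
  -- `c`, to the power one over the exponent.
  refine ⟨(C * (WCscK.volumeMeasure omX).real Set.univ / c) ^ (1 / (2 * p + 2)), ?_⟩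
  intro v hv vpos hconc om m hom _ hm hw _ ρ hs hρi hpsh hpshC hρM hρK φ F S hφ hφi hpos hF _ _ _
    hsol hS hφC hFC hFK
  obtain ⟨J, hJ, hJ0, hJC, hJK⟩ := H v hv vpos hconc om m hom hm
    (fun q hq => hw q (Set.mem_union_left _ hq)) ρ hs hρi hpsh hpshC hρM hρK φ F S hφ.inCharts hφi
    hpos hF.inCharts hsol hS hφC hFC hFK
  have hh := WCscK.isKahler_twist hom.toIsClosedOneOne hφ.inCharts hpos
  exact WCscK.eLpNorm_le_of_integral_eq_zero (by linarith) hc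
    (fun x => (WCscK.formTrace_pos (homX.oneOne x) (homX.pos x) (hh.oneOne x) (hh.pos x)).le)
    hK.isClosed.measurableSet
    (hJ.integrable_of_hasCompactSupport (HasCompactSupport.of_compactSpace J)) hJ0 hJC hJK
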